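/- Conventions. Manifolds are smooth ($C^\infty$), Hausdorff, without boundary. An Engel structure on a four-manifold $Q$ is a smooth rank 2 distribution $D\subset TQ$ such that $D^2=[D,D]$ is a rank 3 distribution and $D^3=D^2+[D,D^2]=TQ$. Its characteristic line field $L\subset D$ is defined by $[L,D^2]\subset D^2$. An Engel immersion $\phi:(Q,D)\to(Q',D')$ between Engel four-manifolds is a smooth immersion with $d\phi_q(D_q)=D'_{\phi(q)}$ for all $q$. We say that $(Q,D)$ has a nice leaf space if there are a three-manifold $M$ and a surjective submersion $\pi:Q\to M$ whose fibers are exactly the leaves of $L$ (so $M=Q/L$). For a plane field $\xi\subset TM$, $\mathbb P\xi$ (resp. $S\xi$) is the four-manifold of pairs $(m,\ell)$ with $\ell$ a line through $0$ (resp. a ray from $0$) in $\xi_m$; its canonical distribution at $(m,\ell)$ consists of the tangent vectors whose projection to $T_mM$ lies in the line spanned by $\ell$. **Lemma.** Let $(Q,D)$ be an Engel manifold with nice leaf space $\pi:Q\to M$. Then $\xi:=\pi_*D^2$, $\xi_{\pi(q)}=d\pi_q(D^2_q)$, is a well-defined contact structure on $M$ (so $(M,\xi)$ is the contactification of $Q$),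 and $\mathbb P\xi$ with its canonical distribution is an Engel manifold. Moreover: 1. The formula $\Psi(q)=d\pi_q(D_q)\subset\xi_{\pi(q)}$ defines an Engel immersion $\Psi:Q\to\mathbb P\xi$ (the development). It maps the leaf of $L$ through $q$ to the fiber of $\mathbb P\xi\to M$ over $\pi(q)$, and the restriction of $\Psi$ to the leaf is a local homeomorphism to this projective line (thus giving the leaf a real projective structure). If $Q$ is compact, then $\Psi$ is a surjective covering map. 2. Two Engel immersions of $Q$ that agree at three distinct, sufficiently close points of a leaf of $L$ agree along the whole leaf. Precisely: (a) every $p\in Q$ has a neighborhood $U$ such that for every Engel manifold $(Q',D')$ with nice leaf space and all Engel immersions $\phi,\psi:Q\to Q'$ which agree at three distinct points of $U\cap\ell_p$, where $\ell_p$ is the leaf through $p$, one has $\phi=\psi$ on $\ell_p$; (b) for an arbitrary Engel manifold $(Q',D')$, all Engel immersions $\phi,\psi:Q\to Q'$ and all $p\in Q$, there is a neighborhood $U$ of $p$ (depending on $\phi,\psi$) such that if $\phi,\psi$ agree at three distinct points of $U\cap\ell_p$, then $\phi=\psi$ on $\ell_p$. 3. (Oriented version.) $S\xi$ with its canonical distribution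 is an Engel manifold. Suppose that $Q$ and $D$ are oriented. Call local sections $W$ of $L$ and $X$ of $D$ adapted at $q$ if, at $q$, $(W,X)$ is a positive frame of $D$ and $(W,X,[W,X],[[W,X],X])$ is a positive frame of $TQ$. Adapted sections exist at every $q$; there are orientations of $\xi$ and of $M$ for which, for all adapted $W,X$, the pairs $(d\pi X,d\pi[W,X])$ and the triples $(d\pi X,d\pi[W,X],d\pi[[W,X],X])$ at $\pi(q)$ are positive; and $\Psi(q)=$ the ray of $d\pi_q(X(q))$, for any adapted $W,X$, defines an Engel immersion $\Psi:Q\to S\xi$ which preserves the orientations of the Engel planes and of the four-manifolds. Here $S\xi$ and its canonical distribution are oriented as follows: at the ray of $u\in\xi_m$, with $(u,v)$ a positive basis of $\xi_m$, $W$ the velocity at $t=0$ of the vertical curve of rays of $u+tv$, and $X$ a vector over $u$, the frame $(W,X)$ of the canonical distribution is positive, and so is $(W,X,Y,Z)$ whenever $(X,Y,Z)$ projects to a positive basis of $T_mM$. -/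

import Mathlib

open Set Filter Topology Manifold Module
open scoped ContDiff

/-! ### Distributions, derived distributions, Engel and contact structures -/

section Distributions

variable {E : Type*} [NormedAddCommGroup E] [NormedSpace ℝ E]
variable {Q : Type*} [TopologicalSpace Q] [ChartedSpace E Q]

/-- A (not necessarily smooth) field of tangent subspaces on a manifold modelled on `E`. -/
abbrev Distr (E : Type*) [NormedAddCommGroup E] [NormedSpace ℝ E]
    (Q : Type*) [TopologicalSpace Q] [ChartedSpace E Q] : Type _ :=
  ∀ q : Q, Submodule ℝ (TangentSpace 𝓘(ℝ, E) q)

/-- Vector fields (no regularity required). -/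
abbrev VField (E : Type*) [NormedAddCommGroup E] [NormedSpace ℝ E]
    (Q : Type*) [TopologicalSpace Q] [ChartedSpace E Q] : Type _ :=
  ∀ q : Q, TangentSpace 𝓘(ℝ, E) q

/-- The tangent distribution. -/
noncomputable def fullDistr (E : Type*) [NormedAddCommGroup E] [NormedSpace ℝ E]
    (Q : Type*) [TopologicalSpace Q] [ChartedSpace E Q] : Distr E Q := fun _ => ⊤

/-- The Lie bracket of vector fields. -/
noncomputable abbrev lieBr (X Y : VField E Q) : VField E Q :=
  VectorField.mlieBracket 𝓘(ℝ, E) X Y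

variable [IsManifold 𝓘(ℝ, E) ∞ Q]

/-- `X` is a smooth section of `D` over the set `U`. -/
def IsSection (D : Distr E Q) (U : Set Q) (X : VField E Q) : Prop :=
  ContMDiffOn 𝓘(ℝ, E) (𝓘(ℝ, E).prod 𝓘(ℝ, E)) ∞
    (fun q => (⟨q, X q⟩ : TangentBundle 𝓘(ℝ, E) Q)) U ∧ ∀ q ∈ U, X q ∈ D q

/-- `D` is a smooth subbundle of rank `k`: it has local smooth frames with `k` elements. -/
def IsSmoothDistr (k : ℕ) (D : Distr E Q) : Prop :=
  ∀ q₀ : Q, ∃ U : Set Q, IsOpen U ∧ q₀ ∈ U ∧ ∃ X : Fin k → VField E Q,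
    (∀ i, IsSection D U (X i)) ∧
    ∀ q ∈ U, LinearIndependent ℝ (fun i => X i q) ∧
      D q = Submodule.span ℝ (range fun i => X i q)

/-- The values `[D, D']` of all Lie brackets of local smooth sections of `D` and of `D'`. -/
noncomputable def bracketDistr (D D' : Distr E Q) : Distr E Q := fun q =>
  Submodule.span ℝ {v | ∃ U : Set Q, IsOpen U ∧ q ∈ U ∧ ∃ X Y : VField E Q,
    IsSection D U X ∧ IsSection D' U Y ∧ v = lieBr X Y q}

/-- `D² = [D, D]`. -/
noncomputable def derived2 (D : Distr E Q) : Distr E Q := bracketDistr D D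

/-- `D³ = D² + [D, D²]`. -/
noncomputable def derived3 (D : Distr E Q) : Distr E Q := fun q =>
  derived2 D q ⊔ bracketDistr D (derived2 D) q

/-- An Engel structure on a four-manifold. -/
structure IsEngel (D : Distr E Q) : Prop where
  dim : finrank ℝ E = 4
  rank_two : IsSmoothDistr 2 D
  rank_three : IsSmoothDistr 3 (derived2 D)
  top : ∀ q, derived3 D q = ⊤

/-- The characteristic line field `L ⊂ D` of an Engel structure, given by `[L, D²] ⊂ D²`. -/
noncomputable def charLine (D : Distr E Q) : Distr E Q := fun q =>
  Submodule.span ℝ {v | ∃ U : Set Q, IsOpen U ∧ q ∈ U ∧ ∃ W : VField E Q,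
    IsSection D U W ∧ v = W q ∧
    ∀ V : Set Q, IsOpen V → q ∈ V → ∀ Y : VField E Q, IsSection (derived2 D) V Y →
      lieBr W Y q ∈ derived2 D q}

/-- The leaf through `q` of the foliation defined by the characteristic line field: all points
which can be joined to `q` by a smooth curve tangent to the line field. -/
def leaf (D : Distr E Q) (q : Q) : Set Q :=
  {q' | ∃ γ : ℝ → Q, ContMDiff 𝓘(ℝ, ℝ) 𝓘(ℝ, E) ∞ γ ∧ γ 0 = q ∧ γ 1 = q' ∧
    ∀ t : ℝ, mfderiv 𝓘(ℝ, ℝ) 𝓘(ℝ, E) γ t (1 : ℝ) ∈ charLine D (γ t)}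

/-- Engel immersions between Engel manifolds of the same dimension. -/
structure IsEngelImmersion
    {E' : Type*} [NormedAddCommGroup E'] [NormedSpace ℝ E']
    {Q' : Type*} [TopologicalSpace Q'] [ChartedSpace E' Q']
    (D : Distr E Q) (D' : Distr E' Q') (φ : Q → Q') : Prop where
  smooth : ContMDiff 𝓘(ℝ, E) 𝓘(ℝ, E') ∞ φ
  immersion : ∀ q, Function.Injective (mfderiv 𝓘(ℝ, E) 𝓘(ℝ, E') φ q)
  map_eq : ∀ q, (D q).map (mfderiv 𝓘(ℝ, E) 𝓘(ℝ, E') φ q).toLinearMap = D' (φ q)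

/-- `π : Q → M` realizes the manifold `M` as the leaf space of the characteristic foliation:
it is a surjective smooth submersion whose fibers are exactly the leaves. -/
structure IsLeafQuotient
    (F : Type*) [NormedAddCommGroup F] [NormedSpace ℝ F]
    {M : Type*} [TopologicalSpace M] [ChartedSpace F M]
    (D : Distr E Q) (π : Q → M) : Prop where
  smooth : ContMDiff 𝓘(ℝ, E) 𝓘(ℝ, F) ∞ π
  surjective : Function.Surjective π
  submersion : ∀ q, Function.Surjective (mfderiv 𝓘(ℝ, E) 𝓘(ℝ, F) π q)
  fiber_eq_leaf : ∀ q, π ⁻¹' {π q} = leaf D q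

/-- An orientation of the rank `k` distribution `D`: an orientation of each `D q` which is
locally given by smooth frames. -/
structure DistrOrientation (k : ℕ) (D : Distr E Q) where
  orient : ∀ q, Orientation ℝ (D q) (Fin k)
  continuous : ∀ q₀ : Q, ∃ U : Set Q, IsOpen U ∧ q₀ ∈ U ∧ ∃ X : Fin k → VField E Q,
    (∀ i, IsSection D U (X i)) ∧
    ∀ q ∈ U, ∃ b : Basis (Fin k) ℝ (D q),
      (∀ i, (b i : TangentSpace 𝓘(ℝ, E) q) = X i q) ∧ b.orientation = orient q

/-- `v` is a positively oriented basis of `D q`. -/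
def DistrOrientation.IsPos {k : ℕ} {D : Distr E Q} (o : DistrOrientation k D) (q : Q)
    (v : Fin k → TangentSpace 𝓘(ℝ, E) q) : Prop :=
  ∃ b : Basis (Fin k) ℝ (D q),
    (∀ i, (b i : TangentSpace 𝓘(ℝ, E) q) = v i) ∧ b.orientation = o.orient q

/-- An Engel immersion preserving the orientations of the Engel planes and of the manifolds. -/
structure IsOrientedEngelImmersion
    {E' : Type*} [NormedAddCommGroup E'] [NormedSpace ℝ E']
    {Q' : Type*} [TopologicalSpace Q'] [ChartedSpace E' Q'] [IsManifold 𝓘(ℝ, E') ∞ Q']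
    {D : Distr E Q} {D' : Distr E' Q'}
    (oD : DistrOrientation 2 D) (oQ : DistrOrientation 4 (fullDistr E Q))
    (oD' : DistrOrientation 2 D') (oQ' : DistrOrientation 4 (fullDistr E' Q'))
    (φ : Q → Q') : Prop where
  engel : IsEngelImmersion D D' φ
  pos_planes : ∀ q v, oD.IsPos q v →
    oD'.IsPos (φ q) (fun i => mfderiv 𝓘(ℝ, E) 𝓘(ℝ, E') φ q (v i))
  pos_manifold : ∀ q v, oQ.IsPos q v →
    oQ'.IsPos (φ q) (fun i => mfderiv 𝓘(ℝ, E) 𝓘(ℝ, E') φ q (v i))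

/-- Near `q`, the fields `W` and `X` are smooth sections of the characteristic line field and of
the oriented Engel field `D`, such that at `q` the frame `(W, X)` of `D` and the frame
`(W, X, [W, X], [[W, X], X])` of the oriented four-manifold are positive. -/
def IsAdapted {D : Distr E Q} (oD : DistrOrientation 2 D)
    (oQ : DistrOrientation 4 (fullDistr E Q)) (q : Q) (W X : VField E Q) : Prop :=
  (∃ U : Set Q, IsOpen U ∧ q ∈ U ∧ IsSection (charLine D) U W ∧ IsSection D U X) ∧
  oD.IsPos q ![W q, X q] ∧
  oQ.IsPos q ![W q, X q, lieBr W X q, lieBr (lieBr W X) X q]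

end Distributions

/-! ### Plane fields and their prolongations -/

section Prolongation

/-- A smooth field of tangent 2-planes. -/
structure PlaneField (F : Type*) [NormedAddCommGroup F] [NormedSpace ℝ F]
    (M : Type*) [TopologicalSpace M] [ChartedSpace F M] [IsManifold 𝓘(ℝ, F) ∞ M] where
  plane : Distr F M
  smooth : IsSmoothDistr 2 plane

/-- The two kinds of directions in a vector space: lines through the origin, and rays. -/
inductive DirKind
  | line
  | ray

/-- The scalars by which one may multiply without changing the direction. -/
def DirKind.scalars : DirKind → Set ℝ
  | .line => {a | a ≠ 0}
  | .ray => {a | 0 < a}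

variable {F : Type*} [NormedAddCommGroup F] [NormedSpace ℝ F]
variable {M : Type*} [TopologicalSpace M] [ChartedSpace F M] [IsManifold 𝓘(ℝ, F) ∞ M]

/-- A contact structure on a three-manifold. -/
structure PlaneField.IsContact (ξ : PlaneField F M) : Prop where
  dim : finrank ℝ F = 3
  top : ∀ m, derived2 ξ.plane m = ⊤

/-- The prolongation of a plane field `ξ`: the set of pairs consisting of a point `m` and a
direction in `ξ m`. For `DirKind.line` this is the projectivization `ℙ ξ`, a direction being given
as a line with the origin removed; for `DirKind.ray` it is the circle bundle `S ξ` of open rays. -/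
@[ext]
structure Prolong (ξ : PlaneField F M) (κ : DirKind) where
  base : M
  dir : Set (TangentSpace 𝓘(ℝ, F) base)
  isDir : ∃ v ∈ ξ.plane base, v ≠ 0 ∧ dir = {u | ∃ a ∈ κ.scalars, u = a • v}

namespace Prolong

variable {ξ : PlaneField F M} {κ : DirKind}

/-- The direction of a nonzero vector. -/
def ofVec (ξ : PlaneField F M) (κ : DirKind) (m : M) (v : TangentSpace 𝓘(ℝ, F) m)
    (hv : v ∈ ξ.plane m) (h0 : v ≠ 0) : Prolong ξ κ :=
  ⟨m, {u | ∃ a ∈ κ.scalars, u = a • v}, v, hv, h0, rfl⟩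

/-- `e` is the chart `(m, ℓ) ↦ (c m, w)`, where `c` is a chart of `M`, `ℓ` is the direction of
`X₀ m + w • X₁ m`, and `X₀, X₁` is a smooth frame of `ξ` over an open set `U`. -/
def IsFrameChart (ξ : PlaneField F M) (κ : DirKind) (e : PartialEquiv (Prolong ξ κ) (F × ℝ)) :
    Prop :=
  ∃ c ∈ atlas F M, ∃ U : Set M, IsOpen U ∧ U ⊆ c.source ∧ ∃ X₀ X₁ : VField F M,
    IsSection ξ.plane U X₀ ∧ IsSection ξ.plane U X₁ ∧
    (∀ m ∈ U, LinearIndependent ℝ ![X₀ m, X₁ m]) ∧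
    e.source = {p | p.base ∈ U ∧ ∃ w : ℝ, X₀ p.base + w • X₁ p.base ∈ p.dir} ∧
    e.target = {y | y.1 ∈ c.target ∧ c.symm y.1 ∈ U} ∧
    ∀ p ∈ e.source, (e p).1 = c p.base ∧ X₀ p.base + (e p).2 • X₁ p.base ∈ p.dir


theorem _root_.DirKind.one_mem (κ : DirKind) : (1 : ℝ) ∈ κ.scalars := by
  cases κ <;> simp [DirKind.scalars]

theorem _root_.DirKind.mul_mem (κ : DirKind) {a b : ℝ} (ha : a ∈ κ.scalars)
    (hb : b ∈ κ.scalars) : a * b ∈ κ.scalars := by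
  cases κ
  · exact mul_ne_zero ha hb
  · exact mul_pos (show 0 < a from ha) hb

theorem _root_.DirKind.inv_mem (κ : DirKind) {a : ℝ} (ha : a ∈ κ.scalars) :
    a⁻¹ ∈ κ.scalars := by
  cases κ
  · exact inv_ne_zero ha
  · exact inv_pos.2 (show 0 < a from ha)

theorem _root_.DirKind.ne_zero (κ : DirKind) {a : ℝ} (ha : a ∈ κ.scalars) : a ≠ 0 := by
  cases κ
  · exact ha
  · exact ne_of_gt (show 0 < a from ha)

theorem _root_.DirKind.isOpen_scalars (κ : DirKind) : IsOpen κ.scalars := by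
  cases κ
  · exact isOpen_ne
  · exact isOpen_Ioi

theorem mem_plane (p : Prolong ξ κ) {v : TangentSpace 𝓘(ℝ, F) p.base} (hv : v ∈ p.dir) :
    v ∈ ξ.plane p.base := by
  obtain ⟨x, hx, -, h⟩ := p.isDir
  rw [h] at hv
  obtain ⟨a, -, rfl⟩ := hv
  exact Submodule.smul_mem _ _ hx

theorem ne_zero (p : Prolong ξ κ) {v : TangentSpace 𝓘(ℝ, F) p.base} (hv : v ∈ p.dir) :
    v ≠ 0 := by
  obtain ⟨x, -, h0, h⟩ := p.isDir
  rw [h] at hv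
  obtain ⟨a, ha, rfl⟩ := hv
  exact smul_ne_zero (κ.ne_zero ha) h0

theorem dir_eq (p : Prolong ξ κ) {v : TangentSpace 𝓘(ℝ, F) p.base} (hv : v ∈ p.dir) :
    p.dir = {u | ∃ a ∈ κ.scalars, u = a • v} := by
  obtain ⟨x, -, -, h⟩ := p.isDir
  rw [h] at hv
  obtain ⟨a, ha, rfl⟩ := hv
  rw [h]
  ext u
  constructor
  · rintro ⟨b, hb, rfl⟩
    refine ⟨b * a⁻¹, κ.mul_mem hb (κ.inv_mem ha), ?_⟩
    rw [smul_smul, mul_assoc, inv_mul_cancel₀ (κ.ne_zero ha), mul_one]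
  · rintro ⟨b, hb, rfl⟩
    exact ⟨b * a, κ.mul_mem hb ha, by rw [smul_smul]⟩

theorem exists_mem (p : Prolong ξ κ) : ∃ v, v ∈ p.dir := by
  obtain ⟨x, -, -, h⟩ := p.isDir
  exact ⟨x, by rw [h]; exact ⟨1, κ.one_mem, (one_smul _ _).symm⟩⟩

theorem mem_ofVec (m : M) (v : TangentSpace 𝓘(ℝ, F) m)
    (hv : v ∈ ξ.plane m) (h0 : v ≠ 0) : v ∈ (ofVec ξ κ m v hv h0).dir :=
  ⟨1, κ.one_mem, (one_smul _ _).symm⟩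

theorem eq_ofVec (p : Prolong ξ κ) {v : TangentSpace 𝓘(ℝ, F) p.base} (hv : v ∈ p.dir) :
    p = ofVec ξ κ p.base v (p.mem_plane hv) (p.ne_zero hv) :=
  Prolong.ext rfl (p.dir_eq hv)

theorem exists_coeff (ξ : PlaneField F M) {m : M} {x y z : TangentSpace 𝓘(ℝ, F) m}
    (hx : x ∈ ξ.plane m) (hy : y ∈ ξ.plane m) (hz : z ∈ ξ.plane m)
    (h : LinearIndependent ℝ ![x, y]) : ∃ a b : ℝ, z = a • x + b • y := by
  obtain ⟨U, -, hm, X, -, hX⟩ := ξ.smooth m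
  obtain ⟨hli, hspan⟩ := hX m hm
  have h2 : finrank ℝ (ξ.plane m) = 2 := by
    rw [hspan, finrank_span_eq_card hli, Fintype.card_fin]
  have hfin : FiniteDimensional ℝ (ξ.plane m) := Module.finite_of_finrank_pos (by omega)
  have hle : Submodule.span ℝ (range ![x, y]) ≤ ξ.plane m := by
    rw [Submodule.span_le]
    rintro _ ⟨i, rfl⟩
    fin_cases i
    · exact hx
    · exact hy
  have heq : Submodule.span ℝ (range ![x, y]) = ξ.plane m := by
    apply Submodule.eq_of_le_of_finrank_eq hle
    rw [finrank_span_eq_card h, h2, Fintype.card_fin]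
  rw [← heq, Matrix.range_cons, Matrix.range_cons, Matrix.range_empty, union_empty,
    singleton_union, Submodule.mem_span_pair] at hz
  obtain ⟨a, b, h⟩ := hz
  exact ⟨a, b, h.symm⟩

theorem exists_coeff_smooth [FiniteDimensional ℝ F] (ξ : PlaneField F M) {V : Set M}
    (hV : IsOpen V) {X Y Z : VField F M} (hX : IsSection ξ.plane V X) (hY : IsSection ξ.plane V Y)
    (hZ : IsSection ξ.plane V Z) (hli : ∀ m ∈ V, LinearIndependent ℝ ![X m, Y m]) :
    ∃ a b : M → ℝ, ContMDiffOn 𝓘(ℝ, F) 𝓘(ℝ, ℝ) ∞ a V ∧ ContMDiffOn 𝓘(ℝ, F) 𝓘(ℝ, ℝ) ∞ b V ∧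
      ∀ m ∈ V, Z m = a m • X m + b m • Y m := by
  have key : ∀ m, ∃ ab : ℝ × ℝ, m ∈ V → Z m = ab.1 • X m + ab.2 • Y m := by
    intro m
    by_cases hm : m ∈ V
    · obtain ⟨a, b, h⟩ := exists_coeff ξ (hX.2 m hm) (hY.2 m hm) (hZ.2 m hm) (hli m hm)
      exact ⟨(a, b), fun _ => h⟩
    · exact ⟨0, fun h => absurd h hm⟩
  choose ab hab using key
  have main : ∀ m₀ ∈ V, ContMDiffAt 𝓘(ℝ, F) 𝓘(ℝ, ℝ) ∞ (fun m => (ab m).1) m₀ ∧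
      ContMDiffAt 𝓘(ℝ, F) 𝓘(ℝ, ℝ) ∞ (fun m => (ab m).2) m₀ := by
    intro m₀ hm₀
    let t := trivializationAt F (TangentSpace 𝓘(ℝ, F) : M → Type _) m₀
    have hb : m₀ ∈ t.baseSet := FiberBundle.mem_baseSet_trivializationAt' m₀
    have sm : ∀ {S : VField F M}, IsSection ξ.plane V S →
        ContMDiffAt 𝓘(ℝ, F) 𝓘(ℝ, F) ∞ (fun m => (t ⟨m, S m⟩).2) m₀ := by
      intro S hS
      have := hS.1.contMDiffAt (hV.mem_nhds hm₀)
      exact (Bundle.contMDiffAt_section (s := S) m₀).1 this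
    have hx := sm hX
    have hy := sm hY
    have hz := sm hZ
    have rel : ∀ᶠ m in 𝓝 m₀, (t ⟨m, Z m⟩).2 =
        (ab m).1 • (t ⟨m, X m⟩).2 + (ab m).2 • (t ⟨m, Y m⟩).2 := by
      filter_upwards [hV.mem_nhds hm₀, t.open_baseSet.mem_nhds hb] with m hm hmb
      have hc : ∀ v, (t ⟨m, v⟩).2 = t.continuousLinearEquivAt ℝ m hmb v := fun v => rfl
      rw [hc, hc, hc, hab m hm, map_add, map_smul, map_smul]
    have hli' : LinearIndependent ℝ ![(t ⟨m₀, X m₀⟩).2, (t ⟨m₀, Y m₀⟩).2] := by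
      have h := (hli m₀ hm₀).map' (t.continuousLinearEquivAt ℝ m₀ hb).toLinearEquiv.toLinearMap
        (LinearEquiv.ker _)
      have e : (t.continuousLinearEquivAt ℝ m₀ hb).toLinearEquiv.toLinearMap ∘ ![X m₀, Y m₀] =
          ![(t ⟨m₀, X m₀⟩).2, (t ⟨m₀, Y m₀⟩).2] := by
        funext i
        fin_cases i <;> rfl
      rw [← e]
      exact h
    have dual : ∀ i : Fin 2, ∃ l : F →L[ℝ] ℝ, ∀ j : Fin 2,
        l (![(t ⟨m₀, X m₀⟩).2, (t ⟨m₀, Y m₀⟩).2] j) = if j = i then 1 else 0 := by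
      intro i
      obtain ⟨g, hg⟩ := LinearMap.exists_extend
        ((Finsupp.lapply i : (Fin 2 →₀ ℝ) →ₗ[ℝ] ℝ) ∘ₗ hli'.repr)
      refine ⟨LinearMap.toContinuousLinearMap g, fun j => ?_⟩
      have hmem : ![(t ⟨m₀, X m₀⟩).2, (t ⟨m₀, Y m₀⟩).2] j ∈
          Submodule.span ℝ (range ![(t ⟨m₀, X m₀⟩).2, (t ⟨m₀, Y m₀⟩).2]) :=
        Submodule.subset_span ⟨j, rfl⟩
      have h1 := LinearMap.congr_fun hg ⟨_, hmem⟩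
      have h2 := hli'.repr_eq_single j ⟨_, hmem⟩ rfl
      simp only [LinearMap.comp_apply, Submodule.subtype_apply] at h1
      rw [h2] at h1
      simp only [LinearMap.coe_toContinuousLinearMap']
      rw [h1]
      simp [Finsupp.single_apply]
    obtain ⟨l, hl⟩ := dual 0
    obtain ⟨k, hk⟩ := dual 1
    have sl : ∀ (f : F →L[ℝ] ℝ) {u : M → F}, ContMDiffAt 𝓘(ℝ, F) 𝓘(ℝ, F) ∞ u m₀ →
        ContMDiffAt 𝓘(ℝ, F) 𝓘(ℝ, ℝ) ∞ (fun m => f (u m)) m₀ := fun f u hu =>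
      f.contMDiff.contMDiffAt.comp m₀ hu
    let d : M → ℝ := fun m => l (t ⟨m, X m⟩).2 * k (t ⟨m, Y m⟩).2 -
      l (t ⟨m, Y m⟩).2 * k (t ⟨m, X m⟩).2
    have hd : ContMDiffAt 𝓘(ℝ, F) 𝓘(ℝ, ℝ) ∞ d m₀ :=
      ((sl l hx).mul (sl k hy)).sub ((sl l hy).mul (sl k hx))
    have hd0 : d m₀ ≠ 0 := by
      have e1 := hl 0
      have e2 := hl 1
      have e3 := hk 0
      have e4 := hk 1
      simp at e1 e2 e3 e4
      simp [d, e1, e2, e3, e4]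
    have hdn : ∀ᶠ m in 𝓝 m₀, d m ≠ 0 := hd.continuousAt.eventually_ne hd0
    constructor
    · refine ContMDiffAt.congr_of_eventuallyEq (f := fun m =>
        (l (t ⟨m, Z m⟩).2 * k (t ⟨m, Y m⟩).2 - l (t ⟨m, Y m⟩).2 * k (t ⟨m, Z m⟩).2) / d m)
        ((((sl l hz).mul (sl k hy)).sub ((sl l hy).mul (sl k hz))).div₀ hd hd0) ?_
      filter_upwards [rel, hdn] with m hr hm
      rw [eq_div_iff hm, hr]
      simp only [map_add, map_smul, smul_eq_mul, d]
      ring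
    · refine ContMDiffAt.congr_of_eventuallyEq (f := fun m =>
        (l (t ⟨m, X m⟩).2 * k (t ⟨m, Z m⟩).2 - l (t ⟨m, Z m⟩).2 * k (t ⟨m, X m⟩).2) / d m)
        ((((sl l hx).mul (sl k hz)).sub ((sl l hz).mul (sl k hx))).div₀ hd hd0) ?_
      filter_upwards [rel, hdn] with m hr hm
      rw [eq_div_iff hm, hr]
      simp only [map_add, map_smul, smul_eq_mul, d]
      ring
  exact ⟨fun m => (ab m).1, fun m => (ab m).2, fun m hm => (main m hm).1.contMDiffWithinAt,
    fun m hm => (main m hm).2.contMDiffWithinAt, hab⟩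

theorem smul_mem_dir (p : Prolong ξ κ) {v : TangentSpace 𝓘(ℝ, F) p.base} (hv : v ∈ p.dir) {a : ℝ}
    (ha : a ∈ κ.scalars) : a • v ∈ p.dir := by
  rw [p.dir_eq hv]
  exact ⟨a, ha, rfl⟩

/-- Around each point there is a frame chart. -/
theorem exists_frameChart (p : Prolong ξ κ) : ∃ e, IsFrameChart ξ κ e ∧ p ∈ e.source := by
  classical
  obtain ⟨U', hU', hpU', X, hX, hX'⟩ := ξ.smooth p.base
  obtain ⟨v, hv⟩ := p.exists_mem
  have hXp : ∀ m ∈ U', ∀ i, X i m ∈ ξ.plane m := fun m hm i => (hX i).2 m hm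
  have hli : ∀ m ∈ U', LinearIndependent ℝ ![X 0 m, X 1 m] := by
    intro m hm
    have := (hX' m hm).1
    convert this using 1
    funext i
    fin_cases i <;> rfl
  obtain ⟨a, b, hab⟩ := exists_coeff ξ (hXp _ hpU' 0) (hXp _ hpU' 1) (p.mem_plane hv) (hli _ hpU')
  have hne : a ^ 2 + b ^ 2 ≠ 0 := by
    intro h
    have ha : a = 0 := by nlinarith [sq_nonneg a, sq_nonneg b]
    have hb : b = 0 := by nlinarith [sq_nonneg a, sq_nonneg b]
    exact p.ne_zero hv (by rw [hab, ha, hb, zero_smul, zero_smul, add_zero])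
  let c := chartAt F p.base
  let U : Set M := U' ∩ c.source
  have hU : IsOpen U := hU'.inter c.open_source
  have hpU : p.base ∈ U := ⟨hpU', mem_chart_source F p.base⟩
  let Y₀ : VField F M := fun m => a • X 0 m + b • X 1 m
  let Y₁ : VField F M := fun m => (-b) • X 0 m + a • X 1 m
  have hsec : ∀ r s : ℝ, IsSection ξ.plane U (fun m => r • X 0 m + s • X 1 m) := by
    intro r s
    refine ⟨?_, fun m hm => Submodule.add_mem _ (Submodule.smul_mem _ _ (hXp m hm.1 0))
      (Submodule.smul_mem _ _ (hXp m hm.1 1))⟩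
    exact ContMDiffOn.add_section
      (ContMDiffOn.const_smul_section ((hX 0).1.mono inter_subset_left))
      (ContMDiffOn.const_smul_section ((hX 1).1.mono inter_subset_left))
  have hliY : ∀ m ∈ U, LinearIndependent ℝ ![Y₀ m, Y₁ m] := by
    intro m hm
    rw [LinearIndependent.pair_iff]
    intro s t hst
    have h := LinearIndependent.pair_iff.1 (hli m hm.1) (s * a - t * b) (s * b + t * a) (by
      rw [← hst]
      simp only [Y₀, Y₁]
      module)
    obtain ⟨h1, h2⟩ := h
    constructor
    · have : s * (a ^ 2 + b ^ 2) = 0 := by linear_combination a * h1 + b * h2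
      exact (mul_eq_zero.1 this).resolve_right hne
    · have : t * (a ^ 2 + b ^ 2) = 0 := by linear_combination a * h2 - b * h1
      exact (mul_eq_zero.1 this).resolve_right hne
  have hYmem : ∀ m ∈ U, ∀ w : ℝ, Y₀ m + w • Y₁ m ∈ ξ.plane m := fun m hm w =>
    Submodule.add_mem _ ((hsec a b).2 m hm) (Submodule.smul_mem _ _ ((hsec (-b) a).2 m hm))
  have hYne : ∀ m ∈ U, ∀ w : ℝ, Y₀ m + w • Y₁ m ≠ 0 := by
    intro m hm w h
    have := LinearIndependent.pair_iff.1 (hliY m hm) 1 w (by rw [one_smul]; exact h)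
    exact one_ne_zero this.1
  have huniq : ∀ q : Prolong ξ κ, q.base ∈ U → ∀ w w' : ℝ, Y₀ q.base + w • Y₁ q.base ∈ q.dir →
      Y₀ q.base + w' • Y₁ q.base ∈ q.dir → w = w' := by
    intro q hq w w' h h'
    rw [q.dir_eq h'] at h
    obtain ⟨s, -, hs⟩ := h
    have := LinearIndependent.pair_iff.1 (hliY _ hq) (1 - s) (w - s * w') (by
      rw [sub_smul, sub_smul, one_smul, mul_smul]
      have : Y₀ q.base + w • Y₁ q.base - s • (Y₀ q.base + w' • Y₁ q.base) = 0 := by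
        rw [hs, sub_self]
      rw [← this]
      module)
    obtain ⟨h1, h2⟩ := this
    have : s = 1 := by linarith
    rw [this] at h2
    linarith
  let f : Prolong ξ κ → F × ℝ := fun q =>
    (c q.base, if h : ∃ w : ℝ, Y₀ q.base + w • Y₁ q.base ∈ q.dir then h.choose else 0)
  let g : F × ℝ → Prolong ξ κ := fun y =>
    if h : c.symm y.1 ∈ U then
      ofVec ξ κ (c.symm y.1) (Y₀ (c.symm y.1) + y.2 • Y₁ (c.symm y.1)) (hYmem _ h _) (hYne _ h _)
    else p
  have hf : ∀ q : Prolong ξ κ, (∃ w : ℝ, Y₀ q.base + w • Y₁ q.base ∈ q.dir) →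
      Y₀ q.base + (f q).2 • Y₁ q.base ∈ q.dir := by
    intro q h
    have : (f q).2 = h.choose := dif_pos h
    rw [this]
    exact h.choose_spec
  have hg : ∀ (m : M) (hm : m ∈ U) (w : ℝ),
      g (c m, w) = ofVec ξ κ m (Y₀ m + w • Y₁ m) (hYmem _ hm _) (hYne _ hm _) := by
    intro m hm w
    have h1 : c.symm (c m) = m := c.left_inv hm.2
    have h2 : g (c m, w) = ofVec ξ κ (c.symm (c m)) (Y₀ (c.symm (c m)) + w • Y₁ (c.symm (c m)))
        (hYmem _ (h1.symm ▸ hm) _) (hYne _ (h1.symm ▸ hm) _) := dif_pos (h1.symm ▸ hm)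
    have gen : ∀ m', m' = m → ∀ hm' : m' ∈ U,
        ofVec ξ κ m' (Y₀ m' + w • Y₁ m') (hYmem _ hm' _) (hYne _ hm' _) =
        ofVec ξ κ m (Y₀ m + w • Y₁ m) (hYmem _ hm _) (hYne _ hm _) := by
      rintro _ rfl _
      rfl
    rw [h2]
    exact gen _ h1 (h1.symm ▸ hm)
  let e : PartialEquiv (Prolong ξ κ) (F × ℝ) :=
    { toFun := f
      invFun := g
      source := {q | q.base ∈ U ∧ ∃ w : ℝ, Y₀ q.base + w • Y₁ q.base ∈ q.dir}
      target := {y | y.1 ∈ c.target ∧ c.symm y.1 ∈ U}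
      map_source' := by
        rintro q ⟨hq, -⟩
        refine ⟨c.map_source hq.2, ?_⟩
        change c.symm (c q.base) ∈ U
        rw [c.left_inv hq.2]
        exact hq
      map_target' := by
        rintro ⟨x, w⟩ ⟨hx, hxU⟩
        have h1 := hg (c.symm x) hxU w
        rw [c.right_inv hx] at h1
        rw [h1]
        exact ⟨hxU, w, mem_ofVec _ _ _ _⟩
      left_inv' := by
        rintro q ⟨hq, hw⟩
        have h1 := hg q.base hq (f q).2
        have h2 : f q = (c q.base, (f q).2) := rfl
        rw [h2, h1]
        exact (q.eq_ofVec (hf q hw)).symm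
      right_inv' := by
        rintro ⟨x, w⟩ ⟨hx, hxU⟩
        have h1 := hg (c.symm x) hxU w
        rw [c.right_inv hx] at h1
        rw [h1]
        have h3 := mem_ofVec (κ := κ) _ _ (hYmem _ hxU w) (hYne _ hxU w)
        refine Prod.ext (c.right_inv hx) ?_
        exact huniq _ hxU _ _ (hf _ ⟨w, h3⟩) h3 }
  refine ⟨e, ⟨c, chart_mem_atlas F p.base, U, hU, inter_subset_right, Y₀, Y₁, hsec a b,
    hsec (-b) a, hliY, rfl, rfl, fun q hq => ⟨rfl, hf q hq.2⟩⟩, hpU, 0, ?_⟩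
  rw [zero_smul, add_zero]
  change a • X 0 p.base + b • X 1 p.base ∈ p.dir
  rw [← hab]
  exact hv

/-- The transition maps between frame charts are smooth, with open domains. -/
theorem IsFrameChart.transition [FiniteDimensional ℝ F] {e e' : PartialEquiv (Prolong ξ κ) (F × ℝ)}
    (he : IsFrameChart ξ κ e) (he' : IsFrameChart ξ κ e') :
    IsOpen (e.symm.trans e').source ∧
      ContDiffOn ℝ ∞ (e.symm.trans e') (e.symm.trans e').source := by
  obtain ⟨c, hc, U, hU, hUc, X, Y, hX, hY, hli, hs, ht, hv⟩ := he
  obtain ⟨c', hc', U', hU', hUc', X', Y', hX', hY', hli', hs', ht', hv'⟩ := he'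
  have hV : IsOpen (U ∩ U') := hU.inter hU'
  have res : ∀ {W : Set M} {S : VField F M}, IsSection ξ.plane W S → U ∩ U' ⊆ W →
      IsSection ξ.plane (U ∩ U') S := fun h hW => ⟨h.1.mono hW, fun m hm => h.2 m (hW hm)⟩
  have hliV : ∀ m ∈ U ∩ U', LinearIndependent ℝ ![X' m, Y' m] := fun m hm => hli' m hm.2
  obtain ⟨a₀, b₀, ha₀, hb₀, h₀⟩ := exists_coeff_smooth ξ hV (res hX' inter_subset_right)
    (res hY' inter_subset_right) (res hX inter_subset_left) hliV
  obtain ⟨a₁, b₁, ha₁, hb₁, h₁⟩ := exists_coeff_smooth ξ hV (res hX' inter_subset_right)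
    (res hY' inter_subset_right) (res hY inter_subset_left) hliV
  let T : Set (F × ℝ) := {y | y.1 ∈ c.target ∧ c.symm y.1 ∈ U ∩ U'}
  have hT₀ : IsOpen (c.target ∩ c.symm ⁻¹' (U ∩ U')) := c.isOpen_inter_preimage_symm hV
  have hT : IsOpen T := hT₀.preimage continuous_fst
  let A : F × ℝ → ℝ := fun y => a₀ (c.symm y.1) + y.2 * a₁ (c.symm y.1)
  let B : F × ℝ → ℝ := fun y => b₀ (c.symm y.1) + y.2 * b₁ (c.symm y.1)
  have hcs : ContMDiffOn 𝓘(ℝ, F) 𝓘(ℝ, F) ∞ c.symm c.target :=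
    contMDiffOn_symm_of_mem_maximalAtlas (IsManifold.subset_maximalAtlas hc)
  have lift : ∀ {u : M → ℝ}, ContMDiffOn 𝓘(ℝ, F) 𝓘(ℝ, ℝ) ∞ u (U ∩ U') →
      ContDiffOn ℝ ∞ (fun y : F × ℝ => u (c.symm y.1)) T := by
    intro u hu
    have h1 : ContMDiffOn 𝓘(ℝ, F) 𝓘(ℝ, ℝ) ∞ (u ∘ c.symm) (c.target ∩ c.symm ⁻¹' (U ∩ U')) :=
      hu.comp (hcs.mono inter_subset_left) fun x hx => hx.2
    exact (contMDiffOn_iff_contDiffOn.1 h1).comp contDiff_fst.contDiffOn fun y hy => hy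
  have hA : ContDiffOn ℝ ∞ A T := (lift ha₀).add (contDiff_snd.contDiffOn.mul (lift ha₁))
  have hB : ContDiffOn ℝ ∞ B T := (lift hb₀).add (contDiff_snd.contDiffOn.mul (lift hb₁))
  have comb : ∀ m ∈ U ∩ U', ∀ w : ℝ, X m + w • Y m =
      (a₀ m + w * a₁ m) • X' m + (b₀ m + w * b₁ m) • Y' m := by
    intro m hm w
    rw [h₀ m hm, h₁ m hm]
    module
  have hback : ∀ y ∈ e.target, (e.symm y).base = c.symm y.1 ∧ (e.symm y).base ∈ U ∧
      X (e.symm y).base + y.2 • Y (e.symm y).base ∈ (e.symm y).dir := by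
    intro y hy
    have hsrc := e.map_target hy
    obtain ⟨h1, h2⟩ := hv _ hsrc
    rw [e.right_inv hy] at h1 h2
    rw [hs] at hsrc
    exact ⟨by rw [h1, c.left_inv (hUc hsrc.1)], hsrc.1, h2⟩
  have hsource : (e.symm.trans e').source = T ∩ A ⁻¹' κ.scalars := by
    ext y
    rw [PartialEquiv.trans_source]
    constructor
    · rintro ⟨hy, hy'⟩
      change y ∈ e.target at hy
      change e.symm y ∈ e'.source at hy'
      obtain ⟨h1, h2, h3⟩ := hback y hy
      rw [hs'] at hy'
      obtain ⟨h4, w, h5⟩ := hy'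
      rw [(e.symm y).dir_eq h5] at h3
      obtain ⟨s, hsκ, h6⟩ := h3
      rw [comb _ ⟨h2, h4⟩] at h6
      have h7 := LinearIndependent.pair_iff.1 (hli' _ h4)
        (a₀ (e.symm y).base + y.2 * a₁ (e.symm y).base - s)
        (b₀ (e.symm y).base + y.2 * b₁ (e.symm y).base - s * w) (by
          rw [sub_smul, sub_smul, mul_smul, ← sub_eq_zero.2 h6]
          module)
      rw [ht] at hy
      refine ⟨⟨hy.1, hy.2, h1 ▸ h4⟩, ?_⟩
      change a₀ (c.symm y.1) + y.2 * a₁ (c.symm y.1) ∈ κ.scalars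
      rw [← h1, sub_eq_zero.1 h7.1]
      exact hsκ
    · rintro ⟨⟨h1, h2, h3⟩, h4⟩
      have hy : y ∈ e.target := by rw [ht]; exact ⟨h1, h2⟩
      refine ⟨hy, ?_⟩
      change e.symm y ∈ e'.source
      obtain ⟨h5, h6, h7⟩ := hback y hy
      rw [← h5] at h3
      change a₀ (c.symm y.1) + y.2 * a₁ (c.symm y.1) ∈ κ.scalars at h4
      rw [← h5] at h4
      rw [comb _ ⟨h6, h3⟩] at h7
      have h8 := (e.symm y).smul_mem_dir h7 (κ.inv_mem h4)
      rw [smul_add, smul_smul, smul_smul, inv_mul_cancel₀ (κ.ne_zero h4), one_smul] at h8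
      rw [hs']
      exact ⟨h3, _, h8⟩
  have hval : ∀ y ∈ (e.symm.trans e').source,
      (e.symm.trans e') y = (c' (c.symm y.1), B y / A y) := by
    intro y hy
    have hy0 := hy
    rw [hsource] at hy0
    obtain ⟨⟨h1, h2, h3⟩, h4⟩ := hy0
    rw [PartialEquiv.trans_source] at hy
    obtain ⟨hy1, hy2⟩ := hy
    change y ∈ e.target at hy1
    change e.symm y ∈ e'.source at hy2
    obtain ⟨h5, h6, h7⟩ := hback y hy1
    obtain ⟨h8, h9⟩ := hv' _ hy2
    change e' (e.symm y) = _
    refine Prod.ext (by rw [h8, h5]) ?_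
    change (e' (e.symm y)).2 = (b₀ (c.symm y.1) + y.2 * b₁ (c.symm y.1)) /
      (a₀ (c.symm y.1) + y.2 * a₁ (c.symm y.1))
    change a₀ (c.symm y.1) + y.2 * a₁ (c.symm y.1) ∈ κ.scalars at h4
    rw [← h5] at h3 h4 ⊢
    rw [comb _ ⟨h6, h3⟩, (e.symm y).dir_eq h9] at h7
    obtain ⟨s, -, hs6⟩ := h7
    have h10 := LinearIndependent.pair_iff.1 (hli' _ h3)
      (a₀ (e.symm y).base + y.2 * a₁ (e.symm y).base - s)
      (b₀ (e.symm y).base + y.2 * b₁ (e.symm y).base - s * (e' (e.symm y)).2) (by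
        rw [sub_smul, sub_smul, mul_smul, ← sub_eq_zero.2 hs6]
        module)
    rw [eq_div_iff (κ.ne_zero h4), sub_eq_zero.1 h10.1, sub_eq_zero.1 h10.2, mul_comm]
  have hopen : IsOpen (T ∩ A ⁻¹' κ.scalars) :=
    hA.continuousOn.isOpen_inter_preimage hT κ.isOpen_scalars
  refine ⟨hsource ▸ hopen, ContDiffOn.congr ?_ hval⟩
  rw [hsource]
  refine ContDiffOn.prodMk ?_ ((hB.mono inter_subset_left).div (hA.mono inter_subset_left)
    fun y hy => κ.ne_zero hy.2)
  have hcc : ContMDiffOn 𝓘(ℝ, F) 𝓘(ℝ, F) ∞ c' c'.source :=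
    contMDiffOn_of_mem_maximalAtlas (IsManifold.subset_maximalAtlas hc')
  have h1 : ContMDiffOn 𝓘(ℝ, F) 𝓘(ℝ, F) ∞ (c' ∘ c.symm) (c.target ∩ c.symm ⁻¹' (U ∩ U')) :=
    hcc.comp (hcs.mono inter_subset_left) fun x hx => hUc' hx.2.2
  exact (contMDiffOn_iff_contDiffOn.1 h1).comp contDiff_fst.contDiffOn fun y hy => hy.1

/-- The smooth structure of the prolongation: its atlas consists of all frame charts. -/
noncomputable def core [FiniteDimensional ℝ F] (ξ : PlaneField F M) (κ : DirKind) :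
    ChartedSpaceCore (F × ℝ) (Prolong ξ κ) where
  atlas := {e | IsFrameChart ξ κ e}
  chartAt p := (exists_frameChart p).choose
  mem_chart_source p := (exists_frameChart p).choose_spec.2
  chart_mem_atlas p := (exists_frameChart p).choose_spec.1
  open_source _ _ he he' := (IsFrameChart.transition he he').1
  continuousOn_toFun _ _ he he' := (IsFrameChart.transition he he').2.continuousOn

noncomputable instance [FiniteDimensional ℝ F] : TopologicalSpace (Prolong ξ κ) :=
  (core ξ κ).toTopologicalSpace

noncomputable instance [FiniteDimensional ℝ F] : ChartedSpace (F × ℝ) (Prolong ξ κ) :=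
  (core ξ κ).toChartedSpace

instance [FiniteDimensional ℝ F] : IsManifold 𝓘(ℝ, F × ℝ) ∞ (Prolong ξ κ) := by
  apply isManifold_of_contDiffOn
  intro e e' he he'
  obtain ⟨e, hh, rfl⟩ := mem_iUnion₂.1 he
  obtain ⟨e', hh', rfl⟩ := mem_iUnion₂.1 he'
  have := (IsFrameChart.transition hh hh').2
  simp only [modelWithCornersSelf_coe, modelWithCornersSelf_coe_symm, Function.comp_id,
    Function.id_comp, preimage_id, range_id, inter_univ]
  exact this

/-- The canonical distribution of the prolongation: a tangent vector at `(m, ℓ)` belongs to it iff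
its image in `T_m M` lies in the line spanned by `ℓ`. -/
noncomputable def canonical [FiniteDimensional ℝ F] (ξ : PlaneField F M) (κ : DirKind) :
    Distr (F × ℝ) (Prolong ξ κ) := fun p =>
  (Submodule.span ℝ p.dir).comap
    (mfderiv 𝓘(ℝ, F × ℝ) 𝓘(ℝ, F) (base : Prolong ξ κ → M) p).toLinearMap

/-- The curve `t ↦ u + t v` of directions in the plane `ξ m`. -/
noncomputable def rotation (ξ : PlaneField F M) (κ : DirKind) (m : M) (u v : TangentSpace 𝓘(ℝ, F) m)
    (hu : u ∈ ξ.plane m) (hv : v ∈ ξ.plane m) (h : LinearIndependent ℝ ![u, v]) (t : ℝ) :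
    Prolong ξ κ :=
  ofVec ξ κ m (u + t • v) (Submodule.add_mem _ hu (Submodule.smul_mem _ _ hv)) fun h0 =>
    one_ne_zero (LinearIndependent.pair_iff.1 h 1 t (by rw [one_smul]; exact h0)).1

/-- The canonical orientations of the Engel planes and of the total space of `S ξ`, for an
oriented plane field `ξ` on an oriented three-manifold. At the ray of `u`, let `(u, v)` be a
positive basis of `ξ m`, let `W` be the vertical vector given by rotating `u` towards `v`, and let
`X` be a vector of the canonical distribution over `u`. Then `(W, X)` is positive, and so is
`(W, X, Y, Z)` whenever the projection of `(X, Y, Z)` to `T_m M` is positive. -/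
def IsCanonicalOrientation [FiniteDimensional ℝ F] {ξ : PlaneField F M}
    (oξ : DistrOrientation 2 ξ.plane) (oM : DistrOrientation 3 (fullDistr F M))
    (oC : DistrOrientation 2 (canonical ξ .ray))
    (oS : DistrOrientation 4 (fullDistr (F × ℝ) (Prolong ξ .ray))) : Prop :=
  ∀ (m : M) (u v : TangentSpace 𝓘(ℝ, F) m) (hu : u ∈ ξ.plane m) (hv : v ∈ ξ.plane m)
    (h : LinearIndependent ℝ ![u, v]), oξ.IsPos m ![u, v] →
    ∀ W X : TangentSpace 𝓘(ℝ, F × ℝ) (rotation ξ .ray m u v hu hv h 0),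
      W = mfderiv 𝓘(ℝ, ℝ) 𝓘(ℝ, F × ℝ) (rotation ξ .ray m u v hu hv h) 0 (1 : ℝ) →
      (mfderiv 𝓘(ℝ, F × ℝ) 𝓘(ℝ, F) base (rotation ξ .ray m u v hu hv h 0) X :
        TangentSpace 𝓘(ℝ, F) m) = u →
      oC.IsPos (rotation ξ .ray m u v hu hv h 0) ![W, X] ∧
      ∀ Y Z : TangentSpace 𝓘(ℝ, F × ℝ) (rotation ξ .ray m u v hu hv h 0),
        oM.IsPos m ![u,
          mfderiv 𝓘(ℝ, F × ℝ) 𝓘(ℝ, F) base (rotation ξ .ray m u v hu hv h 0) Y,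
          mfderiv 𝓘(ℝ, F × ℝ) 𝓘(ℝ, F) base (rotation ξ .ray m u v hu hv h 0) Z] →
        oS.IsPos (rotation ξ .ray m u v hu hv h 0) ![W, X, Y, Z]

end Prolong

/-- The orientations of `ξ` and of `M` inherited from orientations of `D` and of `Q` along
`π : Q → M`: the images of `(X, [W, X])` and of `(X, [W, X], [[W, X], X])` are positive. -/
def IsInheritedOrientation
    {E : Type*} [NormedAddCommGroup E] [NormedSpace ℝ E]
    {Q : Type*} [TopologicalSpace Q] [ChartedSpace E Q] [IsManifold 𝓘(ℝ, E) ∞ Q]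
    {D : Distr E Q} (oD : DistrOrientation 2 D) (oQ : DistrOrientation 4 (fullDistr E Q))
    (π : Q → M) {ξ : PlaneField F M}
    (oξ : DistrOrientation 2 ξ.plane) (oM : DistrOrientation 3 (fullDistr F M)) : Prop :=
  ∀ q W X, IsAdapted oD oQ q W X →
    oξ.IsPos (π q) ![mfderiv 𝓘(ℝ, E) 𝓘(ℝ, F) π q (X q),
      mfderiv 𝓘(ℝ, E) 𝓘(ℝ, F) π q (lieBr W X q)] ∧
    oM.IsPos (π q) ![mfderiv 𝓘(ℝ, E) 𝓘(ℝ, F) π q (X q),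
      mfderiv 𝓘(ℝ, E) 𝓘(ℝ, F) π q (lieBr W X q),
      mfderiv 𝓘(ℝ, E) 𝓘(ℝ, F) π q (lieBr (lieBr W X) X q)]

end Prolongation

/-! Everything is read off from local Engel frames: fields `W`, `X` spanning `D` such that `W, X,
[W,X], [[W,X],X]` is a frame of the tangent bundle and `[W,[W,X]]` lies in `D²`. They exist because,
starting from a frame `Y, X` with `[[Y,X],X]` outside `D²`, a suitable multiple of `X` can be added
to `Y` (`exists_engelFrame`), and then `W` spans the characteristic line (`EngelFrame.charLine_eq`).

Invariance along leaves is obtained without flows. If `h` is constant along leaves, then `W h = 0`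
and hence `W(Y h) = [W,Y] h`. For a distribution `P` with frame `Y_i` and `[W,Y_i] ∈ P`, the
functions `Y_i h` therefore satisfy a linear differential equation along every leaf curve, and
vanish on the whole curve if they do at one point (`transport_of_frames`). With `P = D²` this shows
that `dπ(D²)` does not depend on the point of the leaf. With `P` the whole tangent bundle it shows
that the differential of a leafwise constant map `g` is `A ∘ dπ` with one linear map `A` for the
whole leaf (`IsLeafQuotient.factor_transport`). The plane field `ξ` is contact because along a
suitable section of `π` the bracket of the projections of `X` and `[W,X]` is, up to sign, the
projection of `[[W,X],X]`.

For the development, let `dπ X = a (X₀ + w X₁)` in a frame of `ξ`. Differentiating along `W`, which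
does not move the base point, gives `dπ [W,X] = r dπ X + a (W w) X₁`. As `dπ X` and `dπ [W,X]` are
independent, `W w ≠ 0`: the direction turns with nonzero speed along the leaf. Hence the development
is an immersion between manifolds of dimension four, thus a local homeomorphism. The leaf is the
full preimage of a fiber, so the same holds for its restriction. For compact `Q` the map is a
covering, and its image is clopen, hence a union of the connected fibers.

For the three point statement, an Engel immersion `φ` into a manifold with leaf space `π'` satisfies
`d(π' φ) = A dπ` along a leaf, so the development of the target composed with `φ` is the development
of `Q` followed by the projective map of `A`. Projective maps of a line agreeing at three points are
equal (`exists_factor_of_three`), and since the development of the target is locally injective, `φ`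
and `ψ` agree by unique continuation. In (a) any neighborhood on which the development of `Q` is
injective serves for all targets at once. In (b) the target has no leaf space, but near a
coincidence point `φ⁻¹ ψ` is a local Engel map from `Q` to itself, to be compared with the identity;
the agreement obtained near `p` then propagates along the leaf.

For the orientations, let `W' = f W` and `X' = r W + g X`. The changes of the two- and four-frames
have determinants `f g` and `(f g)³ g`. If both are positive, then `f` and `g` are positive, so the
ray of `dπ X` and the orientations of the projected frames are well defined at a point, and by
continuity along a leaf (`IsAdapted.compare`, `IsAdapted.posRel`). -/

set_option linter.unusedSectionVars false


/-! ### Derivatives and smooth vector fields -/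

section Basics

variable {E : Type*} [NormedAddCommGroup E] [NormedSpace ℝ E]
variable {Q : Type*} [TopologicalSpace Q] [ChartedSpace E Q]
variable {E' : Type*} [NormedAddCommGroup E'] [NormedSpace ℝ E']
variable {Q' : Type*} [TopologicalSpace Q'] [ChartedSpace E' Q']
variable {E'' : Type*} [NormedAddCommGroup E''] [NormedSpace ℝ E'']
variable {Q'' : Type*} [TopologicalSpace Q''] [ChartedSpace E'' Q'']
variable {G : Type*} [NormedAddCommGroup G] [NormedSpace ℝ G]

/-- The derivative of a map between manifolds, as a map between the model spaces. -/
noncomputable def dd (E : Type*) [NormedAddCommGroup E] [NormedSpace ℝ E]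
    {Q : Type*} [TopologicalSpace Q] [ChartedSpace E Q]
    (E' : Type*) [NormedAddCommGroup E'] [NormedSpace ℝ E']
    {Q' : Type*} [TopologicalSpace Q'] [ChartedSpace E' Q'] (f : Q → Q') (q : Q) : E →L[ℝ] E' :=
  mfderiv 𝓘(ℝ, E) 𝓘(ℝ, E') f q

/-- Smoothness of a map at a point, for boundaryless manifolds. -/
abbrev CM (E : Type*) [NormedAddCommGroup E] [NormedSpace ℝ E]
    {Q : Type*} [TopologicalSpace Q] [ChartedSpace E Q]
    (E' : Type*) [NormedAddCommGroup E'] [NormedSpace ℝ E']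
    {Q' : Type*} [TopologicalSpace Q'] [ChartedSpace E' Q'] (f : Q → Q') (q : Q) : Prop :=
  ContMDiffAt 𝓘(ℝ, E) 𝓘(ℝ, E') ∞ f q

/-- The vector field `X` is smooth at `q`. -/
def SmAt [IsManifold 𝓘(ℝ, E) ∞ Q] (X : VField E Q) (q : Q) : Prop :=
  ContMDiffAt 𝓘(ℝ, E) (𝓘(ℝ, E).prod 𝓘(ℝ, E)) ∞
    (fun q => (⟨q, X q⟩ : TangentBundle 𝓘(ℝ, E) Q)) q

/-- The derivative of a vector valued function along a vector field. -/
noncomputable def dv (E' : Type*) [NormedAddCommGroup E'] [NormedSpace ℝ E']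
    (f : Q → E') (X : VField E Q) (q : Q) : E' := dd E E' f q (X q)

theorem CM.mdiff {f : Q → Q'} {q : Q} (hf : CM E E' f q) :
    MDifferentiableAt 𝓘(ℝ, E) 𝓘(ℝ, E') f q := ContMDiffAt.mdifferentiableAt hf (by simp)

theorem CM.eventually_mdiff [IsManifold 𝓘(ℝ, E) ∞ Q] [IsManifold 𝓘(ℝ, E') ∞ Q']
    {f : Q → Q'} {q : Q} (hf : CM E E' f q) :
    ∀ᶠ q' in 𝓝 q, MDifferentiableAt 𝓘(ℝ, E) 𝓘(ℝ, E') f q' := by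
  have : IsManifold 𝓘(ℝ, E) 1 Q := IsManifold.of_le (n := ∞) (by simp)
  have : IsManifold 𝓘(ℝ, E') 1 Q' := IsManifold.of_le (n := ∞) (by simp)
  -- Smoothness of finite order at a point persists nearby; for order `∞` the neighborhood may
  -- shrink with the order, so the argument passes to order one.
  have h : ContMDiffAt 𝓘(ℝ, E) 𝓘(ℝ, E') 1 f q := hf.of_le (by simp)
  filter_upwards [(contMDiffAt_iff_contMDiffAt_nhds (by simp)).1 h] with q' hq'
  exact hq'.mdifferentiableAt (by simp)

theorem CM.comp {g : Q' → Q''} {f : Q → Q'} {q : Q} (hg : CM E' E'' g (f q)) (hf : CM E E' f q) :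
    CM E E'' (fun x => g (f x)) q := ContMDiffAt.comp (I' := 𝓘(ℝ, E')) q hg hf

theorem dd_comp {g : Q' → Q''} {f : Q → Q'} {q : Q}
    (hg : MDifferentiableAt 𝓘(ℝ, E') 𝓘(ℝ, E'') g (f q))
    (hf : MDifferentiableAt 𝓘(ℝ, E) 𝓘(ℝ, E') f q) :
    dd E E'' (g ∘ f) q = (dd E' E'' g (f q)).comp (dd E E' f q) :=
  mfderiv_comp q hg hf

theorem dd_comp_apply {g : Q' → Q''} {f : Q → Q'} {q : Q}
    (hg : MDifferentiableAt 𝓘(ℝ, E') 𝓘(ℝ, E'') g (f q))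
    (hf : MDifferentiableAt 𝓘(ℝ, E) 𝓘(ℝ, E') f q) (v : E) :
    dd E E'' (fun x => g (f x)) q v = dd E' E'' g (f q) (dd E E' f q v) :=
  congrArg (fun l : E →L[ℝ] E'' => l v) (dd_comp hg hf)

theorem dd_congr {f g : Q → Q'} {q : Q} (h : f =ᶠ[𝓝 q] g) : dd E E' f q = dd E E' g q :=
  h.mfderiv_eq

theorem dd_id (q : Q) : dd E E (id : Q → Q) q = ContinuousLinearMap.id ℝ E :=
  mfderiv_id

theorem dd_comp_eq_id {g : Q' → Q} {f : Q → Q'} {q : Q}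
    (hg : MDifferentiableAt 𝓘(ℝ, E') 𝓘(ℝ, E) g (f q))
    (hf : MDifferentiableAt 𝓘(ℝ, E) 𝓘(ℝ, E') f q) (h : ∀ᶠ x in 𝓝 q, g (f x) = x) :
    (dd E' E g (f q)).comp (dd E E' f q) = .id ℝ E := by
  rw [← dd_comp hg hf, ← dd_id (E := E) q]
  exact dd_congr h

theorem dd_const (c : Q') (q : Q) : dd E E' (fun _ : Q => c) q = 0 :=
  mfderiv_const

theorem dd_eq_fderiv (f : E → E') (x : E) : dd E E' f x = fderiv ℝ f x :=
  mfderiv_eq_fderiv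

theorem dd_clm (l : E →L[ℝ] E') (x : E) : dd E E' l x = l := by
  rw [dd_eq_fderiv]; exact l.fderiv

theorem dd_clm_comp (l : E' →L[ℝ] G) {f : Q → E'} {q : Q}
    (hf : MDifferentiableAt 𝓘(ℝ, E) 𝓘(ℝ, E') f q) (v : E) :
    dd E G (fun x => l (f x)) q v = l (dd E E' f q v) := by
  rw [dd_comp_apply (E' := E') (g := l) ((l.contMDiff (n := 1)).contMDiffAt.mdifferentiableAt (by simp)) hf, dd_clm]

/-- The tangent space at `q` is identified with the model space by the preferred chart at `q`. This
lets vectors at `q` be compared with their components there. -/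
theorem dd_extChartAt_self [IsManifold 𝓘(ℝ, E) ∞ Q] (q : Q) :
    dd E E (extChartAt 𝓘(ℝ, E) q) q = ContinuousLinearMap.id ℝ E := by
  have : IsManifold 𝓘(ℝ, E) 1 Q := IsManifold.of_le (n := ∞) (by simp)
  exact mfderiv_extChartAt_self

theorem cm_extChartAt [IsManifold 𝓘(ℝ, E) ∞ Q] {q q' : Q} (h : q' ∈ (chartAt E q).source) :
    CM E E (extChartAt 𝓘(ℝ, E) q) q' := contMDiffAt_extChartAt' h

theorem cm_extChartAt_symm [IsManifold 𝓘(ℝ, E) ∞ Q] {q : Q} {x : E}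
    (h : x ∈ (extChartAt 𝓘(ℝ, E) q).target) : CM E E (extChartAt 𝓘(ℝ, E) q).symm x :=
  (contMDiffOn_extChartAt_symm q).contMDiffAt ((isOpen_extChartAt_target q).mem_nhds h)

/-- The trivialization of the tangent bundle over a preferred chart is the differential of that
chart, so smoothness can be tested on the chart components. -/
theorem smAt_iff [IsManifold 𝓘(ℝ, E) ∞ Q] {X : VField E Q} {q₀ q : Q}
    (hq : q ∈ (chartAt E q₀).source) :
    SmAt X q ↔ CM E E (dv E (extChartAt 𝓘(ℝ, E) q₀) X) q := by
  have : IsManifold 𝓘(ℝ, E) 1 Q := IsManifold.of_le (n := ∞) (by simp)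
  let t := trivializationAt E (TangentSpace 𝓘(ℝ, E) : Q → Type _) q₀
  have hb : q ∈ t.baseSet := hq
  have h1 : SmAt X q ↔ ContMDiffAt 𝓘(ℝ, E) 𝓘(ℝ, E) ∞ (fun m => (t ⟨m, X m⟩).2) q := by
    unfold SmAt
    exact t.contMDiffAt_section_iff hb
  rw [h1]
  apply Filter.EventuallyEq.contMDiffAt_iff
  filter_upwards [(chartAt E q₀).open_source.mem_nhds hq] with m hm
  have := TangentBundle.continuousLinearMapAt_trivializationAt (I := 𝓘(ℝ, E)) hm
  have h2 := congrArg (fun l : E →L[ℝ] E => l (X m)) this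
  change _ = dd E E (extChartAt 𝓘(ℝ, E) q₀) m (X m)
  refine Eq.trans ?_ h2
  change _ = (Bundle.Trivialization.continuousLinearMapAt ℝ t m) (X m)
  have hmb : m ∈ t.baseSet := hm
  exact (congrFun (Bundle.Trivialization.coe_linearMapAt_of_mem (R := ℝ) t hmb) (X m)).symm

/-- The derivative of a smooth function along a smooth vector field is smooth. -/
theorem cm_dv [IsManifold 𝓘(ℝ, E) ∞ Q] {f : Q → E'} {X : VField E Q} {q : Q}
    (hf : CM E E' f q) (hX : SmAt X q) : CM E E' (dv E' f X) q := by
  set c := extChartAt 𝓘(ℝ, E) q with hc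
  have hX' := (smAt_iff (mem_chart_source E q)).1 hX
  have hcq : c.symm (c q) = q := extChartAt_to_inv q
  have h1 : ContMDiffAt 𝓘(ℝ, E) 𝓘(ℝ, E') ∞ (f ∘ c.symm) (c q) :=
    ContMDiffAt.comp (I' := 𝓘(ℝ, E)) _ (by rw [hcq]; exact hf)
      (cm_extChartAt_symm (mem_extChartAt_target q))
  have h2 : ContDiffAt ℝ ∞ (fderiv ℝ (f ∘ c.symm)) (c q) :=
    (contMDiffAt_iff_contDiffAt.1 h1).fderiv_right (by simp)
  have h3 : CM E (E →L[ℝ] E') (fun q' => fderiv ℝ (f ∘ c.symm) (c q')) q :=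
    ContMDiffAt.comp (I' := 𝓘(ℝ, E)) q h2.contMDiffAt (cm_extChartAt (mem_chart_source E q))
  have h4 := ContMDiffAt.clm_apply h3 hX'
  refine h4.congr_of_eventuallyEq ?_
  filter_upwards [(chartAt E q).open_source.mem_nhds (mem_chart_source E q),
    hf.eventually_mdiff] with q' hq' hfq
  have hs : q' ∈ c.source := by rw [hc, extChartAt_source]; exact hq'
  have hcq' : c.symm (c q') = q' := c.left_inv hs
  -- The differential is the coordinate derivative, smooth in the point, composed with the chart
  -- differential; applied to `X` the latter gives the smooth components of `X`.
  have h5 : dd E E' f q' = (fderiv ℝ (f ∘ c.symm) (c q')).comp (dd E E c q') := by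
    rw [← dd_eq_fderiv, ← dd_comp]
    · apply dd_congr
      filter_upwards [(isOpen_extChartAt_source q).mem_nhds hs] with x hx
      simp only [Function.comp]
      rw [c.left_inv hx]
    · refine MDifferentiableAt.comp (I' := 𝓘(ℝ, E)) _ (by rw [hcq']; exact hfq)
        (cm_extChartAt_symm (c.map_source hs)).mdiff
    · exact (cm_extChartAt hq').mdiff
  change dd E E' f q' (X q') = _
  rw [h5]; rfl

/-- The bracket of vector fields is the commutator of derivations. -/
theorem dv_lieBr [CompleteSpace E] [IsManifold 𝓘(ℝ, E) ∞ Q] {f : Q → E'} {X Y : VField E Q} {q : Q}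
    (hf : CM E E' f q) (hX : SmAt X q) (hY : SmAt Y q) :
    dv E' f (lieBr X Y) q = dv E' (dv E' f Y) X q - dv E' (dv E' f X) Y q := by
  have : IsManifold 𝓘(ℝ, E) 1 Q := IsManifold.of_le (n := ∞) (by simp)
  set c := extChartAt 𝓘(ℝ, E) q with hc
  have hcq : c.symm (c q) = q := extChartAt_to_inv q
  have htgt : c.target ∈ 𝓝 (c q) := extChartAt_target_mem_nhds q
  have hcs : CM E E c.symm (c q) := cm_extChartAt_symm (mem_extChartAt_target q)
  have h1 : ContDiffAt ℝ ∞ (f ∘ c.symm) (c q) := contMDiffAt_iff_contDiffAt.1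
    (ContMDiffAt.comp (I' := 𝓘(ℝ, E)) _ (by rw [hcq]; exact hf) hcs)
  have hcomp : ∀ x ∈ c.target, (dd E E c (c.symm x)).comp (dd E E c.symm x) = .id ℝ E := by
    intro x hx
    rw [← dd_comp, ← dd_id (E := E) x]
    · apply dd_congr
      filter_upwards [(isOpen_extChartAt_target q).mem_nhds hx] with y hy
      exact c.right_inv hy
    · apply (cm_extChartAt _).mdiff
      have := c.map_target hx
      rwa [hc, extChartAt_source] at this
    · exact (cm_extChartAt_symm hx).mdiff
  have hcomp' : ∀ x ∈ c.target, (dd E E c.symm x).comp (dd E E c (c.symm x)) = .id ℝ E := by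
    intro x hx
    have hm := c.map_target hx
    have h0 : dd E E c.symm x = dd E E c.symm (c (c.symm x)) := by rw [c.right_inv hx]
    rw [h0, ← dd_comp, ← dd_id (E := E) (c.symm x)]
    · apply dd_congr
      filter_upwards [(isOpen_extChartAt_source q).mem_nhds hm] with y hy
      exact c.left_inv hy
    · rw [c.right_inv hx]
      exact (cm_extChartAt_symm hx).mdiff
    · apply (cm_extChartAt _).mdiff
      rwa [hc, extChartAt_source] at hm
  -- The bracket on the manifold is defined by pulling fields back along the inverse chart, hence
  -- through the inverse of its differential.
  have hinv : ∀ x ∈ c.target, (mfderiv 𝓘(ℝ, E) 𝓘(ℝ, E) c.symm x).inverse = dd E E c (c.symm x) := by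
    intro x hx
    exact ContinuousLinearMap.inverse_eq (hcomp' x hx) (hcomp x hx)
  -- The field `Z'` consists of the components of `Z` in the chart. It represents both the pullback
  -- of `Z` and the derivation defined by `Z`.
  have key : ∀ {Z : VField E Q}, SmAt Z q → ∃ Z' : E → E, ContDiffAt ℝ ∞ Z' (c q) ∧
      (∀ᶠ x in 𝓝 (c q), Z' x = dv E c Z (c.symm x)) ∧
      VectorField.mpullback 𝓘(ℝ, E) 𝓘(ℝ, E) c.symm Z =ᶠ[𝓝 (c q)] Z' ∧
      ∀ {G : Type _} [NormedAddCommGroup G] [NormedSpace ℝ G] (g : Q → G), CM E G g q →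
        (∀ᶠ x in 𝓝 (c q), dv G g Z (c.symm x) = fderiv ℝ (g ∘ c.symm) x (Z' x)) := by
    intro Z hZ
    refine ⟨fun x => dv E c Z (c.symm x), ?_, Eventually.of_forall fun _ => rfl, ?_, ?_⟩
    · have h2 := (smAt_iff (mem_chart_source E q)).1 hZ
      exact contMDiffAt_iff_contDiffAt.1
        (ContMDiffAt.comp (I' := 𝓘(ℝ, E)) (c q) (by rw [hcq]; exact h2) hcs)
    · filter_upwards [htgt] with x hx
      change (mfderiv 𝓘(ℝ, E) 𝓘(ℝ, E) c.symm x).inverse (Z (c.symm x)) = _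
      rw [hinv x hx]; rfl
    · intro G _ _ g hg
      have hcont : ContinuousAt c.symm (c q) := hcs.continuousAt
      have hg' := hg.eventually_mdiff
      rw [← hcq] at hg'
      filter_upwards [htgt, hcont.eventually hg'] with x hx hgx
      rw [← dd_eq_fderiv, dd_comp hgx (cm_extChartAt_symm hx).mdiff]
      have h3 := congrArg (fun l : E →L[ℝ] E => l (Z (c.symm x))) (hcomp' x hx)
      change dd E G g (c.symm x) (Z (c.symm x)) = dd E G g (c.symm x) _
      congr 1
      exact h3.symm
  obtain ⟨X', hX's, hX'v, hX'e, hX'd⟩ := key hX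
  obtain ⟨Y', hY's, hY'v, hY'e, hY'd⟩ := key hY
  have hself : ∀ (g : Q → E') (Z : VField E Q) (Z' : E → E), CM E E' g q →
      Z' (c q) = dv E c Z (c.symm (c q)) →
      dv E' g Z q = fderiv ℝ (g ∘ c.symm) (c q) (Z' (c q)) := by
    intro g Z Z' hg hZ
    rw [hZ, ← dd_eq_fderiv, dd_comp (by rw [hcq]; exact hg.mdiff) hcs.mdiff]
    have h3 := congrArg (fun l : E →L[ℝ] E => l (Z (c.symm (c q))))
      (hcomp' _ (mem_extChartAt_target q))
    have h4 : dv E' g Z q = dv E' g Z (c.symm (c q)) := by rw [hcq]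
    rw [h4]
    change dd E E' g (c.symm (c q)) (Z (c.symm (c q))) = dd E E' g (c.symm (c q)) _
    congr 1
    exact h3.symm
  have hXY : dv E' (dv E' f Y) X q =
      fderiv ℝ (fun x => fderiv ℝ (f ∘ c.symm) x (Y' x)) (c q) (X' (c q)) := by
    rw [hself _ X X' (cm_dv hf hY) hX'v.self_of_nhds]
    congr 1
    exact (show (dv E' f Y) ∘ c.symm =ᶠ[𝓝 (c q)] _ from hY'd f hf).fderiv_eq
  have hYX : dv E' (dv E' f X) Y q =
      fderiv ℝ (fun x => fderiv ℝ (f ∘ c.symm) x (X' x)) (c q) (Y' (c q)) := by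
    rw [hself _ Y Y' (cm_dv hf hX) hY'v.self_of_nhds]
    congr 1
    exact (show (dv E' f X) ∘ c.symm =ᶠ[𝓝 (c q)] _ from hX'd f hf).fderiv_eq
  have hbr : dv E c (lieBr X Y) (c.symm (c q)) = VectorField.lieBracket ℝ X' Y' (c q) := by
    -- At the center of the chart the outer differential is the identity, so the bracket is
    -- literally the bracket of the components.
    have h5 : (lieBr X Y q : E) = VectorField.lieBracket ℝ X' Y' (c q) := by
      change VectorField.mlieBracket 𝓘(ℝ, E) X Y q = _
      rw [← VectorField.mlieBracketWithin_univ, VectorField.mlieBracketWithin_apply]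
      simp only [modelWithCornersSelf_coe, range_id, preimage_univ, inter_univ,
        VectorField.mpullbackWithin_univ]
      rw [mfderiv_extChartAt_self]
      refine Eq.trans (b := VectorField.lieBracketWithin ℝ
        (VectorField.mpullback 𝓘(ℝ, E) 𝓘(ℝ, E) c.symm X)
        (VectorField.mpullback 𝓘(ℝ, E) 𝓘(ℝ, E) c.symm Y) univ (c q))
        (congrArg (fun l : E →L[ℝ] E => l _)
          (ContinuousLinearMap.inverse_id (R := ℝ) (M := E))) ?_
      refine Eq.trans (congrFun (VectorField.lieBracketWithin_univ (𝕜 := ℝ) (E := E)) (c q)) ?_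
      exact Filter.EventuallyEq.lieBracket_vectorField_eq hX'e hY'e
    rw [hcq]
    change dd E E c q (lieBr X Y q) = _
    rw [hc, dd_extChartAt_self]
    exact h5
  rw [hself f (lieBr X Y) (fun _ => VectorField.lieBracket ℝ X' Y' (c q)) hf hbr.symm, hXY, hYX]
  have hd2 : DifferentiableAt ℝ (fderiv ℝ (f ∘ c.symm)) (c q) :=
    (h1.fderiv_right (m := 1) (by norm_cast)).differentiableAt (by simp)
  -- The second order terms of the two iterated derivatives cancel by symmetry.
  have hsym : IsSymmSndFDerivAt ℝ (f ∘ c.symm) (c q) := by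
    apply h1.isSymmSndFDerivAt
    simp [minSmoothness_of_isRCLikeNormedField]
    norm_cast
  rw [fderiv_clm_apply hd2 (hY's.differentiableAt (by simp)),
    fderiv_clm_apply hd2 (hX's.differentiableAt (by simp))]
  simp only [VectorField.lieBracket, add_apply, ContinuousLinearMap.comp_apply,
    ContinuousLinearMap.flip_apply, map_sub]
  rw [hsym.eq (X' (c q)) (Y' (c q))]
  abel

end Basics

/-! ### Smooth coefficients, uniqueness for differential inequalities, inverse functions and
sections -/

section Calculus

variable {E : Type*} [NormedAddCommGroup E] [NormedSpace ℝ E]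
variable {Q : Type*} [TopologicalSpace Q] [ChartedSpace E Q]
variable {E' : Type*} [NormedAddCommGroup E'] [NormedSpace ℝ E']
variable {Q' : Type*} [TopologicalSpace Q'] [ChartedSpace E' Q']
variable {F : Type*} [NormedAddCommGroup F] [NormedSpace ℝ F]
variable {G : Type*} [NormedAddCommGroup G] [NormedSpace ℝ G]

/-- Coefficients with respect to a smooth family of linearly independent vectors are smooth. -/
theorem cm_coeff [FiniteDimensional ℝ F] {ι : Type*} [Fintype ι] {u : ι → Q → F} {s : Q → F}
    {c : ι → Q → ℝ} {q : Q} (hu : ∀ i, CM E F (u i) q) (hs : CM E F s q)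
    (hli : LinearIndependent ℝ fun i => u i q) (h : ∀ᶠ x in 𝓝 q, s x = ∑ i, c i x • u i x) (i : ι) :
    CM E ℝ (c i) q := by
  classical
  -- The coefficients at `x` solve the linear system with matrix `A x`, which depends smoothly on
  -- `x`.
  let A : Q → (ι → ℝ) →L[ℝ] F := fun x => ∑ i, (ContinuousLinearMap.proj i).smulRight (u i x)
  have hA : ∀ x (v : ι → ℝ), A x v = ∑ i, v i • u i x := by
    intro x v
    simp [A]
  have hAs : CM E ((ι → ℝ) →L[ℝ] F) A q := by
    refine ContMDiffAt.sum fun i _ => ?_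
    exact ((ContinuousLinearMap.smulRightL ℝ (ι → ℝ) F (ContinuousLinearMap.proj i)).contMDiff
      (n := ∞)).contMDiffAt.comp q (hu i)
  have hker : (A q : (ι → ℝ) →ₗ[ℝ] F).ker = ⊥ := by
    rw [LinearMap.ker_eq_bot']
    intro v hv
    funext j
    exact Fintype.linearIndependent_iff.1 hli v (by rw [← hA]; exact hv) j
  -- A left inverse at the single point `q` suffices: composed with `A x` it is the identity at `x =
  -- q`, hence invertible nearby with smooth inverse.
  obtain ⟨b, hb⟩ := LinearMap.exists_leftInverse_of_injective _ hker
  let B : F →L[ℝ] (ι → ℝ) := LinearMap.toContinuousLinearMap b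
  have hBA : B.comp (A q) = (ContinuousLinearEquiv.refl ℝ (ι → ℝ) : (ι → ℝ) →L[ℝ] (ι → ℝ)) := by
    ext1 v
    exact LinearMap.congr_fun hb v
  let T : Q → (ι → ℝ) →L[ℝ] (ι → ℝ) := fun x => B.comp (A x)
  have hT : CM E ((ι → ℝ) →L[ℝ] (ι → ℝ)) T q := ((ContinuousLinearMap.compL ℝ (ι → ℝ) F (ι → ℝ) B).contMDiff
      (n := ∞)).contMDiffAt.comp q hAs
  have hinv : CM E ((ι → ℝ) →L[ℝ] (ι → ℝ)) (fun x => (T x).inverse) q := by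
    have h1 : ContDiffAt ℝ ∞ (ContinuousLinearMap.inverse : ((ι → ℝ) →L[ℝ] (ι → ℝ)) → _) (T q) := by
      rw [show T q = _ from hBA]
      exact contDiffAt_map_inverse _
    exact CM.comp (f := T) h1.contMDiffAt hT
  have hBs : CM E (ι → ℝ) (fun x => B (s x)) q := (B.contMDiff (n := ∞)).contMDiffAt.comp q hs
  have hv : CM E (ι → ℝ) (fun x => (T x).inverse (B (s x))) q := ContMDiffAt.clm_apply hinv hBs
  have hvi : CM E ℝ (fun x => (T x).inverse (B (s x)) i) q :=
    ((ContinuousLinearMap.proj (R := ℝ) (φ := fun _ : ι => ℝ) i).contMDiff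
      (n := ∞)).contMDiffAt.comp q hv
  refine hvi.congr_of_eventuallyEq ?_
  have hunit : ∀ᶠ x in 𝓝 q, (T x).IsInvertible := by
    have h2 : {l : (ι → ℝ) →L[ℝ] (ι → ℝ) | l.IsInvertible} ∈ 𝓝 (T q) := by
      rw [show T q = _ from hBA]
      exact ContinuousLinearEquiv.nhds _
    exact hT.continuousAt h2
  filter_upwards [h, hunit] with x hx hTx
  have h3 : B (s x) = T x (fun i => c i x) := by
    change _ = B (A x _)
    rw [hA, hx]
  have h4 : (T x).inverse (T x (fun i => c i x)) = fun i => c i x := by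
    obtain ⟨e, he⟩ := hTx
    rw [← he, ContinuousLinearMap.inverse_equiv]
    exact e.symm_apply_apply _
  rw [h3, h4]

theorem eventually_linearIndependent [FiniteDimensional ℝ F] {ι : Type*} [Finite ι] {u : ι → Q → F}
    {q : Q} (hu : ∀ i, ContinuousAt (u i) q) (hli : LinearIndependent ℝ fun i => u i q) :
    ∀ᶠ x in 𝓝 q, LinearIndependent ℝ fun i => u i x := by
  have h : ContinuousAt (fun x => fun i => u i x) q := continuousAt_pi.2 hu
  exact h.eventually hli.eventually

/-- Uniqueness for linear differential inequalities. -/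
theorem eventually_zero_of_deriv_le {u u' : ℝ → G} {t₀ K : ℝ}
    (hu : ∀ᶠ t in 𝓝 t₀, HasDerivAt u (u' t) t) (hb : ∀ᶠ t in 𝓝 t₀, ‖u' t‖ ≤ K * ‖u t‖)
    (h0 : u t₀ = 0) : ∀ᶠ t in 𝓝 t₀, u t = 0 := by
  obtain ⟨ε, hε, h⟩ := Metric.eventually_nhds_iff_ball.1 (hu.and hb)
  have hball : ∀ s, |s| < ε → t₀ + s ∈ Metric.ball t₀ ε := by
    intro s hs
    rw [Metric.mem_ball, Real.dist_eq]
    simpa using hs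
  have right : ∀ s ∈ Ico 0 ε, u (t₀ + s) = 0 := by
    intro s hs
    refine eq_zero_of_abs_deriv_le_mul_abs_self_of_eq_zero_right (K := K) (a := 0) (b := s)
      (f := fun r => u (t₀ + r)) (f' := fun r => u' (t₀ + r)) ?_ ?_ (by simpa using h0) ?_ s
      ⟨hs.1, le_rfl⟩
    · intro r hr
      have h1 := (h _ (hball r (by rw [abs_of_nonneg hr.1]; linarith [hr.2, hs.2]))).1
      exact (h1.comp_const_add t₀ r).continuousAt.continuousWithinAt
    · intro r hr
      have h1 := (h _ (hball r (by rw [abs_of_nonneg hr.1]; linarith [hr.2, hs.2]))).1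
      exact (h1.comp_const_add t₀ r).hasDerivWithinAt
    · intro r hr
      exact (h _ (hball r (by rw [abs_of_nonneg hr.1]; linarith [hr.2, hs.2]))).2
  -- The one-sided estimate is applied to the curve run backwards.
  have left : ∀ s ∈ Ico 0 ε, u (t₀ - s) = 0 := by
    intro s hs
    have hb' : ∀ r ∈ Icc 0 s, t₀ - r ∈ Metric.ball t₀ ε := fun r hr => by
      have := hball (-r) (by rw [abs_neg, abs_of_nonneg hr.1]; linarith [hr.2, hs.2])
      rwa [← sub_eq_add_neg] at this
    refine eq_zero_of_abs_deriv_le_mul_abs_self_of_eq_zero_right (K := K) (a := 0) (b := s)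
      (f := fun r => u (t₀ - r)) (f' := fun r => -u' (t₀ - r)) ?_ ?_ (by simpa using h0) ?_ s
      ⟨hs.1, le_rfl⟩
    · intro r hr
      exact ((h _ (hb' r hr)).1.comp_const_sub t₀ r).continuousAt.continuousWithinAt
    · intro r hr
      exact ((h _ (hb' r ⟨hr.1, hr.2.le⟩)).1.comp_const_sub t₀ r).hasDerivWithinAt
    · intro r hr
      rw [norm_neg]
      exact (h _ (hb' r ⟨hr.1, hr.2.le⟩)).2
  filter_upwards [Metric.ball_mem_nhds t₀ hε] with t ht
  rw [Metric.mem_ball, Real.dist_eq] at ht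
  rcases le_total t₀ t with h1 | h1
  · have := right (t - t₀) ⟨by linarith, by rwa [abs_of_nonneg (by linarith)] at ht⟩
    rwa [add_sub_cancel] at this
  · have := left (t₀ - t) ⟨by linarith, by rw [abs_of_nonpos (by linarith)] at ht; linarith⟩
    rwa [sub_sub_cancel] at this

theorem hasDerivAt_of_mdiff {γ : ℝ → F} {t : ℝ} (h : MDifferentiableAt 𝓘(ℝ, ℝ) 𝓘(ℝ, F) γ t) :
    HasDerivAt γ (dd ℝ F γ t 1) t := by
  rw [dd_eq_fderiv]
  exact h.differentiableAt.hasDerivAt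

/-- The derivative of a function along a curve. -/
theorem hasDerivAt_comp_curve {f : Q → F} {γ : ℝ → Q} {t : ℝ}
    (hf : MDifferentiableAt 𝓘(ℝ, E) 𝓘(ℝ, F) f (γ t))
    (hγ : MDifferentiableAt 𝓘(ℝ, ℝ) 𝓘(ℝ, E) γ t) :
    HasDerivAt (fun s => f (γ s)) (dd E F f (γ t) (dd ℝ E γ t 1)) t := by
  have h1 : MDifferentiableAt 𝓘(ℝ, ℝ) 𝓘(ℝ, F) (fun s => f (γ s)) t := hf.comp t hγ
  have h := hasDerivAt_of_mdiff h1
  rwa [dd_comp_apply hf hγ] at h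

/-- In a chart around the starting point this is the differential inequality with constant zero. -/
theorem eventually_const_of_dd_eq_zero [IsManifold 𝓘(ℝ, E) ∞ Q] {γ : ℝ → Q} {t₀ : ℝ}
    (hc : ContinuousAt γ t₀)
    (h : ∀ᶠ t in 𝓝 t₀, MDifferentiableAt 𝓘(ℝ, ℝ) 𝓘(ℝ, E) γ t ∧ dd ℝ E γ t 1 = 0) :
    ∀ᶠ t in 𝓝 t₀, γ t = γ t₀ := by
  let c := extChartAt 𝓘(ℝ, E) (γ t₀)
  have hs : ∀ᶠ t in 𝓝 t₀, γ t ∈ (chartAt E (γ t₀)).source :=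
    hc ((chartAt E (γ t₀)).open_source.mem_nhds (mem_chart_source E _))
  have h1 : ∀ᶠ t in 𝓝 t₀, HasDerivAt (fun s => c (γ s) - c (γ t₀)) 0 t := by
    filter_upwards [h, hs] with t ht hts
    have h2 := hasDerivAt_comp_curve (cm_extChartAt hts).mdiff ht.1
    rw [ht.2, map_zero] at h2
    exact h2.sub_const _
  have h2 := eventually_zero_of_deriv_le (K := 0) h1 (by simp) (sub_self _)
  filter_upwards [h2, hs] with t ht hts
  have hsrc : ∀ {q}, q ∈ (chartAt E (γ t₀)).source → q ∈ c.source := by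
    intro q hq
    rw [extChartAt_source]; exact hq
  exact c.injOn (hsrc hts) (hsrc (mem_chart_source E _)) (sub_eq_zero.1 ht)

theorem const_of_dd_eq_zero [IsManifold 𝓘(ℝ, E) ∞ Q] [T2Space Q] {γ : ℝ → Q}
    (h : ∀ t, MDifferentiableAt 𝓘(ℝ, ℝ) 𝓘(ℝ, E) γ t ∧ dd ℝ E γ t 1 = 0) (t : ℝ) : γ t = γ 0 := by
  have hc : Continuous γ := continuous_iff_continuousAt.2 fun t => (h t).1.continuousAt
  have h1 : IsClopen {t | γ t = γ 0} := by
    refine ⟨isClosed_eq hc continuous_const, isOpen_iff_mem_nhds.2 fun s hs => ?_⟩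
    filter_upwards [eventually_const_of_dd_eq_zero hc.continuousAt (Eventually.of_forall h)]
      with r hr
    exact hr.trans hs
  have h2 := h1.eq_univ ⟨0, rfl⟩
  exact (h2 ▸ mem_univ t : t ∈ {t | γ t = γ 0})

/-- The inverse function theorem on manifolds. -/
theorem exists_localInverse [CompleteSpace E] [IsManifold 𝓘(ℝ, E) ∞ Q] [IsManifold 𝓘(ℝ, E') ∞ Q']
    {f : Q → Q'} {N : Set Q} (hN : IsOpen N) {q : Q} (hq : q ∈ N) (hf : ∀ x ∈ N, CM E E' f x)
    (hb : ∀ x ∈ N, (dd E E' f x).IsInvertible) :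
    ∃ e : OpenPartialHomeomorph Q Q', q ∈ e.source ∧ e.source ⊆ N ∧ EqOn e f e.source ∧
      ∀ y ∈ e.target, CM E' E e.symm y := by
  let a := chartAt E q
  let b := chartAt E' (f q)
  have ha : ∀ {x}, x ∈ a.source → CM E E a x := fun hx => contMDiffAt_of_mem_maximalAtlas
    (IsManifold.chart_mem_maximalAtlas q) hx
  have hb' : ∀ {x}, x ∈ b.source → CM E' E' b x := fun hx => contMDiffAt_of_mem_maximalAtlas
    (IsManifold.chart_mem_maximalAtlas (f q)) hx
  have has : ∀ {x}, x ∈ a.target → CM E E a.symm x := fun hx => contMDiffAt_symm_of_mem_maximalAtlas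
    (IsManifold.chart_mem_maximalAtlas q) hx
  have hbs : ∀ {x}, x ∈ b.target → CM E' E' b.symm x := fun hx =>
    contMDiffAt_symm_of_mem_maximalAtlas (IsManifold.chart_mem_maximalAtlas (f q)) hx
  have hcN : ContinuousOn f N := fun x hx => (hf x hx).continuousAt.continuousWithinAt
  let N' : Set Q := (N ∩ f ⁻¹' b.source) ∩ a.source
  have hN' : IsOpen N' := (hcN.isOpen_inter_preimage hN b.open_source).inter a.open_source
  have hqN' : q ∈ N' := ⟨⟨hq, mem_chart_source E' _⟩, mem_chart_source E q⟩
  -- The coordinate expression of `f`, to which the inverse function theorem in the model space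
  -- applies.
  let g : E → E' := fun x => b (f (a.symm x))
  have hg : ∀ x ∈ a.target, a.symm x ∈ N' → ContDiffAt ℝ ∞ g x := by
    intro x hx hxN
    refine contMDiffAt_iff_contDiffAt.1 ?_
    exact ContMDiffAt.comp (I' := 𝓘(ℝ, E')) x (hb' hxN.1.2)
      (ContMDiffAt.comp (I' := 𝓘(ℝ, E)) x (hf _ hxN.1.1) (has hx))
  have hg' : ∀ x ∈ a.target, a.symm x ∈ N' → (fderiv ℝ g x).IsInvertible := by
    intro x hx hxN
    have h1 : fderiv ℝ g x = (dd E' E' b (f (a.symm x))).comp ((dd E E' f (a.symm x)).comp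
        (dd E E a.symm x)) := by
      have h2 : CM E E' (fun x => f (a.symm x)) x := CM.comp (f := a.symm) (hf _ hxN.1.1) (has hx)
      have h3 : dd E E' (fun x => f (a.symm x)) x = _ :=
        dd_comp (g := f) (f := a.symm) (hf _ hxN.1.1).mdiff (has hx).mdiff
      rw [← dd_eq_fderiv, ← h3]
      exact dd_comp (g := b) (f := fun x => f (a.symm x)) (hb' hxN.1.2).mdiff h2.mdiff
    have i1 : (dd E' E' b (f (a.symm x))).IsInvertible :=
      ⟨(mdifferentiable_chart (I := 𝓘(ℝ, E')) (f q)).mfderiv hxN.1.2, rfl⟩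
    have i2 : (dd E E a.symm x).IsInvertible :=
      ⟨(mdifferentiable_chart (I := 𝓘(ℝ, E)) q).symm.mfderiv hx, rfl⟩
    rw [h1]
    exact i1.comp ((hb _ hxN.1.1).comp i2)
  have hat : a q ∈ a.target := a.map_source (mem_chart_source E q)
  have haq : a.symm (a q) = q := a.left_inv (mem_chart_source E q)
  obtain ⟨e', he'⟩ := hg' (a q) hat (by rw [haq]; exact hqN')
  have hg0 := hg (a q) hat (by rw [haq]; exact hqN')
  have hd0 : HasFDerivAt g (e' : E →L[ℝ] E') (a q) := by
    rw [he']
    exact (hg0.differentiableAt (by simp)).hasFDerivAt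
  let Φ := hg0.toOpenPartialHomeomorph g hd0 (by simp)
  have hΦ : ∀ x, Φ x = g x := fun x => rfl
  let e := ((a.trans Φ).trans b.symm).restrOpen N' hN'
  have hes : ∀ x ∈ e.source, x ∈ N' ∧ a x ∈ Φ.source := by
    intro x hx
    refine ⟨hx.2, ?_⟩
    exact (hx.1.1.2 : _)
  have hval : ∀ x ∈ N', b.symm (g (a x)) = f x := by
    intro x hx
    change b.symm (b (f (a.symm (a x)))) = f x
    rw [a.left_inv hx.2, b.left_inv hx.1.2]
  have hev : EqOn e f e.source := fun x hx => hval x (hes x hx).1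
  refine ⟨e, ?_, fun x hx => (hes x hx).1.1.1, hev, ?_⟩
  · refine ⟨⟨⟨mem_chart_source E q, ?_⟩, ?_⟩, hqN'⟩
    · exact hg0.mem_toOpenPartialHomeomorph_source hd0 (by simp)
    · change g (a q) ∈ b.target
      change b (f (a.symm (a q))) ∈ b.target
      rw [haq]
      exact b.map_source (mem_chart_source E' _)
  · intro y hy
    set x := e.symm y with hx
    have hxs : x ∈ e.source := e.map_target hy
    have hyx : y = f x := by rw [← hev hxs, hx, e.right_inv hy]
    obtain ⟨hxN, hxΦ⟩ := hes x hxs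
    have hyb : y ∈ b.source := by rw [hyx]; exact hxN.1.2
    have hby : b y = g (a x) := by
      change _ = b (f (a.symm (a x)))
      rw [hyx, a.left_inv hxN.2]
    have hΦy : Φ.symm (b y) = a x := by
      rw [hby, ← hΦ]; exact Φ.left_inv hxΦ
    have hat' : a x ∈ a.target := a.map_source hxN.2
    have hax : a.symm (a x) ∈ N' := by rw [a.left_inv hxN.2]; exact hxN
    obtain ⟨l, hl⟩ := hg' _ hat' hax
    -- Smoothness of the inverse is needed on the whole target and not just at the image of `q`; it
    -- holds since the derivative is invertible throughout `N`.
    have h1 : ContDiffAt ℝ ∞ Φ.symm (b y) := by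
      refine Φ.contDiffAt_symm (f₀' := l) ?_ ?_ ?_
      · rw [hby, ← hΦ]; exact Φ.map_source hxΦ
      · rw [hΦy, hl]
        exact ((hg _ hat' hax).differentiableAt (by simp)).hasFDerivAt
      · rw [hΦy]; exact hg _ hat' hax
    have h2 : CM E' E (fun z => a.symm (Φ.symm (b z))) y := by
      refine ContMDiffAt.comp (I' := 𝓘(ℝ, E)) y ?_ (ContMDiffAt.comp (I' := 𝓘(ℝ, E')) y
        h1.contMDiffAt (hb' hyb))
      rw [hΦy]
      exact has hat'
    refine h2.congr_of_eventuallyEq ?_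
    exact Eventually.of_forall fun z => rfl

/-- A submersion has local sections with prescribed derivative. -/
theorem exists_localSection [CompleteSpace F] [IsManifold 𝓘(ℝ, E) ∞ Q]
    {M : Type*} [TopologicalSpace M] [ChartedSpace F M] [IsManifold 𝓘(ℝ, F) ∞ M]
    {π : Q → M} (hπ : ∀ q, CM E F π q) (q : Q) (s : F →L[ℝ] E)
    (hs : (dd E F π q).comp s = .id ℝ F) :
    ∃ (σ : M → Q) (V : Set M), IsOpen V ∧ π q ∈ V ∧ σ (π q) = q ∧
      (∀ m ∈ V, CM F E σ m ∧ π (σ m) = m) ∧ dd F E σ (π q) = s := by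
  let m := π q
  let a := extChartAt 𝓘(ℝ, E) q
  let b := extChartAt 𝓘(ℝ, F) m
  have hbm : CM F F b m := cm_extChartAt (mem_chart_source F m)
  -- A first approximation: the affine map with linear part `s` in charts. It has the right
  -- derivative at `π q` but need not be a section.
  let τ : M → Q := fun y => a.symm (a q + s (b y - b m))
  have hτm : τ m = q := by
    change a.symm (a q + s (b m - b m)) = q
    rw [sub_self, map_zero, add_zero]
    exact extChartAt_to_inv q
  let N : Set M := b.source ∩ (fun y => a q + s (b y - b m)) ⁻¹' a.target
  have hcont : ContinuousOn (fun y => a q + s (b y - b m)) b.source :=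
    continuousOn_const.add (s.continuous.comp_continuousOn
      ((continuousOn_extChartAt m).sub continuousOn_const))
  have hN : IsOpen N := hcont.isOpen_inter_preimage (isOpen_extChartAt_source m)
    (isOpen_extChartAt_target q)
  have hmN : m ∈ N := by
    refine ⟨mem_extChartAt_source m, ?_⟩
    change a q + s (b m - b m) ∈ a.target
    rw [sub_self, map_zero, add_zero]
    exact mem_extChartAt_target q
  have hin : ∀ y ∈ N, CM F E (fun y => a q + s (b y - b m)) y := by
    intro y hy
    have h1 : CM F F b y := cm_extChartAt (by have := hy.1; rwa [extChartAt_source] at this)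
    exact contMDiffAt_const.add ((s.contMDiff (n := ∞)).contMDiffAt.comp y
      (h1.sub contMDiffAt_const))
  have hτ : ∀ y ∈ N, CM F E τ y := fun y hy =>
    ContMDiffAt.comp (I' := 𝓘(ℝ, E)) y (cm_extChartAt_symm hy.2) (hin y hy)
  have hdτ : dd F E τ m = s := by
    have hid : dd F E (fun y => a q + s (b y - b m)) m = s := by
      ext1 v
      have h0 : dd F E (fun y => a q + s (b y - b m)) m v =
          dd F E (fun y : F => a q + s (y - b m)) (b m) (dd F F b m v) :=
        dd_comp_apply (g := fun y : F => a q + s (y - b m)) (f := b) (by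
          apply DifferentiableAt.mdifferentiableAt
          fun_prop) hbm.mdiff v
      rw [h0, dd_extChartAt_self, dd_eq_fderiv]
      have h8 : HasFDerivAt (fun y : F => a q + s (y - b m)) s (b m) :=
        (s.hasFDerivAt.comp (b m) ((hasFDerivAt_id (b m)).sub_const (b m))).const_add (a q)
      rw [h8.fderiv]; rfl
    have has : dd E E a.symm (a q + s (b m - b m)) = .id ℝ E := by
      rw [sub_self, map_zero, add_zero]
      have h2 : (dd E E a.symm (a q)).comp (dd E E a q) = .id ℝ E :=
        dd_comp_eq_id (cm_extChartAt_symm (mem_extChartAt_target q)).mdiff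
          (cm_extChartAt (mem_chart_source E q)).mdiff (by
            filter_upwards [extChartAt_source_mem_nhds (I := 𝓘(ℝ, E)) q]
              with z hz
            exact a.left_inv hz)
      rwa [dd_extChartAt_self, ContinuousLinearMap.comp_id] at h2
    have h3 : dd F E τ m = (dd E E a.symm (a q + s (b m - b m))).comp
        (dd F E (fun y => a q + s (b y - b m)) m) :=
      dd_comp (g := a.symm) (f := fun y => a q + s (b y - b m)) (cm_extChartAt_symm hmN.2).mdiff
        (hin m hmN).mdiff
    rw [h3, has, hid, ContinuousLinearMap.id_comp]
  -- The map `f` has the identity as derivative at `m`, so it is a local diffeomorphism there;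
  -- composing `τ` with its inverse gives a true section without changing the derivative at `m`.
  let f : M → M := fun y => π (τ y)
  have hf : ∀ y ∈ N, CM F F f y := fun y hy => ContMDiffAt.comp (I' := 𝓘(ℝ, E)) y (hπ _) (hτ y hy)
  have hdf : dd F F f m = .id ℝ F := by
    have h4 : dd F F f m = (dd E F π (τ m)).comp (dd F E τ m) :=
      dd_comp (hπ _).mdiff (hτ m hmN).mdiff
    rw [h4, hτm, hdτ, hs]
  -- the derivative of `f` is invertible near `m`
  have hinv : ∀ᶠ y in 𝓝 m, (dd F F f y).IsInvertible := by
    have hfm : f m = m := by change π (τ m) = m; rw [hτm]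
    let g : F → F := fun x => b (f (b.symm x))
    have hbmt : b.symm (b m) = m := extChartAt_to_inv m
    have hbs : CM F F b.symm (b m) := cm_extChartAt_symm (mem_extChartAt_target m)
    have hfc : ContinuousAt f m := (hf m hmN).continuousAt
    have hg : ContDiffAt ℝ ∞ g (b m) := by
      refine contMDiffAt_iff_contDiffAt.1 ?_
      refine CM.comp (g := b) (f := fun x => f (b.symm x)) ?_
        (CM.comp (g := f) (by rw [hbmt]; exact hf m hmN) hbs)
      rw [hbmt, hfm]; exact hbm
    have hfac : ∀ᶠ y in 𝓝 m, (dd F F b (f y)).comp (dd F F f y) =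
        (fderiv ℝ g (b y)).comp (dd F F b y) ∧ (dd F F b (f y)).IsInvertible ∧
        (dd F F b y).IsInvertible := by
      have hsrc : ∀ᶠ y in 𝓝 m, f y ∈ (chartAt F m).source := hfc (by
        rw [hfm]; exact (chartAt F m).open_source.mem_nhds (mem_chart_source F m))
      filter_upwards [hsrc, hN.mem_nhds hmN, hsrc.eventually_nhds] with y hy hyN hyn
      have hy1 : y ∈ (chartAt F m).source := by have := hyN.1; rwa [extChartAt_source] at this
      have i1 : ∀ z ∈ (chartAt F m).source, (dd F F b z).IsInvertible := by
        intro z hz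
        have : IsManifold 𝓘(ℝ, F) 1 M := IsManifold.of_le (n := ∞) (by simp)
        exact isInvertible_mfderiv_extChartAt (by rw [extChartAt_source]; exact hz)
      refine ⟨?_, i1 _ hy, i1 _ hy1⟩
      have hby : b.symm (b y) = y := b.left_inv hyN.1
      rw [← dd_eq_fderiv, ← dd_comp, ← dd_comp]
      · apply dd_congr
        filter_upwards [(isOpen_extChartAt_source m).mem_nhds hyN.1] with z hz
        change b (f z) = b (f (b.symm (b z)))
        rw [b.left_inv hz]
      · refine CM.mdiff (CM.comp (g := b) (f := fun x => f (b.symm x)) ?_ (CM.comp (g := f)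
          (by rw [hby]; exact hf y hyN) (cm_extChartAt_symm (b.map_source hyN.1))))
        rw [hby]; exact cm_extChartAt hy
      · exact (cm_extChartAt hy1).mdiff
      · exact (cm_extChartAt hy).mdiff
      · exact (hf y hyN).mdiff
    have hg1 : fderiv ℝ g (b m) = .id ℝ F := by
      have h5 := hfac.self_of_nhds.1
      rw [hfm, hdf, dd_extChartAt_self] at h5
      simpa using h5.symm
    have hgc : ContinuousAt (fun y => fderiv ℝ g (b y)) m :=
      ContinuousAt.comp (f := b) (g := fderiv ℝ g)
        (hg.fderiv_right (m := ∞) (by simp)).continuousAt hbm.continuousAt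
    have hgi : ∀ᶠ y in 𝓝 m, (fderiv ℝ g (b y)).IsInvertible := by
      have h6 : {l : F →L[ℝ] F | l.IsInvertible} ∈ 𝓝 (fderiv ℝ g (b m)) := by
        rw [hg1]
        exact ContinuousLinearEquiv.nhds (ContinuousLinearEquiv.refl ℝ F)
      exact hgc h6
    filter_upwards [hfac, hgi] with y hy hgy
    obtain ⟨h7, ⟨l1, hl1⟩, h9⟩ := hy
    have h10 : dd F F f y = (l1.symm : F →L[ℝ] F).comp ((fderiv ℝ g (b y)).comp (dd F F b y)) := by
      rw [← h7, ← hl1]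
      ext v
      simp
    rw [h10]
    exact ContinuousLinearMap.IsInvertible.comp ⟨l1.symm, rfl⟩ (hgy.comp h9)
  obtain ⟨N', hN'sub, hN'o, hmN'⟩ := mem_nhds_iff.1 (inter_mem hinv (hN.mem_nhds hmN))
  obtain ⟨e, hme, heN, hef, hes⟩ := exists_localInverse hN'o hmN' (fun x hx => hf x (hN'sub hx).2)
    (fun x hx => (hN'sub hx).1)
  have hfm : f m = m := by change π (τ m) = m; rw [hτm]
  have hem : e m = m := (hef hme).trans hfm
  have hesm : e.symm m = m := by
    have := e.left_inv hme
    rwa [hem] at this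
  have hmt : m ∈ e.target := by rw [← hem]; exact e.map_source hme
  refine ⟨fun y => τ (e.symm y), e.target, e.open_target, hmt, ?_, ?_, ?_⟩
  · change τ (e.symm m) = q
    rw [hesm, hτm]
  · intro y hy
    refine ⟨CM.comp (g := τ)
      (hτ _ (hN'sub (heN (e.map_target hy))).2) (hes y hy), ?_⟩
    change f (e.symm y) = y
    rw [← hef (e.map_target hy), e.right_inv hy]
  · have h1 : dd F F e.symm m = .id ℝ F := by
      have h2 : (dd F F f (e.symm m)).comp (dd F F e.symm m) = .id ℝ F := by
        rw [← dd_comp, ← dd_id (E := F) m]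
        · apply dd_congr
          filter_upwards [e.open_target.mem_nhds hmt] with y hy
          change f (e.symm y) = y
          rw [← hef (e.map_target hy), e.right_inv hy]
        · rw [hesm]; exact (hf m hmN).mdiff
        · exact (hes m hmt).mdiff
      rw [hesm, hdf] at h2
      simpa using h2
    have h3 : dd F E (fun y => τ (e.symm y)) m = (dd F E τ (e.symm m)).comp (dd F F e.symm m) :=
      dd_comp (by rw [hesm]; exact (hτ m hmN).mdiff) (hes m hmt).mdiff
    change dd F E (fun y => τ (e.symm y)) m = s
    rw [h3, h1, hesm, hdτ, ContinuousLinearMap.comp_id]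

end Calculus

/-! ### Calculus of Lie brackets and brackets of distributions -/

section VectorFields

variable {E : Type*} [NormedAddCommGroup E] [NormedSpace ℝ E]
variable {Q : Type*} [TopologicalSpace Q] [ChartedSpace E Q]

theorem lieBr_congr {X X' Y Y' : VField E Q} {q : Q} (hX : ∀ᶠ x in 𝓝 q, X x = X' x)
    (hY : ∀ᶠ x in 𝓝 q, Y x = Y' x) : lieBr X Y q = lieBr X' Y' q :=
  Filter.EventuallyEq.mlieBracket_vectorField_eq hX hY

theorem lieBr_swap (X Y : VField E Q) (q : Q) : lieBr X Y q = -lieBr Y X q :=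
  VectorField.mlieBracket_swap_apply

theorem lieBr_self (X : VField E Q) (q : Q) : lieBr X X q = 0 := by
  have : VectorField.mlieBracket 𝓘(ℝ, E) X X = 0 := VectorField.mlieBracket_self
  exact congrFun this q

theorem lieBr_zero_right (T : VField E Q) (q : Q) : lieBr T (fun _ => 0) q = 0 := by
  have : VectorField.mlieBracket 𝓘(ℝ, E) T 0 = 0 := VectorField.mlieBracket_zero_right
  exact congrFun this q

variable [IsManifold 𝓘(ℝ, E) ∞ Q]

theorem isManifold_minSmoothness : IsManifold 𝓘(ℝ, E) (minSmoothness ℝ 2) Q := by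
  simp only [minSmoothness_of_isRCLikeNormedField]
  exact IsManifold.of_le (n := ∞) (by norm_cast)

theorem SmAt.mdiff {X : VField E Q} {q : Q} (h : SmAt X q) :
    MDifferentiableAt 𝓘(ℝ, E) (𝓘(ℝ, E).prod 𝓘(ℝ, E))
      (fun q => (⟨q, X q⟩ : TangentBundle 𝓘(ℝ, E) Q)) q :=
  ContMDiffAt.mdifferentiableAt h (by simp)

theorem SmAt.add {X Y : VField E Q} {q : Q} (hX : SmAt X q) (hY : SmAt Y q) :
    SmAt (fun q => X q + Y q) q := ContMDiffAt.add_section hX hY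

theorem SmAt.smul {X : VField E Q} {a : Q → ℝ} {q : Q} (ha : CM E ℝ a q) (hX : SmAt X q) :
    SmAt (fun q => a q • X q) q := ContMDiffAt.smul_section ha hX

theorem SmAt.sum {ι : Type*} (s : Finset ι) {X : ι → VField E Q} {q : Q}
    (hX : ∀ i ∈ s, SmAt (X i) q) : SmAt (fun q => ∑ i ∈ s, X i q) q :=
  ContMDiffAt.sum_section hX

theorem SmAt.lieBr [CompleteSpace E] {X Y : VField E Q} {q : Q} (hX : SmAt X q) (hY : SmAt Y q) :
    SmAt (lieBr X Y) q := by
  have h : IsManifold 𝓘(ℝ, E) (((⊤ : ℕ∞) : WithTop ℕ∞) + 1) Q := by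
    simpa using (inferInstance : IsManifold 𝓘(ℝ, E) ∞ Q)
  have : IsManifold 𝓘(ℝ, E) (minSmoothness ℝ 2) Q := isManifold_minSmoothness
  exact ContMDiffAt.mlieBracket_vectorField (m := ⊤) (n := ⊤) hX hY (by simp)

theorem isSection_iff {D : Distr E Q} {U : Set Q} (hU : IsOpen U) {X : VField E Q} :
    IsSection D U X ↔ ∀ q ∈ U, SmAt X q ∧ X q ∈ D q :=
  ⟨fun h q hq => ⟨h.1.contMDiffAt (hU.mem_nhds hq), h.2 q hq⟩,
    fun h => ⟨fun q hq => (h q hq).1.contMDiffWithinAt, fun q hq => (h q hq).2⟩⟩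

theorem lieBr_add_right [CompleteSpace E] (T : VField E Q) {X Y : VField E Q} {q : Q}
    (hX : SmAt X q) (hY : SmAt Y q) :
    lieBr T (fun q => X q + Y q) q = lieBr T X q + lieBr T Y q := by
  have : IsManifold 𝓘(ℝ, E) (minSmoothness ℝ 2) Q := isManifold_minSmoothness
  exact VectorField.mlieBracket_add_right hX.mdiff hY.mdiff

theorem lieBr_smul_right [CompleteSpace E] (T : VField E Q) {X : VField E Q} {a : Q → ℝ} {q : Q}
    (ha : CM E ℝ a q) (hX : SmAt X q) :
    lieBr T (fun q => a q • X q) q = dv ℝ a T q • X q + a q • lieBr T X q := by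
  have : IsManifold 𝓘(ℝ, E) (minSmoothness ℝ 2) Q := isManifold_minSmoothness
  exact VectorField.mlieBracket_smul_right ha.mdiff hX.mdiff

theorem lieBr_sum_right [CompleteSpace E] {ι : Type*} (s : Finset ι) (T : VField E Q)
    {X : ι → VField E Q} {a : ι → Q → ℝ} {q : Q} (ha : ∀ i, CM E ℝ (a i) q)
    (hX : ∀ i, SmAt (X i) q) :
    lieBr T (fun q => ∑ i ∈ s, a i q • X i q) q =
      ∑ i ∈ s, (dv ℝ (a i) T q • X i q + a i q • lieBr T (X i) q) := by
  classical
  induction s using Finset.induction_on with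
  | empty => simpa using lieBr_zero_right T q
  | insert j s hj ih =>
    rw [Finset.sum_insert hj, ← ih, ← lieBr_smul_right T (ha j) (hX j),
      ← lieBr_add_right T ((hX j).smul (ha j)) (SmAt.sum s fun i _ => (hX i).smul (ha i))]
    simp only [Finset.sum_insert hj]

/-- Modulo the fields `X i`, the bracket with a combination of them is tensorial. -/
theorem lieBr_sum_right_mem [CompleteSpace E] {ι : Type*} [Fintype ι] {T S : VField E Q}
    {X : ι → VField E Q} {a : ι → Q → ℝ} {q : Q} (ha : ∀ i, CM E ℝ (a i) q)
    (hX : ∀ i, SmAt (X i) q) (hS : ∀ᶠ x in 𝓝 q, S x = ∑ i, a i x • X i x)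
    {P : Submodule ℝ (TangentSpace 𝓘(ℝ, E) q)} (hP : ∀ i, X i q ∈ P)
    (hb : ∀ i, lieBr T (X i) q ∈ P) : lieBr T S q ∈ P := by
  rw [lieBr_congr (Eventually.of_forall fun _ => rfl) hS, lieBr_sum_right _ T ha hX]
  exact Submodule.sum_mem _ fun i _ => add_mem (P.smul_mem _ (hP i)) (P.smul_mem _ (hb i))

/-- The differential of a chart turns the relation between fields into one between functions with
values in the model space. -/
theorem cm_coeff_field [FiniteDimensional ℝ E] {ι : Type*} [Fintype ι] {X : ι → VField E Q}
    {S : VField E Q} {c : ι → Q → ℝ} {q : Q} (hX : ∀ i, SmAt (X i) q) (hS : SmAt S q)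
    (hli : LinearIndependent ℝ fun i => X i q) (h : ∀ᶠ x in 𝓝 q, S x = ∑ i, c i x • X i x)
    (i : ι) : CM E ℝ (c i) q := by
  let f := extChartAt 𝓘(ℝ, E) q
  refine cm_coeff (u := fun i => dv E f (X i)) (s := dv E f S)
    (fun i => (smAt_iff (mem_chart_source E q)).1 (hX i)) ((smAt_iff (mem_chart_source E q)).1 hS)
    ?_ ?_ i
  · have : (fun i => dv E f (X i) q) = fun i => (X i q : E) := by
      funext i
      change dd E E f q (X i q) = _
      rw [dd_extChartAt_self]; rfl
    rw [this]
    exact hli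
  · filter_upwards [h] with x hx
    change dd E E f x (S x) = ∑ i, c i x • dd E E f x (X i x)
    rw [hx]
    exact (map_sum (dd E E f x) _ _).trans (Finset.sum_congr rfl fun i _ => map_smul _ _ _)

/-- The coefficients are chosen pointwise; independence makes them unique on `U`, and this forces
smoothness. -/
theorem exists_coeff_field [FiniteDimensional ℝ E] {ι : Type*} [Fintype ι] {X : ι → VField E Q}
    {S : VField E Q} {U : Set Q} (hU : IsOpen U) (hX : ∀ i, ∀ q ∈ U, SmAt (X i) q)
    (hS : ∀ q ∈ U, SmAt S q) (hli : ∀ q ∈ U, LinearIndependent ℝ fun i => X i q)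
    (hmem : ∀ q ∈ U, S q ∈ Submodule.span ℝ (range fun i => X i q)) :
    ∃ c : ι → Q → ℝ, (∀ i, ∀ q ∈ U, CM E ℝ (c i) q) ∧ ∀ q ∈ U, S q = ∑ i, c i q • X i q := by
  classical
  have h1 : ∀ q, ∃ c : ι → ℝ, q ∈ U → S q = ∑ i, c i • X i q := by
    intro q
    by_cases hq : q ∈ U
    · obtain ⟨c, hc⟩ := (Submodule.mem_span_range_iff_exists_fun ℝ).1 (hmem q hq)
      exact ⟨c, fun _ => hc.symm⟩
    · exact ⟨0, fun h => absurd h hq⟩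
  choose c hc using h1
  refine ⟨fun i q => c q i, fun i q hq => ?_, fun q hq => hc q hq⟩
  refine cm_coeff_field (c := fun i q => c q i) (fun i => hX i q hq) (hS q hq) (hli q hq) ?_ i
  filter_upwards [hU.mem_nhds hq] with x hx
  exact hc x hx

theorem eventually_li_field [FiniteDimensional ℝ E] {ι : Type*} [Finite ι] {X : ι → VField E Q}
    {q : Q} (hX : ∀ i, SmAt (X i) q) (hli : LinearIndependent ℝ fun i => X i q) :
    ∀ᶠ x in 𝓝 q, LinearIndependent ℝ fun i => X i x := by
  let f := extChartAt 𝓘(ℝ, E) q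
  have h : LinearIndependent ℝ fun i => dv E f (X i) q := by
    have : (fun i => dv E f (X i) q) = fun i => (X i q : E) := by
      funext i
      change dd E E f q (X i q) = _
      rw [dd_extChartAt_self]; rfl
    rw [this]
    exact hli
  have h2 := eventually_linearIndependent (u := fun i => dv E f (X i))
    (fun i => ((smAt_iff (mem_chart_source E q)).1 (hX i)).continuousAt) h
  filter_upwards [h2] with x hx
  exact LinearIndependent.of_comp (dd E E f x).toLinearMap hx

/-- The bracket of two distributions is spanned by the brackets of local frames. -/
theorem bracketDistr_le [FiniteDimensional ℝ E] {ι κ : Type*} [Fintype ι] [Fintype κ]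
    {D D' : Distr E Q} {X : ι → VField E Q} {Y : κ → VField E Q} {U : Set Q} (hU : IsOpen U)
    (hX : ∀ i, ∀ q ∈ U, SmAt (X i) q) (hY : ∀ i, ∀ q ∈ U, SmAt (Y i) q)
    (hXli : ∀ q ∈ U, LinearIndependent ℝ fun i => X i q)
    (hYli : ∀ q ∈ U, LinearIndependent ℝ fun i => Y i q)
    (hD : ∀ q ∈ U, D q = Submodule.span ℝ (range fun i => X i q))
    (hD' : ∀ q ∈ U, D' q = Submodule.span ℝ (range fun i => Y i q)) {q : Q} (hq : q ∈ U)
    {P : Submodule ℝ (TangentSpace 𝓘(ℝ, E) q)} (hXP : ∀ i, X i q ∈ P) (hYP : ∀ j, Y j q ∈ P)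
    (hb : ∀ i j, lieBr (X i) (Y j) q ∈ P) : bracketDistr D D' q ≤ P := by
  have : CompleteSpace E := FiniteDimensional.complete ℝ E
  refine Submodule.span_le.2 ?_
  rintro _ ⟨U', hU', hqU', S, T, hS, hT, rfl⟩
  rw [isSection_iff hU'] at hS hT
  have hUU := hU.inter hU'
  obtain ⟨a, ha, haS⟩ := exists_coeff_field hUU (fun i x hx => hX i x hx.1)
    (fun x hx => (hS x hx.2).1) (fun x hx => hXli x hx.1)
    (fun x hx => by rw [← hD x hx.1]; exact (hS x hx.2).2)
  obtain ⟨b, hb', hbT⟩ := exists_coeff_field hUU (fun i x hx => hY i x hx.1)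
    (fun x hx => (hT x hx.2).1) (fun x hx => hYli x hx.1)
    (fun x hx => by rw [← hD' x hx.1]; exact (hT x hx.2).2)
  have hn : ∀ᶠ x in 𝓝 q, x ∈ U ∩ U' := hUU.mem_nhds ⟨hq, hqU'⟩
  refine lieBr_sum_right_mem (fun i => hb' i q ⟨hq, hqU'⟩) (fun i => hY i q hq)
    (hn.mono hbT) hYP fun j => ?_
  rw [lieBr_swap]
  refine P.neg_mem ?_
  refine lieBr_sum_right_mem (fun i => ha i q ⟨hq, hqU'⟩) (fun i => hX i q hq)
    (hn.mono haS) hXP fun i => ?_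
  rw [lieBr_swap]
  exact P.neg_mem (hb i j)

/-- A smooth function with prescribed derivative at a point. -/
theorem exists_function (q : Q) (l : E →L[ℝ] ℝ) : ∃ (g : Q → ℝ) (U : Set Q), IsOpen U ∧ q ∈ U ∧
    (∀ x ∈ U, CM E ℝ g x) ∧ dd E ℝ g q = l := by
  refine ⟨fun x => l (extChartAt 𝓘(ℝ, E) q x), (chartAt E q).source, (chartAt E q).open_source,
    mem_chart_source E q, fun x hx => (l.contMDiff (n := ∞)).contMDiffAt.comp x
      (cm_extChartAt hx), ?_⟩
  ext v
  rw [dd_clm_comp l (cm_extChartAt (mem_chart_source E q)).mdiff, dd_extChartAt_self]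
  rfl

theorem exists_dual {V : Type*} [NormedAddCommGroup V] [NormedSpace ℝ V] [FiniteDimensional ℝ V]
    {P : Submodule ℝ V} {v : V} (hv : v ∉ P) : ∃ l : V →L[ℝ] ℝ, l v = 1 ∧ ∀ p ∈ P, l p = 0 := by
  obtain ⟨f, hf, hP⟩ := Submodule.exists_le_ker_of_notMem hv
  refine ⟨LinearMap.toContinuousLinearMap ((f v)⁻¹ • f), ?_, fun p hp => ?_⟩
  · simp [hf]
  · have : f p = 0 := hP hp
    simp [this]

theorem range_pair_eq {V : Type*} (a b : V) : range ![a, b] = {a, b} := by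
  simp [Matrix.range_cons, Set.pair_comm]

theorem range_triple_eq {V : Type*} (a b c : V) : range ![a, b, c] = {a, b, c} := by
  ext x; simp [Matrix.range_cons]; tauto

/-- `[D, D]` for a distribution of rank two with a given local frame. -/
theorem derived2_eq_of_frame [FiniteDimensional ℝ E] {D : Distr E Q} {U : Set Q} (hU : IsOpen U)
    {W X : VField E Q} (hW : ∀ q ∈ U, SmAt W q) (hX : ∀ q ∈ U, SmAt X q)
    (hli : ∀ q ∈ U, LinearIndependent ℝ ![W q, X q])
    (hD : ∀ q ∈ U, D q = Submodule.span ℝ {W q, X q}) {q : Q} (hq : q ∈ U) :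
    derived2 D q = Submodule.span ℝ {W q, X q, lieBr W X q} := by
  have : CompleteSpace E := FiniteDimensional.complete ℝ E
  let Y : Fin 2 → VField E Q := ![W, X]
  have hYeq : ∀ q, (fun i => Y i q) = ![W q, X q] := by
    intro q; funext i; fin_cases i <;> rfl
  have hY : ∀ i, ∀ q ∈ U, SmAt (Y i) q := by
    intro i q hq
    fin_cases i
    · exact hW q hq
    · exact hX q hq
  set P : Submodule ℝ (TangentSpace 𝓘(ℝ, E) q) := Submodule.span ℝ {W q, X q, lieBr W X q} with hP
  have hWP : W q ∈ P := Submodule.subset_span (by simp)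
  have hXP : X q ∈ P := Submodule.subset_span (by simp)
  have hZP : lieBr W X q ∈ P := Submodule.subset_span (by simp)
  have hYP : ∀ i, Y i q ∈ P := by
    intro i; fin_cases i
    · exact hWP
    · exact hXP
  apply le_antisymm
  · refine bracketDistr_le hU hY hY (fun q hq => by rw [hYeq]; exact hli q hq)
      (fun q hq => by rw [hYeq]; exact hli q hq)
      (fun q hq => by rw [hYeq, range_pair_eq]; exact hD q hq)
      (fun q hq => by rw [hYeq, range_pair_eq]; exact hD q hq) hq hYP hYP ?_
    intro i j
    fin_cases i <;> fin_cases j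
    · change lieBr W W q ∈ P
      rw [lieBr_self]; exact P.zero_mem
    · exact hZP
    · change lieBr X W q ∈ P
      rw [lieBr_swap]; exact P.neg_mem hZP
    · change lieBr X X q ∈ P
      rw [lieBr_self]; exact P.zero_mem
  · have hb : ∀ {S T : VField E Q} {N : Set Q}, IsOpen N → q ∈ N → (∀ x ∈ N, SmAt S x ∧ S x ∈ D x) →
        (∀ x ∈ N, SmAt T x ∧ T x ∈ D x) → lieBr S T q ∈ derived2 D q := by
      intro S T N hN hqN hS hT
      exact Submodule.subset_span ⟨N, hN, hqN, S, T, (isSection_iff hN).2 hS,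
        (isSection_iff hN).2 hT, rfl⟩
    have hWs : ∀ x ∈ U, SmAt W x ∧ W x ∈ D x := fun x hx =>
      ⟨hW x hx, by rw [hD x hx]; exact Submodule.subset_span (by simp)⟩
    have hXs : ∀ x ∈ U, SmAt X x ∧ X x ∈ D x := fun x hx =>
      ⟨hX x hx, by rw [hD x hx]; exact Submodule.subset_span (by simp)⟩
    have hZ : lieBr W X q ∈ derived2 D q := hb hU hq hWs hXs
    -- The field `T` is recovered from brackets: if `S g = 1` at `q`, then `[S, g T] = T + g [S, T]`
    -- there, and both brackets are values of sections of `D`.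
    have main : ∀ {S T : VField E Q}, (∀ x ∈ U, SmAt S x ∧ S x ∈ D x) →
        (∀ x ∈ U, SmAt T x ∧ T x ∈ D x) → S q ≠ 0 → T q ∈ derived2 D q := by
      intro S T hS hT h0
      obtain ⟨l, hl, -⟩ := exists_dual (V := E) (P := ⊥) (v := S q) (by simpa using! h0)
      obtain ⟨g, N, hN, hqN, hg, hgl⟩ := exists_function q l
      have h1 := hb (hU.inter hN) ⟨hq, hqN⟩ (fun x hx => hS x hx.1) (T := fun x => g x • T x)
        fun x hx => ⟨(hT x hx.1).1.smul (hg x hx.2), (D x).smul_mem _ (hT x hx.1).2⟩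
      rw [lieBr_smul_right S (hg q hqN) (hT q hq).1] at h1
      have h2 : dv ℝ g S q = 1 := by
        change dd E ℝ g q (S q) = 1
        rw [hgl, hl]
      rw [h2, one_smul] at h1
      have h3 := (derived2 D q).smul_mem (g q) (hb hU hq hS hT)
      simpa using sub_mem h1 h3
    rw [hP, Submodule.span_le]
    have hW0 : W q ≠ 0 := (hli q hq).ne_zero (0 : Fin 2)
    have hX0 : X q ≠ 0 := (hli q hq).ne_zero (1 : Fin 2)
    rintro v (rfl | rfl | rfl)
    · exact main hXs hWs hX0
    · exact main hWs hXs hW0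
    · exact hZ

end VectorFields

/-! ### Linear independence of three and four vectors -/

section LinAlg

variable {V : Type*} [AddCommGroup V] [Module ℝ V]

theorem li_four_iff {a b c d : V} : LinearIndependent ℝ ![a, b, c, d] ↔
    ∀ r s t u : ℝ, r • a + s • b + t • c + u • d = 0 → r = 0 ∧ s = 0 ∧ t = 0 ∧ u = 0 := by
  rw [Fintype.linearIndependent_iff]
  constructor
  · intro h r s t u h0
    have := h ![r, s, t, u] (by simpa [Fin.sum_univ_four] using h0)
    exact ⟨this 0, this 1, this 2, this 3⟩
  · intro h g hg
    obtain ⟨h1, h2, h3, h4⟩ := h (g 0) (g 1) (g 2) (g 3) (by simpa [Fin.sum_univ_four] using hg)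
    intro i; fin_cases i <;> assumption

theorem li_three_iff {a b c : V} : LinearIndependent ℝ ![a, b, c] ↔
    ∀ r s t : ℝ, r • a + s • b + t • c = 0 → r = 0 ∧ s = 0 ∧ t = 0 := by
  rw [Fintype.linearIndependent_iff]
  constructor
  · intro h r s t h0
    have := h ![r, s, t] (by simpa [Fin.sum_univ_three] using h0)
    exact ⟨this 0, this 1, this 2⟩
  · intro h g hg
    obtain ⟨h1, h2, h3⟩ := h (g 0) (g 1) (g 2) (by simpa [Fin.sum_univ_three] using hg)
    intro i; fin_cases i <;> assumption

theorem li_two_of_three {a b c : V} (h : LinearIndependent ℝ ![a, b, c]) :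
    LinearIndependent ℝ ![a, b] := by
  rw [li_three_iff] at h
  rw [LinearIndependent.pair_iff]
  intro s t hst
  obtain ⟨h1, h2, -⟩ := h s t 0 (by rw [zero_smul, add_zero, hst])
  exact ⟨h1, h2⟩

theorem li_three_of_four {a b c d : V} (h : LinearIndependent ℝ ![a, b, c, d]) :
    LinearIndependent ℝ ![a, b, c] := by
  rw [li_four_iff] at h
  rw [li_three_iff]
  intro r s t h0
  obtain ⟨h1, h2, h3, -⟩ := h r s t 0 (by rw [zero_smul, add_zero, h0])
  exact ⟨h1, h2, h3⟩

theorem mem_span_three {a b c v : V} :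
    v ∈ Submodule.span ℝ {a, b, c} ↔ ∃ r s t : ℝ, r • a + s • b + t • c = v := by
  rw [Submodule.mem_span_triple]

theorem notMem_of_li_four {a b c d : V} (h : LinearIndependent ℝ ![a, b, c, d]) :
    d ∉ Submodule.span ℝ {a, b, c} := by
  rw [mem_span_three]
  rintro ⟨r, s, t, h0⟩
  rw [li_four_iff] at h
  have := (h r s t (-1) (by rw [h0]; module)).2.2.2
  norm_num at this

theorem li_four_of_notMem {a b c d : V} (h : LinearIndependent ℝ ![a, b, c])
    (hd : d ∉ Submodule.span ℝ {a, b, c}) : LinearIndependent ℝ ![a, b, c, d] := by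
  rw [li_four_iff]
  intro r s t u h0
  by_cases hu : u = 0
  · rw [hu, zero_smul, add_zero] at h0
    obtain ⟨h1, h2, h3⟩ := li_three_iff.1 h r s t h0
    exact ⟨h1, h2, h3, hu⟩
  · refine absurd (mem_span_three.2 ⟨-u⁻¹ * r, -u⁻¹ * s, -u⁻¹ * t, ?_⟩) hd
    have h1 : u⁻¹ • (r • a + s • b + t • c + u • d) = 0 := by rw [h0, smul_zero]
    have h2 : u⁻¹ • (u • d) = d := by rw [smul_smul, inv_mul_cancel₀ hu, one_smul]
    rw [smul_add, h2] at h1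
    rw [← neg_eq_of_add_eq_zero_right h1]
    module

theorem mem_span_of_li_four (hV : finrank ℝ V = 4) {a b c d : V}
    (h : LinearIndependent ℝ ![a, b, c, d]) (v : V) :
    ∃ r s t u : ℝ, v = r • a + s • b + t • c + u • d := by
  have hf : FiniteDimensional ℝ V := Module.finite_of_finrank_pos (by omega)
  have h1 := h.span_eq_top_of_card_eq_finrank' (by simp [hV])
  have h2 : v ∈ Submodule.span ℝ (range ![a, b, c, d]) := h1 ▸ Submodule.mem_top
  obtain ⟨g, hg⟩ := (Submodule.mem_span_range_iff_exists_fun ℝ).1 h2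
  exact ⟨g 0, g 1, g 2, g 3, by rw [← hg, Fin.sum_univ_four]; rfl⟩

end LinAlg

/-! ### Engel frames and the characteristic line -/

section Engel

variable {E : Type*} [NormedAddCommGroup E] [NormedSpace ℝ E]
variable {Q : Type*} [TopologicalSpace Q] [ChartedSpace E Q] [IsManifold 𝓘(ℝ, E) ∞ Q]

/-- A local frame of an Engel distribution adapted to its flag. -/
structure EngelFrame (D : Distr E Q) (U : Set Q) (W X : VField E Q) : Prop where
  isOpen : IsOpen U
  smW : ∀ q ∈ U, SmAt W q
  smX : ∀ q ∈ U, SmAt X q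
  dist : ∀ q ∈ U, D q = Submodule.span ℝ {W q, X q}
  li : ∀ q ∈ U, LinearIndependent ℝ ![W q, X q, lieBr W X q, lieBr (lieBr W X) X q]
  char : ∀ q ∈ U, lieBr W (lieBr W X) q ∈ Submodule.span ℝ {W q, X q, lieBr W X q}

variable {D : Distr E Q} {U : Set Q} {W X : VField E Q}

theorem EngelFrame.mono (h : EngelFrame D U W X) {U' : Set Q} (hU' : IsOpen U') (hs : U' ⊆ U) :
    EngelFrame D U' W X :=
  ⟨hU', fun q hq => h.smW q (hs hq), fun q hq => h.smX q (hs hq), fun q hq => h.dist q (hs hq),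
    fun q hq => h.li q (hs hq), fun q hq => h.char q (hs hq)⟩

theorem EngelFrame.smZ [FiniteDimensional ℝ E] (h : EngelFrame D U W X) {q : Q} (hq : q ∈ U) :
    SmAt (lieBr W X) q :=
  have : CompleteSpace E := FiniteDimensional.complete ℝ E
  (h.smW q hq).lieBr (h.smX q hq)

theorem EngelFrame.smV [FiniteDimensional ℝ E] (h : EngelFrame D U W X) {q : Q} (hq : q ∈ U) :
    SmAt (lieBr (lieBr W X) X) q :=
  have : CompleteSpace E := FiniteDimensional.complete ℝ E
  (h.smZ hq).lieBr (h.smX q hq)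

theorem EngelFrame.derived2_eq [FiniteDimensional ℝ E] (h : EngelFrame D U W X) {q : Q}
    (hq : q ∈ U) : derived2 D q = Submodule.span ℝ {W q, X q, lieBr W X q} :=
  derived2_eq_of_frame h.isOpen h.smW h.smX
    (fun q hq => li_two_of_three (li_three_of_four (h.li q hq))) h.dist hq

theorem EngelFrame.W_mem (h : EngelFrame D U W X) {q : Q} (hq : q ∈ U) : W q ∈ D q := by
  rw [h.dist q hq]; exact Submodule.subset_span (by simp)

theorem EngelFrame.X_mem (h : EngelFrame D U W X) {q : Q} (hq : q ∈ U) : X q ∈ D q := by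
  rw [h.dist q hq]; exact Submodule.subset_span (by simp)

theorem EngelFrame.W_ne_zero (h : EngelFrame D U W X) {q : Q} (hq : q ∈ U) : W q ≠ 0 :=
  (h.li q hq).ne_zero (0 : Fin 4)

/-- The characteristic line field is spanned by the first field of an Engel frame. -/
theorem EngelFrame.charLine_eq [FiniteDimensional ℝ E] (h : EngelFrame D U W X) {q : Q}
    (hq : q ∈ U) : charLine D q = Submodule.span ℝ {W q} := by
  have : CompleteSpace E := FiniteDimensional.complete ℝ E
  apply le_antisymm
  · refine Submodule.span_le.2 ?_
    rintro _ ⟨U', hU', hqU', W', hW', rfl, hbr⟩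
    rw [isSection_iff hU'] at hW'
    have hUU := h.isOpen.inter hU'
    have hY : ∀ i : Fin 2, ∀ x ∈ U, SmAt ((![W, X] : Fin 2 → VField E Q) i) x := by
      intro i x hx
      fin_cases i
      · exact h.smW x hx
      · exact h.smX x hx
    have hYeq : ∀ q, (fun i => (![W, X] : Fin 2 → VField E Q) i q) = ![W q, X q] := by
      intro q; funext i; fin_cases i <;> rfl
    obtain ⟨a, ha, haS⟩ := exists_coeff_field (X := ![W, X]) (S := W') hUU
      (fun i x hx => hY i x hx.1) (fun x hx => (hW' x hx.2).1)
      (fun x hx => by rw [hYeq]; exact li_two_of_three (li_three_of_four (h.li x hx.1)))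
      (fun x hx => by
        rw [hYeq, range_pair_eq, ← h.dist x hx.1]
        exact (hW' x hx.2).2)
    have hqq : q ∈ U ∩ U' := ⟨hq, hqU'⟩
    -- Write `W' = a₀ W + a₁ X` and test the defining property on `[W,X]`. Modulo `D²` the bracket
    -- of `[W,X]` with `W'` is `a₁ [[W,X],X]`, which forces `a₁ = 0`.
    have h1 := hbr U h.isOpen hq (lieBr W X) ((isSection_iff h.isOpen).2 fun x hx =>
      ⟨h.smZ hx, by rw [h.derived2_eq hx]; exact Submodule.subset_span (by simp)⟩)
    rw [lieBr_swap, Submodule.neg_mem_iff, lieBr_congr (Eventually.of_forall fun _ => rfl)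
      (eventually_of_mem (hUU.mem_nhds hqq) haS), lieBr_sum_right _ _ (fun i => ha i q hqq)
      (fun i => hY i q hq), Fin.sum_univ_two, h.derived2_eq hq] at h1
    change (_ • W q + a 0 q • lieBr (lieBr W X) W q) + (_ • X q + a 1 q • lieBr (lieBr W X) X q) ∈ _
      at h1
    have hWm : W q ∈ Submodule.span ℝ {W q, X q, lieBr W X q} := Submodule.subset_span (by simp)
    have hXm : X q ∈ Submodule.span ℝ {W q, X q, lieBr W X q} := Submodule.subset_span (by simp)
    have hch := h.char q hq
    rw [lieBr_swap W (lieBr W X), Submodule.neg_mem_iff] at hch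
    have h2 : a 1 q • lieBr (lieBr W X) X q ∈ Submodule.span ℝ {W q, X q, lieBr W X q} := by
      have := Submodule.sub_mem _ (Submodule.sub_mem _ h1 (Submodule.add_mem _
        (Submodule.smul_mem _ (dv ℝ (a 0) (lieBr W X) q) hWm) (Submodule.smul_mem _ (a 0 q) hch)))
        (Submodule.smul_mem _ (dv ℝ (a 1) (lieBr W X) q) hXm)
      convert this using 1
      module
    have h3 : a 1 q = 0 := by
      by_contra h0
      exact notMem_of_li_four (h.li q hq) ((Submodule.smul_mem_iff _ h0).1 h2)
    have h4 := haS q hqq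
    rw [Fin.sum_univ_two, h3, zero_smul, add_zero] at h4
    change W' q ∈ _
    rw [h4]
    exact Submodule.smul_mem _ _ (Submodule.subset_span rfl)
  · rw [Submodule.span_singleton_le_iff_mem]
    refine Submodule.subset_span ⟨U, h.isOpen, hq, W, (isSection_iff h.isOpen).2 fun x hx =>
      ⟨h.smW x hx, h.W_mem hx⟩, rfl, ?_⟩
    intro U' hU' hqU' Y hY
    rw [isSection_iff hU'] at hY
    have hUU := h.isOpen.inter hU'
    -- Conversely, bracketing with `W` is tensorial modulo `D²` on sections of `D²`, so it suffices
    -- to look at the three frame fields.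
    let T : Fin 3 → VField E Q := ![W, X, lieBr W X]
    have hT : ∀ i : Fin 3, ∀ x ∈ U, SmAt (T i) x := by
      intro i x hx
      fin_cases i
      · exact h.smW x hx
      · exact h.smX x hx
      · exact h.smZ hx
    have hTeq : ∀ q, (fun i => T i q) = ![W q, X q, lieBr W X q] := by
      intro q; funext i; fin_cases i <;> rfl
    obtain ⟨a, ha, haS⟩ := exists_coeff_field (X := T) (S := Y) hUU
      (fun i x hx => hT i x hx.1) (fun x hx => (hY x hx.2).1)
      (fun x hx => by rw [hTeq]; exact li_three_of_four (h.li x hx.1))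
      (fun x hx => by
        rw [hTeq, range_triple_eq, ← h.derived2_eq hx.1]
        exact (hY x hx.2).2)
    have hqq : q ∈ U ∩ U' := ⟨hq, hqU'⟩
    refine lieBr_sum_right_mem (fun i => ha i q hqq) (fun i => hT i q hq)
      (eventually_of_mem (hUU.mem_nhds hqq) haS) ?_ ?_
    · intro i
      rw [h.derived2_eq hq]
      fin_cases i <;> exact Submodule.subset_span (by simp [T])
    · intro i
      rw [h.derived2_eq hq]
      fin_cases i
      · change lieBr W W q ∈ _
        rw [lieBr_self]; exact Submodule.zero_mem _
      · exact (Submodule.subset_span (by simp) :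
          lieBr W X q ∈ Submodule.span ℝ {W q, X q, lieBr W X q})
      · exact h.char q hq

/-- A distribution with local Engel frames is an Engel structure. -/
theorem isEngel_of_frames (hE : finrank ℝ E = 4)
    (h : ∀ q, ∃ U W X, q ∈ U ∧ EngelFrame D U W X) : IsEngel D := by
  have hfin : FiniteDimensional ℝ E := Module.finite_of_finrank_pos (by omega)
  refine ⟨hE, ?_, ?_, ?_⟩
  · intro q
    obtain ⟨U, W, X, hq, hf⟩ := h q
    have heq : ∀ q, (fun i => (![W, X] : Fin 2 → VField E Q) i q) = ![W q, X q] := by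
      intro q; funext i; fin_cases i <;> rfl
    refine ⟨U, hf.isOpen, hq, ![W, X], fun i => (isSection_iff hf.isOpen).2 fun x hx => ?_,
      fun x hx => ?_⟩
    · fin_cases i
      · exact ⟨hf.smW x hx, hf.W_mem hx⟩
      · exact ⟨hf.smX x hx, hf.X_mem hx⟩
    · rw [heq, range_pair_eq]
      exact ⟨li_two_of_three (li_three_of_four (hf.li x hx)), hf.dist x hx⟩
  · intro q
    obtain ⟨U, W, X, hq, hf⟩ := h q
    have heq : ∀ q, (fun i => (![W, X, lieBr W X] : Fin 3 → VField E Q) i q) =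
        ![W q, X q, lieBr W X q] := by
      intro q; funext i; fin_cases i <;> rfl
    refine ⟨U, hf.isOpen, hq, ![W, X, lieBr W X], fun i => (isSection_iff hf.isOpen).2
      fun x hx => ?_, fun x hx => ?_⟩
    · rw [hf.derived2_eq hx]
      fin_cases i
      · exact ⟨hf.smW x hx, Submodule.subset_span (by simp)⟩
      · exact ⟨hf.smX x hx, Submodule.subset_span (by simp)⟩
      · exact ⟨hf.smZ hx, Submodule.subset_span (by simp)⟩
    · rw [heq, range_triple_eq]
      exact ⟨li_three_of_four (hf.li x hx), hf.derived2_eq hx⟩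
  · intro q
    obtain ⟨U, W, X, hq, hf⟩ := h q
    rw [eq_top_iff]
    intro v _
    obtain ⟨r, s, t, u, rfl⟩ := mem_span_of_li_four hE (hf.li q hq) v
    have h2 : r • W q + s • X q + t • lieBr W X q ∈ derived2 D q := by
      rw [hf.derived2_eq hq]
      exact mem_span_three.2 ⟨r, s, t, rfl⟩
    have h3 : lieBr (lieBr W X) X q ∈ bracketDistr D (derived2 D) q := by
      rw [lieBr_swap]
      refine Submodule.neg_mem _ (Submodule.subset_span ⟨U, hf.isOpen, hq, X, lieBr W X,
        (isSection_iff hf.isOpen).2 fun x hx => ⟨hf.smX x hx, hf.X_mem hx⟩,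
        (isSection_iff hf.isOpen).2 fun x hx => ⟨hf.smZ hx, ?_⟩, rfl⟩)
      rw [hf.derived2_eq hx]
      exact Submodule.subset_span (by simp)
    exact Submodule.add_mem _ (Submodule.mem_sup_left h2)
      (Submodule.mem_sup_right (Submodule.smul_mem _ _ h3))

/-- From a frame `(Y, X)` with `[[Y, X], X] ∉ D²` to an Engel frame. -/
theorem exists_engelFrame_of_frame (hE : finrank ℝ E = 4) {Y : VField E Q} (hU : IsOpen U)
    (hY : ∀ q ∈ U, SmAt Y q) (hX : ∀ q ∈ U, SmAt X q)
    (hD : ∀ q ∈ U, D q = Submodule.span ℝ {Y q, X q}) {q₀ : Q} (hq₀ : q₀ ∈ U)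
    (hli : LinearIndependent ℝ ![Y q₀, X q₀, lieBr Y X q₀, lieBr (lieBr Y X) X q₀]) :
    ∃ U' W, q₀ ∈ U' ∧ EngelFrame D U' W X := by
  have hfin : FiniteDimensional ℝ E := Module.finite_of_finrank_pos (by omega)
  have : CompleteSpace E := FiniteDimensional.complete ℝ E
  set Z₀ := lieBr Y X with hZ₀
  set V₀ := lieBr Z₀ X with hV₀
  have smZ : ∀ q ∈ U, SmAt Z₀ q := fun q hq => (hY q hq).lieBr (hX q hq)
  have smV : ∀ q ∈ U, SmAt V₀ q := fun q hq => (smZ q hq).lieBr (hX q hq)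
  let T : Fin 4 → VField E Q := ![Y, X, Z₀, V₀]
  have hT : ∀ i : Fin 4, ∀ x ∈ U, SmAt (T i) x := by
    intro i x hx
    fin_cases i
    · exact hY x hx
    · exact hX x hx
    · exact smZ x hx
    · exact smV x hx
  have hTeq : ∀ q, (fun i => T i q) = ![Y q, X q, Z₀ q, V₀ q] := by
    intro q; funext i; fin_cases i <;> rfl
  have hev := eventually_li_field (X := T) (fun i => hT i q₀ hq₀) (by rw [hTeq]; exact hli)
  obtain ⟨U', hU's, hU', hqU'⟩ := mem_nhds_iff.1 (inter_mem hev (hU.mem_nhds hq₀))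
  have hli' : ∀ q ∈ U', LinearIndependent ℝ ![Y q, X q, Z₀ q, V₀ q] := by
    intro q hq
    rw [← hTeq]
    exact (hU's hq).1
  have sub : ∀ {q}, q ∈ U' → q ∈ U := fun hq => (hU's hq).2
  obtain ⟨c, hc, hcS⟩ := exists_coeff_field (X := T) (S := lieBr Y Z₀) hU'
      (fun i x hx => hT i x (sub hx)) (fun x hx => (hY x (sub hx)).lieBr (smZ x (sub hx)))
      (fun x hx => by rw [hTeq]; exact hli' x hx)
      (fun x hx => by
        rw [hTeq]
        obtain ⟨r, s, t, u, h⟩ := mem_span_of_li_four hE (hli' x hx) (lieBr Y Z₀ x)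
        rw [h]
        refine add_mem (add_mem (add_mem ?_ ?_) ?_) ?_
        · exact Submodule.smul_mem _ _ (Submodule.subset_span ⟨0, rfl⟩)
        · exact Submodule.smul_mem _ _ (Submodule.subset_span ⟨1, rfl⟩)
        · exact Submodule.smul_mem _ _ (Submodule.subset_span ⟨2, rfl⟩)
        · exact Submodule.smul_mem _ _ (Submodule.subset_span ⟨3, rfl⟩))
  -- The coefficient `c 3` is the `[[Y,X],X]`-component of `[Y,[Y,X]]`. Since `[X,[Y,X]] =
  -- -[[Y,X],X]`, adding `c 3 • X` to `Y` cancels exactly this component of the bracket with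
  -- `[Y,X]`.
  let W : VField E Q := fun q => Y q + c 3 q • X q
  have smW : ∀ q ∈ U', SmAt W q := fun q hq =>
    (hY q (sub hq)).add ((hX q (sub hq)).smul (hc 3 q hq))
  -- brackets with `W`
  have brW : ∀ (S : VField E Q), ∀ q ∈ U', lieBr W S q =
      lieBr Y S q + c 3 q • lieBr X S q - dv ℝ (c 3) S q • X q := by
    intro S q hq
    rw [lieBr_swap W S, lieBr_add_right S (hY q (sub hq)) ((hX q (sub hq)).smul (hc 3 q hq)),
      lieBr_smul_right S (hc 3 q hq) (hX q (sub hq)), lieBr_swap S Y, lieBr_swap S X]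
    module
  let f : Q → ℝ := fun q => -dv ℝ (c 3) X q
  have hf : ∀ q ∈ U', CM E ℝ f q := fun q hq => (cm_dv (hc 3 q hq) (hX q (sub hq))).neg
  have hZ : ∀ q ∈ U', lieBr W X q = Z₀ q + f q • X q := by
    intro q hq
    rw [brW X q hq, lieBr_self, smul_zero, add_zero, sub_eq_add_neg, ← neg_smul]
  have evZ : ∀ q ∈ U', ∀ᶠ x in 𝓝 q, lieBr W X x = Z₀ x + f x • X x := fun q hq =>
    eventually_of_mem (hU'.mem_nhds hq) hZ
  have hV : ∀ q ∈ U', lieBr (lieBr W X) X q = V₀ q - dv ℝ f X q • X q := by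
    intro q hq
    rw [lieBr_congr (evZ q hq) (Eventually.of_forall fun _ => rfl), lieBr_swap,
      lieBr_add_right X (smZ q (sub hq)) ((hX q (sub hq)).smul (hf q hq)),
      lieBr_smul_right X (hf q hq) (hX q (sub hq)), lieBr_self, smul_zero, add_zero, lieBr_swap X Z₀]
    module
  have hWZ : ∀ q ∈ U', lieBr W (lieBr W X) q =
      lieBr W Z₀ q + (dv ℝ f W q • X q + f q • lieBr W X q) := by
    intro q hq
    rw [lieBr_congr (Eventually.of_forall fun _ => rfl) (evZ q hq),
      lieBr_add_right W (smZ q (sub hq)) ((hX q (sub hq)).smul (hf q hq)),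
      lieBr_smul_right W (hf q hq) (hX q (sub hq))]
  refine ⟨U', W, hqU', hU', smW, fun q hq => hX q (sub hq), fun q hq => ?_, fun q hq => ?_,
    fun q hq => ?_⟩
  · rw [hD q (sub hq)]
    apply le_antisymm
    · rw [Submodule.span_le]
      have hXm : X q ∈ Submodule.span ℝ {W q, X q} := Submodule.subset_span (by simp)
      have hWm : W q ∈ Submodule.span ℝ {W q, X q} := Submodule.subset_span (by simp)
      rintro v (rfl | rfl)
      · have := Submodule.sub_mem _ hWm (Submodule.smul_mem _ (c 3 q) hXm)
        simpa [W] using this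
      · exact hXm
    · rw [Submodule.span_le]
      have hXm : X q ∈ Submodule.span ℝ {Y q, X q} := Submodule.subset_span (by simp)
      have hYm : Y q ∈ Submodule.span ℝ {Y q, X q} := Submodule.subset_span (by simp)
      rintro v (rfl | rfl)
      · exact Submodule.add_mem _ hYm (Submodule.smul_mem _ (c 3 q) hXm)
      · exact hXm
  · rw [hZ q hq, hV q hq, li_four_iff]
    intro r s t u h0
    have h1 := li_four_iff.1 (hli' q hq) r (r * c 3 q + s + t * f q - u * dv ℝ f X q) t u (by
      rw [← h0]
      simp only [W]
      module)
    obtain ⟨h1, h2, h3, h4⟩ := h1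
    refine ⟨h1, ?_, h3, h4⟩
    rw [h1, h3, h4] at h2
    simpa using h2
  · rw [hWZ q hq, brW Z₀ q hq, hcS q hq, Fin.sum_univ_four]
    change (c 0 q • Y q + c 1 q • X q + c 2 q • Z₀ q + c 3 q • V₀ q) + c 3 q • lieBr X Z₀ q - _ + _ ∈
      Submodule.span ℝ {W q, X q, lieBr W X q}
    rw [lieBr_swap X Z₀, hZ q hq, mem_span_three]
    -- Obtained by substituting `Y = W - c₃ X` and `[Y,X] = [W,X] - f X`; the terms in `[[Y,X],X]`
    -- have cancelled.
    refine ⟨c 0 q, -c 0 q * c 3 q + c 1 q - c 2 q * f q - dv ℝ (c 3) Z₀ q + dv ℝ f W q,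
      c 2 q + f q, ?_⟩
    simp only [W, hV₀]
    module

/-- Engel structures have local Engel frames. -/
theorem exists_engelFrame (hD : IsEngel D) (q₀ : Q) : ∃ U W X, q₀ ∈ U ∧ EngelFrame D U W X := by
  have hE := hD.dim
  have hfin : FiniteDimensional ℝ E := Module.finite_of_finrank_pos (by omega)
  have : CompleteSpace E := FiniteDimensional.complete ℝ E
  obtain ⟨U, hU, hq₀, Y, hY, hYD⟩ := hD.rank_two q₀
  set A := Y 0
  set B := Y 1
  have heq : ∀ q, (fun i => Y i q) = ![A q, B q] := by
    intro q; funext i; fin_cases i <;> rfl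
  have smA : ∀ q ∈ U, SmAt A q := fun q hq => ((isSection_iff hU).1 (hY 0) q hq).1
  have smB : ∀ q ∈ U, SmAt B q := fun q hq => ((isSection_iff hU).1 (hY 1) q hq).1
  have hli2 : ∀ q ∈ U, LinearIndependent ℝ ![A q, B q] := fun q hq => heq q ▸ (hYD q hq).1
  have hdist : ∀ q ∈ U, D q = Submodule.span ℝ {A q, B q} := by
    intro q hq
    rw [(hYD q hq).2, heq, range_pair_eq]
  have hd2 : ∀ q ∈ U, derived2 D q = Submodule.span ℝ {A q, B q, lieBr A B q} := fun q hq =>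
    derived2_eq_of_frame hU smA smB hli2 hdist hq
  set C := lieBr A B with hC
  have smC : ∀ q ∈ U, SmAt C q := fun q hq => (smA q hq).lieBr (smB q hq)
  have hli3 : ∀ q ∈ U, LinearIndependent ℝ ![A q, B q, C q] := by
    intro q hq
    obtain ⟨U₃, -, hq3, T, -, hT⟩ := hD.rank_three q
    obtain ⟨h1, h2⟩ := hT q hq3
    have h3 : finrank ℝ (derived2 D q) = 3 := by
      rw [h2, finrank_span_eq_card h1, Fintype.card_fin]
    rw [hd2 q hq, ← range_triple_eq] at h3
    exact linearIndependent_iff_card_eq_finrank_span.2 (by rw [Fintype.card_fin]; exact h3.symm)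
  let S3 : Fin 3 → VField E Q := ![A, B, C]
  have hS3 : ∀ i : Fin 3, ∀ x ∈ U, SmAt (S3 i) x := by
    intro i x hx
    fin_cases i
    · exact smA x hx
    · exact smB x hx
    · exact smC x hx
  have hS3eq : ∀ q, (fun i => S3 i q) = ![A q, B q, C q] := by
    intro q; funext i; fin_cases i <;> rfl
  -- Otherwise `[D, D²]` is contained in `D²`, so that `D³ = D²` would have rank three.
  have key : lieBr A C q₀ ∉ derived2 D q₀ ∨ lieBr B C q₀ ∉ derived2 D q₀ := by
    by_contra hcon
    push Not at hcon
    obtain ⟨hAC, hBC⟩ := hcon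
    have hAm : A q₀ ∈ derived2 D q₀ := by rw [hd2 q₀ hq₀]; exact Submodule.subset_span (by simp)
    have hBm : B q₀ ∈ derived2 D q₀ := by rw [hd2 q₀ hq₀]; exact Submodule.subset_span (by simp)
    have hCm : C q₀ ∈ derived2 D q₀ := by rw [hd2 q₀ hq₀]; exact Submodule.subset_span (by simp)
    have hle : bracketDistr D (derived2 D) q₀ ≤ derived2 D q₀ := by
      refine bracketDistr_le (X := Y) (Y := S3) hU
        (fun i q hq => ((isSection_iff hU).1 (hY i) q hq).1) hS3 (fun q hq => (hYD q hq).1)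
        (fun q hq => by rw [hS3eq]; exact hli3 q hq) (fun q hq => (hYD q hq).2)
        (fun q hq => by rw [hS3eq, range_triple_eq]; exact hd2 q hq) hq₀ ?_ ?_ ?_
      · intro i; fin_cases i
        · exact hAm
        · exact hBm
      · intro i; fin_cases i
        · exact hAm
        · exact hBm
        · exact hCm
      · intro i j
        fin_cases i <;> fin_cases j
        · change lieBr A A q₀ ∈ _
          rw [lieBr_self]; exact Submodule.zero_mem _
        · exact hCm
        · exact hAC
        · change lieBr B A q₀ ∈ _
          rw [lieBr_swap]; exact Submodule.neg_mem _ hCm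
        · change lieBr B B q₀ ∈ _
          rw [lieBr_self]; exact Submodule.zero_mem _
        · exact hBC
    have h1 := hD.top q₀
    rw [derived3, sup_eq_left.2 hle] at h1
    have h2 : finrank ℝ (derived2 D q₀) = 3 := by
      rw [hd2 q₀ hq₀, ← range_triple_eq, finrank_span_eq_card (hli3 q₀ hq₀), Fintype.card_fin]
    rw [h1, finrank_top] at h2
    have h3 : finrank ℝ (TangentSpace 𝓘(ℝ, E) q₀) = 4 := hE
    omega
  rw [hd2 q₀ hq₀] at key
  -- The field whose bracket with `C` leaves `D²` plays the role of `X`, up to signs.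
  rcases key with hk | hk
  · have hBA : ∀ q, lieBr B A q = -C q := fun q => lieBr_swap B A q
    have hV : lieBr (lieBr B A) A q₀ = lieBr A C q₀ := by
      rw [lieBr_swap, lieBr_congr (Eventually.of_forall fun _ => rfl) (Y' := fun q => (-1 : ℝ) • C q)
        (Eventually.of_forall fun q => by rw [hBA, neg_one_smul]),
        lieBr_smul_right A (a := fun _ => -1) contMDiffAt_const (smC q₀ hq₀)]
      have : dv ℝ (fun _ : Q => (-1 : ℝ)) A q₀ = 0 := by
        change dd E ℝ (fun _ : Q => (-1 : ℝ)) q₀ (A q₀) = 0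
        rw [dd_const]; rfl
      rw [this]; module
    obtain ⟨U', W, h1, h2⟩ := exists_engelFrame_of_frame (D := D) (X := A) (Y := B) hE hU smB smA
      (fun q hq => by rw [hdist q hq, Set.pair_comm]) hq₀ (by
        rw [hV, hBA]
        have h4 := li_four_iff.1 (li_four_of_notMem (hli3 q₀ hq₀) hk)
        rw [li_four_iff]
        intro r s t u h0
        obtain ⟨h5, h6, h7, h8⟩ := h4 s r (-t) u (by rw [← h0]; module)
        exact ⟨h6, h5, neg_eq_zero.1 h7, h8⟩)
    exact ⟨U', W, A, h1, h2⟩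
  · obtain ⟨U', W, h1, h2⟩ := exists_engelFrame_of_frame (D := D) (X := B) (Y := A) hE hU smA smB hdist hq₀ (by
        rw [lieBr_swap (lieBr A B) B]
        have h4 := li_four_iff.1 (li_four_of_notMem (hli3 q₀ hq₀) hk)
        rw [li_four_iff]
        intro r s t u h0
        obtain ⟨h5, h6, h7, h8⟩ := h4 r s t (-u) (by rw [← h0]; module)
        exact ⟨h5, h6, h7, neg_eq_zero.1 h8⟩)
    exact ⟨U', W, B, h1, h2⟩

end Engel

/-! ### Leaf curves and transport along them -/

section Leaves

variable {E : Type*} [NormedAddCommGroup E] [NormedSpace ℝ E]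
variable {Q : Type*} [TopologicalSpace Q] [ChartedSpace E Q] [IsManifold 𝓘(ℝ, E) ∞ Q]
variable {G : Type*} [NormedAddCommGroup G] [NormedSpace ℝ G]

theorem dd_smul {E' : Type*} [NormedAddCommGroup E'] [NormedSpace ℝ E'] {Q' : Type*}
    [TopologicalSpace Q'] [ChartedSpace E' Q'] (f : Q → Q') (q : Q) (r : ℝ)
    (v : TangentSpace 𝓘(ℝ, E) q) : dd E E' f q (r • v) = r • dd E E' f q v := map_smul _ _ _

theorem dd_add {E' : Type*} [NormedAddCommGroup E'] [NormedSpace ℝ E'] {Q' : Type*}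
    [TopologicalSpace Q'] [ChartedSpace E' Q'] (f : Q → Q') (q : Q)
    (v w : TangentSpace 𝓘(ℝ, E) q) : dd E E' f q (v + w) = dd E E' f q v + dd E E' f q w :=
  map_add _ _ _

theorem dd_neg {E' : Type*} [NormedAddCommGroup E'] [NormedSpace ℝ E'] {Q' : Type*}
    [TopologicalSpace Q'] [ChartedSpace E' Q'] (f : Q → Q') (q : Q)
    (v : TangentSpace 𝓘(ℝ, E) q) : dd E E' f q (-v) = -dd E E' f q v := map_neg _ _

theorem dd_comp_vec {E' : Type*} [NormedAddCommGroup E'] [NormedSpace ℝ E'] {Q' : Type*}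
    [TopologicalSpace Q'] [ChartedSpace E' Q'] {E'' : Type*} [NormedAddCommGroup E'']
    [NormedSpace ℝ E''] {Q'' : Type*} [TopologicalSpace Q''] [ChartedSpace E'' Q'']
    {g : Q' → Q''} {f : Q → Q'} {q : Q}
    (hg : MDifferentiableAt 𝓘(ℝ, E') 𝓘(ℝ, E'') g (f q))
    (hf : MDifferentiableAt 𝓘(ℝ, E) 𝓘(ℝ, E') f q) (v : TangentSpace 𝓘(ℝ, E) q) :
    dd E E'' (fun x => g (f x)) q v = dd E' E'' g (f q) (dd E E' f q v) := dd_comp_apply hg hf v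

theorem dd_clm_comp_vec {E' : Type*} [NormedAddCommGroup E'] [NormedSpace ℝ E']
    (l : E' →L[ℝ] G) {f : Q → E'} {q : Q}
    (hf : MDifferentiableAt 𝓘(ℝ, E) 𝓘(ℝ, E') f q) (v : TangentSpace 𝓘(ℝ, E) q) :
    dd E G (fun x => l (f x)) q v = l (dd E E' f q v) := dd_clm_comp l hf v

/-- A smooth curve in `N` which is tangent to the characteristic line field. -/
structure IsLeafCurve (D : Distr E Q) (N : Set Q) (γ : ℝ → Q) : Prop where
  smooth : ∀ t, CM ℝ E γ t
  mem : ∀ t, γ t ∈ N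
  tangent : ∀ t, dd ℝ E γ t 1 ∈ charLine D (γ t)

theorem mem_leaf_iff {D : Distr E Q} {q q' : Q} :
    q' ∈ leaf D q ↔ ∃ γ, IsLeafCurve D univ γ ∧ γ 0 = q ∧ γ 1 = q' :=
  ⟨fun ⟨γ, h1, h2, h3, h4⟩ => ⟨γ, ⟨fun t => h1 t, fun _ => trivial, h4⟩, h2, h3⟩,
    fun ⟨γ, h1, h2, h3⟩ => ⟨γ, h1.smooth, h2, h3, h1.tangent⟩⟩

theorem IsLeafCurve.continuous {D : Distr E Q} {N : Set Q} {γ : ℝ → Q} (h : IsLeafCurve D N γ) :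
    Continuous γ := continuous_iff_continuousAt.2 fun t => (h.smooth t).continuousAt

/-- Affine reparametrization of a leaf curve. -/
theorem IsLeafCurve.affine {D : Distr E Q} {N : Set Q} {γ : ℝ → Q} (h : IsLeafCurve D N γ)
    (a b : ℝ) : IsLeafCurve D N (fun t => γ (a * t + b)) := by
  have hd : ∀ t, HasDerivAt (fun t : ℝ => a * t + b) a t := fun t => by
    simpa using ((hasDerivAt_id t).const_mul a).add_const b
  have hs : ContDiff ℝ ∞ (fun t : ℝ => a * t + b) := by fun_prop
  have hsm : ∀ t, CM ℝ ℝ (fun t : ℝ => a * t + b) t := fun t => hs.contDiffAt.contMDiffAt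
  refine ⟨fun t => CM.comp (f := fun t : ℝ => a * t + b) (h.smooth _) (hsm t),
    fun t => h.mem _, fun t => ?_⟩
  rw [dd_comp_apply (E' := ℝ) (g := γ) (f := fun t : ℝ => a * t + b) (h.smooth _).mdiff
    (hsm t).mdiff]
  have h1 : dd ℝ ℝ (fun t : ℝ => a * t + b) t 1 = a • (1 : ℝ) := by
    rw [dd_eq_fderiv, fderiv_eq_smul_deriv, (hd t).deriv]; simp
  rw [h1, map_smul]
  exact Submodule.smul_mem _ _ (h.tangent _)

theorem IsLeafCurve.mono {D : Distr E Q} {N N' : Set Q} {γ : ℝ → Q} (h : IsLeafCurve D N γ)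
    (hN : N ⊆ N') : IsLeafCurve D N' γ := ⟨h.smooth, fun t => hN (h.mem t), h.tangent⟩

theorem IsLeafCurve.mem_leaf {D : Distr E Q} {N : Set Q} {γ : ℝ → Q} (h : IsLeafCurve D N γ)
    (s t : ℝ) : γ t ∈ leaf D (γ s) :=
  mem_leaf_iff.2 ⟨_, (h.mono (subset_univ N)).affine (t - s) s, by simp, by simp⟩

/-- The components of the velocity of a leaf curve in an Engel frame. -/
theorem IsLeafCurve.exists_coeff [FiniteDimensional ℝ E] {D : Distr E Q} {N : Set Q} {γ : ℝ → Q}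
    (h : IsLeafCurve D N γ) {U : Set Q} {W X : VField E Q} (hf : EngelFrame D U W X) {t₀ : ℝ}
    (ht : γ t₀ ∈ U) : ∃ r : ℝ → ℝ, ContinuousAt r t₀ ∧
      ∀ᶠ t in 𝓝 t₀, (dd ℝ E γ t 1 : TangentSpace 𝓘(ℝ, E) (γ t)) = r t • W (γ t) := by
  have hU : ∀ᶠ t in 𝓝 t₀, γ t ∈ U := h.continuous.continuousAt (hf.isOpen.mem_nhds ht)
  have h1 : ∀ t, ∃ r : ℝ, γ t ∈ U →
      (dd ℝ E γ t 1 : TangentSpace 𝓘(ℝ, E) (γ t)) = r • W (γ t) := by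
    intro t
    by_cases hU : γ t ∈ U
    · have h1 : (dd ℝ E γ t 1 : TangentSpace 𝓘(ℝ, E) (γ t)) ∈ charLine D (γ t) := h.tangent t
      rw [hf.charLine_eq hU] at h1
      obtain ⟨r, hr⟩ := (Submodule.mem_span_singleton (R := ℝ)
        (M := TangentSpace 𝓘(ℝ, E) (γ t))).1 h1
      exact ⟨r, fun _ => hr.symm⟩
    · exact ⟨0, fun h => absurd h hU⟩
  choose r hr using h1
  let c := extChartAt 𝓘(ℝ, E) (γ t₀)
  have hsrc : ∀ᶠ t in 𝓝 t₀, γ t ∈ (chartAt E (γ t₀)).source := h.continuous.continuousAt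
    ((chartAt E (γ t₀)).open_source.mem_nhds (mem_chart_source E _))
  have hcγ : CM ℝ E (fun t => c (γ t)) t₀ :=
    CM.comp (cm_extChartAt (mem_chart_source E _)) (h.smooth t₀)
  have hs : CM ℝ E (fun t => dd ℝ E (fun t => c (γ t)) t 1) t₀ := by
    have h2 : ContDiffAt ℝ ∞ (fderiv ℝ (fun t => c (γ t))) t₀ :=
      (contMDiffAt_iff_contDiffAt.1 hcγ).fderiv_right (by simp)
    refine (h2.clm_apply (contDiffAt_const (c := (1 : ℝ)))).contMDiffAt.congr_of_eventuallyEq ?_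
    exact Eventually.of_forall fun t => by
      change dd ℝ E (fun t => c (γ t)) t 1 = fderiv ℝ (fun t => c (γ t)) t 1
      rw [dd_eq_fderiv]
  have hu : CM ℝ E (fun t => dv E c W (γ t)) t₀ := CM.comp
    ((smAt_iff (mem_chart_source E _)).1 (hf.smW _ ht)) (h.smooth t₀)
  refine ⟨r, ?_, hU.mono hr⟩
  -- In a chart the velocity is a multiple of the nonvanishing components of `W`, so the factor is a
  -- coefficient with respect to a family of one vector and hence continuous.
  refine (cm_coeff (ι := Unit) (u := fun _ t => dv E c W (γ t)) (c := fun _ => r)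
    (fun _ => hu) hs ?_ ?_ ()).continuousAt
  · refine linearIndependent_unique_iff.2 ?_
    change dd E E c (γ t₀) (W (γ t₀)) ≠ 0
    rw [dd_extChartAt_self]
    exact hf.W_ne_zero ht
  · filter_upwards [hU, hsrc] with t ht hts
    rw [dd_comp_apply (cm_extChartAt hts).mdiff (h.smooth t).mdiff, hr t ht, dd_smul]
    simp [dv, c]

/-- Let `h` be constant along the characteristic foliation, and let `P` be a distribution which is
preserved by it. If the derivative of `h` vanishes on `P` at a point of a leaf curve, then so it
does along the curve. -/
theorem transport_of_frames [FiniteDimensional ℝ E] {D P : Distr E Q} {k : ℕ} {N : Set Q}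
    (hN : IsOpen N)
    (hP : ∀ q, ∃ (U : Set Q) (W X : VField E Q) (Y : Fin k → VField E Q), q ∈ U ∧
      EngelFrame D U W X ∧ ∀ x ∈ U, (∀ i, SmAt (Y i) x) ∧ (LinearIndependent ℝ fun i => Y i x) ∧
      P x = Submodule.span ℝ (range fun i => Y i x) ∧ ∀ i, lieBr W (Y i) x ∈ P x)
    {h : Q → G} (hh : ∀ q ∈ N, CM E G h q) (hL : ∀ q ∈ N, ∀ v ∈ charLine D q, dd E G h q v = 0)
    {γ : ℝ → Q} (hγ : IsLeafCurve D N γ) {s : ℝ} (h0 : ∀ v ∈ P (γ s), dd E G h (γ s) v = 0) (t : ℝ) :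
    ∀ v ∈ P (γ t), dd E G h (γ t) v = 0 := by
  have : CompleteSpace E := FiniteDimensional.complete ℝ E
  let S : Set ℝ := {t | ∀ v ∈ P (γ t), dd E G h (γ t) v = 0}
  suffices hS : IsClopen S by
    have := hS.eq_univ ⟨s, h0⟩
    exact (this ▸ mem_univ t : t ∈ S)
  have main : ∀ t₀, ∃ (u : ℝ → Fin k → G), ContinuousAt u t₀ ∧
      (∀ᶠ t in 𝓝 t₀, t ∈ S ↔ u t = 0) ∧ (u t₀ = 0 → ∀ᶠ t in 𝓝 t₀, u t = 0) := by
    intro t₀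
    obtain ⟨U, W, X, Y, hqU, hf, hY⟩ := hP (γ t₀)
    have hUN : IsOpen (U ∩ N) := hf.isOpen.inter hN
    have hev : ∀ᶠ t in 𝓝 t₀, γ t ∈ U ∩ N :=
      hγ.continuous.continuousAt (hUN.mem_nhds ⟨hqU, hγ.mem t₀⟩)
    -- The derivatives of `h` along the frame of `P`; they vanish at time `t` exactly when `dh`
    -- kills `P` there.
    let u : ℝ → Fin k → G := fun t i => dv G h (Y i) (γ t)
    have hsm : ∀ i, ∀ x ∈ U ∩ N, CM E G (dv G h (Y i)) x := fun i x hx =>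
      cm_dv (hh x hx.2) ((hY x hx.1).1 i)
    have huc : ContinuousAt u t₀ := by
      refine continuousAt_pi.2 fun i => ?_
      exact ContinuousAt.comp (f := γ) (hsm i _ ⟨hqU, hγ.mem t₀⟩).continuousAt
        hγ.continuous.continuousAt
    refine ⟨u, huc, ?_, fun hu0 => ?_⟩
    · filter_upwards [hev] with t ht
      constructor
      · intro hS
        funext i
        exact hS _ (by rw [(hY _ ht.1).2.2.1]; exact Submodule.subset_span ⟨i, rfl⟩)
      · intro hu v hv
        rw [(hY _ ht.1).2.2.1] at hv
        have hle : Submodule.span ℝ (range fun i => Y i (γ t)) ≤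
            (LinearMap.ker (dd E G h (γ t)).toLinearMap : Submodule ℝ E) := by
          refine Submodule.span_le.2 ?_
          rintro _ ⟨i, rfl⟩
          exact congrFun hu i
        exact hle hv
    · obtain ⟨r, hrc, hr⟩ := hγ.exists_coeff hf hqU
      have hB : ∀ i, ∃ c : Fin k → Q → ℝ, (∀ j, ∀ q ∈ U, CM E ℝ (c j) q) ∧
          ∀ q ∈ U, lieBr W (Y i) q = ∑ j, c j q • Y j q := fun i =>
        exists_coeff_field hf.isOpen (fun j q hq => (hY q hq).1 j)
          (fun q hq => (hf.smW q hq).lieBr ((hY q hq).1 i)) (fun q hq => (hY q hq).2.1)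
          (fun q hq => (hY q hq).2.2.1 ▸ (hY q hq).2.2.2 i)
      choose B hBs hB using hB
      -- A continuous bound for the coefficient matrix of the linear equation satisfied by `u`.
      let K : ℝ → ℝ := fun t => ∑ i, |r t| * ∑ j, |B i j (γ t)|
      have hK : ContinuousAt K t₀ := by
        refine tendsto_finsetSum _ fun i _ => hrc.abs.mul (tendsto_finsetSum _ fun j _ => ?_)
        exact ContinuousAt.abs (ContinuousAt.comp (f := γ) (hBs i j _ hqU).continuousAt
          hγ.continuous.continuousAt)
      have hKb : ∀ᶠ t in 𝓝 t₀, K t ≤ K t₀ + 1 :=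
        (hK.eventually (gt_mem_nhds (lt_add_one (K t₀)))).mono fun t ht => le_of_lt ht
      let u' : ℝ → Fin k → G := fun t i => r t • ∑ j, B i j (γ t) • u t j
      refine eventually_zero_of_deriv_le (u' := u') (K := K t₀ + 1) ?_ ?_ hu0
      · filter_upwards [hev, hr] with t ht hrt
        refine hasDerivAt_pi.2 fun i => ?_
        have h1 := hasDerivAt_comp_curve (hsm i _ ht).mdiff (hγ.smooth t).mdiff
        convert h1 using 1
        -- As `W h = 0` near the curve, `W (Y_i h) = [W, Y_i] h`. Invariance of `P` expresses this
        -- through the functions `Y_j h` themselves.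
        have h2 := dv_lieBr (hh _ ht.2) (hf.smW _ ht.1) ((hY _ ht.1).1 i)
        have h3 : dv G (dv G h W) (Y i) (γ t) = 0 := by
          have h4 : dd E G (dv G h W) (γ t) = dd E G (fun _ : Q => (0 : G)) (γ t) := by
            apply dd_congr
            filter_upwards [hUN.mem_nhds ht] with x hx
            refine hL x hx.2 _ ?_
            rw [hf.charLine_eq hx.1]
            exact Submodule.mem_span_singleton_self _
          change dd E G (dv G h W) (γ t) (Y i (γ t)) = 0
          rw [h4, dd_const]; rfl
        rw [h3, sub_zero] at h2
        rw [hrt, dd_smul]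
        change r t • ∑ j, B i j (γ t) • u t j = r t • dv G (dv G h (Y i)) W (γ t)
        rw [← h2]
        congr 1
        change _ = dd E G h (γ t) (lieBr W (Y i) (γ t))
        rw [hB i _ ht.1]
        symm
        exact (map_sum (dd E G h (γ t)) _ _).trans (Finset.sum_congr rfl fun j _ => map_smul _ _ _)
      · filter_upwards [hKb] with t ht
        refine (pi_norm_le_iff_of_nonneg ?_).2 fun i => ?_
        · refine mul_nonneg (le_trans ?_ ht) (norm_nonneg _)
          exact Finset.sum_nonneg fun i _ => mul_nonneg (abs_nonneg _)
            (Finset.sum_nonneg fun j _ => abs_nonneg _)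
        · calc ‖u' t i‖ ≤ |r t| * ∑ j, |B i j (γ t)| * ‖u t‖ := by
                change ‖r t • ∑ j, B i j (γ t) • u t j‖ ≤ _
                rw [norm_smul, Real.norm_eq_abs]
                refine mul_le_mul_of_nonneg_left ((norm_sum_le _ _).trans
                  (Finset.sum_le_sum fun j _ => ?_)) (abs_nonneg _)
                rw [norm_smul, Real.norm_eq_abs]
                exact mul_le_mul_of_nonneg_left (norm_le_pi_norm _ _) (abs_nonneg _)
            _ = (|r t| * ∑ j, |B i j (γ t)|) * ‖u t‖ := by rw [← Finset.sum_mul, mul_assoc]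
            _ ≤ K t * ‖u t‖ := by
                refine mul_le_mul_of_nonneg_right ?_ (norm_nonneg _)
                exact Finset.single_le_sum (f := fun i => |r t| * ∑ j, |B i j (γ t)|)
                  (fun i _ => mul_nonneg (abs_nonneg _) (Finset.sum_nonneg fun j _ => abs_nonneg _))
                  (Finset.mem_univ i)
            _ ≤ (K t₀ + 1) * ‖u t‖ := mul_le_mul_of_nonneg_right ht (norm_nonneg _)
  constructor
  · rw [← isOpen_compl_iff, isOpen_iff_mem_nhds]
    intro t₀ ht₀
    obtain ⟨u, huc, huS, -⟩ := main t₀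
    have h1 : u t₀ ≠ 0 := fun h => ht₀ (huS.self_of_nhds.2 h)
    filter_upwards [huS, huc.eventually_ne h1] with t ht htn hS
    exact htn (ht.1 hS)
  · rw [isOpen_iff_mem_nhds]
    intro t₀ ht₀
    obtain ⟨u, -, huS, hu⟩ := main t₀
    filter_upwards [huS, hu (huS.self_of_nhds.1 ht₀)] with t ht htn
    exact ht.2 htn

/-- The frame `W, X, [W,X]` of `D²` is carried into `D²` by brackets with `W`, the last field by the
definition of an Engel frame. -/
theorem transport_derived2 {D : Distr E Q} (hD : IsEngel D) {N : Set Q} (hN : IsOpen N)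
    {h : Q → G} (hh : ∀ q ∈ N, CM E G h q) (hL : ∀ q ∈ N, ∀ v ∈ charLine D q, dd E G h q v = 0)
    {γ : ℝ → Q} (hγ : IsLeafCurve D N γ) {s : ℝ} (h0 : ∀ v ∈ derived2 D (γ s), dd E G h (γ s) v = 0)
    (t : ℝ) : ∀ v ∈ derived2 D (γ t), dd E G h (γ t) v = 0 := by
  have hfin : FiniteDimensional ℝ E := Module.finite_of_finrank_pos (by have := hD.dim; omega)
  refine transport_of_frames (k := 3) hN (fun q => ?_) hh hL hγ h0 t
  obtain ⟨U, W, X, hq, hf⟩ := exists_engelFrame hD q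
  refine ⟨U, W, X, ![W, X, lieBr W X], hq, hf, fun x hx => ?_⟩
  have heq : (fun i => (![W, X, lieBr W X] : Fin 3 → VField E Q) i x) = ![W x, X x, lieBr W X x] := by
    funext i; fin_cases i <;> rfl
  rw [heq, range_triple_eq, hf.derived2_eq hx]
  refine ⟨fun i => ?_, li_three_of_four (hf.li x hx), rfl, fun i => ?_⟩
  · fin_cases i
    · exact hf.smW x hx
    · exact hf.smX x hx
    · exact hf.smZ hx
  · fin_cases i
    · change lieBr W W x ∈ _
      rw [lieBr_self]; exact Submodule.zero_mem _
    · exact (Submodule.subset_span (by simp) :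
          lieBr W X x ∈ Submodule.span ℝ {W x, X x, lieBr W X x})
    · exact hf.char x hx

/-- Invariance of the whole tangent bundle is automatic, so a map constant along leaves with zero
differential at one point of a leaf curve has zero differential along the curve. -/
theorem transport_full {D : Distr E Q} (hD : IsEngel D) {N : Set Q} (hN : IsOpen N)
    {h : Q → G} (hh : ∀ q ∈ N, CM E G h q) (hL : ∀ q ∈ N, ∀ v ∈ charLine D q, dd E G h q v = 0)
    {γ : ℝ → Q} (hγ : IsLeafCurve D N γ) {s : ℝ} (h0 : dd E G h (γ s) = 0)
    (t : ℝ) : dd E G h (γ t) = 0 := by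
  have hfin : FiniteDimensional ℝ E := Module.finite_of_finrank_pos (by have := hD.dim; omega)
  have := transport_of_frames (k := 4) (P := fullDistr E Q) hN (fun q => ?_) hh hL hγ
    (fun v _ => by rw [h0]; rfl) t
  · ext v
    exact this v trivial
  obtain ⟨U, W, X, hq, hf⟩ := exists_engelFrame hD q
  refine ⟨U, W, X, ![W, X, lieBr W X, lieBr (lieBr W X) X], hq, hf, fun x hx => ?_⟩
  have heq : (fun i => (![W, X, lieBr W X, lieBr (lieBr W X) X] : Fin 4 → VField E Q) i x) =
      ![W x, X x, lieBr W X x, lieBr (lieBr W X) X x] := by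
    funext i; fin_cases i <;> rfl
  rw [heq]
  refine ⟨fun i => ?_, hf.li x hx, ?_, fun i => trivial⟩
  · fin_cases i
    · exact hf.smW x hx
    · exact hf.smX x hx
    · exact hf.smZ hx
    · exact hf.smV hx
  · have : FiniteDimensional ℝ (TangentSpace 𝓘(ℝ, E) x) := hfin
    have h4 : finrank ℝ (TangentSpace 𝓘(ℝ, E) x) = 4 := hD.dim
    exact ((hf.li x hx).span_eq_top_of_card_eq_finrank' (by rw [h4]; simp)).symm

end Leaves

theorem li_three_neg {V : Type*} [AddCommGroup V] [Module ℝ V] {a b c : V}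
    (h : LinearIndependent ℝ ![a, b, c]) : LinearIndependent ℝ ![a, b, -c] := by
  rw [li_three_iff] at h ⊢
  intro r s t h0
  have := h r s (-t) (by rw [neg_smul, ← smul_neg]; exact h0)
  exact ⟨this.1, this.2.1, neg_eq_zero.1 this.2.2⟩

/-! ### The leaf space and its contact structure -/

section LeafSpace

variable {E : Type*} [NormedAddCommGroup E] [NormedSpace ℝ E]
variable {Q : Type*} [TopologicalSpace Q] [ChartedSpace E Q] [IsManifold 𝓘(ℝ, E) ∞ Q]
variable {F : Type*} [NormedAddCommGroup F] [NormedSpace ℝ F]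
variable {M : Type*} [TopologicalSpace M] [ChartedSpace F M] [IsManifold 𝓘(ℝ, F) ∞ M]
variable {D : Distr E Q} {π : Q → M}

theorem IsEngel.finiteDimensional (hD : IsEngel D) : FiniteDimensional ℝ E :=
  Module.finite_of_finrank_pos (by have := hD.dim; omega)

theorem IsLeafQuotient.cm (hπ : IsLeafQuotient F D π) (q : Q) : CM E F π q := hπ.smooth q

theorem IsLeafQuotient.exists_rightInverse [FiniteDimensional ℝ F] (hπ : IsLeafQuotient F D π)
    (q : Q) : ∃ s : F →L[ℝ] E, (dd E F π q).comp s = .id ℝ F := by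
  obtain ⟨s, hs⟩ := (dd E F π q).toLinearMap.exists_rightInverse_of_surjective
    (LinearMap.range_eq_top.2 (hπ.submersion q))
  refine ⟨LinearMap.toContinuousLinearMap s, ?_⟩
  ext y
  exact LinearMap.congr_fun hs y

theorem IsLeafQuotient.apply_leafCurve (hπ : IsLeafQuotient F D π) {N : Set Q} {γ : ℝ → Q}
    (hγ : IsLeafCurve D N γ) (s t : ℝ) : π (γ t) = π (γ s) := by
  have := hγ.mem_leaf s t
  rw [← hπ.fiber_eq_leaf] at this
  exact this

theorem IsLeafQuotient.dd_leafCurve (hπ : IsLeafQuotient F D π) {N : Set Q} {γ : ℝ → Q}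
    (hγ : IsLeafCurve D N γ) (t : ℝ) : dd E F π (γ t) (dd ℝ E γ t 1) = 0 := by
  rw [← dd_comp_apply (f := γ) (g := π) (hπ.cm _).mdiff (hγ.smooth t).mdiff]
  have : (fun x => π (γ x)) = fun _ => π (γ 0) := funext fun x => hπ.apply_leafCurve hγ 0 x
  rw [this, dd_const]
  rfl

/-- The projection to the leaf space kills the characteristic line field. -/
theorem IsLeafQuotient.dd_W [T2Space Q] [FiniteDimensional ℝ F] (hF : finrank ℝ F = 3)
    (hD : IsEngel D) (hπ : IsLeafQuotient F D π)
    {U : Set Q} {W X : VField E Q} (hf : EngelFrame D U W X) {q : Q} (hq : q ∈ U) :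
    dd E F π q (W q) = 0 := by
  have hfin := hD.finiteDimensional
  -- Leaves are sets of points reached by tangent curves, on which `π` is constant. If `dπ W` were
  -- nonzero near `q`, such curves could not move there, leaves would be single points, and a
  -- submersion from dimension four to three would be injective near `q`.
  by_contra hne
  have hcF : CompleteSpace F := FiniteDimensional.complete ℝ F
  let c := extChartAt 𝓘(ℝ, F) (π q)
  have hcπ : CM E F (fun x => c (π x)) q :=
    CM.comp (f := π) (g := c) (cm_extChartAt (mem_chart_source F _)) (hπ.cm q)
  have hsrc : ∀ᶠ x in 𝓝 q, π x ∈ (chartAt F (π q)).source :=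
    (hπ.cm q).continuousAt ((chartAt F (π q)).open_source.mem_nhds (mem_chart_source F _))
  have hu : CM E F (dv F (fun x => c (π x)) W) q := cm_dv hcπ (hf.smW q hq)
  have hu0 : dv F (fun x => c (π x)) W q ≠ 0 := by
    change dd E F (fun x => c (π x)) q (W q) ≠ 0
    rw [dd_comp_vec (f := π) (g := c) (cm_extChartAt (mem_chart_source F _)).mdiff
      (hπ.cm q).mdiff, dd_extChartAt_self]
    exact hne
  have hev : ∀ᶠ x in 𝓝 q, dd E F π x (W x) ≠ 0 := by
    filter_upwards [hu.continuousAt.eventually_ne hu0, hsrc] with x hx hxs h0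
    apply hx
    change dd E F (fun x => c (π x)) x (W x) = 0
    rw [dd_comp_vec (f := π) (g := c) (cm_extChartAt hxs).mdiff (hπ.cm x).mdiff, h0, map_zero]
  obtain ⟨N, hN, hNo, hqN⟩ := eventually_nhds_iff.1 (hev.and (hf.isOpen.mem_nhds hq))
  -- The velocity is `r W` and is killed by `dπ`, so `r = 0` as long as the curve is in `N`. Hence
  -- the times spent at `x` form an open set, and a closed one since points are closed.
  have hleaf : ∀ x ∈ N, ∀ y ∈ leaf D x, y = x := by
    intro x hx y hy
    obtain ⟨γ, hγ, h0, h1⟩ := mem_leaf_iff.1 hy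
    have hopen : IsOpen {t | γ t = x} := by
      rw [isOpen_iff_mem_nhds]
      intro t₀ ht₀
      have ht₀' : γ t₀ = x := ht₀
      have h2 : ∀ᶠ t in 𝓝 t₀, γ t ∈ N :=
        hγ.continuous.continuousAt (hNo.mem_nhds (ht₀'.symm ▸ hx))
      have h3 := eventually_const_of_dd_eq_zero (E := E) hγ.continuous.continuousAt (h2.mono
        fun t ht => ⟨(hγ.smooth t).mdiff, ?_⟩)
      · filter_upwards [h3] with t ht
        exact ht.trans ht₀'
      · have h4 : (dd ℝ E γ t 1 : TangentSpace 𝓘(ℝ, E) (γ t)) ∈ charLine D (γ t) := hγ.tangent t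
        rw [hf.charLine_eq (hN _ ht).2] at h4
        obtain ⟨r, hr⟩ := (Submodule.mem_span_singleton (R := ℝ)
          (M := TangentSpace 𝓘(ℝ, E) (γ t))).1 h4
        have h5 := hπ.dd_leafCurve hγ t
        rw [← hr, dd_smul] at h5
        have h6 := (smul_eq_zero.1 h5).resolve_right (hN _ ht).1
        rw [← hr, h6]
        exact zero_smul ℝ _
    have hcl : IsClosed {t | γ t = x} := isClosed_singleton.preimage hγ.continuous
    have h7 := (IsClopen.eq_univ ⟨hcl, hopen⟩ ⟨0, h0⟩ : {t | γ t = x} = univ)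
    rw [← h1]
    exact (h7 ▸ mem_univ (1 : ℝ) : (1 : ℝ) ∈ {t | γ t = x})
  have hinj : InjOn π N := by
    intro x hx y hy hxy
    refine (hleaf x hx y ?_).symm
    rw [← hπ.fiber_eq_leaf]
    exact hxy.symm
  obtain ⟨s, hs⟩ := hπ.exists_rightInverse q
  have hker : ∃ w : E, w ≠ 0 ∧ dd E F π q w = 0 := by
    by_contra! h
    have hi : Function.Injective (dd E F π q).toLinearMap :=
      LinearMap.ker_eq_bot.1 ((Submodule.eq_bot_iff _).2 fun w hw => by
        by_contra hw0
        exact h w hw0 hw)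
    have := LinearMap.finrank_le_finrank_of_injective hi
    have h4 := hD.dim
    omega
  obtain ⟨w, hw0, hw⟩ := hker
  have hnt : Nontrivial F := Module.nontrivial_of_finrank_pos (R := ℝ) (by omega)
  obtain ⟨y, hy⟩ := exists_ne (0 : F)
  obtain ⟨l, hl, -⟩ := exists_dual (P := (⊥ : Submodule ℝ F)) (v := y) (by simpa using hy)
  -- Adding a kernel vector produces a second right inverse. The two resulting sections through `q`
  -- have different derivatives, but injectivity of `π` on `N` makes them coincide.
  have hs' : (dd E F π q).comp (s + l.smulRight w) = .id ℝ F := by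
    rw [ContinuousLinearMap.comp_add, hs]
    ext z
    simp [hw]
  obtain ⟨σ, V, hV, hqV, hσq, hσ, hdσ⟩ := exists_localSection hπ.cm q s hs
  obtain ⟨σ', V', hV', hqV', hσq', hσ', hdσ'⟩ := exists_localSection hπ.cm q _ hs'
  have heq : σ =ᶠ[𝓝 (π q)] σ' := by
    have h1 : ∀ᶠ m in 𝓝 (π q), σ m ∈ N :=
      (hσ _ hqV).1.continuousAt (hNo.mem_nhds (hσq.symm ▸ hqN))
    have h2 : ∀ᶠ m in 𝓝 (π q), σ' m ∈ N :=
      (hσ' _ hqV').1.continuousAt (hNo.mem_nhds (hσq'.symm ▸ hqN))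
    filter_upwards [h1, h2, hV.mem_nhds hqV, hV'.mem_nhds hqV'] with m h1 h2 h3 h4
    exact hinj h1 h2 (((hσ m h3).2).trans (hσ' m h4).2.symm)
  have h1 := dd_congr (E := F) (E' := E) heq
  rw [hdσ, hdσ'] at h1
  have h2 := congrArg (fun L : F →L[ℝ] E => L y) h1
  simp [hl] at h2
  exact hw0 h2

/-- The characteristic line is the kernel of the projection to the leaf space. -/
theorem IsLeafQuotient.dd_eq_zero_iff [T2Space Q] [FiniteDimensional ℝ F] (hF : finrank ℝ F = 3)
    (hD : IsEngel D) (hπ : IsLeafQuotient F D π)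
    {U : Set Q} {W X : VField E Q} (hf : EngelFrame D U W X) {q : Q} (hq : q ∈ U)
    (v : TangentSpace 𝓘(ℝ, E) q) : dd E F π q v = 0 ↔ ∃ r : ℝ, v = r • W q := by
  have hfin := hD.finiteDimensional
  constructor
  · intro hv
    have h1 : finrank ℝ (LinearMap.ker (dd E F π q).toLinearMap) = 1 := by
      have := LinearMap.finrank_range_add_finrank_ker (dd E F π q).toLinearMap
      rw [LinearMap.range_eq_top.2 (show Function.Surjective (dd E F π q).toLinearMap from
        hπ.submersion q), finrank_top, hF, hD.dim] at this
      omega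
    have h2 := (finrank_eq_one_iff_of_nonzero' (V := LinearMap.ker (dd E F π q).toLinearMap)
      ⟨W q, hπ.dd_W hF hD hf hq⟩ (fun h => hf.W_ne_zero hq (congrArg Subtype.val h))).1 h1 ⟨v, hv⟩
    obtain ⟨r, hr⟩ := h2
    exact ⟨r, (congrArg Subtype.val hr).symm⟩
  · rintro ⟨r, rfl⟩
    rw [dd_smul, hπ.dd_W hF hD hf hq, smul_zero]

theorem IsLeafQuotient.mem_charLine_iff [T2Space Q] [FiniteDimensional ℝ F] (hF : finrank ℝ F = 3)
    (hD : IsEngel D) (hπ : IsLeafQuotient F D π) {q : Q} (v : TangentSpace 𝓘(ℝ, E) q) :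
    v ∈ charLine D q ↔ dd E F π q v = 0 := by
  have hfin := hD.finiteDimensional
  obtain ⟨U, W, X, hq, hf⟩ := exists_engelFrame hD q
  rw [hπ.dd_eq_zero_iff hF hD hf hq, hf.charLine_eq hq, Submodule.mem_span_singleton]
  simp only [eq_comm]

/-- The projections of `X`, `[W, X]` and `[[W, X], X]` are independent. -/
theorem IsLeafQuotient.li_push [T2Space Q] [FiniteDimensional ℝ F] (hF : finrank ℝ F = 3)
    (hD : IsEngel D) (hπ : IsLeafQuotient F D π)
    {U : Set Q} {W X : VField E Q} (hf : EngelFrame D U W X) {q : Q} (hq : q ∈ U) :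
    LinearIndependent ℝ ![dd E F π q (X q), dd E F π q (lieBr W X q),
      dd E F π q (lieBr (lieBr W X) X q)] := by
  rw [li_three_iff]
  intro r s t h
  rw [← dd_smul, ← dd_smul, ← dd_smul, ← dd_add, ← dd_add, hπ.dd_eq_zero_iff hF hD hf hq] at h
  obtain ⟨a, ha⟩ := h
  have := li_four_iff.1 (hf.li q hq) (-a) r s t (by
    rw [neg_smul, ← ha]
    module)
  exact this.2

/-- If the projection of `v` were outside the image of `D²` at `q`, a linear form vanishing on this
image and not on `dπ v`, composed with `π` in a chart, would give a leafwise constant function whose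
differential kills `D²` at `q` but not at `q'`, contrary to transport along a leaf curve. Applied in
both directions this makes `π_* D²` well defined. -/
theorem IsLeafQuotient.exists_push_derived2 [T2Space Q] [FiniteDimensional ℝ F]
    (hF : finrank ℝ F = 3) (hD : IsEngel D) (hπ : IsLeafQuotient F D π) {q q' : Q}
    (hqq' : π q' = π q) {v : TangentSpace 𝓘(ℝ, E) q'} (hv : v ∈ derived2 D q') :
    ∃ w ∈ derived2 D q, dd E F π q w = dd E F π q' v := by
  by_contra hcon
  let P : Submodule ℝ F := Submodule.map (dd E F π q).toLinearMap (derived2 D q : Submodule ℝ E)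
  have hP : dd E F π q' v ∉ P := fun ⟨w, hw, h⟩ => hcon ⟨w, hw, h⟩
  obtain ⟨l, hl, hlP⟩ := exists_dual hP
  let c := extChartAt 𝓘(ℝ, F) (π q)
  let N : Set Q := π ⁻¹' (chartAt F (π q)).source
  have hN : IsOpen N := (chartAt F (π q)).open_source.preimage hπ.smooth.continuous
  have hmem : q' ∈ leaf D q := by rw [← hπ.fiber_eq_leaf]; exact hqq'
  obtain ⟨γ, hγ, h0, h1⟩ := mem_leaf_iff.1 hmem
  have hγN : IsLeafCurve D N γ := ⟨hγ.smooth, fun t => by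
    change π (γ t) ∈ (chartAt F (π q)).source
    rw [hπ.apply_leafCurve hγ 0 t, h0]
    exact mem_chart_source F _, hγ.tangent⟩
  have hcπ : ∀ x ∈ N, CM E F (fun x => c (π x)) x := fun x hx =>
    CM.comp (f := π) (g := c) (cm_extChartAt hx) (hπ.cm x)
  have hdd : ∀ x ∈ N, ∀ u : TangentSpace 𝓘(ℝ, E) x, dd E ℝ (fun x => l (c (π x))) x u =
      l (dd F F c (π x) (dd E F π x u)) := fun x hx u => by
    rw [dd_clm_comp_vec l (hcπ x hx).mdiff, dd_comp_vec (f := π) (g := c)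
      (cm_extChartAt hx).mdiff (hπ.cm x).mdiff]
  have hself : ∀ x, π x = π q → x ∈ N ∧ dd F F c (π x) = .id ℝ F := fun x hx => by
    refine ⟨by change π x ∈ (chartAt F (π q)).source; rw [hx]; exact mem_chart_source F _, ?_⟩
    rw [hx]
    exact dd_extChartAt_self _
  have key := transport_derived2 hD hN (h := fun x => l (c (π x))) (fun x hx =>
    CM.comp (f := fun x => c (π x)) (g := l) l.contMDiff.contMDiffAt (hcπ x hx))
    (fun x hx u hu => by
      rw [hdd x hx, (hπ.mem_charLine_iff hF hD u).1 hu, map_zero, map_zero]) hγN (s := 0)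
    (fun u hu => by
      rw [h0] at hu ⊢
      refine (hdd q (hself q rfl).1 u).trans ?_
      rw [(hself q rfl).2]
      exact hlP _ ⟨u, hu, rfl⟩) 1
  rw [h1] at key
  have h2 := key v hv
  rw [hdd q' (hself q' hqq').1, (hself q' hqq').2] at h2
  change l (dd E F π q' v) = 0 at h2
  rw [hl] at h2
  exact one_ne_zero h2

/-- The field along a local section `σ` of `π` obtained by projecting the field `X`. -/
noncomputable def pushField (F : Type*) [NormedAddCommGroup F] [NormedSpace ℝ F]
    {M : Type*} [TopologicalSpace M] [ChartedSpace F M] (π : Q → M) (σ : M → Q) (X : VField E Q) :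
    VField F M := fun m => dd E F π (σ m) (X (σ m))

theorem dv_chart_pushField (hπ : ∀ q, CM E F π q) {σ : M → Q} {m₀ m : M}
    (hσ : π (σ m) = m) (hm : m ∈ (chartAt F m₀).source) (X : VField E Q) :
    dv F (extChartAt 𝓘(ℝ, F) m₀) (pushField F π σ X) m =
      dv F (fun x => extChartAt 𝓘(ℝ, F) m₀ (π x)) X (σ m) := by
  change dd F F (extChartAt 𝓘(ℝ, F) m₀) m (dd E F π (σ m) (X (σ m))) =
    dd E F (fun x => extChartAt 𝓘(ℝ, F) m₀ (π x)) (σ m) (X (σ m))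
  rw [dd_comp_vec (f := π) (g := extChartAt 𝓘(ℝ, F) m₀)
    (cm_extChartAt (by rw [hσ]; exact hm)).mdiff (hπ _).mdiff, hσ]

theorem smAt_pushField (hπ : ∀ q, CM E F π q) {σ : M → Q} {V : Set M} (hV : IsOpen V)
    (hσ : ∀ m ∈ V, CM F E σ m ∧ π (σ m) = m) {X : VField E Q} {m : M} (hm : m ∈ V)
    (hX : SmAt X (σ m)) : SmAt (pushField F π σ X) m := by
  rw [smAt_iff (mem_chart_source F m)]
  have h1 : CM E F (dv F (fun x => extChartAt 𝓘(ℝ, F) m (π x)) X) (σ m) := by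
    refine cm_dv (CM.comp (f := π) (g := extChartAt 𝓘(ℝ, F) m) (cm_extChartAt ?_) (hπ _)) hX
    rw [(hσ m hm).2]
    exact mem_chart_source F m
  refine ContMDiffAt.congr_of_eventuallyEq (CM.comp (f := σ) h1 (hσ m hm).1) ?_
  filter_upwards [hV.mem_nhds hm, (chartAt F m).open_source.mem_nhds (mem_chart_source F m)]
    with x hx hxs
  exact dv_chart_pushField hπ (hσ x hx).2 hxs X

/-- A section need not be tangent to the given fields for its projected fields to have the projected
bracket. Tangency at the one point is enough: when the two sides are compared as derivations on a
chart, only the first derivatives of the projected fields in these two directions occur. -/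
theorem lieBr_pushField [CompleteSpace E] [CompleteSpace F] (hπ : ∀ q, CM E F π q) {σ : M → Q}
    {V : Set M} (hV : IsOpen V)
    (hσ : ∀ m ∈ V, CM F E σ m ∧ π (σ m) = m) {X Y : VField E Q} {m : M} (hm : m ∈ V)
    (hX : SmAt X (σ m)) (hY : SmAt Y (σ m))
    (hdX : dd F E σ m (dd E F π (σ m) (X (σ m))) = X (σ m))
    (hdY : dd F E σ m (dd E F π (σ m) (Y (σ m))) = Y (σ m)) :
    lieBr (pushField F π σ X) (pushField F π σ Y) m = dd E F π (σ m) (lieBr X Y (σ m)) := by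
  let c := extChartAt 𝓘(ℝ, F) m
  have hcm : CM F F c (π (σ m)) := cm_extChartAt (by
    rw [(hσ m hm).2]
    exact mem_chart_source F m)
  have hcπ : CM E F (fun x => c (π x)) (σ m) := CM.comp (f := π) (g := c) hcm (hπ _)
  have h1 := dv_lieBr (f := c) (cm_extChartAt (mem_chart_source F m))
    (smAt_pushField hπ hV hσ hm hX) (smAt_pushField hπ hV hσ hm hY)
  have h2 := dv_lieBr hcπ hX hY
  have h3 : ∀ {A B : VField E Q}, SmAt A (σ m) →
      dd F E σ m (dd E F π (σ m) (B (σ m))) = B (σ m) →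
      dv F (dv F c (pushField F π σ A)) (pushField F π σ B) m =
        dv F (dv F (fun x => c (π x)) A) B (σ m) := by
    intro A B hA hB
    have h4 : dv F c (pushField F π σ A) =ᶠ[𝓝 m] fun x => dv F (fun x => c (π x)) A (σ x) := by
      filter_upwards [hV.mem_nhds hm, (chartAt F m).open_source.mem_nhds (mem_chart_source F m)]
        with x hx hxs
      exact dv_chart_pushField hπ (hσ x hx).2 hxs A
    change dd F F (dv F c (pushField F π σ A)) m (dd E F π (σ m) (B (σ m))) =
      dd E F (dv F (fun x => c (π x)) A) (σ m) (B (σ m))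
    rw [dd_congr h4, dd_comp_apply (f := σ) (cm_dv hcπ hA).mdiff (hσ m hm).1.mdiff, hB]
  rw [h3 hX hdY, h3 hY hdX, ← h2] at h1
  have h5 : dd E F (fun x => c (π x)) (σ m) = dd E F π (σ m) := by
    have := dd_comp (f := π) (g := c) hcm.mdiff (hπ (σ m)).mdiff
    refine this.trans ?_
    have h6 : dd F F c (π (σ m)) = .id ℝ F := by
      rw [(hσ m hm).2]
      exact dd_extChartAt_self _
    rw [h6]
    rfl
  have h7 : dd F F c m = .id ℝ F := dd_extChartAt_self _
  change dd F F c m _ = dd E F (fun x => c (π x)) (σ m) _ at h1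
  rw [h5, h7] at h1
  exact h1

/-- A local section of `π` whose differential at `π q` inverts `dπ` on `X` and `[W, X]`. -/
theorem IsLeafQuotient.exists_section [T2Space Q] [FiniteDimensional ℝ F] (hF : finrank ℝ F = 3)
    (hD : IsEngel D) (hπ : IsLeafQuotient F D π)
    {U : Set Q} {W X : VField E Q} (hf : EngelFrame D U W X) {q : Q} (hq : q ∈ U) :
    ∃ (σ : M → Q) (V : Set M), IsOpen V ∧ π q ∈ V ∧ σ (π q) = q ∧
      (∀ m ∈ V, CM F E σ m ∧ π (σ m) = m) ∧ (∀ m ∈ V, σ m ∈ U) ∧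
      dd F E σ (π q) (dd E F π q (X q)) = X q ∧
      dd F E σ (π q) (dd E F π q (lieBr W X q)) = lieBr W X q := by
  have hcF : CompleteSpace F := FiniteDimensional.complete ℝ F
  have hli := hπ.li_push hF hD hf hq
  -- The three projections form a basis, so a right inverse of `dπ` can be prescribed on them; the
  -- third vector only completes the basis.
  let b : Basis (Fin 3) ℝ F := basisOfLinearIndependentOfCardEqFinrank hli (by simp [hF])
  have hb : ∀ i, b i = ![dd E F π q (X q), dd E F π q (lieBr W X q),
      dd E F π q (lieBr (lieBr W X) X q)] i := fun i => by
    rw [coe_basisOfLinearIndependentOfCardEqFinrank]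
  let s : F →L[ℝ] E := LinearMap.toContinuousLinearMap
    (b.constr ℝ (![X q, lieBr W X q, lieBr (lieBr W X) X q] : Fin 3 → E))
  have hs : ∀ i, s (b i) = (![X q, lieBr W X q, lieBr (lieBr W X) X q] : Fin 3 → E) i := fun i =>
    b.constr_basis ℝ _ i
  have h1 : (dd E F π q).comp s = .id ℝ F := by
    apply ContinuousLinearMap.coe_injective
    refine b.ext fun i => ?_
    change dd E F π q (s (b i)) = b i
    rw [hs, hb]
    fin_cases i <;> rfl
  obtain ⟨σ, V, hV, hqV, hσq, hσ, hdσ⟩ := exists_localSection hπ.cm q s h1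
  have hU : ∀ᶠ m in 𝓝 (π q), σ m ∈ U :=
    (hσ _ hqV).1.continuousAt (hf.isOpen.mem_nhds (hσq.symm ▸ hq))
  obtain ⟨V', hV'U, hV', hqV'⟩ := eventually_nhds_iff.1 hU
  refine ⟨σ, V ∩ V', hV.inter hV', ⟨hqV, hqV'⟩, hσq, fun m hm => hσ m hm.1,
    fun m hm => hV'U m hm.2, ?_, ?_⟩
  · rw [hdσ]
    have := hs 0
    rw [hb] at this
    exact this
  · rw [hdσ]
    have := hs 1
    rw [hb] at this
    exact this

/-- The image of `D²` in the leaf space. -/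
theorem IsLeafQuotient.mem_push_iff [T2Space Q] [FiniteDimensional ℝ F] (hF : finrank ℝ F = 3)
    (hD : IsEngel D) (hπ : IsLeafQuotient F D π)
    {U : Set Q} {W X : VField E Q} (hf : EngelFrame D U W X) {q : Q} (hq : q ∈ U) (y : F) :
    (∃ w ∈ derived2 D q, dd E F π q w = y) ↔
      y ∈ Submodule.span ℝ {dd E F π q (X q), dd E F π q (lieBr W X q)} := by
  have hfin := hD.finiteDimensional
  rw [hf.derived2_eq hq, Submodule.mem_span_pair]
  constructor
  · rintro ⟨w, hw, rfl⟩
    obtain ⟨r, s, t, rfl⟩ := mem_span_three.1 hw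
    refine ⟨s, t, ?_⟩
    rw [dd_add, dd_add, dd_smul, dd_smul, dd_smul, hπ.dd_W hF hD hf hq, smul_zero, zero_add]
  · rintro ⟨s, t, rfl⟩
    refine ⟨s • X q + t • lieBr W X q, mem_span_three.2 ⟨0, s, t, by module⟩, ?_⟩
    rw [dd_add, dd_smul, dd_smul]

/-- Along a local section of `π` the projections of `X` and `[W,X]` form a smooth frame of the plane
field. Where the section is tangent to both fields, their bracket is minus the projection of
`[[W,X],X]`, which is transverse to the plane. -/
theorem IsLeafQuotient.exists_contact [T2Space Q] [FiniteDimensional ℝ F] (hF : finrank ℝ F = 3)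
    (hD : IsEngel D) (hπ : IsLeafQuotient F D π) :
    ∃ ξ : PlaneField F M, (∀ q, ξ.plane (π q) =
        (derived2 D q).map (mfderiv 𝓘(ℝ, E) 𝓘(ℝ, F) π q).toLinearMap) ∧ ξ.IsContact := by
  have hfin := hD.finiteDimensional
  have hcE : CompleteSpace E := FiniteDimensional.complete ℝ E
  have hcF : CompleteSpace F := FiniteDimensional.complete ℝ F
  -- An arbitrary choice of preimages, harmless since the image plane is the same at all points of a
  -- leaf.
  let s := Function.surjInv hπ.surjective
  have hs : ∀ m, π (s m) = m := Function.surjInv_eq hπ.surjective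
  let plane : Distr F M := fun m =>
    (Submodule.map (dd E F π (s m)).toLinearMap (derived2 D (s m) : Submodule ℝ E) : Submodule ℝ F)
  have hplane : ∀ q (y : F), y ∈ plane (π q) ↔ ∃ w ∈ derived2 D q, dd E F π q w = y := by
    intro q y
    constructor
    · rintro ⟨w, hw, rfl⟩
      exact hπ.exists_push_derived2 hF hD (hs (π q)) hw
    · rintro ⟨w, hw, rfl⟩
      exact hπ.exists_push_derived2 hF hD (hs (π q)).symm hw
  have hframe : ∀ q, ∃ (V : Set M) (X₀ X₁ : VField F M), IsOpen V ∧ π q ∈ V ∧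
      (∀ m ∈ V, SmAt X₀ m) ∧ (∀ m ∈ V, SmAt X₁ m) ∧
      (∀ m ∈ V, LinearIndependent ℝ ![X₀ m, X₁ m]) ∧
      (∀ m ∈ V, plane m = Submodule.span ℝ {X₀ m, X₁ m}) ∧
      LinearIndependent ℝ ![X₀ (π q), X₁ (π q), lieBr X₀ X₁ (π q)] := by
    intro q
    obtain ⟨U, W, X, hq, hf⟩ := exists_engelFrame hD q
    obtain ⟨σ, V, hV, hqV, hσq, hσ, hσU, hX, hZ⟩ := hπ.exists_section hF hD hf hq
    refine ⟨V, pushField F π σ X, pushField F π σ (lieBr W X), hV, hqV,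
      fun m hm => smAt_pushField hπ.cm hV hσ hm (hf.smX _ (hσU m hm)),
      fun m hm => smAt_pushField hπ.cm hV hσ hm (hf.smZ (hσU m hm)),
      fun m hm => li_two_of_three (hπ.li_push hF hD hf (hσU m hm)), fun m hm => ?_, ?_⟩
    · apply Submodule.ext
      intro y
      have h1 := hplane (σ m) y
      rw [(hσ m hm).2] at h1
      exact h1.trans (hπ.mem_push_iff hF hD hf (hσU m hm) y)
    -- The section is tangent to `X` and `[W,X]` at `π q` only, so the bracket is computed at that
    -- point only. This suffices because every point of `M` can serve as `π q`.
    · have h1 := lieBr_pushField hπ.cm hV hσ hqV (X := X) (Y := lieBr W X)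
        (hf.smX _ (hσU _ hqV)) (hf.smZ (hσU _ hqV)) (by rw [hσq]; exact hX)
        (by rw [hσq]; exact hZ)
      have h2 := hπ.li_push hF hD hf (hσU _ hqV)
      rw [h1, lieBr_swap, dd_neg]
      exact li_three_neg (V := F) h2
  refine ⟨⟨plane, fun m => ?_⟩, fun q => ?_, ⟨hF, fun m => ?_⟩⟩
  · obtain ⟨V, X₀, X₁, hV, hm, h0, h1, hli, hsp, -⟩ := hframe (s m)
    rw [hs] at hm
    have heq : ∀ m, (fun i => (![X₀, X₁] : Fin 2 → VField F M) i m) = ![X₀ m, X₁ m] := by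
      intro m; funext i; fin_cases i <;> rfl
    refine ⟨V, hV, hm, ![X₀, X₁], fun i => (isSection_iff hV).2 fun x hx => ?_, fun x hx => ?_⟩
    · rw [hsp x hx]
      fin_cases i
      · exact ⟨h0 x hx, Submodule.subset_span (mem_insert _ _)⟩
      · exact ⟨h1 x hx, Submodule.subset_span (mem_insert_of_mem _ rfl)⟩
    · rw [heq, range_pair_eq]
      exact ⟨hli x hx, hsp x hx⟩
  · apply Submodule.ext
    intro y
    exact hplane q y
  · obtain ⟨V, X₀, X₁, hV, hm, h0, h1, hli, hsp, h3⟩ := hframe (s m)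
    rw [hs] at hm h3
    refine (derived2_eq_of_frame hV h0 h1 hli hsp hm).trans ?_
    have hfinT : FiniteDimensional ℝ (TangentSpace 𝓘(ℝ, F) m) := ‹FiniteDimensional ℝ F›
    have h3F : finrank ℝ (TangentSpace 𝓘(ℝ, F) m) = 3 := hF
    rw [← range_triple_eq]
    exact h3.span_eq_top_of_card_eq_finrank' (by rw [h3F]; simp)

end LeafSpace

/-! ### Vector fields given by their components -/

section Coordinates

variable {E : Type*} [NormedAddCommGroup E] [NormedSpace ℝ E]
variable {Q : Type*} [TopologicalSpace Q] [ChartedSpace E Q] [IsManifold 𝓘(ℝ, E) ∞ Q]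
variable {G : Type*} [NormedAddCommGroup G] [NormedSpace ℝ G]

/-- The vector field with given smooth components in a local coordinate system is smooth. -/
theorem smAt_of_coords [CompleteSpace E] {f : Q → G} {N : Set Q} (hN : IsOpen N)
    (hf : ∀ x ∈ N, CM E G f x)
    (hinv : ∀ x ∈ N, (dd E G f x).IsInvertible) {g : Q → G} {q : Q} (hq : q ∈ N)
    (hg : CM E G g q) : SmAt (fun x => (dd E G f x).inverse (g x)) q := by
  refine (smAt_iff (X := fun x => ((dd E G f x).inverse (g x) : E)) (mem_chart_source E q)).2 ?_
  let c := extChartAt 𝓘(ℝ, E) q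
  let f' : E → G := fun y => f (c.symm y)
  have hcq : c.symm (c q) = q := extChartAt_to_inv (I := 𝓘(ℝ, E)) q
  have hf' : ContDiffAt ℝ ∞ f' (c q) := by
    refine (contMDiffAt_iff_contDiffAt (n := ∞)).1 (CM.comp (f := c.symm) (g := f) ?_
      (cm_extChartAt_symm (mem_extChartAt_target (I := 𝓘(ℝ, E)) q)))
    rw [hcq]; exact hf q hq
  have hD : CM E (E →L[ℝ] G) (fun x => fderiv ℝ f' (c x)) q :=
    CM.comp (f := c) (g := fderiv ℝ f') (hf'.fderiv_right (by simp)).contMDiffAt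
      (cm_extChartAt (mem_chart_source E q))
  have hrel : ∀ᶠ x in 𝓝 q, dd E G f x = (fderiv ℝ f' (c x)).comp (dd E E c x) := by
    have h1 : ∀ᶠ x in 𝓝 q, DifferentiableAt ℝ f' (c x) :=
      (cm_extChartAt (mem_chart_source E q)).continuousAt.eventually
        (((hf'.of_le (m := 1) (by exact_mod_cast le_top)).eventually (by simp)).mono fun y hy => hy.differentiableAt (by simp))
    filter_upwards [h1, (chartAt E q).open_source.eventually_mem (mem_chart_source E q)]
      with x hx hxs
    have h2 : f =ᶠ[𝓝 x] f' ∘ c := by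
      filter_upwards [(chartAt E q).open_source.eventually_mem hxs] with y hy
      change f y = f (c.symm (c y))
      rw [c.left_inv (by rw [extChartAt_source]; exact hy)]
    rw [dd_congr h2, dd_comp hx.mdifferentiableAt (cm_extChartAt hxs).mdiff, dd_eq_fderiv]
  have hq0 : fderiv ℝ f' (c q) = dd E G f q := by
    have h1 := hrel.self_of_nhds
    rw [dd_extChartAt_self] at h1
    exact h1.symm
  obtain ⟨e, he⟩ := hinv q hq
  have hin : CM E (G →L[ℝ] E) (fun x => (fderiv ℝ f' (c x)).inverse) q := by
    refine CM.comp (f := fun x => fderiv ℝ f' (c x)) (g := ContinuousLinearMap.inverse) ?_ hD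
    rw [hq0]
    exact ((hinv q hq).contDiffAt_map_inverse).contMDiffAt
  have hev : ∀ᶠ x in 𝓝 q, (fderiv ℝ f' (c x)).IsInvertible := by
    have h1 := ContinuousLinearEquiv.nhds e
    rw [he, ← hq0] at h1
    exact hD.continuousAt h1
  refine ContMDiffAt.congr_of_eventuallyEq (ContMDiffAt.clm_apply hin hg) ?_
  filter_upwards [hrel, hev, hN.mem_nhds hq] with x hx hxe hxN
  change dd E E c x ((dd E G f x).inverse (g x)) = (fderiv ℝ f' (c x)).inverse (g x)
  symm
  rw [hxe.inverse_apply_eq]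
  have h3 := (hinv x hxN).self_apply_inverse (g x)
  rw [hx] at h3 ⊢
  exact h3.symm

end Coordinates

/-! ### Frame charts and the Hausdorff property of the prolongation -/

namespace Prolong

variable {F : Type*} [NormedAddCommGroup F] [NormedSpace ℝ F]
variable {M : Type*} [TopologicalSpace M] [ChartedSpace F M] [IsManifold 𝓘(ℝ, F) ∞ M]
variable {ξ : PlaneField F M} {κ : DirKind}

/-- `e` is the frame chart given by the chart `c` of `M` and the frame `X₀, X₁` of `ξ` over `U`. -/
structure FrameChart (ξ : PlaneField F M) (κ : DirKind) (e : PartialEquiv (Prolong ξ κ) (F × ℝ))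
    (c : OpenPartialHomeomorph M F) (U : Set M) (X₀ X₁ : VField F M) : Prop where
  chart_mem : c ∈ atlas F M
  isOpen : IsOpen U
  sub : U ⊆ c.source
  sec₀ : IsSection ξ.plane U X₀
  sec₁ : IsSection ξ.plane U X₁
  li : ∀ m ∈ U, LinearIndependent ℝ ![X₀ m, X₁ m]
  source_eq : e.source = {p | p.base ∈ U ∧ ∃ w : ℝ, X₀ p.base + w • X₁ p.base ∈ p.dir}
  target_eq : e.target = {y | y.1 ∈ c.target ∧ c.symm y.1 ∈ U}
  apply_eq : ∀ p ∈ e.source, (e p).1 = c p.base ∧ X₀ p.base + (e p).2 • X₁ p.base ∈ p.dir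

theorem exists_frameChartData (p : Prolong ξ κ) :
    ∃ e c U X₀ X₁, FrameChart ξ κ e c U X₀ X₁ ∧ p ∈ e.source := by
  obtain ⟨e, ⟨c, hc, U, hU, hUc, X₀, X₁, h0, h1, hli, hs, ht, ha⟩, hp⟩ := exists_frameChart p
  exact ⟨e, c, U, X₀, X₁, ⟨hc, hU, hUc, h0, h1, hli, hs, ht, ha⟩, hp⟩

namespace FrameChart

variable {e : PartialEquiv (Prolong ξ κ) (F × ℝ)} {c : OpenPartialHomeomorph M F} {U : Set M}
  {X₀ X₁ : VField F M}

theorem isFrameChart (h : FrameChart ξ κ e c U X₀ X₁) : IsFrameChart ξ κ e :=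
  ⟨c, h.chart_mem, U, h.isOpen, h.sub, X₀, X₁, h.sec₀, h.sec₁, h.li, h.source_eq, h.target_eq,
    h.apply_eq⟩

theorem base_mem (h : FrameChart ξ κ e c U X₀ X₁) {p : Prolong ξ κ} (hp : p ∈ e.source) :
    p.base ∈ U := by
  rw [h.source_eq] at hp
  exact hp.1

theorem sm₀ (h : FrameChart ξ κ e c U X₀ X₁) {m : M} (hm : m ∈ U) : SmAt X₀ m :=
  ((isSection_iff h.isOpen).1 h.sec₀ m hm).1

theorem sm₁ (h : FrameChart ξ κ e c U X₀ X₁) {m : M} (hm : m ∈ U) : SmAt X₁ m :=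
  ((isSection_iff h.isOpen).1 h.sec₁ m hm).1

theorem cm_c (h : FrameChart ξ κ e c U X₀ X₁) {m : M} (hm : m ∈ c.source) : CM F F c m :=
  (contMDiffOn_of_mem_maximalAtlas (IsManifold.subset_maximalAtlas h.chart_mem)).contMDiffAt
    (c.open_source.mem_nhds hm)

theorem cm_c_symm (h : FrameChart ξ κ e c U X₀ X₁) {y : F} (hy : y ∈ c.target) :
    CM F F c.symm y :=
  (contMDiffOn_symm_of_mem_maximalAtlas (IsManifold.subset_maximalAtlas h.chart_mem)).contMDiffAt
    (c.open_target.mem_nhds hy)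

theorem dd_c_invertible (h : FrameChart ξ κ e c U X₀ X₁) {m : M} (hm : m ∈ c.source) :
    (dd F F c m).IsInvertible := by
  have h1 := h.cm_c_symm (c.map_source hm)
  refine ContinuousLinearMap.IsInvertible.of_inverse (g := dd F F c.symm (c m)) ?_ ?_
  · have h2 : CM F F c (c.symm (c m)) := by rw [c.left_inv hm]; exact h.cm_c hm
    have h3 := dd_comp_eq_id (g := c) (f := c.symm) (q := c m) h2.mdiff h1.mdiff
      ((c.open_target.eventually_mem (c.map_source hm)).mono fun y hy => c.right_inv hy)
    rw [c.left_inv hm] at h3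
    exact h3
  · exact dd_comp_eq_id (g := c.symm) (f := c) h1.mdiff (h.cm_c hm).mdiff
      ((c.open_source.eventually_mem hm).mono fun y hy => c.left_inv hy)

variable [FiniteDimensional ℝ F]

theorem mem_atlas (h : FrameChart ξ κ e c U X₀ X₁) :
    (core ξ κ).openPartialHomeomorph e h.isFrameChart ∈ atlas (F × ℝ) (Prolong ξ κ) :=
  mem_iUnion₂.2 ⟨e, h.isFrameChart, rfl⟩

theorem isOpen_source (h : FrameChart ξ κ e c U X₀ X₁) : IsOpen e.source :=
  ((core ξ κ).openPartialHomeomorph e h.isFrameChart).open_source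

theorem isOpen_target (h : FrameChart ξ κ e c U X₀ X₁) : IsOpen e.target :=
  ((core ξ κ).openPartialHomeomorph e h.isFrameChart).open_target

theorem cm_e (h : FrameChart ξ κ e c U X₀ X₁) {p : Prolong ξ κ} (hp : p ∈ e.source) :
    CM (F × ℝ) (F × ℝ) e p :=
  (contMDiffOn_of_mem_maximalAtlas (IsManifold.subset_maximalAtlas h.mem_atlas)).contMDiffAt
    (h.isOpen_source.mem_nhds hp)

theorem cm_e_symm (h : FrameChart ξ κ e c U X₀ X₁) {y : F × ℝ} (hy : y ∈ e.target) :
    CM (F × ℝ) (F × ℝ) e.symm y :=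
  (contMDiffOn_symm_of_mem_maximalAtlas (IsManifold.subset_maximalAtlas h.mem_atlas)).contMDiffAt
    (h.isOpen_target.mem_nhds hy)

theorem dd_e_invertible (h : FrameChart ξ κ e c U X₀ X₁) {p : Prolong ξ κ} (hp : p ∈ e.source) :
    (dd (F × ℝ) (F × ℝ) e p).IsInvertible := by
  have h1 := h.cm_e_symm (e.map_source hp)
  refine ContinuousLinearMap.IsInvertible.of_inverse (g := dd (F × ℝ) (F × ℝ) e.symm (e p)) ?_ ?_
  · have h2 : CM (F × ℝ) (F × ℝ) e (e.symm (e p)) := by rw [e.left_inv hp]; exact h.cm_e hp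
    have h3 := dd_comp_eq_id (g := e) (f := e.symm) (q := e p) h2.mdiff h1.mdiff
      ((h.isOpen_target.eventually_mem (e.map_source hp)).mono fun y hy => e.right_inv hy)
    rw [e.left_inv hp] at h3
    exact h3
  · exact dd_comp_eq_id (g := e.symm) (f := e) h1.mdiff (h.cm_e hp).mdiff
      ((h.isOpen_source.eventually_mem hp).mono fun y hy => e.left_inv hy)

theorem base_eq (h : FrameChart ξ κ e c U X₀ X₁) {p : Prolong ξ κ} (hp : p ∈ e.source) :
    p.base = c.symm (e p).1 := by
  rw [(h.apply_eq p hp).1, c.left_inv (h.sub (h.base_mem hp))]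

theorem cm_base (h : FrameChart ξ κ e c U X₀ X₁) {p : Prolong ξ κ} (hp : p ∈ e.source) :
    CM (F × ℝ) F (base : Prolong ξ κ → M) p := by
  have h1 : CM (F × ℝ) F (fun x : Prolong ξ κ => (e x).1) p :=
    CM.comp (f := e) (g := Prod.fst) contDiff_fst.contDiffAt.contMDiffAt (h.cm_e hp)
  have h2 : CM (F × ℝ) F (fun x : Prolong ξ κ => c.symm (e x).1) p := by
    refine CM.comp (f := fun x : Prolong ξ κ => (e x).1) (g := c.symm) (h.cm_c_symm ?_) h1
    rw [(h.apply_eq p hp).1]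
    exact c.map_source (h.sub (h.base_mem hp))
  exact h2.congr_of_eventuallyEq ((h.isOpen_source.eventually_mem hp).mono fun x hx => h.base_eq hx)

theorem cm_w (h : FrameChart ξ κ e c U X₀ X₁) {p : Prolong ξ κ} (hp : p ∈ e.source) :
    CM (F × ℝ) ℝ (fun x : Prolong ξ κ => (e x).2) p :=
  CM.comp (f := e) (g := Prod.snd) contDiff_snd.contDiffAt.contMDiffAt (h.cm_e hp)

/-- The differential of a frame chart. -/
theorem dd_e (h : FrameChart ξ κ e c U X₀ X₁) {p : Prolong ξ κ} (hp : p ∈ e.source)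
    (v : TangentSpace 𝓘(ℝ, F × ℝ) p) : dd (F × ℝ) (F × ℝ) e p v =
      (dd F F c p.base (dd (F × ℝ) F (base : Prolong ξ κ → M) p v),
        dd (F × ℝ) ℝ (fun x : Prolong ξ κ => (e x).2) p v) := by
  refine Prod.ext ?_ ?_
  · rw [← dd_comp_vec (f := (base : Prolong ξ κ → M)) (g := c) (h.cm_c (h.sub (h.base_mem hp))).mdiff
      (h.cm_base hp).mdiff]
    refine (dd_clm_comp_vec (.fst ℝ F ℝ) (h.cm_e hp).mdiff v).symm.trans ?_
    refine congrArg (fun L : F × ℝ →L[ℝ] F => L v) (dd_congr ?_)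
    exact (h.isOpen_source.eventually_mem hp).mono fun x hx => (h.apply_eq x hx).1
  · exact (dd_clm_comp_vec (.snd ℝ F ℝ) (h.cm_e hp).mdiff v).symm

/-- A frame chart consists of coordinates of the base point and the fiber coordinate `w`, so these
two differentials determine a tangent vector. -/
theorem eq_of_dd (h : FrameChart ξ κ e c U X₀ X₁) {p : Prolong ξ κ} (hp : p ∈ e.source)
    {v v' : TangentSpace 𝓘(ℝ, F × ℝ) p}
    (hb : dd (F × ℝ) F (base : Prolong ξ κ → M) p v = dd (F × ℝ) F (base : Prolong ξ κ → M) p v')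
    (hw : dd (F × ℝ) ℝ (fun x : Prolong ξ κ => (e x).2) p v =
      dd (F × ℝ) ℝ (fun x : Prolong ξ κ => (e x).2) p v') : v = v' := by
  apply (h.dd_e_invertible hp).injective
  rw [h.dd_e hp, h.dd_e hp, hb, hw]

end FrameChart

variable [FiniteDimensional ℝ F]

theorem cm_base (p : Prolong ξ κ) : CM (F × ℝ) F (base : Prolong ξ κ → M) p := by
  obtain ⟨e, c, U, X₀, X₁, h, hp⟩ := exists_frameChartData p
  exact h.cm_base hp

theorem continuous_base : Continuous (base : Prolong ξ κ → M) :=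
  continuous_iff_continuousAt.2 fun p => (cm_base p).continuousAt

/-- The admissible scalars are closed among the nonzero numbers; for rays this excludes that a limit
of a direction is the opposite direction. -/
theorem mem_closure_scalars {κ : DirKind} {a : ℝ} (ha : a ∈ closure κ.scalars) (h0 : a ≠ 0) :
    a ∈ κ.scalars := by
  cases κ
  · exact h0
  · have h1 : a ∈ Ici (0 : ℝ) := by rw [← closure_Ioi]; exact ha
    exact lt_of_le_of_ne h1 (Ne.symm h0)

/-- Two points without disjoint neighborhoods lie over the same base point, and a filter converges
to both. The spanning vector of the second chart, written in the frame of the first as `A X₀ + B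
X₁`, satisfies `B = w A` with `A` admissible along the filter; in the limit the two directions
agree. -/
theorem t2Space [T2Space M] : T2Space (Prolong ξ κ) := by
  rw [t2_iff_nhds]
  intro p p' hne
  let l := 𝓝 p ⊓ 𝓝 p'
  have hbase : p.base = p'.base := tendsto_nhds_unique (f := (base : Prolong ξ κ → M)) (l := l)
    (continuous_base.continuousAt.mono_left inf_le_left)
    (continuous_base.continuousAt.mono_left inf_le_right)
  obtain ⟨e, c, U, X₀, X₁, h, hp⟩ := exists_frameChartData p
  obtain ⟨e', c', U', Y₀, Y₁, h', hp'⟩ := exists_frameChartData p'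
  have hV : IsOpen (U ∩ U') := h.isOpen.inter h'.isOpen
  have res : ∀ {W : Set M} {S : VField F M}, IsSection ξ.plane W S → U ∩ U' ⊆ W →
      IsSection ξ.plane (U ∩ U') S := fun h hW => ⟨h.1.mono hW, fun m hm => h.2 m (hW hm)⟩
  obtain ⟨a₀, b₀, ha₀, hb₀, hY₀⟩ := exists_coeff_smooth ξ hV (res h.sec₀ inter_subset_left)
    (res h.sec₁ inter_subset_left) (res h'.sec₀ inter_subset_right) fun m hm => h.li m hm.1
  obtain ⟨a₁, b₁, ha₁, hb₁, hY₁⟩ := exists_coeff_smooth ξ hV (res h.sec₀ inter_subset_left)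
    (res h.sec₁ inter_subset_left) (res h'.sec₁ inter_subset_right) fun m hm => h.li m hm.1
  have hm : p'.base ∈ U ∩ U' := ⟨hbase ▸ h.base_mem hp, h'.base_mem hp'⟩
  let A : Prolong ξ κ → ℝ := fun q => a₀ q.base + (e' q).2 * a₁ q.base
  let B : Prolong ξ κ → ℝ := fun q => b₀ q.base + (e' q).2 * b₁ q.base
  have comb : ∀ q : Prolong ξ κ, q.base ∈ U ∩ U' →
      Y₀ q.base + (e' q).2 • Y₁ q.base = A q • X₀ q.base + B q • X₁ q.base := by
    intro q hq
    rw [hY₀ _ hq, hY₁ _ hq]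
    module
  have cont : ∀ {u v : M → ℝ}, ContMDiffOn 𝓘(ℝ, F) 𝓘(ℝ, ℝ) ∞ u (U ∩ U') →
      ContMDiffOn 𝓘(ℝ, F) 𝓘(ℝ, ℝ) ∞ v (U ∩ U') →
      ContinuousAt (fun q : Prolong ξ κ => u q.base + (e' q).2 * v q.base) p' := by
    intro u v hu hv
    have h1 := (hu.continuousOn.continuousAt (hV.mem_nhds hm)).comp
      (continuous_base (ξ := ξ) (κ := κ)).continuousAt
    have h2 := (hv.continuousOn.continuousAt (hV.mem_nhds hm)).comp
      (continuous_base (ξ := ξ) (κ := κ)).continuousAt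
    exact h1.add ((h'.cm_w hp').continuousAt.mul h2)
  have hA : Tendsto A l (𝓝 (A p')) := (cont ha₀ ha₁).mono_left inf_le_right
  have hB : Tendsto B l (𝓝 (B p')) := (cont hb₀ hb₁).mono_left inf_le_right
  have hw : Tendsto (fun q : Prolong ξ κ => (e q).2) l (𝓝 (e p).2) :=
    (h.cm_w hp).continuousAt.mono_left inf_le_left
  have hev : ∀ᶠ q in l, A q ∈ κ.scalars ∧ B q = (e q).2 * A q := by
    have h1 : ∀ᶠ q in l, q ∈ e.source := inf_le_left (a := 𝓝 p) (h.isOpen_source.mem_nhds hp)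
    have h2 : ∀ᶠ q in l, q ∈ e'.source := inf_le_right (b := 𝓝 p') (h'.isOpen_source.mem_nhds hp')
    filter_upwards [h1, h2] with q hq hq'
    have hqU : q.base ∈ U ∩ U' := ⟨h.base_mem hq, h'.base_mem hq'⟩
    have h3 := (h'.apply_eq q hq').2
    rw [comb q hqU, q.dir_eq (h.apply_eq q hq).2] at h3
    obtain ⟨s, hs, h4⟩ := h3
    have h5 := LinearIndependent.pair_iff.1 (h.li _ hqU.1) (A q - s) (B q - s * (e q).2) (by
      rw [sub_smul, sub_smul, mul_smul, ← sub_eq_zero.2 h4]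
      module)
    rw [sub_eq_zero.1 h5.1]
    exact ⟨hs, by rw [sub_eq_zero.1 h5.2, mul_comm]⟩
  -- The fiber coordinate of the first chart converges at `p`, while `A` and `B` converge at `p'`.
  have hBA : B p' = (e p).2 * A p' := tendsto_nhds_unique hB
    ((hw.mul hA).congr' (hev.mono fun q hq => hq.2.symm))
  have hcl : A p' ∈ closure κ.scalars := mem_closure_of_tendsto hA (hev.mono fun q hq => hq.1)
  have hp'd := (h'.apply_eq p' hp').2
  rw [comb p' hm, hBA] at hp'd
  -- The vector at `p'` is nonzero, so its two coefficients cannot both vanish; this is what makes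
  -- the limit scalar admissible.
  have hA0 : A p' ≠ 0 := by
    intro h0
    apply p'.ne_zero hp'd
    rw [h0, mul_zero, zero_smul, zero_smul, add_zero]
  have hAs := mem_closure_scalars hcl hA0
  have hpd := p.smul_mem_dir (h.apply_eq p hp).2 hAs
  have hpd' : A p' • X₀ p.base + ((e p).2 * A p') • X₁ p.base ∈ p.dir := by
    convert hpd using 1
    module
  generalize A p' = s at hp'd hpd'
  generalize (e p).2 * s = t at hp'd hpd'
  clear * - hp'd hpd' hbase
  rw [p.eq_ofVec hpd', p'.eq_ofVec hp'd]
  obtain ⟨m, d, hd⟩ := p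
  obtain ⟨m', d', hd'⟩ := p'
  subst hbase
  rfl

end Prolong

/-! ### Leibniz and sum rules for derivatives along fields -/

section ProductRule

variable {E : Type*} [NormedAddCommGroup E] [NormedSpace ℝ E]
variable {Q : Type*} [TopologicalSpace Q] [ChartedSpace E Q]
variable {G : Type*} [NormedAddCommGroup G] [NormedSpace ℝ G]

theorem dd_smul_fun {a : Q → ℝ} {u : Q → G} {q : Q} (ha : CM E ℝ a q) (hu : CM E G u q) (v : E) :
    dd E G (fun x => a x • u x) q v = a q • dd E G u q v + dd E ℝ a q v • u q := by
  let p : Q → ℝ × G := fun x => (a x, u x)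
  have hp : CM E (ℝ × G) p q := ha.prodMk_space hu
  have hg : HasFDerivAt (fun y : ℝ × G => y.1 • y.2)
      ((p q).1 • ContinuousLinearMap.snd ℝ ℝ G + (ContinuousLinearMap.fst ℝ ℝ G).smulRight (p q).2)
      (p q) := hasFDerivAt_fst.smul hasFDerivAt_snd
  have h1 : dd E G (fun x => a x • u x) q v = dd (ℝ × G) G (fun y : ℝ × G => y.1 • y.2) (p q)
      (dd E (ℝ × G) p q v) :=
    dd_comp_apply (f := p) (g := fun y : ℝ × G => y.1 • y.2)
      hg.differentiableAt.mdifferentiableAt hp.mdiff v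
  have h2 : (dd E (ℝ × G) p q v).1 = dd E ℝ a q v :=
    (dd_clm_comp (.fst ℝ ℝ G) hp.mdiff v).symm
  have h3 : (dd E (ℝ × G) p q v).2 = dd E G u q v :=
    (dd_clm_comp (.snd ℝ ℝ G) hp.mdiff v).symm
  rw [h1, dd_eq_fderiv, hg.fderiv]
  change a q • (dd E (ℝ × G) p q v).2 + (dd E (ℝ × G) p q v).1 • u q = _
  rw [h2, h3]

theorem dd_add_fun {f g : Q → G} {q : Q} (hf : CM E G f q) (hg : CM E G g q) (v : E) :
    dd E G (fun x => f x + g x) q v = dd E G f q v + dd E G g q v := by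
  have h1 : dd E G (fun x => f x + g x) q = dd E G f q + dd E G g q :=
    (hf.mdiff.hasMFDerivAt.add hg.mdiff.hasMFDerivAt).mfderiv
  rw [h1]
  rfl

theorem dv_congr {f g : Q → G} {X : VField E Q} {q : Q} (h : f =ᶠ[𝓝 q] g) :
    dv G f X q = dv G g X q := by
  change dd E G f q (X q) = dd E G g q (X q)
  rw [dd_congr h]

theorem dv_congr_of_isOpen {f g : Q → G} {U : Set Q} (hU : IsOpen U) (X : VField E Q) {q : Q}
    (hq : q ∈ U) (h : ∀ x ∈ U, f x = g x) : dv G f X q = dv G g X q :=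
  dv_congr ((hU.eventually_mem hq).mono h)

theorem dv_const (c : G) (X : VField E Q) (q : Q) : dv G (fun _ => c) X q = 0 := by
  change dd E G (fun _ : Q => c) q (X q) = 0
  rw [dd_const]
  rfl

end ProductRule

/-! ### The Engel structure of the prolongation -/

namespace Prolong

variable {F : Type*} [NormedAddCommGroup F] [NormedSpace ℝ F] [FiniteDimensional ℝ F]
variable {M : Type*} [TopologicalSpace M] [ChartedSpace F M] [IsManifold 𝓘(ℝ, F) ∞ M]
variable {ξ : PlaneField F M} {κ : DirKind}

namespace FrameChart

variable {e : PartialEquiv (Prolong ξ κ) (F × ℝ)} {c : OpenPartialHomeomorph M F} {U : Set M}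
  {X₀ X₁ : VField F M}

/-- The contact condition says that the frame of `ξ` and its bracket span the tangent space; three
spanning vectors in dimension three are independent. -/
theorem li_contact (h : FrameChart ξ κ e c U X₀ X₁) (hc : ξ.IsContact) {m : M} (hm : m ∈ U) :
    LinearIndependent ℝ ![X₀ m, X₁ m, lieBr X₁ X₀ m] := by
  have h1 := derived2_eq_of_frame (D := ξ.plane) h.isOpen (fun m hm => h.sm₀ hm)
    (fun m hm => h.sm₁ hm) h.li (fun m hm => ?_) hm
  · rw [hc.top, ← range_triple_eq] at h1
    have h2 : LinearIndependent ℝ ![X₀ m, X₁ m, lieBr X₀ X₁ m] := by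
      refine linearIndependent_of_top_le_span_of_card_eq_finrank h1.le ?_
      have h3F : finrank ℝ (TangentSpace 𝓘(ℝ, F) m) = 3 := hc.dim
      rw [h3F, Fintype.card_fin]
    have h3 := li_three_neg h2
    rw [← lieBr_swap] at h3
    exact h3
  · apply le_antisymm
    · intro v hv
      obtain ⟨a, b, rfl⟩ := exists_coeff ξ (h.sec₀.2 m hm) (h.sec₁.2 m hm) hv (h.li m hm)
      exact Submodule.mem_span_pair.2 ⟨a, b, rfl⟩
    · refine Submodule.span_le.2 ?_
      rintro v (rfl | rfl)
      · exact h.sec₀.2 m hm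
      · exact h.sec₁.2 m hm

theorem dd_c_injective (h : FrameChart ξ κ e c U X₀ X₁) {m : M} (hm : m ∈ U) {v w : F}
    (heq : dd F F c m v = dd F F c m w) : v = w :=
  (h.dd_c_invertible (h.sub hm)).injective heq

/-- The canonical Engel frame of the prolongation over a frame chart: the first field rotates the
direction, and the second one is a horizontal lift of the direction. -/
theorem exists_engelFrame (h : FrameChart ξ κ e c U X₀ X₁) (hc : ξ.IsContact) :
    ∃ W X : VField (F × ℝ) (Prolong ξ κ), EngelFrame (canonical ξ κ) e.source W X ∧
      ∀ p ∈ e.source, dd (F × ℝ) F (base : Prolong ξ κ → M) p (W p) = 0 ∧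
        dd (F × ℝ) ℝ (fun x : Prolong ξ κ => (e x).2) p (W p) = 1 ∧
        dd (F × ℝ) F (base : Prolong ξ κ → M) p (X p) = X₀ p.base + (e p).2 • X₁ p.base ∧
        dd (F × ℝ) F (base : Prolong ξ κ → M) p (lieBr W X p) = X₁ p.base ∧
        dd (F × ℝ) F (base : Prolong ξ κ → M) p (lieBr (lieBr W X) X p) =
          lieBr X₁ X₀ p.base := by
  have hcF : CompleteSpace F := FiniteDimensional.complete ℝ F
  let a₀ : M → F := dv F c X₀
  let a₁ : M → F := dv F c X₁
  let w : Prolong ξ κ → ℝ := fun x => (e x).2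
  let A : Prolong ξ κ → F := fun x => a₀ x.base + w x • a₁ x.base
  let f₁ : Prolong ξ κ → F := fun x => c x.base
  -- The coordinate field of the fiber coordinate.
  let W : VField (F × ℝ) (Prolong ξ κ) := fun x =>
    ((dd (F × ℝ) (F × ℝ) e x).inverse (0, 1) : F × ℝ)
  -- The lift of `X₀ + w X₁` with zero fiber component.
  let X : VField (F × ℝ) (Prolong ξ κ) := fun x =>
    ((dd (F × ℝ) (F × ℝ) e x).inverse (A x, 0) : F × ℝ)
  have hcb : ∀ p ∈ e.source, CM F F c p.base := fun p hp => h.cm_c (h.sub (h.base_mem hp))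
  have hf₁ : ∀ p ∈ e.source, CM (F × ℝ) F f₁ p := fun p hp =>
    CM.comp (f := (base : Prolong ξ κ → M)) (g := c) (hcb p hp) (Prolong.cm_base p)
  have hw : ∀ p ∈ e.source, CM (F × ℝ) ℝ w p := fun p hp => h.cm_w hp
  have ha₀ : ∀ p ∈ e.source, CM F F a₀ p.base := fun p hp => cm_dv (hcb p hp) (h.sm₀ (h.base_mem hp))
  have ha₁ : ∀ p ∈ e.source, CM F F a₁ p.base := fun p hp => cm_dv (hcb p hp) (h.sm₁ (h.base_mem hp))
  have ha₀b : ∀ p ∈ e.source, CM (F × ℝ) F (fun x : Prolong ξ κ => a₀ x.base) p := fun p hp =>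
    CM.comp (f := (base : Prolong ξ κ → M)) (ha₀ p hp) (Prolong.cm_base p)
  have ha₁b : ∀ p ∈ e.source, CM (F × ℝ) F (fun x : Prolong ξ κ => a₁ x.base) p := fun p hp =>
    CM.comp (f := (base : Prolong ξ κ → M)) (ha₁ p hp) (Prolong.cm_base p)
  have hwa : ∀ p ∈ e.source, CM (F × ℝ) F (fun x : Prolong ξ κ => w x • a₁ x.base) p := fun p hp =>
    (hw p hp).smul (ha₁b p hp)
  have hA : ∀ p ∈ e.source, CM (F × ℝ) F A p := fun p hp => (ha₀b p hp).add (hwa p hp)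
  have hW : ∀ p ∈ e.source, SmAt W p := fun p hp => smAt_of_coords h.isOpen_source
    (fun x hx => h.cm_e hx) (fun x hx => h.dd_e_invertible hx) hp contMDiffAt_const
  have hX : ∀ p ∈ e.source, SmAt X p := fun p hp => smAt_of_coords h.isOpen_source
    (fun x hx => h.cm_e hx) (fun x hx => h.dd_e_invertible hx) hp
    ((hA p hp).prodMk_space contMDiffAt_const)
  have hdf₁ : ∀ p ∈ e.source, ∀ v : TangentSpace 𝓘(ℝ, F × ℝ) p, dd (F × ℝ) F f₁ p v =
      dd F F c p.base (dd (F × ℝ) F (base : Prolong ξ κ → M) p v) := fun p hp v =>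
    dd_comp_vec (f := (base : Prolong ξ κ → M)) (g := c) (hcb p hp).mdiff (Prolong.cm_base p).mdiff v
  have hWc : ∀ p ∈ e.source, dv F f₁ W p = 0 ∧ dv ℝ w W p = 1 := by
    intro p hp
    have h1 : dd (F × ℝ) (F × ℝ) e p (W p) = (0, 1) := (h.dd_e_invertible hp).self_apply_inverse _
    rw [h.dd_e hp, ← hdf₁ p hp] at h1
    exact ⟨congrArg Prod.fst h1, congrArg Prod.snd h1⟩
  have hXc : ∀ p ∈ e.source, dv F f₁ X p = A p ∧ dv ℝ w X p = 0 := by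
    intro p hp
    have h1 : dd (F × ℝ) (F × ℝ) e p (X p) = (A p, 0) :=
      (h.dd_e_invertible hp).self_apply_inverse _
    rw [h.dd_e hp, ← hdf₁ p hp] at h1
    exact ⟨congrArg Prod.fst h1, congrArg Prod.snd h1⟩
  have hdA : ∀ p ∈ e.source, ∀ v : TangentSpace 𝓘(ℝ, F × ℝ) p, dd (F × ℝ) F A p v =
      dd F F a₀ p.base (dd (F × ℝ) F (base : Prolong ξ κ → M) p v) +
      (w p • dd F F a₁ p.base (dd (F × ℝ) F (base : Prolong ξ κ → M) p v) +
        dd (F × ℝ) ℝ w p v • a₁ p.base) := by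
    intro p hp v
    refine (dd_add_fun (ha₀b p hp) (hwa p hp) v).trans ?_
    rw [dd_comp_vec (f := (base : Prolong ξ κ → M)) (g := a₀) (ha₀ p hp).mdiff (Prolong.cm_base p).mdiff]
    refine congrArg _ ((dd_smul_fun (hw p hp) (ha₁b p hp) v).trans ?_)
    rw [dd_comp_vec (f := (base : Prolong ξ κ → M)) (g := a₁) (ha₁ p hp).mdiff (Prolong.cm_base p).mdiff]
  have hWb : ∀ p ∈ e.source, dd (F × ℝ) F (base : Prolong ξ κ → M) p (W p) = 0 := fun p hp =>
    h.dd_c_injective (h.base_mem hp) (by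
      rw [← hdf₁ p hp, map_zero]
      exact (hWc p hp).1)
  have hXb : ∀ p ∈ e.source, dd (F × ℝ) F (base : Prolong ξ κ → M) p (X p) =
      X₀ p.base + (e p).2 • X₁ p.base := fun p hp =>
    h.dd_c_injective (h.base_mem hp) (by
      rw [← hdf₁ p hp]
      refine (hXc p hp).1.trans ?_
      exact ((dd_add c p.base _ _).trans (congrArg _ (dd_smul c p.base _ _))).symm)
  -- Since `W` only differentiates the factor `w`, the bracket `[W,X]` is the lift of `X₁` with zero
  -- fiber component.
  have hZ : ∀ p ∈ e.source, SmAt (lieBr W X) p := fun p hp => (hW p hp).lieBr (hX p hp)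
  have hZc : ∀ p ∈ e.source, dv F f₁ (lieBr W X) p = a₁ p.base ∧ dv ℝ w (lieBr W X) p = 0 := by
    intro p hp
    rw [dv_lieBr (hf₁ p hp) (hW p hp) (hX p hp), dv_lieBr (hw p hp) (hW p hp) (hX p hp),
      dv_congr_of_isOpen h.isOpen_source (g := A) W hp (fun x hx => (hXc x hx).1),
      dv_congr_of_isOpen h.isOpen_source (g := fun _ => (0 : F)) X hp (fun x hx => (hWc x hx).1),
      dv_congr_of_isOpen h.isOpen_source (g := fun _ => (0 : ℝ)) W hp (fun x hx => (hXc x hx).2),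
      dv_congr_of_isOpen h.isOpen_source (g := fun _ => (1 : ℝ)) X hp (fun x hx => (hWc x hx).2),
      dv_const, dv_const, dv_const, sub_zero, sub_zero]
    refine ⟨(hdA p hp (W p)).trans ?_, rfl⟩
    rw [hWb p hp, map_zero, map_zero, smul_zero, zero_add, zero_add]
    have : dd (F × ℝ) ℝ w p (W p) = 1 := (hWc p hp).2
    rw [this, one_smul]
  have hZb : ∀ p ∈ e.source, dd (F × ℝ) F (base : Prolong ξ κ → M) p (lieBr W X p) = X₁ p.base :=
    fun p hp => h.dd_c_injective (h.base_mem hp) (by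
      rw [← hdf₁ p hp]
      exact (hZc p hp).1)
  -- The components of `[W,X]` do not depend on `w`, so its bracket with `W` vanishes; this is the
  -- characteristic property of `W`.
  have hWZ : ∀ p ∈ e.source, lieBr W (lieBr W X) p = 0 := by
    intro p hp
    refine h.eq_of_dd hp ?_ ?_
    · apply h.dd_c_injective (h.base_mem hp)
      rw [← hdf₁ p hp, ← hdf₁ p hp]
      refine (dv_lieBr (hf₁ p hp) (hW p hp) (hZ p hp)).trans ?_
      rw [dv_congr_of_isOpen h.isOpen_source (g := fun x => a₁ x.base) W hp (fun x hx => (hZc x hx).1),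
        dv_congr_of_isOpen h.isOpen_source (g := fun _ => (0 : F)) _ hp (fun x hx => (hWc x hx).1), dv_const, sub_zero]
      change dd (F × ℝ) F (fun x : Prolong ξ κ => a₁ x.base) p (W p) = _
      rw [dd_comp_vec (f := (base : Prolong ξ κ → M)) (g := a₁) (ha₁ p hp).mdiff (Prolong.cm_base p).mdiff,
        hWb p hp, map_zero]
      exact (map_zero _).symm
    · refine (dv_lieBr (hw p hp) (hW p hp) (hZ p hp)).trans ?_
      rw [dv_congr_of_isOpen h.isOpen_source (g := fun _ => (0 : ℝ)) W hp (fun x hx => (hZc x hx).2),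
        dv_congr_of_isOpen h.isOpen_source (g := fun _ => (1 : ℝ)) _ hp (fun x hx => (hWc x hx).2), dv_const, dv_const, sub_zero]
      exact (map_zero _).symm
  have hVc : ∀ p ∈ e.source, dd (F × ℝ) F (base : Prolong ξ κ → M) p (lieBr (lieBr W X) X p) =
      lieBr X₁ X₀ p.base ∧ dv ℝ w (lieBr (lieBr W X) X) p = 0 := by
    intro p hp
    constructor
    · apply h.dd_c_injective (h.base_mem hp)
      rw [← hdf₁ p hp]
      refine (dv_lieBr (hf₁ p hp) (hZ p hp) (hX p hp)).trans ?_
      rw [dv_congr_of_isOpen h.isOpen_source (g := A) _ hp (fun x hx => (hXc x hx).1),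
        dv_congr_of_isOpen h.isOpen_source (g := fun x => a₁ x.base) X hp (fun x hx => (hZc x hx).1)]
      refine Eq.trans (congrArg₂ _ (hdA p hp (lieBr W X p)) (dd_comp_vec
        (f := (base : Prolong ξ κ → M)) (g := a₁) (ha₁ p hp).mdiff (Prolong.cm_base p).mdiff (X p))) ?_
      have h1 : dd (F × ℝ) ℝ w p (lieBr W X p) = 0 := (hZc p hp).2
      rw [hZb p hp, hXb p hp, h1, zero_smul, add_zero]
      -- The projection of `[[W,X],X]` is the bracket of `X₁` with `X₀ + w X₁` for fixed `w`,
      -- because `[W,X]` and `X` have no fiber component. The two terms in `w` cancel.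
      have h2 := dv_lieBr (hcb p hp) (h.sm₁ (h.base_mem hp)) (h.sm₀ (h.base_mem hp))
      refine Eq.trans ?_ h2.symm
      have h3 : dd F F a₁ p.base (X₀ p.base + (e p).2 • X₁ p.base) =
          dd F F a₁ p.base (X₀ p.base) + (e p).2 • dd F F a₁ p.base (X₁ p.base) :=
        (dd_add a₁ p.base _ _).trans (congrArg _ (dd_smul a₁ p.base _ _))
      rw [h3]
      change dd F F a₀ p.base (X₁ p.base) + w p • dd F F a₁ p.base (X₁ p.base) -
        (dd F F a₁ p.base (X₀ p.base) + w p • dd F F a₁ p.base (X₁ p.base)) =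
        dd F F a₀ p.base (X₁ p.base) - dd F F a₁ p.base (X₀ p.base)
      abel
    · rw [dv_lieBr (hw p hp) (hZ p hp) (hX p hp),
        dv_congr_of_isOpen h.isOpen_source (g := fun _ => (0 : ℝ)) _ hp (fun x hx => (hXc x hx).2),
        dv_congr_of_isOpen h.isOpen_source (g := fun _ => (0 : ℝ)) X hp (fun x hx => (hZc x hx).2), dv_const, dv_const, sub_zero]
  refine ⟨W, X, ⟨h.isOpen_source, hW, hX, fun p hp => ?_, fun p hp => ?_, fun p hp => ?_⟩,
    fun p hp => ⟨hWb p hp, (hWc p hp).2, hXb p hp, hZb p hp, (hVc p hp).1⟩⟩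
  · ext v
    rw [Submodule.mem_span_pair]
    have hdir : ∀ y : TangentSpace 𝓘(ℝ, F) p.base, y ∈ Submodule.span ℝ p.dir ↔ ∃ t : ℝ,
        y = t • (X₀ p.base + (e p).2 • X₁ p.base) := by
      intro y
      have hd := (h.apply_eq p hp).2
      constructor
      · intro hy
        have hle : Submodule.span ℝ p.dir ≤
            Submodule.span ℝ {X₀ p.base + (e p).2 • X₁ p.base} := by
          refine Submodule.span_le.2 fun u hu => ?_
          rw [p.dir_eq hd] at hu
          obtain ⟨s, -, rfl⟩ := hu
          exact Submodule.smul_mem _ _ (Submodule.mem_span_singleton_self _)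
        obtain ⟨t, ht⟩ := (Submodule.mem_span_singleton (R := ℝ)
          (M := TangentSpace 𝓘(ℝ, F) p.base)).1 (hle hy)
        exact ⟨t, ht.symm⟩
      · rintro ⟨t, rfl⟩
        exact Submodule.smul_mem _ _ (Submodule.subset_span hd)
    refine (hdir (dd (F × ℝ) F (base : Prolong ξ κ → M) p v)).trans ?_
    constructor
    · rintro ⟨t, ht⟩
      refine ⟨dd (F × ℝ) ℝ w p v, t, (h.eq_of_dd hp ?_ ?_).symm⟩
      · rw [ht, dd_add, dd_smul, dd_smul, hWb p hp, hXb p hp, smul_zero, zero_add]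
        rfl
      · rw [dd_add, dd_smul, dd_smul]
        have h1 : dd (F × ℝ) ℝ w p (W p) = 1 := (hWc p hp).2
        have h2 : dd (F × ℝ) ℝ w p (X p) = 0 := (hXc p hp).2
        change dd (F × ℝ) ℝ w p v = dd (F × ℝ) ℝ w p v • dd (F × ℝ) ℝ w p (W p) +
          t • dd (F × ℝ) ℝ w p (X p)
        rw [h1, h2]
        simp
    · rintro ⟨s, t, rfl⟩
      refine ⟨t, ?_⟩
      rw [dd_add, dd_smul, dd_smul, hWb p hp, hXb p hp, smul_zero, zero_add]
      rfl
  · rw [li_four_iff]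
    intro r s t u hrel
    have h1 : dd (F × ℝ) F (base : Prolong ξ κ → M) p
        (r • W p + s • X p + t • lieBr W X p + u • lieBr (lieBr W X) X p) = 0 := by
      rw [hrel]; exact map_zero _
    rw [dd_add, dd_add, dd_add, dd_smul, dd_smul, dd_smul, dd_smul, hWb p hp, hXb p hp, hZb p hp,
      (hVc p hp).1] at h1
    have key : ∀ x y z : F, r • (0 : F) + s • (x + (e p).2 • y) + t • y + u • z =
        s • x + (s * (e p).2 + t) • y + u • z := by
      intro x y z
      module
    have h2 := li_three_iff.1 (h.li_contact hc (h.base_mem hp)) s (s * (e p).2 + t) u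
      ((key _ _ _).symm.trans h1)
    obtain ⟨rfl, h3, rfl⟩ := h2
    have ht : t = 0 := by simpa using h3
    subst ht
    have h4 : r • W p = 0 := by
      rw [← hrel]
      module
    refine ⟨(smul_eq_zero.1 h4).resolve_right fun h0 => ?_, rfl, rfl, rfl⟩
    have h5 : dd (F × ℝ) ℝ w p (W p) = 1 := (hWc p hp).2
    rw [h0] at h5
    exact zero_ne_one ((map_zero (dd (F × ℝ) ℝ w p)).symm.trans h5)
  · rw [hWZ p hp]
    exact Submodule.zero_mem _

theorem mem_source_of_mem_dir (h : FrameChart ξ κ e c U X₀ X₁) {p : Prolong ξ κ} (hp : p.base ∈ U)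
    {s t : ℝ} (hs : s ∈ κ.scalars) (hd : s • X₀ p.base + t • X₁ p.base ∈ p.dir) :
    p ∈ e.source := by
  rw [h.source_eq]
  refine ⟨hp, s⁻¹ * t, ?_⟩
  have := p.smul_mem_dir hd (κ.inv_mem hs)
  rwa [smul_add, smul_smul, smul_smul, inv_mul_cancel₀ (κ.ne_zero hs), one_smul] at this

theorem coeff_of_mem_dir (h : FrameChart ξ κ e c U X₀ X₁) {p : Prolong ξ κ} (hp : p ∈ e.source)
    {s t : ℝ} (hd : s • X₀ p.base + t • X₁ p.base ∈ p.dir) :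
    s ∈ κ.scalars ∧ t = s * (e p).2 := by
  rw [p.dir_eq (h.apply_eq p hp).2] at hd
  obtain ⟨r, hr, h4⟩ := hd
  have h5 := LinearIndependent.pair_iff.1 (h.li _ (h.base_mem hp)) (s - r) (t - r * (e p).2) (by
    rw [sub_smul, sub_smul, mul_smul, ← sub_eq_zero.2 h4]
    module)
  rw [sub_eq_zero.1 h5.1]
  exact ⟨hr, sub_eq_zero.1 h5.2⟩

/-- A map to the prolongation is smooth if its base point is, and if its direction is spanned by a
smooth vector field along the map. -/
theorem cm_of_dir {E : Type*} [NormedAddCommGroup E] [NormedSpace ℝ E]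
    {Q : Type*} [TopologicalSpace Q] [ChartedSpace E Q] [IsManifold 𝓘(ℝ, E) ∞ Q]
    (h : FrameChart ξ κ e c U X₀ X₁) {f : Q → Prolong ξ κ} {q : Q} (hq : f q ∈ e.source)
    (hb : CM E F (fun x => (f x).base) q) {u : ∀ x, TangentSpace 𝓘(ℝ, F) (f x).base}
    (hu : ∀ᶠ x in 𝓝 q, u x ∈ (f x).dir)
    (hus : CM E F (fun x => dd F F c (f x).base (u x)) q) :
    CM E (F × ℝ) f q ∧ ∃ a : Q → ℝ, CM E ℝ a q ∧ ∀ᶠ x in 𝓝 q, f x ∈ e.source ∧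
      a x ∈ κ.scalars ∧ u x = a x • (X₀ (f x).base + (e (f x)).2 • X₁ (f x).base) := by
  have hU : ∀ᶠ x in 𝓝 q, (f x).base ∈ U := hb.continuousAt (h.isOpen.mem_nhds (h.base_mem hq))
  have h1 : ∀ x, ∃ ab : Fin 2 → ℝ, (f x).base ∈ U → u x ∈ (f x).dir →
      u x = ab 0 • X₀ (f x).base + ab 1 • X₁ (f x).base := by
    intro x
    by_cases hx : (f x).base ∈ U ∧ u x ∈ (f x).dir
    · obtain ⟨a, b, hab⟩ := exists_coeff ξ (h.sec₀.2 _ hx.1) (h.sec₁.2 _ hx.1)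
        ((f x).mem_plane hx.2) (h.li _ hx.1)
      exact ⟨![a, b], fun _ _ => hab⟩
    · exact ⟨0, fun h1 h2 => absurd ⟨h1, h2⟩ hx⟩
  choose ab hab using h1
  have hcb : CM F F c (f q).base := h.cm_c (h.sub (h.base_mem hq))
  have hco : ∀ i, CM E ℝ (fun x => ab x i) q := by
    refine cm_coeff (ι := Fin 2) (u := ![fun x => dv F c X₀ (f x).base, fun x => dv F c X₁ (f x).base])
      (c := fun i x => ab x i) ?_ hus ?_ ?_
    · intro i
      fin_cases i
      · exact CM.comp (f := fun x => (f x).base) (g := dv F c X₀)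
          (cm_dv hcb (h.sm₀ (h.base_mem hq))) hb
      · exact CM.comp (f := fun x => (f x).base) (g := dv F c X₁)
          (cm_dv hcb (h.sm₁ (h.base_mem hq))) hb
    · have h2 := (LinearIndependent.pair_iff (R := ℝ)).1 (h.li _ (h.base_mem hq))
      have heq : (fun i => (![fun x => dv F c X₀ (f x).base, fun x => dv F c X₁ (f x).base] :
          Fin 2 → Q → F) i q) = ![dv F c X₀ (f q).base, dv F c X₁ (f q).base] := by
        funext i; fin_cases i <;> rfl
      rw [heq, LinearIndependent.pair_iff]
      intro s t hst
      refine h2 s t (h.dd_c_injective (h.base_mem hq) ?_)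
      refine ((dd_add c _ _ _).trans (congrArg₂ _ (dd_smul c _ _ _) (dd_smul c _ _ _))).trans ?_
      exact hst.trans (map_zero _).symm
    · filter_upwards [hU, hu] with x hx hux
      rw [hab x hx hux, Fin.sum_univ_two]
      exact (dd_add c _ _ _).trans (congrArg₂ _ (dd_smul c _ _ _) (dd_smul c _ _ _))
  -- At `q` the first coefficient is an admissible scalar; this is an open condition, so `f` stays
  -- in the domain of the chart.
  have hq0 := h.coeff_of_mem_dir hq (hab q (h.base_mem hq) hu.self_of_nhds ▸ hu.self_of_nhds)
  have hsc : ∀ᶠ x in 𝓝 q, ab x 0 ∈ κ.scalars :=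
    (hco 0).continuousAt (κ.isOpen_scalars.mem_nhds hq0.1)
  have hev : ∀ᶠ x in 𝓝 q, f x ∈ e.source ∧ ab x 0 ∈ κ.scalars ∧ ab x 1 = ab x 0 * (e (f x)).2 ∧
      u x = ab x 0 • X₀ (f x).base + ab x 1 • X₁ (f x).base := by
    filter_upwards [hU, hu, hsc] with x hx hux hs
    have hd : ab x 0 • X₀ (f x).base + ab x 1 • X₁ (f x).base ∈ (f x).dir :=
      hab x hx hux ▸ hux
    have hsrc := h.mem_source_of_mem_dir hx hs hd
    exact ⟨hsrc, hs, (h.coeff_of_mem_dir hsrc hd).2, hab x hx hux⟩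
  refine ⟨?_, fun x => ab x 0, hco 0, hev.mono fun x hx => ⟨hx.1, hx.2.1, ?_⟩⟩
  -- The fiber coordinate of `f x` is the quotient of the two smooth coefficients.
  · have h2 : CM E (F × ℝ) (fun x => (c (f x).base, ab x 1 / ab x 0)) q :=
      (CM.comp (f := fun x => (f x).base) (g := c) hcb hb).prodMk_space
        ((hco 1).div₀ (hco 0) (κ.ne_zero hq0.1))
    have h3 : ∀ x, f x ∈ e.source → ab x 0 ∈ κ.scalars → ab x 1 = ab x 0 * (e (f x)).2 →
        (c (f x).base, ab x 1 / ab x 0) = e (f x) := by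
      intro x hx hs h1
      refine Prod.ext (h.apply_eq _ hx).1.symm ?_
      change ab x 1 / ab x 0 = _
      rw [h1, mul_div_cancel_left₀ _ (κ.ne_zero hs)]
    have h4 := hev.self_of_nhds
    have h5 : CM E (F × ℝ) (fun x => e.symm (c (f x).base, ab x 1 / ab x 0)) q := by
      refine CM.comp (f := fun x => (c (f x).base, ab x 1 / ab x 0)) (g := e.symm)
        (h.cm_e_symm ?_) h2
      rw [h3 q h4.1 h4.2.1 h4.2.2.1]
      exact e.map_source hq
    refine h5.congr_of_eventuallyEq (hev.mono fun x hx => ?_)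
    change f x = e.symm (c (f x).base, ab x 1 / ab x 0)
    rw [h3 x hx.1 hx.2.1 hx.2.2.1, e.left_inv hx.1]
  · rw [hx.2.2.2, hx.2.2.1]
    module

end FrameChart

theorem isEngel_canonical (hc : ξ.IsContact) : IsEngel (canonical ξ κ) := by
  refine isEngel_of_frames ?_ fun p => ?_
  · rw [Module.finrank_prod, hc.dim, Module.finrank_self]
  · obtain ⟨e, c, U, X₀, X₁, h, hp⟩ := exists_frameChartData p
    obtain ⟨W, X, hf, -⟩ := h.exists_engelFrame hc
    exact ⟨e.source, W, X, hp, hf⟩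

end Prolong

/-- Continuity, local injectivity and openness all pass to the restriction over a subset of the
target; this transfers the property from a development to a single leaf. -/
theorem IsLocalHomeomorph.restrict_preimage {X Y : Type*} [TopologicalSpace X] [TopologicalSpace Y]
    {f : X → Y} (hf : IsLocalHomeomorph f) (S : Set Y) : IsLocalHomeomorph (S.restrictPreimage f) := by
  rw [isLocalHomeomorph_iff_isOpenEmbedding_restrict]
  intro x
  obtain ⟨U, hU, hxU, hinj⟩ := hf.isLocallyInjective x
  refine ⟨Subtype.val ⁻¹' U, (hU.preimage continuous_subtype_val).mem_nhds hxU,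
    IsOpenEmbedding.of_continuous_injective_isOpenMap
      ((hf.continuous.restrictPreimage).comp continuous_subtype_val) ?_
      ((hf.isOpenMap.restrictPreimage S).comp
        (hU.preimage continuous_subtype_val).isOpenEmbedding_subtypeVal.isOpenMap)⟩
  rintro ⟨⟨a, ha⟩, haU⟩ ⟨⟨b, hb⟩, hbU⟩ hab
  have h1 : a = b := hinj haU hbU (congrArg Subtype.val hab)
  subst h1
  rfl

/-! ### Rotation curves and connectedness of the projective fibers -/

namespace Prolong

variable {F : Type*} [NormedAddCommGroup F] [NormedSpace ℝ F] [FiniteDimensional ℝ F]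
variable {M : Type*} [TopologicalSpace M] [ChartedSpace F M] [IsManifold 𝓘(ℝ, F) ∞ M]
variable {ξ : PlaneField F M} {κ : DirKind}

theorem cm_rotation (m : M) {u v : TangentSpace 𝓘(ℝ, F) m}
    (hu : u ∈ ξ.plane m) (hv : v ∈ ξ.plane m) (h : LinearIndependent ℝ ![u, v]) (t : ℝ) :
    CM ℝ (F × ℝ) (rotation ξ κ m u v hu hv h) t := by
  obtain ⟨e, c, U, X₀, X₁, hc, hp⟩ := exists_frameChartData (rotation ξ κ m u v hu hv h t)
  refine (hc.cm_of_dir (u := fun s => u + s • v) hp contMDiffAt_const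
    (Eventually.of_forall fun s => mem_ofVec _ _ _ _) ?_).1
  have h1 : CM ℝ F (fun s : ℝ => dd F F c m u + s • dd F F c m v) t := by
    have h2 : ContDiff ℝ ∞ (fun s : ℝ => dd F F c m u + s • dd F F c m v) := by fun_prop
    exact h2.contDiffAt.contMDiffAt
  refine h1.congr_of_eventuallyEq (Eventually.of_forall fun s => ?_)
  exact (dd_add c m u (s • v)).trans (congrArg _ (dd_smul c m s v))

/-- A clopen subset of a projectivized plane field is a union of fibers. -/
theorem mem_of_isClopen {S : Set (Prolong ξ .line)} (hS : IsClopen S) {p p' : Prolong ξ .line}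
    (hp : p ∈ S) (hb : p'.base = p.base) : p' ∈ S := by
  obtain ⟨u, hu⟩ := p.exists_mem
  obtain ⟨v, hv⟩ := p'.exists_mem
  have hpu := p.eq_ofVec hu
  have hpv := p'.eq_ofVec hv
  rw [hpu] at hp
  suffices h : ofVec ξ .line p'.base v (p'.mem_plane hv) (p'.ne_zero hv) ∈ S from hpv ▸ h
  have hum := p.mem_plane hu
  have hu0 := p.ne_zero hu
  have hvm := p'.mem_plane hv
  have hv0 := p'.ne_zero hv
  clear hpu hpv
  obtain ⟨m, d, hd⟩ := p
  obtain ⟨m', d', hd'⟩ := p'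
  change m' = m at hb
  subst hb
  change TangentSpace 𝓘(ℝ, F) m' at u v
  change ofVec ξ .line m' u hum hu0 ∈ S at hp
  change ofVec ξ .line m' v hvm hv0 ∈ S
  by_cases hli : LinearIndependent ℝ ![u, v]
  -- Independent lines are joined by the curve of lines spanned by `u + t (v - u)`, and the preimage
  -- of a clopen set under it is all of `ℝ`.
  · have hli' : LinearIndependent ℝ ![u, v - u] := by
      rw [LinearIndependent.pair_iff] at hli ⊢
      intro s t hst
      have := hli (s - t) t (by rw [← hst]; module)
      exact ⟨by linarith [this.1, this.2], this.2⟩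
    have hvum : v - u ∈ ξ.plane m' := Submodule.sub_mem _ hvm hum
    let γ := rotation ξ .line m' u (v - u) hum hvum hli'
    have hγ : Continuous γ := continuous_iff_continuousAt.2 fun t =>
      (cm_rotation m' hum hvum hli' t).continuousAt
    have hpre : IsClopen (γ ⁻¹' S) := hS.preimage hγ
    have h0 : γ 0 = ofVec ξ .line m' u hum hu0 := by
      simp only [γ, rotation, zero_smul, add_zero]
    have h1 : γ 1 = ofVec ξ .line m' v hvm hv0 := by
      simp only [γ, rotation, one_smul, add_sub_cancel]
    have h2 := hpre.eq_univ ⟨0, by rw [mem_preimage, h0]; exact hp⟩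
    rw [← h1]
    exact (h2 ▸ mem_univ (1 : ℝ) : (1 : ℝ) ∈ γ ⁻¹' S)
  -- Dependent vectors span the same line, whatever the sign of the factor; here lines rather than
  -- rays are used.
  · rw [LinearIndependent.pair_iff' hu0] at hli
    push Not at hli
    obtain ⟨a, ha⟩ := hli
    have ha0 : a ≠ 0 := by
      rintro rfl
      rw [zero_smul] at ha
      exact hv0 ha.symm
    have : ofVec ξ .line m' u hum hu0 = ofVec ξ .line m' v hvm hv0 := by
      have h1 : v ∈ (ofVec ξ .line m' u hum hu0).dir := ⟨a, ha0, ha.symm⟩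
      exact (ofVec ξ .line m' u hum hu0).eq_ofVec h1
    rw [← this]
    exact hp

end Prolong

/-! ### Ranks and invertibility of Engel immersions -/

section EngelLemmas

variable {E : Type*} [NormedAddCommGroup E] [NormedSpace ℝ E]
variable {Q : Type*} [TopologicalSpace Q] [ChartedSpace E Q] [IsManifold 𝓘(ℝ, E) ∞ Q]
variable {D : Distr E Q}

theorem IsEngel.finrank_eq (hD : IsEngel D) (q : Q) : finrank ℝ (D q) = 2 := by
  obtain ⟨U, -, hx, Y, -, hY⟩ := hD.rank_two q
  rw [(hY q hx).2, finrank_span_eq_card (hY q hx).1, Fintype.card_fin]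

theorem IsEngelImmersion.isInvertible {E' : Type*} [NormedAddCommGroup E'] [NormedSpace ℝ E']
    {Q' : Type*} [TopologicalSpace Q'] [ChartedSpace E' Q'] [IsManifold 𝓘(ℝ, E') ∞ Q']
    {D' : Distr E' Q'} {φ : Q → Q'} (hD : IsEngel D) (hD' : IsEngel D')
    (hφ : IsEngelImmersion D D' φ) (q : Q) : (dd E E' φ q).IsInvertible := by
  have hfin := hD.finiteDimensional
  have hfin' := hD'.finiteDimensional
  let L := LinearEquiv.ofInjectiveOfFinrankEq (dd E E' φ q).toLinearMap (hφ.immersion q)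
    (hD.dim.trans hD'.dim.symm)
  refine ⟨L.toContinuousLinearEquiv, ?_⟩
  ext v
  rfl

end EngelLemmas

/-! ### Developments are Engel immersions -/

section Development

open Prolong

variable {E : Type*} [NormedAddCommGroup E] [NormedSpace ℝ E]
variable {Q : Type*} [TopologicalSpace Q] [T2Space Q] [ChartedSpace E Q] [IsManifold 𝓘(ℝ, E) ∞ Q]
variable {F : Type*} [NormedAddCommGroup F] [NormedSpace ℝ F] [FiniteDimensional ℝ F]
variable {M : Type*} [TopologicalSpace M] [ChartedSpace F M] [IsManifold 𝓘(ℝ, F) ∞ M]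
variable {D : Distr E Q} {π : Q → M} {ξ : PlaneField F M} {κ : DirKind} {Ψ : Q → Prolong ξ κ}

/-- The map `Ψ` covers `π`, and the direction `Ψ q` is spanned by the projection of the second
field of local Engel frames. -/
structure IsDevelopment (D : Distr E Q) (π : Q → M) (Ψ : Q → Prolong ξ κ) : Prop where
  base_eq : ∀ q, (Ψ q).base = π q
  dir_mem : ∀ q, ∃ U W X, q ∈ U ∧ EngelFrame D U W X ∧
    ∀ x ∈ U, (dd E F π x (X x) : F) ∈ (Ψ x).dir

/-- The differential of a development in terms of an Engel frame and of a frame chart. -/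
theorem development_formula (hF : finrank ℝ F = 3) (hD : IsEngel D) (hπ : IsLeafQuotient F D π)
    (hb : ∀ q, (Ψ q).base = π q) {U : Set Q} {W X : VField E Q} (hf : EngelFrame D U W X)
    (hd : ∀ x ∈ U, (dd E F π x (X x) : F) ∈ (Ψ x).dir) {q : Q} (hq : q ∈ U)
    {e : PartialEquiv (Prolong ξ κ) (F × ℝ)} {c : OpenPartialHomeomorph M F} {V : Set M}
    {X₀ X₁ : VField F M} (h : FrameChart ξ κ e c V X₀ X₁) (hqe : Ψ q ∈ e.source) :
    CM E (F × ℝ) Ψ q ∧ ∃ s ∈ κ.scalars, ∃ r : ℝ,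
      (dd E F π q (X q) : F) = s • (X₀ (Ψ q).base + (e (Ψ q)).2 • X₁ (Ψ q).base) ∧
      (dd E F π q (lieBr W X q) : F) - r • dd E F π q (X q) =
        (s * dd (F × ℝ) ℝ (fun x : Prolong ξ κ => (e x).2) (Ψ q) (dd E (F × ℝ) Ψ q (W q))) •
          X₁ (Ψ q).base := by
  have hfin := hD.finiteDimensional
  have hcE : CompleteSpace E := FiniteDimensional.complete ℝ E
  have hbase : (fun x => (Ψ x).base) = π := funext hb
  have hbq : CM E F (fun x => (Ψ x).base) q := by rw [hbase]; exact hπ.cm q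
  have hVq : π q ∈ V := hb q ▸ h.base_mem hqe
  have hev : ∀ᶠ x in 𝓝 q, x ∈ U ∧ π x ∈ V := (hf.isOpen.eventually_mem hq).and
    ((hπ.cm q).continuousAt (h.isOpen.mem_nhds hVq))
  have hcπ : ∀ x, π x ∈ V → CM E F (fun x => c (π x)) x := fun x hx =>
    CM.comp (f := π) (g := c) (h.cm_c (h.sub hx)) (hπ.cm x)
  have hdc : ∀ x, π x ∈ V → ∀ v : TangentSpace 𝓘(ℝ, E) x,
      dd E F (fun x => c (π x)) x v = dd F F c (π x) (dd E F π x v) := fun x hx v =>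
    dd_comp_vec (f := π) (g := c) (h.cm_c (h.sub hx)).mdiff (hπ.cm x).mdiff v
  have hX : CM E F (dv F (fun x => c (π x)) X) q := cm_dv (hcπ q hVq) (hf.smX q hq)
  have hus : CM E F (fun x => dd F F c (Ψ x).base (dd E F π x (X x))) q := by
    refine hX.congr_of_eventuallyEq (hev.mono fun x hx => ?_)
    change dd F F c (Ψ x).base (dd E F π x (X x)) = dd E F (fun x => c (π x)) x (X x)
    rw [hdc x hx.2, hb x]
  obtain ⟨hsm, a, ha, hrel⟩ := h.cm_of_dir (u := fun x => (dd E F π x (X x) : F)) hqe hbq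
    ((hf.isOpen.eventually_mem hq).mono hd) hus
  refine ⟨hsm, a q, hrel.self_of_nhds.2.1, ?_⟩
  let w : Prolong ξ κ → ℝ := fun x => (e x).2
  let a₀ : Q → F := fun x => dv F c X₀ (π x)
  let a₁ : Q → F := fun x => dv F c X₁ (π x)
  have ha₀' : CM F F (dv F c X₀) (π q) := cm_dv (h.cm_c (h.sub hVq)) (h.sm₀ hVq)
  have ha₁' : CM F F (dv F c X₁) (π q) := cm_dv (h.cm_c (h.sub hVq)) (h.sm₁ hVq)
  have ha₀ : CM E F a₀ q := CM.comp (f := π) ha₀' (hπ.cm q)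
  have ha₁ : CM E F a₁ q := CM.comp (f := π) ha₁' (hπ.cm q)
  have hw : CM E ℝ (fun x => w (Ψ x)) q := CM.comp (f := Ψ) (g := w) (h.cm_w hqe) hsm
  have hwa : CM E F (fun x => w (Ψ x) • a₁ x) q := hw.smul ha₁
  have hsum : CM E F (fun x => a₀ x + w (Ψ x) • a₁ x) q := ha₀.add hwa
  have hWπ : dd E F π q (W q) = 0 := hπ.dd_W hF hD hf hq
  have hd₀ : dd E F a₀ q (W q) = 0 := by
    refine (dd_comp_vec (f := π) (g := dv F c X₀) ha₀'.mdiff (hπ.cm q).mdiff (W q)).trans ?_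
    rw [hWπ, map_zero]
  have hd₁ : dd E F a₁ q (W q) = 0 := by
    refine (dd_comp_vec (f := π) (g := dv F c X₁) ha₁'.mdiff (hπ.cm q).mdiff (W q)).trans ?_
    rw [hWπ, map_zero]
  have hdw : dd E ℝ (fun x => w (Ψ x)) q (W q) = dd (F × ℝ) ℝ w (Ψ q) (dd E (F × ℝ) Ψ q (W q)) :=
    dd_comp_vec (f := Ψ) (g := w) (h.cm_w hqe).mdiff hsm.mdiff (W q)
  -- The relation `dπ X = a (X₀ + w X₁)` in a chart of `M`, where `w` is the fiber coordinate of the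
  -- development.
  have hcoord : ∀ᶠ x in 𝓝 q, dv F (fun x => c (π x)) X x = a x • (a₀ x + w (Ψ x) • a₁ x) := by
    filter_upwards [hev, hrel] with x hx hr
    change dd E F (fun x => c (π x)) x (X x) = _
    rw [hdc x hx.2]
    have h1 : (dd E F π x (X x) : F) = a x • (X₀ (π x) + (e (Ψ x)).2 • X₁ (π x)) := by
      have := hr.2.2
      rw [hb x] at this
      exact this
    rw [h1]
    exact (map_smul (dd F F c (π x)) (a x) _).trans (congrArg (fun y : F => a x • y)
      ((map_add (dd F F c (π x)) _ _).trans (congrArg _ (map_smul (dd F F c (π x)) _ _))))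
  have h1 := dv_lieBr (hcπ q hVq) (hf.smW q hq) (hf.smX q hq)
  -- The function `dπ W` vanishes near `q`, so the bracket is just the derivative of `dπ X` along
  -- `W`.
  have h2 : dv F (dv F (fun x => c (π x)) W) X q = 0 := by
    rw [dv_congr (g := fun _ => (0 : F)), dv_const]
    filter_upwards [hev] with x hx
    change dd E F (fun x => c (π x)) x (W x) = 0
    rw [hdc x hx.2, hπ.dd_W hF hD hf hx.1, map_zero]
  -- The coefficients of `X₀` and `X₁` depend on the base point alone, which `W` does not move, so
  -- only `a` and `w` are differentiated.
  have h3 : dv F (dv F (fun x => c (π x)) X) W q =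
      a q • (dd (F × ℝ) ℝ w (Ψ q) (dd E (F × ℝ) Ψ q (W q)) • a₁ q) +
        dd E ℝ a q (W q) • (a₀ q + w (Ψ q) • a₁ q) := by
    rw [dv_congr hcoord]
    refine (dd_smul_fun ha hsum (W q)).trans ?_
    have h4 : dd E F (fun x => a₀ x + w (Ψ x) • a₁ x) q (W q) =
        dd (F × ℝ) ℝ w (Ψ q) (dd E (F × ℝ) Ψ q (W q)) • a₁ q := by
      refine (dd_add_fun ha₀ hwa (W q)).trans ?_
      rw [hd₀, zero_add]
      refine (dd_smul_fun hw ha₁ (W q)).trans ?_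
      rw [hd₁, smul_zero, zero_add, hdw]
    rw [h4]
  rw [h2, sub_zero, h3] at h1
  have h0 := hcoord.self_of_nhds
  have haq : a q ≠ 0 := κ.ne_zero hrel.self_of_nhds.2.1
  -- The derivative of the scale factor `a` contributes a multiple of `dπ X`, and `r` is that
  -- multiple.
  refine ⟨dd E ℝ a q (W q) / a q, hrel.self_of_nhds.2.2, ?_⟩
  apply h.dd_c_injective hVq
  rw [map_sub, map_smul, ← hdc q hVq, ← hdc q hVq]
  change dv F (fun x => c (π x)) (lieBr W X) q -
    (dd E ℝ a q (W q) / a q) • dv F (fun x => c (π x)) X q = _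
  rw [h1, h0, smul_smul (dd E ℝ a q (W q) / a q), div_mul_cancel₀ _ haq, add_sub_cancel_right,
    smul_smul]
  refine Eq.trans ?_ (map_smul (dd F F c (π q)) _ _).symm
  rw [hb q]
  rfl

theorem IsDevelopment.cm (hF : finrank ℝ F = 3) (hD : IsEngel D)
    (hπ : IsLeafQuotient F D π) (hΨ : IsDevelopment D π Ψ) (q : Q) : CM E (F × ℝ) Ψ q := by
  obtain ⟨U, W, X, hq, hf, hd⟩ := hΨ.dir_mem q
  obtain ⟨e, c, V, X₀, X₁, h, hp⟩ := exists_frameChartData (Ψ q)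
  exact (development_formula hF hD hπ hΨ.base_eq hf hd hq h hp).1

theorem dd_base_development (hπ : IsLeafQuotient F D π) (hb : ∀ q, (Ψ q).base = π q) {q : Q}
    (hsm : CM E (F × ℝ) Ψ q) (v : TangentSpace 𝓘(ℝ, E) q) :
    dd (F × ℝ) F (base : Prolong ξ κ → M) (Ψ q) (dd E (F × ℝ) Ψ q v) = dd E F π q v := by
  have h1 : (fun x => (Ψ x).base) = π := funext hb
  rw [← dd_comp_vec (f := Ψ) (g := (base : Prolong ξ κ → M)) (cm_base _).mdiff hsm.mdiff, h1]

/-- The kernel of the differential of `Ψ` lies in that of `dπ`, the characteristic line. It cannot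
contain `W`, for then `dπ [W,X]` would be a multiple of `dπ X`. Both frame fields of `D` go to the
canonical distribution, and equality follows from the ranks. -/
theorem IsDevelopment.isEngelImmersion (hF : finrank ℝ F = 3) (hD : IsEngel D)
    (hπ : IsLeafQuotient F D π) (hξ : ξ.IsContact) (hΨ : IsDevelopment D π Ψ) :
    IsEngelImmersion D (canonical ξ κ) Ψ := by
  have hfin := hD.finiteDimensional
  have hinj : ∀ q, ∀ v : TangentSpace 𝓘(ℝ, E) q, dd E (F × ℝ) Ψ q v = 0 → v = 0 := by
    intro q v hv
    obtain ⟨U, W, X, hq, hf, hd⟩ := hΨ.dir_mem q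
    obtain ⟨e, c, V, X₀, X₁, h, hp⟩ := exists_frameChartData (Ψ q)
    obtain ⟨hsm, s, hs, r, h1, h2⟩ := development_formula hF hD hπ hΨ.base_eq hf hd hq h hp
    have h3 := dd_base_development hπ hΨ.base_eq hsm v
    rw [hv, map_zero] at h3
    obtain ⟨t, rfl⟩ := (hπ.dd_eq_zero_iff hF hD hf hq v).1 h3.symm
    rw [dd_smul] at hv
    rcases smul_eq_zero.1 hv with ht | hW
    · rw [ht, zero_smul]
    -- A vanishing fiber velocity would give a relation between `dπ X` and `dπ [W,X]`.
    · exfalso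
      rw [hW, map_zero, mul_zero, zero_smul] at h2
      have h4 := li_three_iff.1 (hπ.li_push hF hD hf hq) (-r) 1 0 (by
        rw [zero_smul, add_zero, one_smul, neg_smul, neg_add_eq_sub]
        exact h2)
      linarith [h4.2.1]
  have hi : ∀ q, Function.Injective (dd E (F × ℝ) Ψ q) := fun q =>
    (injective_iff_map_eq_zero _).2 fun v hv => hinj q v hv
  refine ⟨fun q => hΨ.cm hF hD hπ q, hi, fun q => ?_⟩
  obtain ⟨U, W, X, hq, hf, hd⟩ := hΨ.dir_mem q
  have hsm := hΨ.cm hF hD hπ q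
  have hW : (dd E (F × ℝ) Ψ q (W q) : F × ℝ) ∈ canonical ξ κ (Ψ q) := by
    change dd (F × ℝ) F (base : Prolong ξ κ → M) (Ψ q) (dd E (F × ℝ) Ψ q (W q)) ∈
      Submodule.span ℝ (Ψ q).dir
    rw [dd_base_development hπ hΨ.base_eq hsm, hπ.dd_W hF hD hf hq]
    exact Submodule.zero_mem _
  have hX : (dd E (F × ℝ) Ψ q (X q) : F × ℝ) ∈ canonical ξ κ (Ψ q) := by
    change dd (F × ℝ) F (base : Prolong ξ κ → M) (Ψ q) (dd E (F × ℝ) Ψ q (X q)) ∈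
      Submodule.span ℝ (Ψ q).dir
    rw [dd_base_development hπ hΨ.base_eq hsm]
    exact Submodule.subset_span (hd q hq)
  have hle : Submodule.map (dd E (F × ℝ) Ψ q).toLinearMap (D q : Submodule ℝ E) ≤
      (canonical ξ κ (Ψ q) : Submodule ℝ (F × ℝ)) := by
    rintro _ ⟨v, hv, rfl⟩
    change v ∈ (D q : Submodule ℝ E) at hv
    rw [hf.dist q hq] at hv
    obtain ⟨a, b, rfl⟩ := (Submodule.mem_span_pair (M := TangentSpace 𝓘(ℝ, E) q)).1 hv
    have h5 : dd E (F × ℝ) Ψ q (a • W q + b • X q) =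
        a • dd E (F × ℝ) Ψ q (W q) + b • dd E (F × ℝ) Ψ q (X q) := by
      rw [dd_add, dd_smul, dd_smul]
    exact h5 ▸ Submodule.add_mem (canonical ξ κ (Ψ q) : Submodule ℝ (F × ℝ))
      (Submodule.smul_mem _ _ hW) (Submodule.smul_mem _ _ hX)
  have hfd : FiniteDimensional ℝ (canonical ξ κ (Ψ q) : Submodule ℝ (F × ℝ)) :=
    FiniteDimensional.finiteDimensional_submodule (K := ℝ) (V := F × ℝ) _
  refine @Submodule.eq_of_le_of_finrank_eq ℝ (F × ℝ) _ _ _ _ _ hfd hle ?_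
  let P : Submodule ℝ E := D q
  have h5 : finrank ℝ P = 2 := hD.finrank_eq q
  refine ((Submodule.equivMapOfInjective (dd E (F × ℝ) Ψ q).toLinearMap (hi q)
    P).finrank_eq.symm.trans h5).trans ?_
  exact ((isEngel_canonical hξ).finrank_eq (Ψ q)).symm

/-- A development is a local homeomorphism. -/
theorem IsEngelImmersion.isLocalHomeomorph {E' : Type*} [NormedAddCommGroup E'] [NormedSpace ℝ E']
    {Q' : Type*} [TopologicalSpace Q'] [ChartedSpace E' Q'] [IsManifold 𝓘(ℝ, E') ∞ Q']
    {D' : Distr E' Q'} {φ : Q → Q'} (hD : IsEngel D) (hD' : IsEngel D')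
    (hφ : IsEngelImmersion D D' φ) : IsLocalHomeomorph φ := by
  have hfin := hD.finiteDimensional
  have hcE : CompleteSpace E := FiniteDimensional.complete ℝ E
  refine IsLocalHomeomorph.mk φ fun q => ?_
  obtain ⟨e, hq, -, heq, -⟩ := exists_localInverse isOpen_univ (mem_univ q)
    (fun x _ => hφ.smooth x) (fun x _ => hφ.isInvertible hD hD' x)
  exact ⟨e, hq, heq.symm⟩

/-- The leaf is exactly the preimage under `Ψ` of the projective line, both being fibers over `M`,
so no topology is lost in restricting `Ψ`. -/
theorem IsDevelopment.leaf_isLocalHomeomorph (hF : finrank ℝ F = 3) (hD : IsEngel D)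
    (hπ : IsLeafQuotient F D π) (hξ : ξ.IsContact) (hΨ : IsDevelopment D π Ψ) (q : Q) :
    ∃ h : MapsTo Ψ (leaf D q) (Prolong.base ⁻¹' {π q}),
      IsLocalHomeomorph (h.restrict Ψ (leaf D q) (Prolong.base ⁻¹' {π q})) := by
  have h1 := (hΨ.isEngelImmersion hF hD hπ hξ).isLocalHomeomorph hD (isEngel_canonical hξ)
  have h2 : ∀ L, L = Ψ ⁻¹' (Prolong.base ⁻¹' {π q}) → ∃ h : MapsTo Ψ L (Prolong.base ⁻¹' {π q}),
      IsLocalHomeomorph (h.restrict Ψ L (Prolong.base ⁻¹' {π q})) := by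
    rintro _ rfl
    exact ⟨mapsTo_preimage _ _, h1.restrict_preimage _⟩
  refine h2 _ ?_
  rw [← hπ.fiber_eq_leaf]
  ext x
  change π x = π q ↔ (Ψ x).base = π q
  rw [hΨ.base_eq]

/-- A local homeomorphism from a compact Hausdorff space to a Hausdorff space is a covering. Its
image is clopen, hence a union of connected fibers, and it meets every fiber because `π` is
surjective. -/
theorem IsDevelopment.isCoveringMap [T2Space M] (hF : finrank ℝ F = 3) (hD : IsEngel D)
    (hπ : IsLeafQuotient F D π) (hξ : ξ.IsContact) {Ψ : Q → Prolong ξ .line}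
    (hΨ : IsDevelopment D π Ψ) [CompactSpace Q] : IsCoveringMap Ψ ∧ Function.Surjective Ψ := by
  have h1 := (hΨ.isEngelImmersion hF hD hπ hξ).isLocalHomeomorph hD (isEngel_canonical hξ)
  have hT : T2Space (Prolong ξ .line) := Prolong.t2Space
  constructor
  · exact isCoveringMap_iff_isCoveringMapOn_univ.2
      (IsCoveringMapOn.of_isLocalHomeomorphOn h1.continuous fun x _ => h1 x)
  · intro p
    have hcl : IsClopen (range Ψ) :=
      ⟨(isCompact_range h1.continuous).isClosed, h1.isOpenMap.isOpen_range⟩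
    obtain ⟨q, hq⟩ := hπ.surjective p.base
    exact mem_of_isClopen hcl (mem_range_self q) (by rw [hΨ.base_eq, hq])

end Development

/-! ### Engel immersions pull back Engel frames -/

section Naturality

variable {E : Type*} [NormedAddCommGroup E] [NormedSpace ℝ E]
variable {Q : Type*} [TopologicalSpace Q] [ChartedSpace E Q] [IsManifold 𝓘(ℝ, E) ∞ Q]
variable {E' : Type*} [NormedAddCommGroup E'] [NormedSpace ℝ E']
variable {Q' : Type*} [TopologicalSpace Q'] [ChartedSpace E' Q'] [IsManifold 𝓘(ℝ, E') ∞ Q']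
variable {D : Distr E Q} {D' : Distr E' Q'} {φ : Q → Q'}

/-- Pullback of a vector field by a local diffeomorphism. -/
noncomputable def pullField (φ : Q → Q') (X : VField E' Q') : VField E Q :=
  VectorField.mpullback 𝓘(ℝ, E) 𝓘(ℝ, E') φ X

theorem dd_pullField {x : Q} (h : (dd E E' φ x).IsInvertible) (X : VField E' Q') :
    dd E E' φ x (pullField (E := E) φ X x) = X (φ x) := h.self_apply_inverse (X (φ x))

theorem smAt_pullField [CompleteSpace E] {x : Q} (hφ : CM E E' φ x)
    (h : (dd E E' φ x).IsInvertible) {X : VField E' Q'} (hX : SmAt X (φ x)) :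
    SmAt (pullField (E := E) φ X) x := by
  have h1 := ContMDiffWithinAt.mpullback_vectorField_preimage (t := univ) (n := ∞) (m := ∞)
    (I := 𝓘(ℝ, E)) (I' := 𝓘(ℝ, E')) (f := φ) (x₀ := x) (V := X) hX hφ h le_rfl
  exact h1

theorem lieBr_pullField [CompleteSpace E] [CompleteSpace E'] {x : Q} (hφ : CM E E' φ x)
    {X Y : VField E' Q'} (hX : SmAt X (φ x))
    (hY : SmAt Y (φ x)) :
    lieBr (pullField (E := E) φ X) (pullField (E := E) φ Y) x =
      pullField (E := E) φ (lieBr X Y) x := by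
  have := isManifold_minSmoothness (E := E) (Q := Q)
  have := isManifold_minSmoothness (E := E') (Q := Q')
  exact (VectorField.mpullback_mlieBracket (n := ∞) hX.mdiff hY.mdiff hφ (by
    simp only [minSmoothness_of_isRCLikeNormedField]; exact ENat.LEInfty.out)).symm

/-- Pullback of an Engel frame by an Engel immersion. -/
theorem IsEngelImmersion.exists_engelFrame_pull (hD : IsEngel D) (hD' : IsEngel D')
    (hφ : IsEngelImmersion D D' φ) {U : Set Q'} {W X : VField E' Q'} (hf : EngelFrame D' U W X) :
    EngelFrame D (φ ⁻¹' U) (pullField (E := E) φ W) (pullField (E := E) φ X) := by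
  have hfin := hD.finiteDimensional
  have hfin' := hD'.finiteDimensional
  have hcE : CompleteSpace E := FiniteDimensional.complete ℝ E
  have hcE' : CompleteSpace E' := FiniteDimensional.complete ℝ E'
  have hinv := hφ.isInvertible hD hD'
  have hopen : IsOpen (φ ⁻¹' U) := hf.isOpen.preimage hφ.smooth.continuous
  have hZ : ∀ x ∈ φ ⁻¹' U, lieBr (pullField (E := E) φ W) (pullField (E := E) φ X) x =
      pullField (E := E) φ (lieBr W X) x := fun x hx =>
    lieBr_pullField (hφ.smooth x) (hf.smW _ hx) (hf.smX _ hx)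
  have hV : ∀ x ∈ φ ⁻¹' U, lieBr (lieBr (pullField (E := E) φ W) (pullField (E := E) φ X))
      (pullField (E := E) φ X) x = pullField (E := E) φ (lieBr (lieBr W X) X) x := fun x hx => by
    rw [lieBr_congr ((hopen.eventually_mem hx).mono hZ) (Eventually.of_forall fun _ => rfl)]
    exact lieBr_pullField (hφ.smooth x) (hf.smZ hx) (hf.smX _ hx)
  have hWZ : ∀ x ∈ φ ⁻¹' U, lieBr (pullField (E := E) φ W)
      (lieBr (pullField (E := E) φ W) (pullField (E := E) φ X)) x =
      pullField (E := E) φ (lieBr W (lieBr W X)) x := fun x hx => by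
    rw [lieBr_congr (Eventually.of_forall fun _ => rfl) ((hopen.eventually_mem hx).mono hZ)]
    exact lieBr_pullField (hφ.smooth x) (hf.smW _ hx) (hf.smZ hx)
  have hmem : ∀ x (v : TangentSpace 𝓘(ℝ, E) x), v ∈ D x ↔
      (dd E E' φ x v : E') ∈ D' (φ x) := by
    intro x v
    rw [← hφ.map_eq x]
    constructor
    · intro hv
      exact ⟨v, hv, rfl⟩
    · rintro ⟨w, hw, hwv⟩
      have : w = v := hφ.immersion x hwv
      exact this ▸ hw
  refine ⟨hopen, fun x hx => smAt_pullField (hφ.smooth x) (hinv x) (hf.smW _ hx),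
    fun x hx => smAt_pullField (hφ.smooth x) (hinv x) (hf.smX _ hx), fun x hx => ?_,
    fun x hx => ?_, fun x hx => ?_⟩
  · ext v
    rw [hmem, hf.dist _ hx, Submodule.mem_span_pair]
    refine (Submodule.mem_span_pair (R := ℝ) (M := TangentSpace 𝓘(ℝ, E') (φ x))).trans ?_
    refine exists_congr fun a => exists_congr fun b => ?_
    have h1 : dd E E' φ x (a • pullField (E := E) φ W x + b • pullField (E := E) φ X x) =
        (a • W (φ x) + b • X (φ x) : TangentSpace 𝓘(ℝ, E') (φ x)) := by
      rw [dd_add, dd_smul, dd_smul, dd_pullField (hinv x), dd_pullField (hinv x)]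
      rfl
    constructor
    · intro h
      exact hφ.immersion x (h1.trans h)
    · intro h
      rw [← h]
      exact h1.symm
  · rw [hZ x hx, hV x hx, li_four_iff]
    intro r s t u h
    refine li_four_iff.1 (hf.li _ hx) r s t u ?_
    have h1 : dd E E' φ x (r • pullField (E := E) φ W x + s • pullField (E := E) φ X x +
        t • pullField (E := E) φ (lieBr W X) x +
        u • pullField (E := E) φ (lieBr (lieBr W X) X) x) = 0 := by
      rw [h]; exact map_zero _
    rw [dd_add, dd_add, dd_add, dd_smul, dd_smul, dd_smul, dd_smul, dd_pullField (hinv x),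
      dd_pullField (hinv x), dd_pullField (hinv x), dd_pullField (hinv x)] at h1
    exact h1
  · rw [hZ x hx, hWZ x hx]
    obtain ⟨r, s, t, h⟩ := mem_span_three.1 (hf.char _ hx)
    refine mem_span_three.2 ⟨r, s, t, hφ.immersion x ?_⟩
    change dd E E' φ x _ = dd E E' φ x _
    rw [dd_add, dd_add, dd_smul, dd_smul, dd_smul, dd_pullField (hinv x),
      dd_pullField (hinv x), dd_pullField (hinv x), dd_pullField (hinv x)]
    exact h

/-- An Engel frame of the target pulls back to one of the source, and the first field of a frame
spans the characteristic line on either side. -/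
theorem IsEngelImmersion.mem_charLine_iff (hD : IsEngel D) (hD' : IsEngel D')
    (hφ : IsEngelImmersion D D' φ) {q : Q} (v : TangentSpace 𝓘(ℝ, E) q) :
    (dd E E' φ q v : E') ∈ charLine D' (φ q) ↔ v ∈ charLine D q := by
  have hfin := hD.finiteDimensional
  have hfin' := hD'.finiteDimensional
  have hinv := hφ.isInvertible hD hD' q
  obtain ⟨U, W, X, hq, hf⟩ := exists_engelFrame hD' (φ q)
  rw [(hφ.exists_engelFrame_pull hD hD' hf).charLine_eq hq, hf.charLine_eq hq,
    Submodule.mem_span_singleton]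
  refine (Submodule.mem_span_singleton (R := ℝ) (M := TangentSpace 𝓘(ℝ, E') (φ q))).trans ?_
  refine exists_congr fun r => ?_
  have h1 : dd E E' φ q (r • pullField (E := E) φ W q) =
      (r • W (φ q) : TangentSpace 𝓘(ℝ, E') (φ q)) := by
    rw [dd_smul, dd_pullField hinv]
    rfl
  constructor
  · intro h
    exact hφ.immersion q (h1.trans h)
  · intro h
    rw [← h]
    exact h1.symm

theorem IsEngelImmersion.mem_iff (hφ : IsEngelImmersion D D' φ) (x : Q)
    (v : TangentSpace 𝓘(ℝ, E) x) : (dd E E' φ x v : E') ∈ D' (φ x) ↔ v ∈ D x := by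
  rw [← hφ.map_eq x]
  constructor
  · rintro ⟨w, hw, hwv⟩
    have : w = v := hφ.immersion x hwv
    exact this ▸ hw
  · intro hv
    exact ⟨v, hv, rfl⟩

end Naturality

/-! ### The line development and differentials of leafwise constant maps -/

section LineDevelopment

open Prolong

variable {E : Type*} [NormedAddCommGroup E] [NormedSpace ℝ E]
variable {Q : Type*} [TopologicalSpace Q] [T2Space Q] [ChartedSpace E Q] [IsManifold 𝓘(ℝ, E) ∞ Q]
variable {F : Type*} [NormedAddCommGroup F] [NormedSpace ℝ F] [FiniteDimensional ℝ F]
variable {M : Type*} [TopologicalSpace M] [ChartedSpace F M] [IsManifold 𝓘(ℝ, F) ∞ M]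
variable {D : Distr E Q} {π : Q → M} {ξ : PlaneField F M}

theorem Prolong.ext_of_mem {κ : DirKind} {p p' : Prolong ξ κ} (hb : p.base = p'.base)
    (h : ∀ y : F, y ∈ p.dir ↔ y ∈ p'.dir) : p = p' := by
  obtain ⟨m, d, hd⟩ := p
  obtain ⟨m', d', hd'⟩ := p'
  change m = m' at hb
  subst hb
  have : d = d' := Set.ext h
  subst this
  rfl

theorem IsLeafQuotient.mem_map_iff (hF : finrank ℝ F = 3) (hD : IsEngel D)
    (hπ : IsLeafQuotient F D π) {U : Set Q} {W X : VField E Q} (hf : EngelFrame D U W X) {q : Q}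
    (hq : q ∈ U) (y : F) : (∃ v ∈ D q, dd E F π q v = y) ↔ ∃ r : ℝ, y = r • dd E F π q (X q) := by
  rw [hf.dist q hq]
  constructor
  · rintro ⟨v, hv, rfl⟩
    obtain ⟨a, b, rfl⟩ := Submodule.mem_span_pair.1 hv
    refine ⟨b, ?_⟩
    rw [dd_add, dd_smul, dd_smul, hπ.dd_W hF hD hf hq, smul_zero, zero_add]
  · rintro ⟨r, rfl⟩
    exact ⟨r • X q, Submodule.smul_mem _ _ (Submodule.subset_span (by simp)), dd_smul _ _ _ _⟩

theorem IsLeafQuotient.push_X_ne_zero (hF : finrank ℝ F = 3) (hD : IsEngel D)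
    (hπ : IsLeafQuotient F D π) {U : Set Q} {W X : VField E Q} (hf : EngelFrame D U W X) {q : Q}
    (hq : q ∈ U) : dd E F π q (X q) ≠ 0 := (hπ.li_push hF hD hf hq).ne_zero 0

theorem IsLeafQuotient.push_X_mem (hF : finrank ℝ F = 3) (hD : IsEngel D)
    (hπ : IsLeafQuotient F D π) (hξ : ∀ q, ξ.plane (π q) =
      (derived2 D q).map (mfderiv 𝓘(ℝ, E) 𝓘(ℝ, F) π q).toLinearMap)
    {U : Set Q} {W X : VField E Q} (hf : EngelFrame D U W X) {q : Q}
    (hq : q ∈ U) : (dd E F π q (X q) : F) ∈ ξ.plane (π q) := by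
  have hfin := hD.finiteDimensional
  rw [hξ]
  refine ⟨X q, ?_, rfl⟩
  have : X q ∈ derived2 D q := by
    rw [hf.derived2_eq hq]
    exact Submodule.subset_span (by simp)
  exact this

/-- The image of `D` is the line of `dπ X`, because `dπ W = 0`; in particular it does not depend on
the frame. The last clause is the form in which two developments are compared. -/
theorem IsLeafQuotient.exists_lineDevelopment (hF : finrank ℝ F = 3) (hD : IsEngel D)
    (hπ : IsLeafQuotient F D π) (hξ : ∀ q, ξ.plane (π q) =
      (derived2 D q).map (mfderiv 𝓘(ℝ, E) 𝓘(ℝ, F) π q).toLinearMap) :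
    ∃ Ψ : Q → Prolong ξ .line, (∀ q, ∃ h, Ψ q = ⟨π q,
          ((D q).map (mfderiv 𝓘(ℝ, E) 𝓘(ℝ, F) π q).toLinearMap :
            Set (TangentSpace 𝓘(ℝ, F) (π q))) \ {0}, h⟩) ∧ IsDevelopment D π Ψ ∧
      ∀ q (y : F), y ∈ (Ψ q).dir ↔ (∃ v ∈ D q, dd E F π q v = y) ∧ y ≠ 0 := by
  have hdir : ∀ q, ∃ v ∈ ξ.plane (π q), v ≠ 0 ∧
      ((D q).map (mfderiv 𝓘(ℝ, E) 𝓘(ℝ, F) π q).toLinearMap :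
            Set (TangentSpace 𝓘(ℝ, F) (π q))) \ {0} =
        {u | ∃ a ∈ DirKind.line.scalars, u = a • v} := by
    intro q
    obtain ⟨U, W, X, hq, hf⟩ := exists_engelFrame hD q
    refine ⟨dd E F π q (X q), hπ.push_X_mem hF hD hξ hf hq, hπ.push_X_ne_zero hF hD hf hq, ?_⟩
    ext y
    constructor
    · rintro ⟨hy, hy0⟩
      obtain ⟨r, hr⟩ := (hπ.mem_map_iff hF hD hf hq y).1 hy
      refine ⟨r, ?_, hr⟩
      rintro rfl
      exact hy0 (hr.trans (zero_smul ℝ _))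
    · rintro ⟨r, hr, hy⟩
      exact ⟨(hπ.mem_map_iff hF hD hf hq y).2 ⟨r, hy⟩, fun h0 => smul_ne_zero hr
        (hπ.push_X_ne_zero hF hD hf hq) (hy.symm.trans h0)⟩
  refine ⟨fun q => ⟨π q, _, hdir q⟩, fun q => ⟨hdir q, rfl⟩, ⟨fun q => rfl, fun q => ?_⟩,
    fun q y => Iff.rfl⟩
  obtain ⟨U, W, X, hq, hf⟩ := exists_engelFrame hD q
  exact ⟨U, W, X, hq, hf, fun x hx => ⟨(hπ.mem_map_iff hF hD hf hx _).2 ⟨1, (one_smul _ _).symm⟩,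
    hπ.push_X_ne_zero hF hD hf hx⟩⟩

/-- The differential of a map which is constant on leaves factors through the leaf space, and the
factorization is constant along the leaves. -/
theorem IsLeafQuotient.factor_transport (hF : finrank ℝ F = 3) (hD : IsEngel D)
    (hπ : IsLeafQuotient F D π)
    {F' : Type*} [NormedAddCommGroup F'] [NormedSpace ℝ F']
    {M' : Type*} [TopologicalSpace M'] [T2Space M'] [ChartedSpace F' M'] [IsManifold 𝓘(ℝ, F') ∞ M']
    {g : Q → M'} {N : Set Q} (hN : IsOpen N) (hg : ∀ x ∈ N, CM E F' g x)
    (hL : ∀ x ∈ N, ∀ v ∈ charLine D x, dd E F' g x v = 0) {γ : ℝ → Q} (hγ : IsLeafCurve D N γ)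
    (s : ℝ) : ∃ A : F →L[ℝ] F', ∀ t, g (γ t) = g (γ s) ∧
      dd E F' g (γ t) = A.comp (dd E F π (γ t)) := by
  have hgγ : ∀ t, g (γ t) = g (γ s) := by
    have h1 : ∀ t, MDifferentiableAt 𝓘(ℝ, ℝ) 𝓘(ℝ, F') (fun t => g (γ t)) t ∧
        dd ℝ F' (fun t => g (γ t)) t 1 = 0 := fun t => by
      refine ⟨(CM.comp (f := γ) (g := g) (hg _ (hγ.mem t)) (hγ.smooth t)).mdiff, ?_⟩
      rw [dd_comp_apply (f := γ) (g := g) (hg _ (hγ.mem t)).mdiff (hγ.smooth t).mdiff]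
      exact hL _ (hγ.mem t) _ (hγ.tangent t)
    intro t
    exact (const_of_dd_eq_zero h1 t).trans (const_of_dd_eq_zero h1 s).symm
  obtain ⟨r, hr⟩ := hπ.exists_rightInverse (γ s)
  -- At `γ s` the factorization exists since `dg` vanishes on the kernel of `dπ`.
  let A : F →L[ℝ] F' := (dd E F' g (γ s)).comp r
  have hA : dd E F' g (γ s) = A.comp (dd E F π (γ s)) := by
    ext v
    have h1 : (r (dd E F π (γ s) v) - v : E) ∈ charLine D (γ s) := by
      refine (hπ.mem_charLine_iff hF hD (r (dd E F π (γ s) v) - v : E)).2 ?_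
      rw [map_sub]
      have h2 : dd E F π (γ s) (r (dd E F π (γ s) v)) = dd E F π (γ s) v :=
        congrArg (fun L : F →L[ℝ] F => L (dd E F π (γ s) v)) hr
      rw [h2, sub_self]
    have h3 := hL _ (hγ.mem s) _ h1
    rw [map_sub, sub_eq_zero] at h3
    exact h3.symm
  refine ⟨A, fun t => ⟨hgγ t, ?_⟩⟩
  let c := extChartAt 𝓘(ℝ, F) (π (γ s))
  let c' := extChartAt 𝓘(ℝ, F') (g (γ s))
  let N' : Set Q := N ∩ (π ⁻¹' (chartAt F (π (γ s))).source ∩ g ⁻¹' (chartAt F' (g (γ s))).source)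
  have hgc : ContinuousOn g N := fun x hx => (hg x hx).continuousAt.continuousWithinAt
  have hN' : IsOpen N' := by
    have h1 := hgc.isOpen_inter_preimage hN (chartAt F' (g (γ s))).open_source
    have h2 := (chartAt F (π (γ s))).open_source.preimage hπ.smooth.continuous
    convert h1.inter h2 using 1
    ext x
    constructor
    · rintro ⟨h1, h2, h3⟩; exact ⟨⟨h1, h3⟩, h2⟩
    · rintro ⟨⟨h1, h3⟩, h2⟩; exact ⟨h1, h2, h3⟩
  have hπγ : ∀ t, π (γ t) = π (γ s) := fun t => hπ.apply_leafCurve hγ s t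
  have hγN' : IsLeafCurve D N' γ := ⟨hγ.smooth, fun t => ⟨hγ.mem t, by
    change π (γ t) ∈ (chartAt F (π (γ s))).source
    rw [hπγ t]; exact mem_chart_source F _, by
    change g (γ t) ∈ (chartAt F' (g (γ s))).source
    rw [hgγ t]; exact mem_chart_source F' _⟩, hγ.tangent⟩
  have hcπ : ∀ x ∈ N', CM E F (fun x => c (π x)) x := fun x hx =>
    CM.comp (f := π) (g := c) (cm_extChartAt hx.2.1) (hπ.cm x)
  have hcg : ∀ x ∈ N', CM E F' (fun x => c' (g x)) x := fun x hx =>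
    CM.comp (f := g) (g := c') (cm_extChartAt hx.2.2) (hg x hx.1)
  have hAc : ∀ x ∈ N', CM E F' (fun x => A (c (π x))) x := fun x hx =>
    CM.comp (f := fun x => c (π x)) (g := A) A.contMDiff.contMDiffAt (hcπ x hx)
  have hnc : ∀ x ∈ N', CM E F' (fun x => (-1 : ℝ) • c' (g x)) x := fun x hx =>
    CM.comp (f := fun x => c' (g x)) (g := ((-1 : ℝ) • ContinuousLinearMap.id ℝ F'))
      (ContinuousLinearMap.contMDiff _).contMDiffAt (hcg x hx)
  have hdd : ∀ x ∈ N', ∀ v : E, dd E F' (fun x => A (c (π x)) + (-1 : ℝ) • c' (g x)) x v =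
      A (dd F F c (π x) (dd E F π x v)) - dd F' F' c' (g x) (dd E F' g x v) := by
    intro x hx v
    rw [dd_add_fun (hAc x hx) (hnc x hx), dd_clm_comp A (hcπ x hx).mdiff,
      dd_comp_apply (f := π) (g := c) (cm_extChartAt hx.2.1).mdiff (hπ.cm x).mdiff]
    have h1 : dd E F' (fun x => (-1 : ℝ) • c' (g x)) x v =
        (-1 : ℝ) • dd F' F' c' (g x) (dd E F' g x v) := by
      rw [← dd_comp_apply (f := g) (g := c') (cm_extChartAt hx.2.2).mdiff (hg x hx.1).mdiff]
      exact dd_clm_comp ((-1 : ℝ) • ContinuousLinearMap.id ℝ F') (hcg x hx).mdiff v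
    rw [h1, neg_one_smul, sub_eq_add_neg]
  have hid : ∀ t, dd F F c (π (γ t)) = .id ℝ F ∧ dd F' F' c' (g (γ t)) = .id ℝ F' := by
    intro t
    rw [hπγ t, hgγ t]
    exact ⟨dd_extChartAt_self _, dd_extChartAt_self _⟩
  -- In charts, the difference of `A ∘ π` and `g` is leafwise constant and has zero differential at
  -- `γ s`. Transport of this vanishing yields the factorization through the same `A` at every time.
  have key := transport_full hD hN' (h := fun x => A (c (π x)) + (-1 : ℝ) • c' (g x))
    (fun x hx => (hAc x hx).add (hnc x hx)) (fun x hx v hv => by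
      refine (hdd x hx v).trans ?_
      have h1 : dd E F π x v = 0 := (hπ.mem_charLine_iff hF hD v).1 hv
      have h2 : dd E F' g x v = 0 := hL x hx.1 v hv
      rw [h1, h2, map_zero, map_zero, map_zero, sub_zero]) hγN' (s := s) (by
      ext v
      rw [hdd _ (hγN'.mem s), (hid s).1, (hid s).2, hA]
      simp) t
  ext v
  have h1 := hdd _ (hγN'.mem t) v
  rw [key, (hid t).1, (hid t).2] at h1
  exact (sub_eq_zero.1 h1.symm).symm

end LineDevelopment

/-- A projective map of a line is determined by three points: proportionality on `u`, `v` and `x u +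
y v` forces the three factors to agree, as `B` is injective and neither `x` nor `y` vanishes. -/
theorem exists_factor_of_three {V V' : Type*} [AddCommGroup V] [Module ℝ V] [AddCommGroup V']
    [Module ℝ V'] {A B : V →ₗ[ℝ] V'} (hA : Function.Injective A) (hB : Function.Injective B)
    {u v : V} (huv : LinearIndependent ℝ ![u, v]) {x y : ℝ} (hx : x ≠ 0) (hy : y ≠ 0)
    (h1 : ∃ r : ℝ, A u = r • B u) (h2 : ∃ r : ℝ, A v = r • B v)
    (h3 : ∃ r : ℝ, A (x • u + y • v) = r • B (x • u + y • v)) :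
    ∃ r : ℝ, r ≠ 0 ∧ ∀ s t : ℝ, A (s • u + t • v) = r • B (s • u + t • v) := by
  obtain ⟨r₁, h1⟩ := h1
  obtain ⟨r₂, h2⟩ := h2
  obtain ⟨r₃, h3⟩ := h3
  have h4 : B ((x * (r₁ - r₃)) • u + (y * (r₂ - r₃)) • v) = 0 := by
    simp only [map_add, map_smul, h1, h2] at h3 ⊢
    rw [← sub_eq_zero] at h3
    rw [← h3]
    module
  have h5 := LinearIndependent.pair_iff.1 huv _ _ (hB (h4.trans (map_zero B).symm))
  have h6 : r₁ = r₃ := by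
    rcases mul_eq_zero.1 h5.1 with h | h
    · exact absurd h hx
    · exact sub_eq_zero.1 h
  have h7 : r₂ = r₃ := by
    rcases mul_eq_zero.1 h5.2 with h | h
    · exact absurd h hy
    · exact sub_eq_zero.1 h
  refine ⟨r₃, ?_, fun s t => ?_⟩
  · rintro rfl
    rw [h6, zero_smul] at h1
    exact huv.ne_zero 0 (hA (h1.trans (map_zero A).symm))
  · simp only [map_add, map_smul, h1, h2, h6, h7]
    module

/-! ### Short leaf curves and factorization along a leaf -/

section LeafBox

open Prolong

variable {E : Type*} [NormedAddCommGroup E] [NormedSpace ℝ E]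
variable {Q : Type*} [TopologicalSpace Q] [T2Space Q] [ChartedSpace E Q] [IsManifold 𝓘(ℝ, E) ∞ Q]
variable {F : Type*} [NormedAddCommGroup F] [NormedSpace ℝ F] [FiniteDimensional ℝ F]
variable {M : Type*} [TopologicalSpace M] [ChartedSpace F M] [IsManifold 𝓘(ℝ, F) ∞ M]
variable {D : Distr E Q} {π : Q → M} {ξ : PlaneField F M}

/-- Points near `p` on the leaf through `p` are joined by short leaf curves. -/
theorem IsDevelopment.exists_leafBox {κ : DirKind} (hF : finrank ℝ F = 3) (hD : IsEngel D)
    (hπ : IsLeafQuotient F D π) (hξ : ξ.IsContact) {Ψ : Q → Prolong ξ κ}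
    (hΨ : IsDevelopment D π Ψ) (p : Q) {O : Set Q} (hO : IsOpen O) (hpO : p ∈ O) :
    ∃ U, IsOpen U ∧ p ∈ U ∧ U ⊆ O ∧
      (∀ a ∈ U ∩ leaf D p, ∀ b ∈ U ∩ leaf D p, ∃ γ, IsLeafCurve D O γ ∧ γ 0 = a ∧ γ 1 = b) ∧
      ∃ a ∈ U ∩ leaf D p, ∃ b ∈ U ∩ leaf D p, ∃ c ∈ U ∩ leaf D p, a ≠ b ∧ a ≠ c ∧ b ≠ c := by
  have hfin := hD.finiteDimensional
  have hcE : CompleteSpace E := FiniteDimensional.complete ℝ E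
  have hE := hΨ.isEngelImmersion hF hD hπ hξ
  obtain ⟨e, c, V, X₀, X₁, h, hp⟩ := exists_frameChartData (Ψ p)
  let N : Set Q := O ∩ Ψ ⁻¹' e.source
  have hN : IsOpen N := hO.inter (h.isOpen_source.preimage hE.smooth.continuous)
  -- A frame chart composed with the development gives local coordinates of `Q` in which the leaves
  -- are the lines of constant first component.
  obtain ⟨τ, hpτ, hτN, heq, hτs⟩ := exists_localInverse (E := E) (E' := F × ℝ)
    (f := fun x => e (Ψ x)) hN (q := p) ⟨hpO, hp⟩
    (fun x hx => CM.comp (f := Ψ) (g := e) (h.cm_e hx.2) (hE.smooth x)) (fun x hx => by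
      have h1 := dd_comp (f := Ψ) (g := e) (h.cm_e hx.2).mdiff (CM.mdiff (hE.smooth x))
      have h2 := (h.dd_e_invertible hx.2).comp (hE.isInvertible hD (isEngel_canonical hξ) x)
      exact h1 ▸ h2)
  have hfst : ∀ x ∈ τ.source, (τ x).1 = c (π x) := fun x hx => by
    rw [heq hx, (h.apply_eq _ (hτN hx).2).1, hΨ.base_eq]
  have hπV : ∀ x ∈ τ.source, π x ∈ c.source := fun x hx => by
    rw [← hΨ.base_eq]
    exact h.sub (h.base_mem (hτN hx).2)
  have hleaf : ∀ x, x ∈ leaf D p ↔ π x = π p := fun x => by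
    rw [← hπ.fiber_eq_leaf]; rfl
  obtain ⟨ε, hε, hball⟩ := Metric.isOpen_iff.1 τ.open_target (τ p) (τ.map_source hpτ)
  have hline : ∀ y ∈ Metric.ball (τ p) ε, y.1 = (τ p).1 → π (τ.symm y) = π p := by
    intro y hy hy1
    have hs := τ.map_target (hball hy)
    have h1 := hfst _ hs
    rw [τ.right_inv (hball hy), hy1, hfst p hpτ] at h1
    exact (c.injOn (hπV _ hpτ) (hπV _ hs) h1).symm
  refine ⟨τ.source ∩ τ ⁻¹' Metric.ball (τ p) ε, τ.isOpen_inter_preimage Metric.isOpen_ball,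
    ⟨hpτ, Metric.mem_ball_self hε⟩, fun x hx => (hτN hx.1).1, ?_, ?_⟩
  · rintro a ⟨⟨ha, haB⟩, hal⟩ b ⟨⟨hb, hbB⟩, hbl⟩
    have ha1 : (τ a).1 = (τ p).1 := by rw [hfst a ha, hfst p hpτ, (hleaf a).1 hal]
    have hb1 : (τ b).1 = (τ p).1 := by rw [hfst b hb, hfst p hpτ, (hleaf b).1 hbl]
    -- The segment from `τ a` to `τ b`, reparametrized so as to be smooth and to stay in the ball
    -- for all real times, as required of a leaf curve.
    let η : ℝ → F × ℝ := fun t => τ a + Real.smoothTransition t • (τ b - τ a)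
    have hη : ContDiff ℝ ∞ η :=
      contDiff_const.add (Real.smoothTransition.contDiff.smul contDiff_const)
    have hηB : ∀ t, η t ∈ Metric.ball (τ p) ε := fun t =>
      (convex_ball _ _).add_smul_sub_mem haB hbB
        ⟨Real.smoothTransition.nonneg t, Real.smoothTransition.le_one t⟩
    have hη1 : ∀ t, (η t).1 = (τ p).1 := fun t => by simp [η, ha1, hb1]
    have hsm : ∀ t, CM ℝ E (fun t => τ.symm (η t)) t := fun t =>
      CM.comp (f := η) (g := τ.symm) (hτs _ (hball (hηB t))) hη.contDiffAt.contMDiffAt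
    refine ⟨fun t => τ.symm (η t), ⟨hsm, fun t => (hτN (τ.map_target (hball (hηB t)))).1,
      fun t => (hπ.mem_charLine_iff hF hD _).2 ?_⟩, ?_, ?_⟩
    · rw [← dd_comp_apply (f := fun t => τ.symm (η t)) (g := π) (hπ.cm _).mdiff (hsm t).mdiff]
      have h1 : (fun t => π (τ.symm (η t))) = fun _ => π p :=
        funext fun t => hline _ (hηB t) (hη1 t)
      rw [h1, dd_const]
      rfl
    · simp [η, τ.left_inv ha]
    · simp [η, τ.left_inv hb]
  -- Three distinct points are found on the vertical line through `τ p`, at heights `0`, `ε / 2` and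
  -- `ε / 3` above it.
  · have hy : ∀ s : ℝ, |s| < ε → ((τ p).1, (τ p).2 + s) ∈ Metric.ball (τ p) ε := fun s hs => by
      rw [Metric.mem_ball, Prod.dist_eq]
      simpa [hε] using hs
    have hmem : ∀ s : ℝ, |s| < ε → τ.symm ((τ p).1, (τ p).2 + s) ∈
        (τ.source ∩ τ ⁻¹' Metric.ball (τ p) ε) ∩ leaf D p := fun s hs => by
      refine ⟨⟨τ.map_target (hball (hy s hs)), ?_⟩, (hleaf _).2 (hline _ (hy s hs) rfl)⟩
      rw [mem_preimage, τ.right_inv (hball (hy s hs))]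
      exact hy s hs
    have hne : ∀ s s' : ℝ, |s| < ε → |s'| < ε → s ≠ s' →
        τ.symm ((τ p).1, (τ p).2 + s) ≠ τ.symm ((τ p).1, (τ p).2 + s') := by
      intro s s' hs hs' hss h1
      have h2 := congrArg τ h1
      rw [τ.right_inv (hball (hy s hs)), τ.right_inv (hball (hy s' hs'))] at h2
      simp only [Prod.mk.injEq, true_and] at h2
      exact hss (add_left_cancel h2)
    have h0 : |(0 : ℝ)| < ε := by simpa using hε
    have h1 : |ε / 2| < ε := by rw [abs_of_pos (by positivity)]; linarith
    have h2 : |ε / 3| < ε := by rw [abs_of_pos (by positivity)]; linarith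
    exact ⟨_, hmem 0 h0, _, hmem _ h1, _, hmem _ h2, hne _ _ h0 h1 (by linarith),
      hne _ _ h0 h2 (by linarith), hne _ _ h1 h2 (by linarith)⟩

/-- Surjectivity of `dπ` at `a` makes the factorizing map unique there, so it is the same for all
leaf curves from `a`. It is injective because `dg` and `dπ` have the same kernel. -/
theorem IsLeafQuotient.factor_along_leaf (hF : finrank ℝ F = 3) (hD : IsEngel D)
    (hπ : IsLeafQuotient F D π)
    {F' : Type*} [NormedAddCommGroup F'] [NormedSpace ℝ F']
    {M' : Type*} [TopologicalSpace M'] [T2Space M'] [ChartedSpace F' M'] [IsManifold 𝓘(ℝ, F') ∞ M']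
    {g : Q → M'} {N : Set Q} (hN : IsOpen N) (hg : ∀ x ∈ N, CM E F' g x)
    (hL : ∀ x ∈ N, ∀ v : TangentSpace 𝓘(ℝ, E) x, dd E F' g x v = 0 ↔ v ∈ charLine D x) {a : Q} (ha : a ∈ N) :
    ∃ A : F →L[ℝ] F', Function.Injective A ∧ ∀ q, (∃ γ, IsLeafCurve D N γ ∧ γ 0 = a ∧ γ 1 = q) →
      g q = g a ∧ dd E F' g q = A.comp (dd E F π q) := by
  have hL' : ∀ x ∈ N, ∀ v ∈ charLine D x, dd E F' g x v = 0 := fun x hx v hv => (hL x hx v).2 hv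
  -- The constant curve defines `A` at `a`, even if no other curve is given.
  have hc : IsLeafCurve D N (fun _ => a) := ⟨fun t => contMDiffAt_const, fun t => ha, fun t => by
    rw [dd_const]
    exact Submodule.zero_mem _⟩
  obtain ⟨A, hA⟩ := hπ.factor_transport hF hD hN hg hL' hc 0
  have hA0 := (hA 0).2
  refine ⟨A, (injective_iff_map_eq_zero A).2 fun y hy => ?_, ?_⟩
  · obtain ⟨v, rfl⟩ := hπ.submersion a y
    have h1 : dd E F' g a v = 0 := by rw [hA0]; exact hy
    exact (hπ.mem_charLine_iff hF hD v).1 ((hL a ha v).1 h1)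
  · rintro _ ⟨γ, hγ, rfl, rfl⟩
    obtain ⟨B, hB⟩ := hπ.factor_transport hF hD hN hg hL' hγ 0
    have : B = A := by
      ext y
      obtain ⟨v, rfl⟩ := hπ.submersion (γ 0) y
      have h1 := (hB 0).2
      rw [hA0] at h1
      exact (congrArg (fun L : E →L[ℝ] F' => L v) h1).symm
    exact this ▸ hB 1

theorem IsLeafQuotient.exists_direction (hF : finrank ℝ F = 3) (hD : IsEngel D)
    (hπ : IsLeafQuotient F D π) (hξ : ∀ q, ξ.plane (π q) =
      (derived2 D q).map (mfderiv 𝓘(ℝ, E) 𝓘(ℝ, F) π q).toLinearMap) (q : Q) :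
    ∃ u : F, u ≠ 0 ∧ u ∈ ξ.plane (π q) ∧
      ∀ y : F, (∃ v ∈ D q, dd E F π q v = y) ↔ ∃ r : ℝ, y = r • u := by
  obtain ⟨U, W, X, hq, hf⟩ := exists_engelFrame hD q
  exact ⟨_, hπ.push_X_ne_zero hF hD hf hq, hπ.push_X_mem hF hD hξ hf hq,
    hπ.mem_map_iff hF hD hf hq⟩

end LeafBox

/-! ### Determination of Engel immersions by three points -/

section ThreePoints

open Prolong

variable {E : Type*} [NormedAddCommGroup E] [NormedSpace ℝ E]
variable {Q : Type*} [TopologicalSpace Q] [T2Space Q] [ChartedSpace E Q] [IsManifold 𝓘(ℝ, E) ∞ Q]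
variable {F : Type*} [NormedAddCommGroup F] [NormedSpace ℝ F] [FiniteDimensional ℝ F]
variable {M : Type*} [TopologicalSpace M] [ChartedSpace F M] [IsManifold 𝓘(ℝ, F) ∞ M]
variable {D : Distr E Q} {π : Q → M} {ξ : PlaneField F M}
variable {E' : Type*} [NormedAddCommGroup E'] [NormedSpace ℝ E']
variable {Q' : Type*} [TopologicalSpace Q'] [T2Space Q'] [ChartedSpace E' Q']
  [IsManifold 𝓘(ℝ, E') ∞ Q']
variable {F' : Type*} [NormedAddCommGroup F'] [NormedSpace ℝ F'] [FiniteDimensional ℝ F']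
variable {M' : Type*} [TopologicalSpace M'] [T2Space M'] [ChartedSpace F' M']
  [IsManifold 𝓘(ℝ, F') ∞ M']
variable {D' : Distr E' Q'} {π' : Q' → M'} {φ ψ : Q → Q'}

/-- The restriction of `φ` to the open set `N` is an Engel immersion. -/
structure IsEngelOn (D : Distr E Q) (D' : Distr E' Q') (N : Set Q) (φ : Q → Q') : Prop where
  smooth : ∀ x ∈ N, CM E E' φ x
  charLine_iff : ∀ x ∈ N, ∀ v : TangentSpace 𝓘(ℝ, E) x,
    (dd E E' φ x v : E') ∈ charLine D' (φ x) ↔ v ∈ charLine D x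
  image : ∀ x ∈ N, ∀ w : E', w ∈ D' (φ x) ↔ ∃ v ∈ D x, dd E E' φ x v = w

theorem IsEngelImmersion.isEngelOn (hD : IsEngel D) (hD' : IsEngel D')
    (hφ : IsEngelImmersion D D' φ) (N : Set Q) : IsEngelOn D D' N φ :=
  ⟨fun x _ => hφ.smooth x, fun _ _ v => hφ.mem_charLine_iff hD hD' v, fun x _ w => by
    rw [← hφ.map_eq x]; rfl⟩

theorem IsEngelOn.dd_eq_zero_iff (hF' : finrank ℝ F' = 3) (hD' : IsEngel D')
    (hπ' : IsLeafQuotient F' D' π') {N : Set Q} (hφ : IsEngelOn D D' N φ) {x : Q} (hx : x ∈ N)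
    (v : TangentSpace 𝓘(ℝ, E) x) :
    dd E F' (fun x => π' (φ x)) x v = 0 ↔ v ∈ charLine D x := by
  rw [dd_comp_vec (f := φ) (g := π') (hπ'.cm _).mdiff (hφ.smooth x hx).mdiff,
    ← hφ.charLine_iff x hx v]
  exact (hπ'.mem_charLine_iff hF' hD' _).symm

theorem IsEngelOn.image_iff (hπ' : IsLeafQuotient F' D' π') {N : Set Q}
    (hφ : IsEngelOn D D' N φ) {x : Q} (hx : x ∈ N) (y : F') :
    (∃ v ∈ D x, dd E F' (fun x => π' (φ x)) x v = y) ↔ ∃ w ∈ D' (φ x), dd E' F' π' (φ x) w = y := by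
  constructor
  · rintro ⟨v, hv, rfl⟩
    exact ⟨dd E E' φ x v, (hφ.image x hx _).2 ⟨v, hv, rfl⟩,
      (dd_comp_vec (f := φ) (g := π') (hπ'.cm _).mdiff (hφ.smooth x hx).mdiff v).symm⟩
  · rintro ⟨w, hw, rfl⟩
    obtain ⟨v, hv, rfl⟩ := (hφ.image x hx w).1 hw
    exact ⟨v, hv, dd_comp_vec (f := φ) (g := π') (hπ'.cm _).mdiff (hφ.smooth x hx).mdiff v⟩

/-- Engel immersions which agree at three points of a leaf with distinct developments have the
same development along the leaf. -/
theorem development_eq_of_three (hF : finrank ℝ F = 3) (hD : IsEngel D)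
    (hπ : IsLeafQuotient F D π) (hξ : ∀ q, ξ.plane (π q) =
      (derived2 D q).map (mfderiv 𝓘(ℝ, E) 𝓘(ℝ, F) π q).toLinearMap)
    {Ψ : Q → Prolong ξ .line} (hb : ∀ q, (Ψ q).base = π q)
    (hdir : ∀ q (y : F), y ∈ (Ψ q).dir ↔ (∃ v ∈ D q, dd E F π q v = y) ∧ y ≠ 0)
    (hF' : finrank ℝ F' = 3) (hD' : IsEngel D') (hπ' : IsLeafQuotient F' D' π')
    {N : Set Q} (hN : IsOpen N) (hφ : IsEngelOn D D' N φ) (hψ : IsEngelOn D D' N ψ)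
    {a b c : Q} (haN : a ∈ N) (hγb : ∃ γ, IsLeafCurve D N γ ∧ γ 0 = a ∧ γ 1 = b)
    (hγc : ∃ γ, IsLeafCurve D N γ ∧ γ 0 = a ∧ γ 1 = c)
    (hab : Ψ a ≠ Ψ b) (hac : Ψ a ≠ Ψ c) (hbc : Ψ b ≠ Ψ c)
    (ha : φ a = ψ a) (hb' : φ b = ψ b) (hc : φ c = ψ c)
    {q : Q} (hγ : ∃ γ, IsLeafCurve D N γ ∧ γ 0 = a ∧ γ 1 = q) :
    π' (φ q) = π' (ψ q) ∧ ∀ y : F', (∃ w ∈ D' (φ q), dd E' F' π' (φ q) w = y) ↔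
      ∃ w ∈ D' (ψ q), dd E' F' π' (ψ q) w = y := by
  have hcg : ∀ {φ : Q → Q'}, IsEngelOn D D' N φ → ∀ x ∈ N, CM E F' (fun x => π' (φ x)) x :=
    fun hφ x hx => CM.comp (g := π') (hπ'.cm _) (hφ.smooth x hx)
  obtain ⟨A, hAi, hA⟩ := hπ.factor_along_leaf hF hD hN (hcg hφ)
    (fun x hx v => hφ.dd_eq_zero_iff hF' hD' hπ' hx v) haN
  obtain ⟨B, hBi, hB⟩ := hπ.factor_along_leaf hF hD hN (hcg hψ)
    (fun x hx v => hψ.dd_eq_zero_iff hF' hD' hπ' hx v) haN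
  have hγN : ∀ {x}, (∃ γ, IsLeafCurve D N γ ∧ γ 0 = a ∧ γ 1 = x) → x ∈ N ∧ π x = π a := by
    rintro _ ⟨η, hη, rfl, rfl⟩
    exact ⟨hη.mem 1, hπ.apply_leafCurve hη 0 1⟩
  -- The given curve run at speed zero joins `a` to itself.
  have hγa : ∃ γ, IsLeafCurve D N γ ∧ γ 0 = a ∧ γ 1 = a := by
    obtain ⟨γ, h, h0, -⟩ := hγ
    exact ⟨fun t => γ (0 * t + 0), h.affine 0 0, by simpa using h0, by simpa using h0⟩
  have hu : ∀ x, π x = π a → ∃ u : F, u ≠ 0 ∧ u ∈ ξ.plane (π a) ∧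
      ∀ y : F, (∃ v ∈ D x, dd E F π x v = y) ↔ ∃ r : ℝ, y = r • u := by
    intro x hx
    rw [← hx]
    exact hπ.exists_direction hF hD hξ x
  -- Points of one leaf with distinct developments give independent directions in the plane of `ξ`.
  have hli : ∀ {x x'} {u u' : F}, π x = π a → π x' = π a → u ≠ 0 →
      (∀ y : F, (∃ v ∈ D x, dd E F π x v = y) ↔ ∃ r : ℝ, y = r • u) →
      (∀ y : F, (∃ v ∈ D x', dd E F π x' v = y) ↔ ∃ r : ℝ, y = r • u') → Ψ x ≠ Ψ x' → u' ≠ 0 →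
      LinearIndependent ℝ ![u, u'] := by
    intro x x' u u' hx hx' hu0 hux hux' hne hu0'
    rw [LinearIndependent.pair_iff' hu0]
    intro r hr
    apply hne
    refine Prolong.ext_of_mem (by rw [hb, hb, hx, hx']) fun y => ?_
    rw [hdir, hdir, hux, hux', ← hr]
    have hr0 : r ≠ 0 := by
      rintro rfl
      exact hu0' (by rw [← hr, zero_smul])
    refine and_congr_left fun _ => ⟨fun ⟨s, hs⟩ => ⟨s * r⁻¹, ?_⟩, fun ⟨s, hs⟩ => ⟨s * r, ?_⟩⟩
    · rw [hs, smul_smul, inv_mul_cancel_right₀ hr0]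
    · rw [hs, smul_smul]
  -- Where `φ` and `ψ` agree, both differentials carry the direction of `D` onto the projection of
  -- the same plane of `D'`, so `A` and `B` are proportional on this direction.
  have hprop : ∀ {x} {u : F}, (∃ γ, IsLeafCurve D N γ ∧ γ 0 = a ∧ γ 1 = x) → φ x = ψ x →
      (∀ y : F, (∃ v ∈ D x, dd E F π x v = y) ↔ ∃ r : ℝ, y = r • u) → ∃ r : ℝ, A u = r • B u := by
    intro x u hγx hx hux
    have hxN := (hγN hγx).1
    obtain ⟨v, hv, hvu⟩ := (hux u).2 ⟨1, (one_smul _ _).symm⟩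
    have h1 : dd E F' (fun x => π' (φ x)) x v = A u := by
      rw [(hA x hγx).2, ← hvu]; rfl
    have h2 : ∃ w ∈ D' (φ x), dd E' F' π' (φ x) w = A u :=
      (hφ.image_iff hπ' hxN (A u)).1 ⟨v, hv, h1⟩
    rw [hx] at h2
    obtain ⟨v', hv', h3⟩ := (hψ.image_iff hπ' hxN (A u)).2 h2
    obtain ⟨r, hr⟩ := (hux _).1 ⟨v', hv', rfl⟩
    refine ⟨r, ?_⟩
    rw [← h3, (hB x hγx).2, ← map_smul, ← hr]
    rfl
  obtain ⟨ua, ha0, haP, hua⟩ := hu a rfl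
  obtain ⟨ub, hb0, hbP, hub⟩ := hu b (hγN hγb).2
  obtain ⟨uc, hc0, hcP, huc⟩ := hu c (hγN hγc).2
  obtain ⟨uq, hq0, hqP, huq⟩ := hu q (hγN hγ).2
  have lab := hli rfl (hγN hγb).2 ha0 hua hub hab hb0
  have lac := hli rfl (hγN hγc).2 ha0 hua huc hac hc0
  have lbc := hli (hγN hγb).2 (hγN hγc).2 hb0 hub huc hbc hc0
  obtain ⟨x, y, hxy⟩ : ∃ x y : ℝ, uc = x • ua + y • ub := exists_coeff ξ haP hbP hcP lab
  obtain ⟨s, t, hst⟩ : ∃ x y : ℝ, uq = x • ua + y • ub := exists_coeff ξ haP hbP hqP lab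
  -- The third direction differs from the first two, so both of its coefficients are nonzero.
  have hx : x ≠ 0 := by
    rintro rfl
    rw [LinearIndependent.pair_iff' hb0] at lbc
    exact lbc y (by rw [hxy, zero_smul, zero_add])
  have hy : y ≠ 0 := by
    rintro rfl
    rw [LinearIndependent.pair_iff' ha0] at lac
    exact lac x (by rw [hxy, zero_smul, add_zero])
  obtain ⟨r, hr0, hr⟩ := exists_factor_of_three (A := A.toLinearMap) (B := B.toLinearMap) hAi hBi
    lab hx hy (hprop hγa ha hua) (hprop hγb hb' hub) (by rw [← hxy]; exact hprop hγc hc huc)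
  -- Being proportional on the whole plane, `A` and `B` also give the same line in the direction at
  -- `q`.
  have hrq : A uq = r • B uq := by rw [hst]; exact hr s t
  have hqN := (hγN hγ).1
  refine ⟨?_, fun y => ?_⟩
  · rw [(hA q hγ).1, (hB q hγ).1, ha]
  · rw [← hφ.image_iff hπ' hqN, ← hψ.image_iff hπ' hqN]
    constructor
    · rintro ⟨v, hv, rfl⟩
      obtain ⟨z, hz⟩ := (huq _).1 ⟨v, hv, rfl⟩
      obtain ⟨v', hv', h'⟩ := (huq ((z * r) • uq)).2 ⟨_, rfl⟩
      refine ⟨v', hv', ?_⟩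
      have h1 : B (dd E F π q v') = A (dd E F π q v) := by
        rw [h', hz, map_smul, map_smul, hrq, smul_smul]
      rw [(hA q hγ).2, (hB q hγ).2]
      exact h1
    · rintro ⟨v, hv, rfl⟩
      obtain ⟨z, hz⟩ := (huq _).1 ⟨v, hv, rfl⟩
      obtain ⟨v', hv', h'⟩ := (huq ((z * r⁻¹) • uq)).2 ⟨_, rfl⟩
      refine ⟨v', hv', ?_⟩
      have h1 : A (dd E F π q v') = B (dd E F π q v) := by
        rw [h', hz, map_smul, map_smul, hrq, smul_smul, inv_mul_cancel_right₀ hr0]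
      rw [(hA q hγ).2, (hB q hγ).2]
      exact h1

/-- Three points of a leaf with distinct developments determine an Engel immersion into an Engel
manifold with nice leaf space along the leaf. -/
theorem IsEngelImmersion.eqOn_leaf_of_three (hF : finrank ℝ F = 3) (hD : IsEngel D)
    (hπ : IsLeafQuotient F D π) (hξ : ∀ q, ξ.plane (π q) =
      (derived2 D q).map (mfderiv 𝓘(ℝ, E) 𝓘(ℝ, F) π q).toLinearMap)
    {Ψ : Q → Prolong ξ .line} (hb : ∀ q, (Ψ q).base = π q)
    (hdir : ∀ q (y : F), y ∈ (Ψ q).dir ↔ (∃ v ∈ D q, dd E F π q v = y) ∧ y ≠ 0)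
    (hF' : finrank ℝ F' = 3) (hD' : IsEngel D') (hπ' : IsLeafQuotient F' D' π')
    (hφ : IsEngelImmersion D D' φ) (hψ : IsEngelImmersion D D' ψ) {p a b c : Q}
    (hap : a ∈ leaf D p) (hbp : b ∈ leaf D p) (hcp : c ∈ leaf D p)
    (hab : Ψ a ≠ Ψ b) (hac : Ψ a ≠ Ψ c) (hbc : Ψ b ≠ Ψ c)
    (ha : φ a = ψ a) (hb' : φ b = ψ b) (hc : φ c = ψ c) : EqOn φ ψ (leaf D p) := by
  obtain ⟨ξ', hξ', hcon⟩ := hπ'.exists_contact hF' hD'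
  obtain ⟨Ψ', -, hΨ', hdir'⟩ := hπ'.exists_lineDevelopment hF' hD' hξ'
  have hloc := (hΨ'.isEngelImmersion hF' hD' hπ' hcon).isLocalHomeomorph hD'
    (isEngel_canonical hcon)
  have hleaf : leaf D a = leaf D p := by
    rw [← hπ.fiber_eq_leaf] at hap
    rw [← hπ.fiber_eq_leaf, ← hπ.fiber_eq_leaf, show π a = π p from hap]
  rw [← hleaf] at hbp hcp ⊢
  rintro q hq
  have key : ∀ x ∈ leaf D a, Ψ' (φ x) = Ψ' (ψ x) := by
    intro x hx
    obtain ⟨h1, h2⟩ := development_eq_of_three hF hD hπ hξ hb hdir hF' hD' hπ' isOpen_univ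
      (hφ.isEngelOn hD hD' univ) (hψ.isEngelOn hD hD' univ) (mem_univ a) (mem_leaf_iff.1 hbp)
      (mem_leaf_iff.1 hcp) hab hac hbc ha hb' hc (mem_leaf_iff.1 hx)
    refine Prolong.ext_of_mem (by rw [hΨ'.base_eq, hΨ'.base_eq, h1]) fun y => ?_
    rw [hdir', hdir', h2]
  obtain ⟨γ, hγ, rfl, rfl⟩ := mem_leaf_iff.1 hq
  -- Along a leaf curve both maps are lifts of the same curve through the locally injective
  -- development of the target. As they agree at time zero, they agree always.
  have h1 := (T2Space.isSeparatedMap Ψ').eq_of_comp_eq hloc.isLocallyInjective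
    (g₁ := fun t => φ (γ t)) (g₂ := fun t => ψ (γ t)) (hφ.smooth.continuous.comp hγ.continuous)
    (hψ.smooth.continuous.comp hγ.continuous) (funext fun t => key _ (hγ.mem_leaf 0 t)) 0 ha
  exact congrFun h1 1

/-- Local version of unique determination by three points, without a leaf space of the target. -/
theorem IsEngelImmersion.exists_nhd_eq_of_three [T2Space M] (hF : finrank ℝ F = 3) (hD : IsEngel D)
    (hπ : IsLeafQuotient F D π) (hD' : IsEngel D')
    (hφ : IsEngelImmersion D D' φ) (hψ : IsEngelImmersion D D' ψ) (p : Q) :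
    ∃ U, IsOpen U ∧ p ∈ U ∧ ∀ a ∈ U ∩ leaf D p, ∀ b ∈ U ∩ leaf D p, ∀ c ∈ U ∩ leaf D p,
      a ≠ b → a ≠ c → b ≠ c → φ a = ψ a → φ b = ψ b → φ c = ψ c → EqOn φ ψ (U ∩ leaf D p) := by
  have hfin := hD.finiteDimensional
  have hcE : CompleteSpace E := FiniteDimensional.complete ℝ E
  -- If `φ` and `ψ` differ at `p`, they take values in disjoint sets near `p`, and the hypothesis on
  -- three points is never met.
  by_cases hp : φ p = ψ p
  swap
  · obtain ⟨u, v, hu, hv, hpu, hpv, huv⟩ := t2_separation hp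
    refine ⟨φ ⁻¹' u ∩ ψ ⁻¹' v, (hu.preimage hφ.smooth.continuous).inter
      (hv.preimage hψ.smooth.continuous), ⟨hpu, hpv⟩, ?_⟩
    rintro a ⟨⟨h1, h2⟩, -⟩ _ _ _ _ _ _ _ ha
    rw [mem_preimage, ← ha] at h2
    exact absurd h2 (disjoint_left.1 huv h1)
  obtain ⟨ξ, hξ, hcon⟩ := hπ.exists_contact hF hD
  obtain ⟨Ψ, -, hΨ, hdir⟩ := hπ.exists_lineDevelopment hF hD hξ
  obtain ⟨OΨ, hOΨ, hpO, hinj⟩ := ((hΨ.isEngelImmersion hF hD hπ hcon).isLocalHomeomorph hD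
    (isEngel_canonical hcon)).isLocallyInjective p
  obtain ⟨e, hpe, -, heq, hes⟩ := exists_localInverse isOpen_univ (mem_univ p)
    (fun x _ => hφ.smooth x) (fun x _ => hφ.isInvertible hD hD' x)
  have hV : IsOpen (ψ ⁻¹' e.target) := e.open_target.preimage hψ.smooth.continuous
  -- With no leaf space for the target, `ψ` is composed with a local inverse of `φ`. The result maps
  -- into `Q`, whose leaf space is available, and agreement of `φ` and `ψ` becomes agreement of `χ`
  -- with the identity.
  let χ : Q → Q := fun x => e.symm (ψ x)
  have hχ : ∀ x ∈ ψ ⁻¹' e.target, CM E E χ x := fun x hx =>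
    CM.comp (f := ψ) (g := e.symm) (hes _ hx) (hψ.smooth x)
  have hφχ : ∀ x ∈ ψ ⁻¹' e.target, φ (χ x) = ψ x := fun x hx => by
    rw [← heq (e.map_target hx)]
    exact e.right_inv hx
  have hχe : ∀ x ∈ e.source, φ x = ψ x → χ x = x := fun x hx h => by
    change e.symm (ψ x) = x
    rw [← h, ← heq hx, e.left_inv hx]
  have hdd : ∀ x ∈ ψ ⁻¹' e.target, ∀ v : TangentSpace 𝓘(ℝ, E) x,
      dd E E' φ (χ x) (dd E E χ x v) = dd E E' ψ x v := fun x hx v => by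
    rw [← dd_comp_vec (f := χ) (g := φ) (CM.mdiff (hφ.smooth _)) (hχ x hx).mdiff]
    exact congrArg (fun L : E →L[ℝ] E' => L v)
      (dd_congr ((hV.eventually_mem hx).mono fun y hy => hφχ y hy))
  have hχE : IsEngelOn D D (ψ ⁻¹' e.target) χ := by
    refine ⟨hχ, fun x hx v => ?_, fun x hx w => ⟨fun hw => ?_, ?_⟩⟩
    · have h1 := hφ.mem_charLine_iff hD hD' (q := χ x) (dd E E χ x v)
      have h2 := hψ.mem_charLine_iff hD hD' (q := x) v
      rw [hdd x hx, hφχ x hx] at h1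
      exact h1.symm.trans h2
    · have h1 := (hφ.mem_iff (χ x) w).2 hw
      rw [hφχ x hx, ← hψ.map_eq x] at h1
      obtain ⟨v, hv, hvw⟩ := h1
      exact ⟨v, hv, hφ.immersion (χ x) ((hdd x hx v).trans hvw)⟩
    · rintro ⟨v, hv, rfl⟩
      have h1 := hφ.mem_iff (χ x) (dd E E χ x v)
      rw [hdd x hx, hφχ x hx] at h1
      exact h1.1 ((hψ.mem_iff x v).2 hv)
  have hχO : IsOpen (ψ ⁻¹' e.target ∩ χ ⁻¹' OΨ) :=
    ContinuousOn.isOpen_inter_preimage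
      (fun x hx => (hχ x hx).continuousAt.continuousWithinAt) hV hOΨ
  -- Here `χ` is defined, and both a point and its image under `χ` lie where the development is
  -- injective.
  let O : Set Q := (ψ ⁻¹' e.target ∩ χ ⁻¹' OΨ) ∩ (OΨ ∩ e.source)
  have hO : IsOpen O := hχO.inter (hOΨ.inter e.open_source)
  have hpO : p ∈ O := by
    refine ⟨⟨?_, ?_⟩, hpO, hpe⟩
    · rw [mem_preimage, ← hp, ← heq hpe]
      exact e.map_source hpe
    · rw [mem_preimage, hχe p hpe hp]
      exact hpO
  obtain ⟨U, hU, hpU, hUO, hbox, -⟩ := hΨ.exists_leafBox hF hD hπ hcon p hO hpO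
  refine ⟨U, hU, hpU, fun a ha b hb c hc hab hac hbc ea eb ec q hq => ?_⟩
  have hne : ∀ x ∈ U, ∀ y ∈ U, x ≠ y → Ψ x ≠ Ψ y := fun x hx y hy hxy h =>
    hxy (hinj (hUO hx).2.1 (hUO hy).2.1 h)
  have hid : IsEngelOn D D O id := by
    refine ⟨fun x _ => contMDiffAt_id, fun x _ v => ?_, fun x _ w => ?_⟩
    · rw [dd_id]; rfl
    · rw [dd_id]
      exact ⟨fun hw => ⟨w, hw, rfl⟩, fun ⟨v, hv, hvw⟩ => hvw ▸ hv⟩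
  have hχO' : IsEngelOn D D O χ := ⟨fun x hx => hχE.smooth x hx.1.1,
    fun x hx => hχE.charLine_iff x hx.1.1, fun x hx => hχE.image x hx.1.1⟩
  obtain ⟨h1, h2⟩ := development_eq_of_three hF hD hπ hξ hΨ.base_eq hdir hF hD hπ hO hχO' hid
    (hUO ha.1) (hbox a ha b hb) (hbox a ha c hc) (hne a ha.1 b hb.1 hab) (hne a ha.1 c hc.1 hac)
    (hne b hb.1 c hc.1 hbc) (hχe a (hUO ha.1).2.2 ea) (hχe b (hUO hb.1).2.2 eb)
    (hχe c (hUO hc.1).2.2 ec) (hbox a ha q hq)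
  have h3 : Ψ (χ q) = Ψ q := by
    refine Prolong.ext_of_mem (by rw [hΨ.base_eq, hΨ.base_eq]; exact h1) fun y => ?_
    rw [hdir, hdir, h2]
    rfl
  have h4 : χ q = q := hinj (hUO hq.1).1.2 (hUO hq.1).2.1 h3
  have h5 := hφχ q (hUO hq.1).1.1
  rwa [h4] at h5

/-- Local agreement propagates: the times of a leaf curve near whose points `φ` and `ψ` agree along
the leaf form a clopen set, because any open piece of agreement contains the three points needed for
the local statement at a limit. -/
theorem IsEngelImmersion.exists_nhds_eqOn_leaf_of_three [T2Space M] (hF : finrank ℝ F = 3)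
    (hD : IsEngel D) (hπ : IsLeafQuotient F D π) (hD' : IsEngel D')
    (hφ : IsEngelImmersion D D' φ) (hψ : IsEngelImmersion D D' ψ) (p : Q) :
    ∃ U ∈ 𝓝 p, ∀ a ∈ U ∩ leaf D p, ∀ b ∈ U ∩ leaf D p, ∀ c ∈ U ∩ leaf D p,
      a ≠ b → a ≠ c → b ≠ c → φ a = ψ a → φ b = ψ b → φ c = ψ c → EqOn φ ψ (leaf D p) := by
  obtain ⟨ξ, hξ, hcon⟩ := hπ.exists_contact hF hD
  obtain ⟨Ψ, -, hΨ, -⟩ := hπ.exists_lineDevelopment hF hD hξ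
  choose U hU hpU h3 using hφ.exists_nhd_eq_of_three hF hD hπ hD' hψ
  refine ⟨U p, (hU p).mem_nhds (hpU p), fun a ha b hb c hc hab hac hbc ea eb ec q hq => ?_⟩
  obtain ⟨γ, hγ, rfl, rfl⟩ := mem_leaf_iff.1 hq
  have hleaf : ∀ t, leaf D (γ t) = leaf D (γ 0) := fun t => by
    rw [← hπ.fiber_eq_leaf, ← hπ.fiber_eq_leaf, hπ.apply_leafCurve hγ 0 t]
  let S : Set ℝ := {t | ∃ O, IsOpen O ∧ γ t ∈ O ∧ EqOn φ ψ (O ∩ leaf D (γ 0))}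
  have hSo : IsOpen S := by
    refine isOpen_iff_mem_nhds.2 fun t ⟨O, hO, ht, h⟩ => ?_
    filter_upwards [(hO.preimage hγ.continuous).mem_nhds ht] with s hs
    exact ⟨O, hO, hs, h⟩
  have hSc : IsClosed S := by
    refine isClosed_of_closure_subset fun t ht => ?_
    obtain ⟨s, hs, O, hO, hsO, hOeq⟩ := mem_closure_iff.1 ht _
      ((hU (γ t)).preimage hγ.continuous) (hpU (γ t))
    -- A point `γ s` close to the limit point lies both in a set of agreement and in the
    -- neighborhood of `γ t` where three points suffice; three distinct points of the leaf are taken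
    -- in the intersection.
    obtain ⟨V, -, -, hVO, -, x, hx, y, hy, z, hz, hxy, hxz, hyz⟩ :=
      hΨ.exists_leafBox hF hD hπ hcon (γ s) (hO.inter (hU (γ t))) ⟨hsO, hs⟩
    rw [hleaf s] at hx hy hz
    have h4 := h3 (γ t)
    rw [hleaf t] at h4
    exact ⟨_, hU _, hpU _, h4 x ⟨(hVO hx.1).2, hx.2⟩ y ⟨(hVO hy.1).2, hy.2⟩ z
      ⟨(hVO hz.1).2, hz.2⟩ hxy hxz hyz (hOeq ⟨(hVO hx.1).1, hx.2⟩) (hOeq ⟨(hVO hy.1).1, hy.2⟩)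
      (hOeq ⟨(hVO hz.1).1, hz.2⟩)⟩
  have hS := (IsClopen.eq_univ ⟨hSc, hSo⟩
    ⟨0, _, hU _, hpU _, h3 _ a ha b hb c hc hab hac hbc ea eb ec⟩ : S = univ)
  obtain ⟨O, -, h1, h2⟩ := (hS ▸ mem_univ 1 : (1 : ℝ) ∈ S)
  exact h2 ⟨h1, hγ.mem_leaf 0 1⟩

end ThreePoints

/-! ### Positively related families and positive bases -/

section PosRel

variable {V V' : Type*} [AddCommGroup V] [Module ℝ V] [AddCommGroup V'] [Module ℝ V'] {k : ℕ}

/-- The family `v'` is obtained from `v` by a matrix of positive determinant. -/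
def PosRel (v v' : Fin k → V) : Prop :=
  ∃ A : Matrix (Fin k) (Fin k) ℝ, 0 < A.det ∧ ∀ j, v' j = ∑ i, A i j • v i

theorem sum_mul_smul {A B : Matrix (Fin k) (Fin k) ℝ} {v v' : Fin k → V}
    (hA : ∀ j, v' j = ∑ i, A i j • v i) (j : Fin k) :
    ∑ i, B i j • v' i = ∑ i, (A * B) i j • v i := by
  simp only [hA, Finset.smul_sum, smul_smul, Matrix.mul_apply, Finset.sum_smul]
  rw [Finset.sum_comm]
  exact Finset.sum_congr rfl fun i _ => Finset.sum_congr rfl fun l _ => by rw [mul_comm]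

theorem PosRel.trans {v v' v'' : Fin k → V} (h : PosRel v v') (h' : PosRel v' v'') :
    PosRel v v'' := by
  obtain ⟨A, hA, h⟩ := h
  obtain ⟨B, hB, h'⟩ := h'
  exact ⟨A * B, by rw [Matrix.det_mul]; positivity, fun j => (h' j).trans (sum_mul_smul h j)⟩

theorem PosRel.symm {v v' : Fin k → V} (h : PosRel v v') : PosRel v' v := by
  obtain ⟨A, hA, h⟩ := h
  refine ⟨A⁻¹, ?_, fun j => ?_⟩
  · rw [Matrix.det_nonsing_inv, Ring.inverse_eq_inv']
    exact inv_pos.2 hA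
  · rw [sum_mul_smul h, Matrix.mul_nonsing_inv A (isUnit_iff_ne_zero.2 hA.ne')]
    simp [Matrix.one_apply]

theorem PosRel.pair {x y x' y' : V} (a b c d : ℝ) (h : 0 < a * d - b * c)
    (hx : x' = a • x + b • y) (hy : y' = c • x + d • y) : PosRel ![x, y] ![x', y'] := by
  refine ⟨!![a, c; b, d], ?_, fun j => ?_⟩
  · rw [Matrix.det_fin_two_of]
    linarith
  · fin_cases j <;> simp [Fin.sum_univ_two, hx, hy]

theorem PosRel.triple {x y z x' y' z' : V} (a b c d e f : ℝ) (h : 0 < a * c * f)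
    (hx : x' = a • x) (hy : y' = b • x + c • y) (hz : z' = d • x + e • y + f • z) :
    PosRel ![x, y, z] ![x', y', z'] := by
  refine ⟨!![a, b, d; 0, c, e; 0, 0, f], ?_, fun j => ?_⟩
  · rw [Matrix.det_fin_three]
    simpa using h
  · fin_cases j <;> simp [Fin.sum_univ_three, hx, hy, hz]

theorem det_cons_cons (A : Matrix (Fin k) (Fin k) ℝ) (f : ℝ) (r : Fin k → ℝ) :
    (Matrix.of (Fin.cons (Fin.cons f r) fun i => Fin.cons 0 (A i)) :
      Matrix (Fin (k + 1)) (Fin (k + 1)) ℝ).det = f * A.det := by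
  rw [Matrix.det_succ_column_zero, Fin.sum_univ_succ]
  simp only [Fin.val_zero, pow_zero, Matrix.of_apply, Fin.cons_zero, one_mul, Fin.cons_succ,
    mul_zero, zero_mul, Finset.sum_const_zero, add_zero]
  rfl

/-- Lifting positivity along a linear map whose kernel is a line. -/
theorem PosRel.cons (P : V →ₗ[ℝ] V') {w w' : V} {f : ℝ} (hf : 0 < f) (hw : w' = f • w)
    (hP : ∀ v, P v = 0 → ∃ r : ℝ, v = r • w) {v v' : Fin k → V}
    (h : PosRel (fun i => P (v i)) fun i => P (v' i)) :
    PosRel (Fin.cons w v : Fin (k + 1) → V) (Fin.cons w' v') := by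
  obtain ⟨A, hA, h⟩ := h
  -- The relation between the projections lifts up to multiples of `w`. These only fill the first
  -- row, so the determinant is multiplied by `f`.
  have h1 : ∀ j, ∃ r : ℝ, v' j - ∑ i, A i j • v i = r • w := fun j => hP _ (by
    rw [map_sub, map_sum, sub_eq_zero]
    simpa using h j)
  choose r hr using h1
  refine ⟨_, (det_cons_cons A f r).symm ▸ mul_pos hf hA, fun j => ?_⟩
  rw [Fin.sum_univ_succ]
  refine Fin.cases ?_ (fun j => ?_) j
  · simp [hw]
  · simp [← hr]

theorem exists_matrix_of_mem_span {v v' : Fin k → V}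
    (h : ∀ j, v' j ∈ Submodule.span ℝ (range v)) :
    ∃ A : Matrix (Fin k) (Fin k) ℝ, ∀ j, v' j = ∑ i, A i j • v i := by
  choose c hc using fun j => (Submodule.mem_span_range_iff_exists_fun ℝ).1 (h j)
  exact ⟨fun i j => c j i, fun j => (hc j).symm⟩

/-- The coefficient matrix with respect to the family at `t₀` depends continuously on `t` and is the
identity at `t₀`, so its determinant stays positive. -/
theorem eventually_posRel {F : Type*} [NormedAddCommGroup F] [NormedSpace ℝ F]
    [FiniteDimensional ℝ F] {v : ℝ → Fin k → F} {t₀ : ℝ}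
    (hv : ContinuousAt v t₀) (hli : LinearIndependent ℝ (v t₀))
    (hs : ∀ᶠ t in 𝓝 t₀, ∀ j, v t j ∈ Submodule.span ℝ (range (v t₀))) :
    ∀ᶠ t in 𝓝 t₀, PosRel (v t₀) (v t) := by
  classical
  let b := Basis.span hli
  -- Coordinates on the span are extended to the whole space to obtain a continuous linear map that
  -- can be applied without membership proofs.
  obtain ⟨g, hg⟩ := LinearMap.exists_extend b.equivFun.toLinearMap
  have hgc : Continuous g := g.continuous_of_finiteDimensional
  have hgm : ∀ y (hy : y ∈ Submodule.span ℝ (range (v t₀))), y = ∑ i, g y i • v t₀ i := by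
    intro y hy
    have h1 : g y = b.equivFun ⟨y, hy⟩ := LinearMap.congr_fun hg ⟨y, hy⟩
    have h2 := congrArg Subtype.val (b.sum_equivFun ⟨y, hy⟩)
    rw [h1]
    rw [AddSubmonoidClass.coe_finsetSum] at h2
    refine h2.symm.trans (Finset.sum_congr rfl fun i _ => ?_)
    rw [Submodule.coe_smul, Basis.span_apply hli]
  let A : ℝ → Matrix (Fin k) (Fin k) ℝ := fun t i j => g (v t j) i
  have hA : ContinuousAt (fun t => (A t).det) t₀ := by
    have h1 : ContinuousAt A t₀ := by
      refine continuousAt_pi.2 fun i => continuousAt_pi.2 fun j => ?_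
      have h2 : ContinuousAt (fun t => v t j) t₀ := (continuousAt_pi.1 hv) j
      exact ((continuous_apply i).comp hgc).continuousAt.comp h2
    exact (Continuous.matrix_det continuous_id).continuousAt.comp h1
  have hA0 : A t₀ = 1 := by
    ext i j
    have h1 : g (v t₀ j) = b.equivFun (b j) := by
      have h2 : g (b j : F) = b.equivFun (b j) := LinearMap.congr_fun hg (b j)
      rw [← h2]
      simp [b, Basis.span_apply hli]
    change g (v t₀ j) i = _
    rw [h1, Basis.equivFun_self, Matrix.one_apply]
    simp only [eq_comm]
  have hpos : 0 < (A t₀).det := by rw [hA0, Matrix.det_one]; exact one_pos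
  filter_upwards [hs, hA.eventually_const_lt hpos] with t ht ht'
  exact ⟨A t, ht', fun j => hgm _ (ht j)⟩

variable {P : Submodule ℝ V}

theorem Module.Basis.det_eq_of_sum (b : Basis (Fin k) ℝ P) {A : Matrix (Fin k) (Fin k) ℝ}
    {v' : Fin k → P} (h : ∀ j, (v' j : V) = ∑ i, A i j • (b i : V)) : b.det v' = A.det := by
  rw [Basis.det_apply]
  congr 1
  ext i j
  have h1 : v' j = ∑ i, A i j • b i := Subtype.ext (by simpa using h j)
  rw [Basis.toMatrix_apply, h1]
  simp [Finsupp.single_apply]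

theorem exists_basis_of_span {v : Fin k → V} (hli : LinearIndependent ℝ v)
    (hs : P = Submodule.span ℝ (range v)) : ∃ b : Basis (Fin k) ℝ P, ∀ i, (b i : V) = v i := by
  subst hs
  exact ⟨Basis.span hli, fun i => congrArg Subtype.val (Basis.span_apply hli i)⟩

/-- The vectors `v` form a positive basis of the oriented subspace `P`. -/
def IsPosBasis (o : Orientation ℝ P (Fin k)) (v : Fin k → V) : Prop :=
  ∃ b : Basis (Fin k) ℝ P, (∀ i, (b i : V) = v i) ∧ b.orientation = o

variable {o : Orientation ℝ P (Fin k)} {v v' : Fin k → V}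

theorem IsPosBasis.linearIndependent (h : IsPosBasis o v) : LinearIndependent ℝ v := by
  obtain ⟨b, hb, -⟩ := h
  have := b.linearIndependent.map' P.subtype P.ker_subtype
  rwa [show P.subtype ∘ b = v from funext hb] at this

theorem IsPosBasis.span_eq (h : IsPosBasis o v) : Submodule.span ℝ (range v) = P := by
  obtain ⟨b, hb, -⟩ := h
  rw [← show P.subtype ∘ b = v from funext hb, range_comp, Submodule.span_image, b.span_eq,
    Submodule.map_subtype_top]

theorem IsPosBasis.mem (h : IsPosBasis o v) (i : Fin k) : v i ∈ P := by
  obtain ⟨b, hb, -⟩ := h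
  exact hb i ▸ (b i).2

theorem IsPosBasis.det_pos (h : IsPosBasis o v) (h' : IsPosBasis o v')
    {A : Matrix (Fin k) (Fin k) ℝ} (hA : ∀ j, v' j = ∑ i, A i j • v i) : 0 < A.det := by
  obtain ⟨b, hb, hbo⟩ := h
  obtain ⟨b', hb', hbo'⟩ := h'
  rw [← b.det_eq_of_sum (v' := b') fun j => by rw [hb', hA]; simp [hb]]
  exact (b.orientation_eq_iff_det_pos b').1 (hbo.trans hbo'.symm)

theorem IsPosBasis.posRel (h : IsPosBasis o v) (h' : IsPosBasis o v') : PosRel v v' := by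
  obtain ⟨A, hA⟩ := exists_matrix_of_mem_span (v := v) (v' := v') fun j => by
    rw [h.span_eq]
    exact h'.mem j
  exact ⟨A, h.det_pos h' hA, hA⟩

theorem orientation_eq_of_posRel {b b' : Basis (Fin k) ℝ P}
    (h : PosRel (fun i => (b i : V)) fun i => (b' i : V)) : b.orientation = b'.orientation := by
  obtain ⟨A, hA, h⟩ := h
  rw [b.orientation_eq_iff_det_pos, b.det_eq_of_sum h]
  exact hA

theorem IsPosBasis.of_posRel (h : IsPosBasis o v) (hv : PosRel v v') : IsPosBasis o v' := by
  have hli := h.linearIndependent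
  obtain ⟨b, hb, hbo⟩ := id h
  obtain ⟨A, hA, hv'⟩ := id hv
  obtain ⟨B, hB, hv⟩ := hv.symm
  have hsp : P = Submodule.span ℝ (range v') := by
    rw [← h.span_eq]
    apply le_antisymm
    · refine Submodule.span_le.2 ?_
      rintro _ ⟨j, rfl⟩
      rw [SetLike.mem_coe, hv]
      exact Submodule.sum_mem _ fun i _ => Submodule.smul_mem _ _ (Submodule.subset_span ⟨i, rfl⟩)
    · refine Submodule.span_le.2 ?_
      rintro _ ⟨j, rfl⟩
      rw [SetLike.mem_coe, hv']
      exact Submodule.sum_mem _ fun i _ => Submodule.smul_mem _ _ (Submodule.subset_span ⟨i, rfl⟩)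
  have hli' : LinearIndependent ℝ v' := by
    rw [linearIndependent_iff_card_eq_finrank_span, Set.finrank, ← hsp,
      Module.finrank_eq_card_basis b]
  obtain ⟨b', hb'⟩ := exists_basis_of_span hli' hsp
  refine ⟨b', hb', ?_⟩
  rw [← hbo]
  refine (orientation_eq_of_posRel ?_).symm
  rw [show (fun i => (b i : V)) = v from funext hb, show (fun i => (b' i : V)) = v' from funext hb']
  exact ⟨A, hA, hv'⟩

/-- One of two bases related by a matrix of negative determinant is positive. -/
theorem IsPosBasis.or_of_det_neg (h : IsPosBasis o v) {u u' : Fin k → V}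
    (hu : LinearIndependent ℝ u) (huP : ∀ i, u i ∈ P) {A : Matrix (Fin k) (Fin k) ℝ}
    (hA : A.det < 0) (huu' : ∀ j, u' j = ∑ i, A i j • u i) : IsPosBasis o u ∨ IsPosBasis o u' := by
  obtain ⟨B, hB⟩ := exists_matrix_of_mem_span (v := v) (v' := u) fun j => by
    rw [h.span_eq]
    exact huP j
  -- A kernel vector of `B` would be a linear relation between the vectors `u j`.
  have hB0 : B.det ≠ 0 := by
    intro h0
    obtain ⟨c, hc, hBc⟩ := Matrix.exists_mulVec_eq_zero_iff.2 h0
    apply hc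
    have h1 : ∑ j, c j • u j = 0 := by
      simp only [hB, Finset.smul_sum, smul_smul]
      rw [Finset.sum_comm]
      refine Finset.sum_eq_zero fun i _ => ?_
      rw [← Finset.sum_smul]
      have h2 := congrFun hBc i
      simp only [Matrix.mulVec, dotProduct, Pi.zero_apply] at h2
      rw [show ∑ j, c j * B i j = 0 by rw [← h2]; exact Finset.sum_congr rfl fun j _ => mul_comm _ _,
        zero_smul]
    exact funext (Fintype.linearIndependent_iff.1 hu c h1)
  rcases hB0.lt_or_gt with h0 | h0
  · refine Or.inr (h.of_posRel ⟨B * A, ?_, fun j => (huu' j).trans (sum_mul_smul hB j)⟩)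
    rw [Matrix.det_mul]
    exact mul_pos_of_neg_of_neg h0 hA
  · exact Or.inl (h.of_posRel ⟨B, h0, hB⟩)

end PosRel

/-! ### Orientations of distributions by local frames -/

section DistrOrientation

variable {E : Type*} [NormedAddCommGroup E] [NormedSpace ℝ E]
variable {Q : Type*} [TopologicalSpace Q] [ChartedSpace E Q] [IsManifold 𝓘(ℝ, E) ∞ Q]
variable {k : ℕ} {D : Distr E Q}

theorem DistrOrientation.exists_isPos (o : DistrOrientation k D) (q : Q) : ∃ v, o.IsPos q v := by
  obtain ⟨U, -, hq, X, -, h⟩ := o.continuous q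
  obtain ⟨b, hb⟩ := h q hq
  exact ⟨_, b, hb⟩

/-- The determinant comparing the frame with one of the positive frames given by the orientation is
continuous, so its sign is locally constant. -/
theorem DistrOrientation.eventually_isPos [FiniteDimensional ℝ E] (o : DistrOrientation k D)
    {U : Set Q} (hU : IsOpen U) {X : Fin k → VField E Q} (hX : ∀ i, IsSection D U (X i)) {q : Q}
    (hq : q ∈ U) (h : o.IsPos q fun i => X i q) : ∀ᶠ x in 𝓝 q, o.IsPos x fun i => X i x := by
  obtain ⟨U', hU', hq', Y, hY, hYo⟩ := o.continuous q
  have hpos : ∀ x ∈ U', o.IsPos x fun i => Y i x := hYo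
  have hO : IsOpen (U ∩ U') := hU.inter hU'
  have hc : ∀ j, ∃ c : Fin k → Q → ℝ, (∀ i, ∀ x ∈ U ∩ U', CM E ℝ (c i) x) ∧
      ∀ x ∈ U ∩ U', X j x = ∑ i, c i x • Y i x := fun j =>
    exists_coeff_field hO (fun i x hx => ((isSection_iff hU').1 (hY i) x hx.2).1)
      (fun x hx => ((isSection_iff hU).1 (hX j) x hx.1).1)
      (fun x hx => IsPosBasis.linearIndependent (hpos x hx.2)) (fun x hx => by
        rw [IsPosBasis.span_eq (hpos x hx.2)]
        exact (hX j).2 x hx.1)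
  choose c hcs hcX using hc
  let A : Q → Matrix (Fin k) (Fin k) ℝ := fun x i j => c j i x
  have hA : ContinuousAt (fun x => (A x).det) q := by
    have h1 : ContinuousAt A q := continuousAt_pi.2 fun i => continuousAt_pi.2 fun j =>
      (hcs j i q ⟨hq, hq'⟩).continuousAt
    exact (Continuous.matrix_det continuous_id).continuousAt.comp h1
  have h0 : 0 < (A q).det := IsPosBasis.det_pos (hpos q hq') h fun j => hcX j q ⟨hq, hq'⟩
  filter_upwards [hA.eventually_const_lt h0, hO.mem_nhds ⟨hq, hq'⟩] with x hx hxO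
  exact IsPosBasis.of_posRel (hpos x hxO.2) ⟨A x, hx, fun j => hcX j x hxO⟩

/-- An orientation of a distribution is given by coherent local frames. -/
theorem DistrOrientation.exists_of_frames (Pos : ∀ q, (Fin k → TangentSpace 𝓘(ℝ, E) q) → Prop)
    (hb : ∀ q v, Pos q v → LinearIndependent ℝ v ∧ D q = Submodule.span ℝ (range v))
    (hrel : ∀ q v v', Pos q v → Pos q v' → PosRel v v')
    (hloc : ∀ q : Q, ∃ U, IsOpen U ∧ q ∈ U ∧ ∃ X : Fin k → VField E Q,
      (∀ i, IsSection D U (X i)) ∧ ∀ x ∈ U, Pos x fun i => X i x) :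
    ∃ o : DistrOrientation k D, ∀ q v, Pos q v → o.IsPos q v := by
  have h1 : ∀ q, ∃ (v : Fin k → TangentSpace 𝓘(ℝ, E) q) (b : Basis (Fin k) ℝ (D q)),
      Pos q v ∧ ∀ i, (b i : TangentSpace 𝓘(ℝ, E) q) = v i := by
    intro q
    obtain ⟨U, -, hq, X, -, hX⟩ := hloc q
    obtain ⟨hli, hs⟩ := hb q _ (hX q hq)
    obtain ⟨b, hb'⟩ := exists_basis_of_span hli hs
    exact ⟨_, b, hX q hq, hb'⟩
  choose v b hv hvb using h1
  have h2 : ∀ q w, Pos q w → ∃ b' : Basis (Fin k) ℝ (D q),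
      (∀ i, (b' i : TangentSpace 𝓘(ℝ, E) q) = w i) ∧ b'.orientation = (b q).orientation := by
    intro q w hw
    obtain ⟨hli, hs⟩ := hb q _ hw
    obtain ⟨b', hb'⟩ := exists_basis_of_span hli hs
    refine ⟨b', hb', orientation_eq_of_posRel ?_⟩
    rw [show (fun i => (b' i : TangentSpace 𝓘(ℝ, E) q)) = w from funext hb',
      show (fun i => (b q i : TangentSpace 𝓘(ℝ, E) q)) = v q from funext (hvb q)]
    exact hrel q _ _ hw (hv q)
  refine ⟨⟨fun q => (b q).orientation, fun q => ?_⟩, h2⟩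
  obtain ⟨U, hU, hq, X, hX, hXP⟩ := hloc q
  exact ⟨U, hU, hq, X, hX, fun x hx => h2 x _ (hXP x hx)⟩

end DistrOrientation

/-! ### Change of Engel frame -/

section FrameChange

variable {E : Type*} [NormedAddCommGroup E] [NormedSpace ℝ E]
variable {Q : Type*} [TopologicalSpace Q] [ChartedSpace E Q] [IsManifold 𝓘(ℝ, E) ∞ Q]
variable {D : Distr E Q} {U : Set Q} {W X : VField E Q}

theorem lieBr_const_smul_right [CompleteSpace E] (T : VField E Q) {X : VField E Q} (a : ℝ) {q : Q}
    (hX : SmAt X q) : lieBr T (fun x => a • X x) q = a • lieBr T X q := by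
  rw [lieBr_smul_right T (a := fun _ => a) contMDiffAt_const hX, dv_const, zero_smul, zero_add]

theorem lieBr_const_smul_left [CompleteSpace E] (T : VField E Q) {X : VField E Q} (a : ℝ) {q : Q}
    (hX : SmAt X q) : lieBr (fun x => a • X x) T q = a • lieBr X T q := by
  rw [lieBr_swap, lieBr_const_smul_right T a hX, lieBr_swap X T, smul_neg]

theorem frame_two (W X : VField E Q) (q : Q) :
    (fun i => (![W, X] : Fin 2 → VField E Q) i q) = ![W q, X q] := by
  funext i; fin_cases i <;> rfl

theorem frame_three (W X Y : VField E Q) (q : Q) :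
    (fun i => (![W, X, Y] : Fin 3 → VField E Q) i q) = ![W q, X q, Y q] := by
  funext i; fin_cases i <;> rfl

theorem frame_four (W X Y Z : VField E Q) (q : Q) :
    (fun i => (![W, X, Y, Z] : Fin 4 → VField E Q) i q) = ![W q, X q, Y q, Z q] := by
  funext i; fin_cases i <;> rfl

theorem EngelFrame.lieBr_const_smul [FiniteDimensional ℝ E] (h : EngelFrame D U W X) (a b : ℝ)
    {q : Q} (hq : q ∈ U) :
    lieBr (fun x => a • W x) (fun x => b • X x) q = (a * b) • lieBr W X q := by
  have : CompleteSpace E := FiniteDimensional.complete ℝ E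
  rw [lieBr_const_smul_left _ a (h.smW q hq), lieBr_const_smul_right _ b (h.smX q hq), smul_smul]

theorem EngelFrame.lieBr_lieBr_const_smul [FiniteDimensional ℝ E] (h : EngelFrame D U W X) (a b : ℝ)
    {q : Q} (hq : q ∈ U) :
    lieBr (lieBr (fun x => a • W x) (fun x => b • X x)) (fun x => b • X x) q =
      (a * b * b) • lieBr (lieBr W X) X q := by
  have : CompleteSpace E := FiniteDimensional.complete ℝ E
  rw [lieBr_congr ((h.isOpen.eventually_mem hq).mono fun x hx => h.lieBr_const_smul a b hx)
    (Eventually.of_forall fun _ => rfl), lieBr_const_smul_left _ _ (h.smZ hq),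
    lieBr_const_smul_right _ b (h.smX q hq), smul_smul]

theorem EngelFrame.const_smul [FiniteDimensional ℝ E] (h : EngelFrame D U W X) {a b : ℝ}
    (ha : a ≠ 0) (hb : b ≠ 0) : EngelFrame D U (fun x => a • W x) (fun x => b • X x) := by
  have hcE : CompleteSpace E := FiniteDimensional.complete ℝ E
  refine ⟨h.isOpen, fun q hq => SmAt.smul (a := fun _ => a) contMDiffAt_const (h.smW q hq),
    fun q hq => SmAt.smul (a := fun _ => b) contMDiffAt_const (h.smX q hq), fun q hq => ?_,
    fun q hq => ?_, fun q hq => ?_⟩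
  · rw [h.dist q hq]
    ext v
    rw [Submodule.mem_span_pair, Submodule.mem_span_pair]
    constructor
    · rintro ⟨r, s, rfl⟩
      exact ⟨r * a⁻¹, s * b⁻¹, by
        rw [smul_smul, smul_smul, inv_mul_cancel_right₀ ha, inv_mul_cancel_right₀ hb]⟩
    · rintro ⟨r, s, rfl⟩
      exact ⟨r * a, s * b, by rw [mul_smul, mul_smul]⟩
  · rw [h.lieBr_const_smul a b hq, h.lieBr_lieBr_const_smul a b hq, li_four_iff]
    intro r s t u h0
    have h1 := li_four_iff.1 (h.li q hq) (r * a) (s * b) (t * (a * b)) (u * (a * b * b)) (by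
      rw [← h0]
      module)
    simpa [ha, hb] using h1
  · rw [h.lieBr_const_smul a b hq, lieBr_congr (Eventually.of_forall fun _ => rfl)
      ((h.isOpen.eventually_mem hq).mono fun x hx => h.lieBr_const_smul a b hx),
      lieBr_const_smul_left _ _ (h.smW q hq), lieBr_const_smul_right _ _ (h.smZ hq)]
    obtain ⟨r, s, t, h1⟩ := mem_span_three.1 (h.char q hq)
    refine mem_span_three.2 ⟨a * b * r, a * a * s, a * t, ?_⟩
    rw [← h1]
    module

/-- Brackets of arbitrary sections of the characteristic line field and of the Engel field in terms
of an Engel frame. -/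
theorem EngelFrame.change [FiniteDimensional ℝ E] (h : EngelFrame D U W X) {q : Q} (hq : q ∈ U)
    {U' : Set Q} (hU' : IsOpen U') (hqU' : q ∈ U') {W' X' : VField E Q}
    (hW' : IsSection (charLine D) U' W') (hX' : IsSection D U' X') :
    ∃ f g r₁ r₂ r₃ r₄ r₅ r₆ : ℝ, W' q = f • W q ∧ X' q = r₁ • W q + g • X q ∧
      lieBr W' X' q = r₂ • W q + r₃ • X q + (f * g) • lieBr W X q ∧
      lieBr (lieBr W' X') X' q = r₄ • W q + r₅ • X q + r₆ • lieBr W X q +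
        (f * g * g) • lieBr (lieBr W X) X q := by
  have hcE : CompleteSpace E := FiniteDimensional.complete ℝ E
  rw [isSection_iff hU'] at hW' hX'
  let O := U ∩ U'
  have hO : IsOpen O := h.isOpen.inter hU'
  have hqO : q ∈ O := ⟨hq, hqU'⟩
  obtain ⟨f, hf, hWf⟩ := exists_coeff_field (X := ![W]) hO (fun i x hx => by
      fin_cases i; exact h.smW x hx.1) (fun x hx => (hW' x hx.2).1) (fun x hx => by
      have : (fun i => (![W] : Fin 1 → VField E Q) i x) = fun _ => W x := by
        funext i; fin_cases i; rfl
      rw [this]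
      exact LinearIndependent.of_subsingleton (i := 0) (h.W_ne_zero hx.1)) (fun x hx => by
      have h1 := (hW' x hx.2).2
      rw [h.charLine_eq hx.1] at h1
      have : range (fun i => (![W] : Fin 1 → VField E Q) i x) = {W x} := by
        ext v; simp [eq_comm]
      rwa [this])
  obtain ⟨g, hg, hXg⟩ := exists_coeff_field (X := ![W, X]) hO (fun i x hx => by
      fin_cases i
      · exact h.smW x hx.1
      · exact h.smX x hx.1) (fun x hx => (hX' x hx.2).1) (fun x hx => by
      rw [frame_two]
      exact li_two_of_three (li_three_of_four (h.li x hx.1))) (fun x hx => by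
      rw [frame_two, range_pair_eq, ← h.dist x hx.1]
      exact (hX' x hx.2).2)
  have hWf' : ∀ x ∈ O, W' x = f 0 x • W x := fun x hx => by rw [hWf x hx]; simp
  have hXg' : ∀ x ∈ O, X' x = g 0 x • W x + g 1 x • X x := fun x hx => by
    rw [hXg x hx]; simp [Fin.sum_univ_two]
  have hTX : ∀ x ∈ O, ∀ T : VField E Q, lieBr T X' x = dv ℝ (g 0) T x • W x + g 0 x • lieBr T W x +
      (dv ℝ (g 1) T x • X x + g 1 x • lieBr T X x) := by
    intro x hx T
    rw [lieBr_congr (Eventually.of_forall fun _ => rfl)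
      ((hO.eventually_mem hx).mono fun y hy => hXg' y hy),
      lieBr_add_right T ((h.smW x hx.1).smul (hg 0 x hx)) ((h.smX x hx.1).smul (hg 1 x hx)),
      lieBr_smul_right T (hg 0 x hx) (h.smW x hx.1), lieBr_smul_right T (hg 1 x hx) (h.smX x hx.1)]
  have hZ : ∀ x ∈ O, lieBr W' X' x = (f 0 x * dv ℝ (g 0) W x - dv ℝ (f 0) X' x) • W x +
      (f 0 x * dv ℝ (g 1) W x) • X x + (f 0 x * g 1 x) • lieBr W X x := by
    intro x hx
    rw [lieBr_congr ((hO.eventually_mem hx).mono fun y hy => hWf' y hy)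
      (Eventually.of_forall fun _ => rfl), lieBr_swap, lieBr_smul_right X' (hf 0 x hx)
      (h.smW x hx.1), lieBr_swap X' W, hTX x hx, lieBr_self]
    module
  -- Smooth coefficients of the first bracket are needed in order to differentiate it once more.
  obtain ⟨c, hc, hZc⟩ := exists_coeff_field (X := ![W, X, lieBr W X]) (S := lieBr W' X') hO
    (fun i x hx => by
      fin_cases i
      · exact h.smW x hx.1
      · exact h.smX x hx.1
      · exact h.smZ hx.1) (fun x hx => (hW' x hx.2).1.lieBr (hX' x hx.2).1) (fun x hx => by
      rw [frame_three]
      exact li_three_of_four (h.li x hx.1)) (fun x hx => by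
      rw [frame_three, range_triple_eq, hZ x hx]
      exact mem_span_three.2 ⟨_, _, _, rfl⟩)
  have hZc' : ∀ x ∈ O, lieBr W' X' x = c 0 x • W x + c 1 x • X x + c 2 x • lieBr W X x :=
    fun x hx => by rw [hZc x hx]; simp [Fin.sum_univ_three]
  have hc2 : c 2 q = f 0 q * g 1 q := by
    have h1 := (hZc' q hqO).symm.trans (hZ q hqO)
    have h2 := li_three_iff.1 (li_three_of_four (h.li q hq))
      (c 0 q - (f 0 q * dv ℝ (g 0) W q - dv ℝ (f 0) X' q)) (c 1 q - f 0 q * dv ℝ (g 1) W q)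
      (c 2 q - f 0 q * g 1 q) (by
        rw [← sub_eq_zero] at h1
        rw [← h1]
        module)
    exact sub_eq_zero.1 h2.2.2
  -- Only the coefficient of `[[W,X],X]` matters for determinants; the lower terms are collected in
  -- the numbers `r₄`, `r₅` and `r₆`.
  have hV : lieBr (lieBr W' X') X' q =
      -(dv ℝ (c 0) X' q • W q + c 0 q • lieBr X' W q + (dv ℝ (c 1) X' q • X q +
        c 1 q • lieBr X' X q) + (dv ℝ (c 2) X' q • lieBr W X q + c 2 q • lieBr X' (lieBr W X) q)) := by
    have s0 : SmAt (fun x => c 0 x • W x) q := (h.smW q hq).smul (hc 0 q hqO)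
    have s1 : SmAt (fun x => c 1 x • X x) q := (h.smX q hq).smul (hc 1 q hqO)
    have s2 : SmAt (fun x => c 2 x • lieBr W X x) q := (h.smZ hq).smul (hc 2 q hqO)
    rw [lieBr_swap, lieBr_congr (Eventually.of_forall fun _ => rfl)
      ((hO.eventually_mem hqO).mono fun y hy => hZc' y hy),
      lieBr_add_right X' (s0.add s1) s2, lieBr_add_right X' s0 s1,
      lieBr_smul_right X' (hc 0 q hqO) (h.smW q hq), lieBr_smul_right X' (hc 1 q hqO) (h.smX q hq),
      lieBr_smul_right X' (hc 2 q hqO) (h.smZ hq)]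
  obtain ⟨a, b, d, hchar⟩ := mem_span_three.1 (h.char q hq)
  have hZW : lieBr (lieBr W X) W q = (-a) • W q + (-b) • X q + (-d) • lieBr W X q := by
    rw [lieBr_swap, ← hchar]
    module
  refine ⟨f 0 q, g 1 q, g 0 q, f 0 q * dv ℝ (g 0) W q - dv ℝ (f 0) X' q, f 0 q * dv ℝ (g 1) W q,
    ?_, ?_, ?_, hWf' q hqO, hXg' q hqO, hZ q hqO, ?_⟩
  rotate_left 3
  · rw [hV, lieBr_swap X' W, lieBr_swap X' X, lieBr_swap X' (lieBr W X), hTX q hqO, hTX q hqO,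
      hTX q hqO, lieBr_self, lieBr_self, lieBr_swap X W, hZW, hc2]
    match_scalars
    · ring_nf
      rfl
    · ring_nf
      rfl
    · ring_nf
      rfl
    · ring

end FrameChange

/-- The class of a point for a relation that is symmetric, transitive and locally satisfied is
clopen in `ℝ`. This turns local comparison of orientations into comparison along a leaf curve. -/
theorem mem_of_rel_locally {R : ℝ → ℝ → Prop} (hs : ∀ {a b}, R a b → R b a)
    (ht : ∀ {a b c}, R a b → R b c → R a c) (h : ∀ t, ∀ᶠ s in 𝓝 t, R t s) (a b : ℝ) : R a b := by
  have hS : IsClopen {t | R a t} := by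
    refine ⟨isClosed_of_closure_subset fun t hta => ?_, isOpen_iff_mem_nhds.2 fun t hta => ?_⟩
    · obtain ⟨s, hs', h1⟩ := mem_closure_iff_nhds.1 hta _ (h t)
      exact ht h1 (hs hs')
    · filter_upwards [h t] with s hts
      exact ht hta hts
  have h1 := hS.eq_univ ⟨a, (h a).self_of_nhds⟩
  exact (h1 ▸ mem_univ b : b ∈ {t | R a t})

/-! ### Existence of adapted frames -/

section Adapted

variable {E : Type*} [NormedAddCommGroup E] [NormedSpace ℝ E]
variable {Q : Type*} [TopologicalSpace Q] [ChartedSpace E Q] [IsManifold 𝓘(ℝ, E) ∞ Q]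
variable {D : Distr E Q} {U : Set Q} {W X : VField E Q}
variable {oD : DistrOrientation 2 D} {oQ : DistrOrientation 4 (fullDistr E Q)}

theorem EngelFrame.section_W [FiniteDimensional ℝ E] (h : EngelFrame D U W X) :
    IsSection (charLine D) U W :=
  (isSection_iff h.isOpen).2 fun q hq => ⟨h.smW q hq, by
    rw [h.charLine_eq hq]
    exact Submodule.mem_span_singleton_self _⟩

theorem EngelFrame.section_X (h : EngelFrame D U W X) : IsSection D U X :=
  (isSection_iff h.isOpen).2 fun q hq => ⟨h.smX q hq, h.X_mem hq⟩

theorem EngelFrame.section_four [FiniteDimensional ℝ E] (h : EngelFrame D U W X) (i : Fin 4) :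
    IsSection (fullDistr E Q) U
      ((![W, X, lieBr W X, lieBr (lieBr W X) X] : Fin 4 → VField E Q) i) :=
  (isSection_iff h.isOpen).2 fun q hq => ⟨by
    fin_cases i
    · exact h.smW q hq
    · exact h.smX q hq
    · exact h.smZ hq
    · exact h.smV hq, trivial⟩

/-- Near every point there is an Engel frame which consists of adapted sections. -/
theorem exists_adaptedFrame (hD : IsEngel D) (oD : DistrOrientation 2 D)
    (oQ : DistrOrientation 4 (fullDistr E Q)) (q : Q) :
    ∃ U W X, q ∈ U ∧ EngelFrame D U W X ∧ ∀ x ∈ U, IsAdapted oD oQ x W X := by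
  have hfin := hD.finiteDimensional
  obtain ⟨U, W, X, hq, h⟩ := exists_engelFrame hD q
  -- Replacing `W` by `-W` changes the sign of three of the four fields, hence the orientation of
  -- the four-frame.
  obtain ⟨a, ha, h4⟩ : ∃ a : ℝ, a ≠ 0 ∧
      oQ.IsPos q ![a • W q, X q, a • lieBr W X q, a • lieBr (lieBr W X) X q] := by
    obtain ⟨v, hv⟩ := oQ.exists_isPos q
    rcases IsPosBasis.or_of_det_neg hv (h.li q hq) (fun i => trivial)
      (A := Matrix.diagonal ![-1, 1, -1, -1])
      (u' := ![(-1 : ℝ) • W q, X q, (-1 : ℝ) • lieBr W X q, (-1 : ℝ) • lieBr (lieBr W X) X q])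
      (by
        rw [Matrix.det_diagonal, Fin.prod_univ_four]
        change (-1 : ℝ) * 1 * (-1) * (-1) < 0
        norm_num)
      (fun j => by fin_cases j <;> simp [Fin.sum_univ_four, Matrix.diagonal]) with h1 | h1
    · exact ⟨1, one_ne_zero, by simp only [one_smul]; exact h1⟩
    · exact ⟨-1, by norm_num, h1⟩
  have hli2 : LinearIndependent ℝ ![a • W q, X q] := by
    have := li_two_of_three (li_three_of_four (IsPosBasis.linearIndependent h4))
    exact this
  -- Replacing `X` by `-X` corrects the two-frame. It changes the sign of `X` and `[W,X]` but not of
  -- `[[W,X],X]`, so the four-frame remains positive.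
  obtain ⟨b, hb, h2⟩ : ∃ b : ℝ, (b = 1 ∨ b = -1) ∧ oD.IsPos q ![a • W q, b • X q] := by
    obtain ⟨v, hv⟩ := oD.exists_isPos q
    rcases IsPosBasis.or_of_det_neg hv hli2 (fun i => by
        fin_cases i
        · exact Submodule.smul_mem _ _ (h.W_mem hq)
        · exact h.X_mem hq)
      (A := Matrix.diagonal ![1, -1]) (u' := ![a • W q, (-1 : ℝ) • X q])
      (by rw [Matrix.det_diagonal]; norm_num [Fin.prod_univ_two])
      (fun j => by fin_cases j <;> simp [Fin.sum_univ_two, Matrix.diagonal]) with h1 | h1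
    · exact ⟨1, Or.inl rfl, by simp only [one_smul]; exact h1⟩
    · exact ⟨-1, Or.inr rfl, h1⟩
  have hb0 : b ≠ 0 := by rcases hb with rfl | rfl <;> norm_num
  have hbb : b * b = 1 := by rcases hb with rfl | rfl <;> norm_num
  have h' := h.const_smul ha hb0
  have h4' : oQ.IsPos q ![a • W q, b • X q, lieBr (fun x => a • W x) (fun x => b • X x) q,
      lieBr (lieBr (fun x => a • W x) (fun x => b • X x)) (fun x => b • X x) q] := by
    rw [h.lieBr_const_smul a b hq, h.lieBr_lieBr_const_smul a b hq]
    refine IsPosBasis.of_posRel h4 ⟨Matrix.diagonal ![1, b, b, 1], ?_, fun j => ?_⟩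
    · rw [Matrix.det_diagonal]
      simp [Fin.prod_univ_four, hbb]
    · fin_cases j
      · simp [Fin.sum_univ_four, Matrix.diagonal]
      · simp [Fin.sum_univ_four, Matrix.diagonal]
      · simp [Fin.sum_univ_four, Matrix.diagonal, smul_smul, mul_comm]
      · simp [Fin.sum_univ_four, Matrix.diagonal, mul_assoc, hbb]
  have e2 := oD.eventually_isPos h'.isOpen (X := ![fun x => a • W x, fun x => b • X x])
    (fun i => by
      fin_cases i
      · exact (isSection_iff h'.isOpen).2 fun q hq => ⟨h'.smW q hq, h'.W_mem hq⟩
      · exact h'.section_X) hq (by rw [frame_two]; exact h2)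
  have e4 := oQ.eventually_isPos h'.isOpen h'.section_four hq (by rw [frame_four]; exact h4')
  obtain ⟨V, hV, hVo, hqV⟩ := eventually_nhds_iff.1 (e2.and (e4.and (h'.isOpen.eventually_mem hq)))
  have h'' := h'.mono hVo fun x hx => (hV x hx).2.2
  refine ⟨V, _, _, hqV, h'', fun x hx => ⟨⟨V, hVo, hx, h''.section_W, h''.section_X⟩, ?_, ?_⟩⟩
  · have := (hV x hx).1
    rwa [frame_two] at this
  · have := (hV x hx).2.1
    rwa [frame_four] at this

end Adapted

/-! ### Orientations of the leaf space and of its contact structure -/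

section Projection

variable {E : Type*} [NormedAddCommGroup E] [NormedSpace ℝ E]
variable {Q : Type*} [TopologicalSpace Q] [T2Space Q] [ChartedSpace E Q] [IsManifold 𝓘(ℝ, E) ∞ Q]
variable {F : Type*} [NormedAddCommGroup F] [NormedSpace ℝ F] [FiniteDimensional ℝ F]
variable {M : Type*} [TopologicalSpace M] [ChartedSpace F M] [IsManifold 𝓘(ℝ, F) ∞ M]
variable {D : Distr E Q} {U : Set Q} {W X W' X' : VField E Q} {π : Q → M} {ξ : PlaneField F M}
variable {oD : DistrOrientation 2 D} {oQ : DistrOrientation 4 (fullDistr E Q)}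

/-- The projections of `X, [W, X]` to the leaf space. -/
noncomputable def pushPair (F : Type*) [NormedAddCommGroup F] [NormedSpace ℝ F]
    {M : Type*} [TopologicalSpace M] [ChartedSpace F M] (π : Q → M) (W X : VField E Q) (q : Q) :
    Fin 2 → F :=
  ![dd E F π q (X q), dd E F π q (lieBr W X q)]

/-- The projections of `X, [W, X], [[W, X], X]` to the leaf space. -/
noncomputable def pushTriple (F : Type*) [NormedAddCommGroup F] [NormedSpace ℝ F]
    {M : Type*} [TopologicalSpace M] [ChartedSpace F M] (π : Q → M) (W X : VField E Q) (q : Q) :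
    Fin 3 → F :=
  ![dd E F π q (X q), dd E F π q (lieBr W X q), dd E F π q (lieBr (lieBr W X) X q)]

/-- Both changes of frame are triangular, with determinants `f g` and `(f g)³ g`. Their positivity
forces `g > 0` and `f > 0`, and the induced changes of the projected frames are triangular with
positive diagonal as well. -/
theorem IsAdapted.compare (hF : finrank ℝ F = 3) (hD : IsEngel D) (hπ : IsLeafQuotient F D π)
    (h : EngelFrame D U W X) {q : Q} (hq : q ∈ U) (ha : IsAdapted oD oQ q W X)
    (ha' : IsAdapted oD oQ q W' X') :
    (∃ g : ℝ, 0 < g ∧ (dd E F π q (X' q) : F) = g • dd E F π q (X q)) ∧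
    PosRel (pushPair F π W X q) (pushPair F π W' X' q) ∧
      PosRel (pushTriple F π W X q) (pushTriple F π W' X' q) := by
  have hfin := hD.finiteDimensional
  obtain ⟨-, h2, h4⟩ := ha
  obtain ⟨⟨U', hU', hqU', hW', hX'⟩, h2', h4'⟩ := ha'
  obtain ⟨f, g, r₁, r₂, r₃, r₄, r₅, r₆, e1, e2, e3, e4⟩ := h.change hq hU' hqU' hW' hX'
  have d2 : 0 < f * g := by
    have := IsPosBasis.det_pos h2 h2' (A := !![f, r₁; 0, g]) (fun j => by
      fin_cases j <;> simp [Fin.sum_univ_two, e1, e2])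
    rw [Matrix.det_fin_two_of] at this
    linarith
  have d4 : 0 < f * g * (f * g) * (f * g * g) := by
    have := IsPosBasis.det_pos h4 h4'
      (A := !![f, r₁, r₂, r₄; 0, g, r₃, r₅; 0, 0, f * g, r₆; 0, 0, 0, f * g * g]) (fun j => by
      fin_cases j <;> simp [Fin.sum_univ_four, e1, e2, e3, e4])
    rw [Matrix.det_of_upperTriangular (by
      intro i j hij
      fin_cases i <;> fin_cases j <;> first | rfl | (exfalso; revert hij; simp))] at this
    simpa [Fin.prod_univ_four] using this
  have hg : 0 < g := by
    have h1 : 0 < f * g * (f * g) * (f * g) := by positivity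
    by_contra hg
    push Not at hg
    nlinarith
  have hdX : (dd E F π q (X' q) : F) = g • dd E F π q (X q) := by
    rw [e2, dd_add, dd_smul, dd_smul, hπ.dd_W hF hD h hq, smul_zero, zero_add]
  have hdZ : (dd E F π q (lieBr W' X' q) : F) =
      r₃ • dd E F π q (X q) + (f * g) • dd E F π q (lieBr W X q) := by
    rw [e3, dd_add, dd_add, dd_smul, dd_smul, dd_smul, hπ.dd_W hF hD h hq, smul_zero, zero_add]
  have hdV : (dd E F π q (lieBr (lieBr W' X') X' q) : F) =
      r₅ • dd E F π q (X q) + r₆ • dd E F π q (lieBr W X q) +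
        (f * g * g) • dd E F π q (lieBr (lieBr W X) X q) := by
    rw [e4, dd_add, dd_add, dd_add, dd_smul, dd_smul, dd_smul, dd_smul, hπ.dd_W hF hD h hq,
      smul_zero, zero_add]
  exact ⟨⟨g, hg, hdX⟩,
    PosRel.pair g 0 r₃ (f * g) (by nlinarith) (by rw [hdX]; module) hdZ,
    PosRel.triple g r₃ (f * g) r₅ r₆ (f * g * g) (by positivity) hdX hdZ hdV⟩

theorem IsLeafQuotient.plane_eq (hF : finrank ℝ F = 3) (hD : IsEngel D) (hπ : IsLeafQuotient F D π)
    (hξ : ∀ q, ξ.plane (π q) =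
      (derived2 D q).map (mfderiv 𝓘(ℝ, E) 𝓘(ℝ, F) π q).toLinearMap)
    (h : EngelFrame D U W X) {q : Q} (hq : q ∈ U) {m : M} (hm : π q = m) :
    ξ.plane m = Submodule.span ℝ (range (pushPair F π W X q)) := by
  subst hm
  rw [hξ, pushPair, range_pair_eq]
  ext y
  exact hπ.mem_push_iff hF hD h hq y

/-- All the vectors lie in the tangent space at one point of `M`, where the preferred chart has the
identity as differential; so they are the values of a smooth function along the curve. -/
theorem continuousAt_push (hπ : IsLeafQuotient F D π) {γ : ℝ → Q} {t₀ : ℝ}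
    (hγ : ContinuousAt γ t₀) (hm : ∀ t, π (γ t) = π (γ t₀)) {Y : VField E Q}
    (hY : SmAt Y (γ t₀)) : ContinuousAt (fun t => (dd E F π (γ t) (Y (γ t)) : F)) t₀ := by
  have h1 : CM E F (fun x => extChartAt 𝓘(ℝ, F) (π (γ t₀)) (π x)) (γ t₀) :=
    CM.comp (f := π) (g := extChartAt 𝓘(ℝ, F) (π (γ t₀))) (cm_extChartAt (mem_chart_source F _))
      (hπ.cm _)
  have h2 : ContinuousAt
      (fun t => dv F (fun x => extChartAt 𝓘(ℝ, F) (π (γ t₀)) (π x)) Y (γ t)) t₀ :=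
    ContinuousAt.comp (f := γ) (cm_dv h1 hY).continuousAt hγ
  refine h2.congr (Eventually.of_forall fun t => ?_)
  have h3 := dd_comp_vec (f := π) (g := extChartAt 𝓘(ℝ, F) (π (γ t₀))) (q := γ t)
    (cm_extChartAt (by rw [hm t]; exact mem_chart_source F (π (γ t₀)))).mdiff (hπ.cm _).mdiff (Y (γ t))
  refine h3.trans ?_
  have h4 : dd F F (extChartAt 𝓘(ℝ, F) (π (γ t₀))) (π (γ t)) = .id ℝ F := by
    rw [hm t]
    exact dd_extChartAt_self _
  rw [h4]
  rfl

/-- The projected frames of adapted sections at points of the same leaf are equally oriented. -/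
theorem IsAdapted.posRel (hF : finrank ℝ F = 3) (hD : IsEngel D) (hπ : IsLeafQuotient F D π)
    (hξ : ∀ q, ξ.plane (π q) =
      (derived2 D q).map (mfderiv 𝓘(ℝ, E) 𝓘(ℝ, F) π q).toLinearMap)
    {q q' : Q} (hqq : π q' = π q) (ha : IsAdapted oD oQ q W X)
    (ha' : IsAdapted oD oQ q' W' X') :
    PosRel (pushPair F π W X q) (pushPair F π W' X' q') ∧
      PosRel (pushTriple F π W X q) (pushTriple F π W' X' q') := by
  choose V Y Z hV hYZ hYZa using exists_adaptedFrame hD oD oQ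
  -- Points are compared through a fixed choice of an adapted frame around each of them.
  let R : Q → Q → Prop := fun x y =>
    PosRel (pushPair F π (Y x) (Z x) x) (pushPair F π (Y y) (Z y) y) ∧
      PosRel (pushTriple F π (Y x) (Z x) x) (pushTriple F π (Y y) (Z y) y)
  have hq' : q' ∈ leaf D q := by
    rw [← hπ.fiber_eq_leaf]
    exact hqq
  obtain ⟨γ, hγ, rfl, rfl⟩ := mem_leaf_iff.1 hq'
  have hπγ : ∀ s t, π (γ t) = π (γ s) := fun s t => hπ.apply_leafCurve hγ s t
  have hR : R (γ 0) (γ 1) := by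
    refine mem_of_rel_locally (R := fun s t => R (γ s) (γ t)) (fun h => ⟨h.1.symm, h.2.symm⟩)
      (fun h h' => ⟨h.1.trans h'.1, h.2.trans h'.2⟩) (fun t => ?_) 0 1
    -- Near `t` a single frame is projected: it varies continuously in a fixed plane and a fixed
    -- tangent space. At the point `γ s` it is then compared with the frame chosen there.
    have hf := hYZ (γ t)
    have hfin := hD.finiteDimensional
    have hev : ∀ᶠ s in 𝓝 t, γ s ∈ V (γ t) :=
      hγ.continuous.continuousAt (hf.isOpen.mem_nhds (hV _))
    have hli := hπ.li_push hF hD hf (hV _)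
    have c1 := continuousAt_push hπ hγ.continuous.continuousAt (hπγ t) (hf.smX _ (hV _))
    have c2 := continuousAt_push hπ hγ.continuous.continuousAt (hπγ t) (hf.smZ (hV _))
    have c3 := continuousAt_push hπ hγ.continuous.continuousAt (hπγ t) (hf.smV (hV _))
    have r2 := eventually_posRel (v := fun s => pushPair F π (Y (γ t)) (Z (γ t)) (γ s)) (t₀ := t)
      (continuousAt_pi.2 fun i => by
        fin_cases i
        · exact c1
        · exact c2) (li_two_of_three hli) (by
        filter_upwards [hev] with s hs j
        have h1 := hπ.plane_eq hF hD hξ hf (hV (γ t)) rfl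
        have h2 := hπ.plane_eq hF hD hξ hf hs (hπγ t s)
        exact (h2.symm.trans h1) ▸ Submodule.subset_span (mem_range_self j))
    have r3 := eventually_posRel (v := fun s => pushTriple F π (Y (γ t)) (Z (γ t)) (γ s)) (t₀ := t)
      (continuousAt_pi.2 fun i => by
        fin_cases i
        · exact c1
        · exact c2
        · exact c3) hli (Eventually.of_forall fun s j => by
        have h1 := hli.span_eq_top_of_card_eq_finrank' (by simp [hF])
        exact h1 ▸ Submodule.mem_top)
    filter_upwards [hev, r2, r3] with s hs h2 h3
    obtain ⟨-, h4, h5⟩ := IsAdapted.compare hF hD hπ hf hs (hYZa _ _ hs) (hYZa (γ s) _ (hV _))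
    exact ⟨h2.trans h4, h3.trans h5⟩
  obtain ⟨-, h1, h2⟩ := IsAdapted.compare hF hD hπ (hYZ (γ 0)) (hV _) (hYZa _ _ (hV _)) ha
  obtain ⟨-, h3, h4⟩ := IsAdapted.compare hF hD hπ (hYZ (γ 1)) (hV _) (hYZa _ _ (hV _)) ha'
  exact ⟨(h1.symm.trans hR.1).trans h3, (h2.symm.trans hR.2).trans h4⟩

/-- Projections of adapted frames at any two points of a leaf are equally oriented, so declaring
them positive is consistent; local sections of `π` through adapted frames give smooth positive
frames. -/
theorem exists_inheritedOrientation (hF : finrank ℝ F = 3) (hD : IsEngel D)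
    (hπ : IsLeafQuotient F D π) (hξ : ∀ q, ξ.plane (π q) =
      (derived2 D q).map (mfderiv 𝓘(ℝ, E) 𝓘(ℝ, F) π q).toLinearMap)
    (oD : DistrOrientation 2 D) (oQ : DistrOrientation 4 (fullDistr E Q)) :
    ∃ (oξ : DistrOrientation 2 ξ.plane) (oM : DistrOrientation 3 (fullDistr F M)),
      IsInheritedOrientation oD oQ π oξ oM := by
  have hfin := hD.finiteDimensional
  have hmem : ∀ {q : Q} {m : M} (_ : π q = m) {U : Set Q} {W X : VField E Q}, EngelFrame D U W X →
      q ∈ U → ∀ i, (pushPair F π W X q i : F) ∈ ξ.plane m := fun hm _ _ _ hf hq i => by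
    rw [hπ.plane_eq hF hD hξ hf hq hm]
    exact Submodule.subset_span (R := ℝ) (M := F) (mem_range_self i)
  obtain ⟨oξ, hoξ⟩ := DistrOrientation.exists_of_frames (D := ξ.plane) (k := 2)
    (fun m v => ∃ q W X, π q = m ∧ IsAdapted oD oQ q W X ∧ v = pushPair F π W X q) (by
      rintro m _ ⟨q, W', X', hm, ha, rfl⟩
      obtain ⟨U, W, X, hq, hf, hfa⟩ := exists_adaptedFrame hD oD oQ q
      obtain ⟨-, h1, -⟩ := IsAdapted.compare hF hD hπ hf hq (hfa q hq) ha
      have h2 := hπ.plane_eq hF hD hξ hf hq hm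
      let P : Submodule ℝ F := ξ.plane m
      obtain ⟨b, hb⟩ := exists_basis_of_span (V := F) (P := P)
        (li_two_of_three (hπ.li_push hF hD hf hq)) h2
      have h3 : IsPosBasis (V := F) (P := P) b.orientation (pushPair F π W' X' q) :=
        IsPosBasis.of_posRel ⟨b, hb, rfl⟩ h1
      exact ⟨h3.linearIndependent, h3.span_eq.symm⟩) (by
      rintro m _ _ ⟨q, W, X, hm, ha, rfl⟩ ⟨q', W', X', hm', ha', rfl⟩
      exact (ha.posRel hF hD hπ hξ (hm'.trans hm.symm) ha').1) (by
      intro m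
      obtain ⟨q, rfl⟩ := hπ.surjective m
      obtain ⟨U, W, X, hq, hf, hfa⟩ := exists_adaptedFrame hD oD oQ q
      obtain ⟨σ, V, hV, hqV, hσq, hσ, hσU, -, -⟩ := hπ.exists_section hF hD hf hq
      refine ⟨V, hV, hqV, ![pushField F π σ X, pushField F π σ (lieBr W X)], fun i => ?_,
        fun m hm => ⟨σ m, W, X, (hσ m hm).2, hfa _ (hσU m hm), frame_two _ _ _⟩⟩
      refine (isSection_iff hV).2 fun m hm => ?_
      fin_cases i
      · exact ⟨smAt_pushField hπ.cm hV hσ hm (hf.smX _ (hσU m hm)),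
          hmem (hσ m hm).2 hf (hσU m hm) 0⟩
      · exact ⟨smAt_pushField hπ.cm hV hσ hm (hf.smZ (hσU m hm)),
          hmem (hσ m hm).2 hf (hσU m hm) 1⟩)
  obtain ⟨oM, hoM⟩ := DistrOrientation.exists_of_frames (D := fullDistr F M) (k := 3)
    (fun m v => ∃ q W X, π q = m ∧ IsAdapted oD oQ q W X ∧ v = pushTriple F π W X q) (by
      rintro m _ ⟨q, W', X', hm, ha, rfl⟩
      obtain ⟨U, W, X, hq, hf, hfa⟩ := exists_adaptedFrame hD oD oQ q
      obtain ⟨-, -, h1⟩ := IsAdapted.compare hF hD hπ hf hq (hfa q hq) ha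
      have hli := hπ.li_push hF hD hf hq
      have h2 := hli.span_eq_top_of_card_eq_finrank' (by simp [hF])
      obtain ⟨b, hb⟩ := exists_basis_of_span hli h2.symm
      have h3 : IsPosBasis b.orientation (pushTriple F π W' X' q) :=
        IsPosBasis.of_posRel ⟨b, hb, rfl⟩ h1
      exact ⟨h3.linearIndependent, h3.span_eq.symm⟩) (by
      rintro m _ _ ⟨q, W, X, hm, ha, rfl⟩ ⟨q', W', X', hm', ha', rfl⟩
      exact (ha.posRel hF hD hπ hξ (hm'.trans hm.symm) ha').2) (by
      intro m
      obtain ⟨q, rfl⟩ := hπ.surjective m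
      obtain ⟨U, W, X, hq, hf, hfa⟩ := exists_adaptedFrame hD oD oQ q
      obtain ⟨σ, V, hV, hqV, hσq, hσ, hσU, -, -⟩ := hπ.exists_section hF hD hf hq
      refine ⟨V, hV, hqV, ![pushField F π σ X, pushField F π σ (lieBr W X),
        pushField F π σ (lieBr (lieBr W X) X)], fun i => ?_,
        fun m hm => ⟨σ m, W, X, (hσ m hm).2, hfa _ (hσU m hm), frame_three _ _ _ _⟩⟩
      refine (isSection_iff hV).2 fun m hm => ⟨?_, trivial⟩
      fin_cases i
      · exact smAt_pushField hπ.cm hV hσ hm (hf.smX _ (hσU m hm))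
      · exact smAt_pushField hπ.cm hV hσ hm (hf.smZ (hσU m hm))
      · exact smAt_pushField hπ.cm hV hσ hm (hf.smV (hσU m hm)))
  exact ⟨oξ, oM, fun q W X ha => ⟨hoξ _ _ ⟨q, W, X, rfl, ha, rfl⟩, hoM _ _ ⟨q, W, X, rfl, ha, rfl⟩⟩⟩

end Projection

/-! ### Positive rotation of directions -/

namespace Prolong

variable {F : Type*} [NormedAddCommGroup F] [NormedSpace ℝ F] [FiniteDimensional ℝ F]
variable {M : Type*} [TopologicalSpace M] [ChartedSpace F M] [IsManifold 𝓘(ℝ, F) ∞ M]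
variable {ξ : PlaneField F M} {κ : DirKind} {e : PartialEquiv (Prolong ξ κ) (F × ℝ)}
  {c : OpenPartialHomeomorph M F} {U : Set M} {X₀ X₁ : VField F M}

theorem isPos_congr {k : ℕ} {P : Distr F M} {o : DistrOrientation k P} {m m' : M} (h : m = m')
    {v : Fin k → F} (hv : o.IsPos m v) : o.IsPos m' v := by
  subst h
  exact hv

/-- The velocity of the rotation in a frame chart. -/
theorem FrameChart.dd_rotation (h : FrameChart ξ κ e c U X₀ X₁) {m : M}
    {u v : TangentSpace 𝓘(ℝ, F) m} (hu : u ∈ ξ.plane m) (hv : v ∈ ξ.plane m)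
    (huv : LinearIndependent ℝ ![u, v]) (hp : rotation ξ κ m u v hu hv huv 0 ∈ e.source)
    {a b a' b' : ℝ} (hua : u = a • X₀ m + b • X₁ m) (hva : v = a' • X₀ m + b' • X₁ m) :
    a ≠ 0 ∧ dd (F × ℝ) ℝ (fun x : Prolong ξ κ => (e x).2) (rotation ξ κ m u v hu hv huv 0)
      (dd ℝ (F × ℝ) (rotation ξ κ m u v hu hv huv) 0 1) = (b' * a - b * a') / a ^ 2 := by
  have hcm := cm_rotation (κ := κ) m hu hv huv
  have hev : ∀ᶠ t in 𝓝 (0 : ℝ), rotation ξ κ m u v hu hv huv t ∈ e.source :=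
    (hcm 0).continuousAt (h.isOpen_source.mem_nhds hp)
  have hco : ∀ t, rotation ξ κ m u v hu hv huv t ∈ e.source → (a + t * a') ∈ κ.scalars ∧
      b + t * b' = (a + t * a') * (e (rotation ξ κ m u v hu hv huv t)).2 := by
    intro t ht
    refine h.coeff_of_mem_dir ht ?_
    have h1 : u + t • v ∈ (rotation ξ κ m u v hu hv huv t).dir := mem_ofVec _ _ _ _
    have h2 : (a + t * a') • X₀ m + (b + t * b') • X₁ m = u + t • v := by
      rw [hua, hva]
      module
    exact h2.symm ▸ h1
  have ha : a ≠ 0 := by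
    have := κ.ne_zero (hco 0 hp).1
    simpa using this
  refine ⟨ha, ?_⟩
  have h1 := hasDerivAt_comp_curve (f := fun x : Prolong ξ κ => (e x).2)
    (γ := rotation ξ κ m u v hu hv huv) (h.cm_w hp).mdiff (hcm 0).mdiff
  -- Along the rotation the fiber coordinate is the quotient of the coefficients of `u + t v` with
  -- respect to `X₁` and `X₀`.
  have h2 : HasDerivAt (fun t : ℝ => (b + t * b') / (a + t * a')) ((b' * a - b * a') / a ^ 2) 0 := by
    have h3 : HasDerivAt (fun t : ℝ => b + t * b') b' 0 := by
      simpa using ((hasDerivAt_id (0 : ℝ)).mul_const b').const_add b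
    have h4 : HasDerivAt (fun t : ℝ => a + t * a') a' 0 := by
      simpa using ((hasDerivAt_id (0 : ℝ)).mul_const a').const_add a
    have h5 := h3.div h4 (by simpa using ha)
    simp only [zero_mul, add_zero] at h5
    exact h5
  refine h1.unique (h2.congr_of_eventuallyEq ?_)
  filter_upwards [hev] with t ht
  obtain ⟨h5, h6⟩ := hco t ht
  rw [h6, mul_div_cancel_left₀ _ (κ.ne_zero h5)]

theorem dd_base_rotation {m : M}
    {u v : TangentSpace 𝓘(ℝ, F) m} (hu : u ∈ ξ.plane m) (hv : v ∈ ξ.plane m)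
    (huv : LinearIndependent ℝ ![u, v]) :
    dd (F × ℝ) F (base : Prolong ξ κ → M) (rotation ξ κ m u v hu hv huv 0)
      (dd ℝ (F × ℝ) (rotation ξ κ m u v hu hv huv) 0 1) = 0 := by
  rw [← dd_comp_apply (f := rotation ξ κ m u v hu hv huv) (g := (base : Prolong ξ κ → M))
    (cm_base _).mdiff (cm_rotation m hu hv huv 0).mdiff]
  have h1 : (fun t => (rotation ξ κ m u v hu hv huv t).base) = fun _ => m := rfl
  rw [h1, dd_const]
  rfl

/-- A point of the prolongation is spanned by `X₀ + w X₁` in a frame chart, and `X₁` serves as the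
direction towards which to rotate. -/
theorem exists_rotation (p : Prolong ξ κ) : ∃ (m : M) (u v : TangentSpace 𝓘(ℝ, F) m)
    (hu : u ∈ ξ.plane m) (hv : v ∈ ξ.plane m) (huv : LinearIndependent ℝ ![u, v]),
    p = rotation ξ κ m u v hu hv huv 0 := by
  obtain ⟨e, c, U, X₀, X₁, h, hp⟩ := exists_frameChartData p
  have hd := (h.apply_eq p hp).2
  have hm := h.base_mem hp
  refine ⟨p.base, _, X₁ p.base, p.mem_plane hd, h.sec₁.2 _ hm, ?_, ?_⟩
  · have hli := LinearIndependent.pair_iff.1 (h.li _ hm)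
    rw [LinearIndependent.pair_iff]
    intro s t hst
    obtain ⟨h1, h2⟩ := hli s (s * (e p).2 + t) (by rw [← hst]; module)
    refine ⟨h1, ?_⟩
    rw [h1, zero_mul, zero_add] at h2
    exact h2
  · refine (p.eq_ofVec hd).trans ?_
    simp only [rotation, zero_smul, add_zero]

variable {oξ : DistrOrientation 2 ξ.plane}

/-- With `u = a X₀ + b X₁` and `ρ` the speed of the fiber coordinate, the matrix from `(X₀, s ρ X₁)`
to `(u, s v)` has determinant `a²`. So whether a vertical vector rotates positively can be tested in
any frame chart. -/
theorem FrameChart.posRel_rotation (h : FrameChart ξ κ e c U X₀ X₁) {m : M}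
    {u v : TangentSpace 𝓘(ℝ, F) m} (hu : u ∈ ξ.plane m) (hv : v ∈ ξ.plane m)
    (huv : LinearIndependent ℝ ![u, v]) (hp : rotation ξ κ m u v hu hv huv 0 ∈ e.source) :
    ∃ ρ : ℝ, ρ ≠ 0 ∧ dd (F × ℝ) ℝ (fun x : Prolong ξ κ => (e x).2)
      (rotation ξ κ m u v hu hv huv 0) (dd ℝ (F × ℝ) (rotation ξ κ m u v hu hv huv) 0 1) = ρ ∧
      ∀ s : ℝ, s ≠ 0 → PosRel ![X₀ m, (s * ρ) • X₁ m] ![u, s • v] := by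
  have hm : m ∈ U := h.base_mem hp
  obtain ⟨a, b, hab⟩ := exists_coeff ξ (h.sec₀.2 _ hm) (h.sec₁.2 _ hm) hu (h.li _ hm)
  obtain ⟨a', b', hab'⟩ := exists_coeff ξ (h.sec₀.2 _ hm) (h.sec₁.2 _ hm) hv (h.li _ hm)
  obtain ⟨ha, hR⟩ := h.dd_rotation hu hv huv hp hab hab'
  have hdet : b' * a - b * a' ≠ 0 := by
    intro h0
    have h1 := LinearIndependent.pair_iff.1 huv a' (-a) (by
      rw [hab, hab']
      have : b' * a = b * a' := sub_eq_zero.1 h0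
      match_scalars
      · ring
      · linear_combination -this)
    exact ha (neg_eq_zero.1 h1.2)
  refine ⟨_, div_ne_zero hdet (pow_ne_zero 2 ha), hR, fun s hs => ?_⟩
  set ρ := (b' * a - b * a') / a ^ 2 with hρ
  have hρ0 : ρ ≠ 0 := div_ne_zero hdet (pow_ne_zero 2 ha)
  have hsρ : s * ρ ≠ 0 := mul_ne_zero hs hρ0
  refine PosRel.pair a (b / (s * ρ)) (s * a') (s * b' / (s * ρ)) ?_ ?_ ?_
  · have : a * (s * b' / (s * ρ)) - b / (s * ρ) * (s * a') = a ^ 2 := by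
      have h1 : ρ * a ^ 2 = b' * a - b * a' := div_mul_cancel₀ _ (pow_ne_zero 2 ha)
      field_simp
      linear_combination -h1
    rw [this]
    positivity
  · rw [hab, smul_smul, div_mul_cancel₀ _ hsρ]
  · rw [hab', smul_add, smul_smul, smul_smul, smul_smul, div_mul_cancel₀ _ hsρ]

/-- `w` is a vertical vector which rotates the directions in the positive sense. -/
def IsPosVertical (oξ : DistrOrientation 2 ξ.plane) (p : Prolong ξ κ)
    (w : TangentSpace 𝓘(ℝ, F × ℝ) p) : Prop :=
  dd (F × ℝ) F (base : Prolong ξ κ → M) p w = 0 ∧ ∃ e c U X₀ X₁, FrameChart ξ κ e c U X₀ X₁ ∧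
    p ∈ e.source ∧ oξ.IsPos p.base ![X₀ p.base,
      dd (F × ℝ) ℝ (fun x : Prolong ξ κ => (e x).2) p w • X₁ p.base]

theorem FrameChart.exists_smul (hc : FrameChart ξ κ e c U X₀ X₁) {p : Prolong ξ κ}
    (hp : p ∈ e.source) {v w : TangentSpace 𝓘(ℝ, F × ℝ) p}
    (hw : dd (F × ℝ) F (base : Prolong ξ κ → M) p w = 0)
    (h0 : dd (F × ℝ) ℝ (fun x : Prolong ξ κ => (e x).2) p w ≠ 0)
    (hv : dd (F × ℝ) F (base : Prolong ξ κ → M) p v = 0) : ∃ r : ℝ, v = r • w := by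
  refine ⟨dd (F × ℝ) ℝ (fun x : Prolong ξ κ => (e x).2) p v /
    dd (F × ℝ) ℝ (fun x : Prolong ξ κ => (e x).2) p w, hc.eq_of_dd hp ?_ ?_⟩
  · rw [hv, dd_smul, hw, smul_zero]
  · rw [dd_smul, smul_eq_mul, div_mul_cancel₀ _ h0]

theorem IsPosVertical.exists_smul_of_dd_eq_zero {p : Prolong ξ κ}
    {w : TangentSpace 𝓘(ℝ, F × ℝ) p} (h : IsPosVertical oξ p w) {v : TangentSpace 𝓘(ℝ, F × ℝ) p}
    (hv : dd (F × ℝ) F (base : Prolong ξ κ → M) p v = 0) : ∃ r : ℝ, v = r • w := by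
  obtain ⟨hb, e, c, U, X₀, X₁, hc, hp, hpos⟩ := h
  refine hc.exists_smul hp hb (fun h0 => ?_) hv
  refine (IsPosBasis.linearIndependent hpos).ne_zero 1 ?_
  simp [h0]

/-- Vertical vectors are multiples of the velocity of a rotation curve, and positivity becomes a
condition on the factor which no longer mentions the frame chart. -/
theorem IsPosVertical.exists_isPos {m : M}
    {u v : TangentSpace 𝓘(ℝ, F) m} {hu : u ∈ ξ.plane m} {hv : v ∈ ξ.plane m}
    {huv : LinearIndependent ℝ ![u, v]}
    {w : TangentSpace 𝓘(ℝ, F × ℝ) (rotation ξ κ m u v hu hv huv 0)}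
    (h : IsPosVertical oξ (rotation ξ κ m u v hu hv huv 0) w) : ∃ s : ℝ, s ≠ 0 ∧
      (w : F × ℝ) = s • dd ℝ (F × ℝ) (rotation ξ κ m u v hu hv huv) 0 1 ∧
        oξ.IsPos m ![u, s • v] := by
  obtain ⟨hb, e, c, U, X₀, X₁, hc, hp, hpos⟩ := h
  obtain ⟨ρ, hρ, hR, hrel⟩ := hc.posRel_rotation hu hv huv hp
  obtain ⟨s, rfl⟩ := hc.exists_smul hp (v := w)
    (w := dd ℝ (F × ℝ) (rotation ξ κ m u v hu hv huv) 0 1) (dd_base_rotation hu hv huv)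
    (by rw [hR]; exact hρ) hb
  have h1 : dd (F × ℝ) ℝ (fun x : Prolong ξ κ => (e x).2) (rotation ξ κ m u v hu hv huv 0)
      (s • dd ℝ (F × ℝ) (rotation ξ κ m u v hu hv huv) 0 1) = s * ρ := by
    rw [map_smul, hR, smul_eq_mul]
  have hpos' : oξ.IsPos m ![X₀ m, (s * ρ) • X₁ m] := by
    rw [← h1]
    exact hpos
  have hs : s ≠ 0 := by
    rintro rfl
    refine (IsPosBasis.linearIndependent hpos').ne_zero 1 ?_
    simp
  exact ⟨s, hs, rfl, IsPosBasis.of_posRel hpos' (hrel s hs)⟩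

/-- Both vectors are multiples of the same rotation velocity, which need not itself be positive; the
factors have the same sign since both make the pair positive. -/
theorem IsPosVertical.exists_smul {p : Prolong ξ κ} {w w' : TangentSpace 𝓘(ℝ, F × ℝ) p}
    (h : IsPosVertical oξ p w) (h' : IsPosVertical oξ p w') : ∃ f : ℝ, 0 < f ∧ w' = f • w := by
  obtain ⟨m, u, v, hu, hv, huv, rfl⟩ := exists_rotation p
  obtain ⟨s, hs0, hs, p1⟩ := h.exists_isPos
  obtain ⟨s', hs0', hs', p2⟩ := h'.exists_isPos
  have hd := IsPosBasis.det_pos p1 p2 (A := !![1, 0; 0, s' / s]) (fun j => by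
    fin_cases j <;> simp [Fin.sum_univ_two, smul_smul, div_mul_cancel₀ _ hs0])
  rw [Matrix.det_fin_two_of] at hd
  refine ⟨s' / s, by linarith, ?_⟩
  have h1 : (w' : F × ℝ) = (s' / s) • (w : F × ℝ) := by
    have key : ∀ R : F × ℝ, s' • R = (s' / s) • (s • R) := fun R => by
      rw [smul_smul, div_mul_cancel₀ _ hs0]
    rw [hs, hs']
    exact key _
  exact h1

theorem isPosVertical_rotation {m : M}
    {u v : TangentSpace 𝓘(ℝ, F) m} (hu : u ∈ ξ.plane m) (hv : v ∈ ξ.plane m)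
    (huv : LinearIndependent ℝ ![u, v]) (hpos : oξ.IsPos m ![u, v]) :
    IsPosVertical oξ (rotation ξ κ m u v hu hv huv 0)
      (dd ℝ (F × ℝ) (rotation ξ κ m u v hu hv huv) 0 1) := by
  refine ⟨dd_base_rotation hu hv huv, ?_⟩
  obtain ⟨e, c, U, X₀, X₁, h, hp⟩ := exists_frameChartData (rotation ξ κ m u v hu hv huv 0)
  obtain ⟨ρ, -, hR, hrel⟩ := h.posRel_rotation hu hv huv hp
  refine ⟨e, c, U, X₀, X₁, h, hp, ?_⟩
  rw [hR]
  have h1 := hrel 1 one_ne_zero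
  rw [one_mul, one_smul] at h1
  exact IsPosBasis.of_posRel hpos h1.symm

end Prolong

/-! ### Canonical orientations of the ray prolongation -/

namespace Prolong

variable {F : Type*} [NormedAddCommGroup F] [NormedSpace ℝ F] [FiniteDimensional ℝ F]
variable {M : Type*} [TopologicalSpace M] [ChartedSpace F M] [IsManifold 𝓘(ℝ, F) ∞ M]
variable {ξ : PlaneField F M} {oξ : DistrOrientation 2 ξ.plane}
  {oM : DistrOrientation 3 (fullDistr F M)}

theorem mem_dir_ray {p : Prolong ξ .ray} {y z : F} (hy : y ∈ p.dir) (hz : z ∈ p.dir) :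
    ∃ g : ℝ, 0 < g ∧ z = g • y := by
  rw [p.dir_eq hy] at hz
  obtain ⟨g, hg, h⟩ := hz
  exact ⟨g, hg, h⟩

/-- Frame charts of `ξ` can locally be made positive. -/
theorem FrameChart.exists_sign {κ : DirKind} {e : PartialEquiv (Prolong ξ κ) (F × ℝ)}
    {c : OpenPartialHomeomorph M F} {U : Set M} {X₀ X₁ : VField F M}
    (h : FrameChart ξ κ e c U X₀ X₁) (oξ : DistrOrientation 2 ξ.plane) {m : M} (hm : m ∈ U) :
    ∃ a : ℝ, a ≠ 0 ∧ ∀ᶠ x in 𝓝 m, oξ.IsPos x ![X₀ x, a • X₁ x] := by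
  obtain ⟨a, ha, h1⟩ : ∃ a : ℝ, a ≠ 0 ∧ oξ.IsPos m ![X₀ m, a • X₁ m] := by
    obtain ⟨v, hv⟩ := oξ.exists_isPos m
    rcases IsPosBasis.or_of_det_neg hv (h.li m hm) (fun i => by
        fin_cases i
        · exact h.sec₀.2 m hm
        · exact h.sec₁.2 m hm)
      (A := Matrix.diagonal ![1, -1]) (u' := ![X₀ m, (-1 : ℝ) • X₁ m])
      (by rw [Matrix.det_diagonal]; norm_num [Fin.prod_univ_two])
      (fun j => by fin_cases j <;> simp [Fin.sum_univ_two, Matrix.diagonal]) with h1 | h1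
    · exact ⟨1, one_ne_zero, by simp only [one_smul]; exact h1⟩
    · exact ⟨-1, by norm_num, h1⟩
  refine ⟨a, ha, ?_⟩
  have h2 := oξ.eventually_isPos h.isOpen (X := ![X₀, fun x => a • X₁ x]) (fun i => by
    fin_cases i
    · exact h.sec₀
    · exact (isSection_iff h.isOpen).2 fun x hx =>
        ⟨SmAt.smul (a := fun _ => a) contMDiffAt_const ((isSection_iff h.isOpen).1 h.sec₁ x hx).1,
          Submodule.smul_mem _ _ (h.sec₁.2 x hx)⟩) hm (by rw [frame_two]; exact h1)
  refine h2.mono fun x hx => ?_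
  rwa [frame_two] at hx

/-- The canonical orientation of the Engel planes of `S ξ`. -/
theorem exists_orientation_canonical (hc : ξ.IsContact) (oξ : DistrOrientation 2 ξ.plane) :
    ∃ oC : DistrOrientation 2 (canonical ξ .ray), ∀ (p : Prolong ξ .ray)
      (w x : TangentSpace 𝓘(ℝ, F × ℝ) p), IsPosVertical oξ p w →
      (dd (F × ℝ) F (base : Prolong ξ .ray → M) p x : F) ∈ p.dir → oC.IsPos p ![w, x] := by
  obtain ⟨oC, hoC⟩ := DistrOrientation.exists_of_frames (D := canonical ξ .ray) (k := 2)
    (fun p v => ∃ w x, v = ![w, x] ∧ IsPosVertical oξ p w ∧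
      (dd (F × ℝ) F (base : Prolong ξ .ray → M) p x : F) ∈ p.dir) (by
      rintro p _ ⟨w, x, rfl, hw, hx⟩
      have hli : LinearIndependent ℝ ![w, x] := by
        rw [LinearIndependent.pair_iff]
        intro r s h0
        have h1 := congrArg (dd (F × ℝ) F (base : Prolong ξ .ray → M) p) h0
        rw [dd_add, dd_smul, dd_smul, hw.1, smul_zero, zero_add] at h1
        have hs : s = 0 := (smul_eq_zero.1 (h1.trans (map_zero _))).resolve_right (p.ne_zero hx)
        rw [hs, zero_smul, add_zero] at h0
        refine ⟨(smul_eq_zero.1 h0).resolve_right ?_, hs⟩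
        rintro rfl
        obtain ⟨-, e, c, U, X₀, X₁, h, hp, hpos⟩ := hw
        refine (IsPosBasis.linearIndependent hpos).ne_zero 1 ?_
        change (dd (F × ℝ) ℝ (fun x : Prolong ξ .ray => (e x).2) p) (0 : F × ℝ) • X₁ p.base = 0
        rw [map_zero, zero_smul]
      refine ⟨hli, ?_⟩
      have hfr := (isEngel_canonical (κ := .ray) hc).finrank_eq p
      have hfin : FiniteDimensional ℝ (canonical ξ .ray p) := Module.finite_of_finrank_pos (by omega)
      refine (Submodule.eq_of_le_of_finrank_eq ?_ ?_).symm
      · refine Submodule.span_le.2 ?_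
        rintro _ ⟨i, rfl⟩
        fin_cases i
        · have : (dd (F × ℝ) F (base : Prolong ξ .ray → M) p w : F) ∈ Submodule.span ℝ p.dir := by
            rw [hw.1]
            exact Submodule.zero_mem _
          exact this
        · exact (Submodule.subset_span hx : _ ∈ Submodule.span ℝ p.dir)
      · rw [finrank_span_eq_card hli, Fintype.card_fin, hfr]) (by
      rintro p _ _ ⟨w, x, rfl, hw, hx⟩ ⟨w', x', rfl, hw', hx'⟩
      obtain ⟨f, hf, hff⟩ := hw.exists_smul hw'
      obtain ⟨g, hg, hgx⟩ := mem_dir_ray hx hx'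
      -- The vertical line is the kernel of the projection to `M`, so it is enough to compare the
      -- vertical vectors and the projections, each up to a positive factor.
      exact PosRel.cons (dd (F × ℝ) F (base : Prolong ξ .ray → M) p).toLinearMap hf hff
        (fun v hv => hw.exists_smul_of_dd_eq_zero hv) (v := ![x]) (v' := ![x'])
        ⟨!![g], by simpa using hg, fun j => by fin_cases j; simpa using hgx⟩) (by
      intro p
      obtain ⟨e, c, U, X₀, X₁, h, hp⟩ := exists_frameChartData p
      obtain ⟨W, X, hf, hWX⟩ := h.exists_engelFrame hc
      obtain ⟨a, ha, hev⟩ := h.exists_sign oξ (h.base_mem hp)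
      obtain ⟨V, hV, hVo, hpV⟩ := eventually_nhds_iff.1 hev
      -- Over `V` the sign `a` makes the pair `(X₀, a X₁)` positive; the field `a W` is then
      -- positive vertical, as `W` moves the fiber coordinate at unit speed.
      have hO : IsOpen (e.source ∩ (base : Prolong ξ .ray → M) ⁻¹' V) :=
        h.isOpen_source.inter (hVo.preimage continuous_base)
      refine ⟨_, hO, ⟨hp, hpV⟩, ![fun x => a • W x, X], fun i => ?_, fun x hx =>
        ⟨_, _, frame_two _ _ _, ⟨?_, e, c, U, X₀, X₁, h, hx.1, ?_⟩, ?_⟩⟩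
      · refine (isSection_iff hO).2 fun x hx => ?_
        fin_cases i
        · exact ⟨SmAt.smul (a := fun _ => a) contMDiffAt_const (hf.smW x hx.1),
            Submodule.smul_mem _ _ (hf.W_mem hx.1)⟩
        · exact ⟨hf.smX x hx.1, hf.X_mem hx.1⟩
      · rw [dd_smul, (hWX x hx.1).1, smul_zero]
      · rw [dd_smul, (hWX x hx.1).2.1, smul_eq_mul, mul_one]
        exact hV _ hx.2
      · rw [(hWX x hx.1).2.2.1]
        exact (h.apply_eq x hx.1).2)
  exact ⟨oC, fun p w x hw hx => hoC p _ ⟨w, x, rfl, hw, hx⟩⟩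

/-- The canonical orientation of the four-manifold `S ξ`. -/
theorem exists_orientation_total (hc : ξ.IsContact) (oξ : DistrOrientation 2 ξ.plane)
    (oM : DistrOrientation 3 (fullDistr F M)) :
    ∃ oS : DistrOrientation 4 (fullDistr (F × ℝ) (Prolong ξ .ray)), ∀ (p : Prolong ξ .ray)
      (w x y z : TangentSpace 𝓘(ℝ, F × ℝ) p), IsPosVertical oξ p w →
      oM.IsPos p.base (![dd (F × ℝ) F (base : Prolong ξ .ray → M) p x,
        dd (F × ℝ) F (base : Prolong ξ .ray → M) p y,
        dd (F × ℝ) F (base : Prolong ξ .ray → M) p z] : Fin 3 → F) → oS.IsPos p ![w, x, y, z] := by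
  have hdim := (isEngel_canonical (κ := .ray) hc).dim
  obtain ⟨oS, hoS⟩ := DistrOrientation.exists_of_frames (D := fullDistr (F × ℝ) (Prolong ξ .ray))
    (k := 4) (fun p v => ∃ w x y z, v = ![w, x, y, z] ∧ IsPosVertical oξ p w ∧
      oM.IsPos p.base (![dd (F × ℝ) F (base : Prolong ξ .ray → M) p x,
        dd (F × ℝ) F (base : Prolong ξ .ray → M) p y,
        dd (F × ℝ) F (base : Prolong ξ .ray → M) p z] : Fin 3 → F)) (by
      rintro p _ ⟨w, x, y, z, rfl, hw, hx⟩
      have hli : LinearIndependent ℝ ![w, x, y, z] := by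
        rw [li_four_iff]
        intro q r s t h0
        have h1 := congrArg (dd (F × ℝ) F (base : Prolong ξ .ray → M) p) h0
        rw [dd_add, dd_add, dd_add, dd_smul, dd_smul, dd_smul, dd_smul, hw.1, smul_zero,
          zero_add] at h1
        obtain ⟨hr, hs, ht⟩ := li_three_iff.1 (IsPosBasis.linearIndependent hx) r s t
          (h1.trans (map_zero _))
        rw [hr, hs, ht, zero_smul, zero_smul, zero_smul, add_zero, add_zero, add_zero] at h0
        refine ⟨(smul_eq_zero.1 h0).resolve_right ?_, hr, hs, ht⟩
        rintro rfl
        obtain ⟨-, e, c, U, X₀, X₁, h, hp, hpos⟩ := hw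
        refine (IsPosBasis.linearIndependent hpos).ne_zero 1 ?_
        change (dd (F × ℝ) ℝ (fun x : Prolong ξ .ray => (e x).2) p) (0 : F × ℝ) • X₁ p.base = 0
        rw [map_zero, zero_smul]
      have hfin : FiniteDimensional ℝ (F × ℝ) := Module.finite_of_finrank_pos (by omega)
      have hli' : LinearIndependent ℝ (![w, x, y, z] : Fin 4 → F × ℝ) := hli
      exact ⟨hli, (hli'.span_eq_top_of_card_eq_finrank' (by rw [hdim, Fintype.card_fin])).symm⟩) (by
      rintro p _ _ ⟨w, x, y, z, rfl, hw, hx⟩ ⟨w', x', y', z', rfl, hw', hx'⟩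
      obtain ⟨f, hf, hff⟩ := hw.exists_smul hw'
      refine PosRel.cons (dd (F × ℝ) F (base : Prolong ξ .ray → M) p).toLinearMap hf hff
        (fun v hv => hw.exists_smul_of_dd_eq_zero hv) (v := ![x, y, z]) (v' := ![x', y', z']) ?_
      obtain ⟨A, hA, hj⟩ := IsPosBasis.posRel hx hx'
      refine ⟨A, hA, fun j => ?_⟩
      have h1 := hj j
      rw [Fin.sum_univ_three] at h1 ⊢
      fin_cases j <;> exact h1) (by
      intro p
      obtain ⟨e, c, U, X₀, X₁, h, hp⟩ := exists_frameChartData p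
      obtain ⟨W, X, hf, hWX⟩ := h.exists_engelFrame hc
      obtain ⟨a, ha, hev⟩ := h.exists_sign oξ (h.base_mem hp)
      have hm := h.base_mem hp
      have hcF : CompleteSpace F := FiniteDimensional.complete ℝ F
      have hsm : ∀ x ∈ U, SmAt (lieBr X₁ X₀) x := fun x hx => (h.sm₁ hx).lieBr (h.sm₀ hx)
      obtain ⟨b, hb⟩ : ∃ b : ℝ, oM.IsPos p.base
          ![X₀ p.base, X₁ p.base, b • lieBr X₁ X₀ p.base] := by
        obtain ⟨v, hv⟩ := oM.exists_isPos p.base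
        rcases IsPosBasis.or_of_det_neg hv (h.li_contact hc hm) (fun i => trivial)
          (A := Matrix.diagonal ![1, 1, -1])
          (u' := ![X₀ p.base, X₁ p.base, (-1 : ℝ) • lieBr X₁ X₀ p.base])
          (by
            rw [Matrix.det_diagonal, Fin.prod_univ_three]
            change (1 : ℝ) * 1 * (-1) < 0
            norm_num)
          (fun j => by fin_cases j <;> simp [Fin.sum_univ_three, Matrix.diagonal]) with h1 | h1
        · exact ⟨1, by simp only [one_smul]; exact h1⟩
        · exact ⟨-1, h1⟩
      have hev' := oM.eventually_isPos h.isOpen (X := ![X₀, X₁, fun x => b • lieBr X₁ X₀ x])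
        (fun i => (isSection_iff h.isOpen).2 fun x hx => ⟨by
          fin_cases i
          · exact h.sm₀ hx
          · exact h.sm₁ hx
          · exact SmAt.smul (a := fun _ => b) contMDiffAt_const (hsm x hx), trivial⟩) hm
        (by rw [frame_three]; exact hb)
      obtain ⟨V, hV, hVo, hpV⟩ := eventually_nhds_iff.1 (hev.and hev')
      have hO : IsOpen (e.source ∩ (base : Prolong ξ .ray → M) ⁻¹' V) :=
        h.isOpen_source.inter (hVo.preimage continuous_base)
      refine ⟨_, hO, ⟨hp, hpV⟩, ![fun x => a • W x, X, lieBr W X,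
        fun x => b • lieBr (lieBr W X) X x], fun i => ?_, fun x hx =>
        ⟨_, _, _, _, frame_four _ _ _ _ _, ⟨?_, e, c, U, X₀, X₁, h, hx.1, ?_⟩, ?_⟩⟩
      · refine (isSection_iff hO).2 fun x hx => ⟨?_, trivial⟩
        fin_cases i
        · exact SmAt.smul (a := fun _ => a) contMDiffAt_const (hf.smW x hx.1)
        · exact hf.smX x hx.1
        · exact hf.smZ hx.1
        · exact SmAt.smul (a := fun _ => b) contMDiffAt_const (hf.smV hx.1)
      · rw [dd_smul, (hWX x hx.1).1, smul_zero]
      · rw [dd_smul, (hWX x hx.1).2.1, smul_eq_mul, mul_one]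
        exact (hV _ hx.2).1
      · have h1 := (hV _ hx.2).2
        rw [frame_three] at h1
        -- The second field projects to `X₀ + w X₁` and the third to `X₁`, so the projected frame is
        -- a unipotent change of the positive frame on `M`.
        refine IsPosBasis.of_posRel h1 ⟨!![1, 0, 0; (e x).2, 1, 0; 0, 0, 1], ?_, fun j => ?_⟩
        · rw [Matrix.det_fin_three]
          simp
        · rw [dd_smul, (hWX x hx.1).2.2.1, (hWX x hx.1).2.2.2.1, (hWX x hx.1).2.2.2.2]
          fin_cases j <;> simp [Fin.sum_univ_three]
          rfl)
  exact ⟨oS, fun p w x y z hw hx => hoS p _ ⟨w, x, y, z, rfl, hw, hx⟩⟩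

end Prolong

/-! ### The oriented development -/

section OrientedDevelopment

open Prolong

variable {E : Type*} [NormedAddCommGroup E] [NormedSpace ℝ E]
variable {Q : Type*} [TopologicalSpace Q] [T2Space Q] [ChartedSpace E Q] [IsManifold 𝓘(ℝ, E) ∞ Q]
variable {F : Type*} [NormedAddCommGroup F] [NormedSpace ℝ F] [FiniteDimensional ℝ F]
variable {M : Type*} [TopologicalSpace M] [ChartedSpace F M] [IsManifold 𝓘(ℝ, F) ∞ M]
variable {D : Distr E Q} {U : Set Q} {W X : VField E Q} {π : Q → M} {ξ : PlaneField F M}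
variable {oD : DistrOrientation 2 D} {oQ : DistrOrientation 4 (fullDistr E Q)}
  {oξ : DistrOrientation 2 ξ.plane} {oM : DistrOrientation 3 (fullDistr F M)}

/-- The vectors `dπ X` of adapted sections at a point differ by positive factors, so they all define
the ray chosen here with a fixed frame at each point. -/
theorem exists_rayDevelopment (hF : finrank ℝ F = 3) (hD : IsEngel D) (hπ : IsLeafQuotient F D π)
    (hξ : ∀ q, ξ.plane (π q) =
      (derived2 D q).map (mfderiv 𝓘(ℝ, E) 𝓘(ℝ, F) π q).toLinearMap)
    (oD : DistrOrientation 2 D) (oQ : DistrOrientation 4 (fullDistr E Q)) :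
    ∃ Ψ : Q → Prolong ξ .ray, IsDevelopment D π Ψ ∧
      ∀ q W X, IsAdapted oD oQ q W X → ∃ hv h0,
        Ψ q = Prolong.ofVec ξ .ray (π q) (mfderiv 𝓘(ℝ, E) 𝓘(ℝ, F) π q (X q)) hv h0 := by
  choose V Y Z hV hYZ hYZa using exists_adaptedFrame hD oD oQ
  let Ψ : Q → Prolong ξ .ray := fun q => Prolong.ofVec ξ .ray (π q)
    (mfderiv 𝓘(ℝ, E) 𝓘(ℝ, F) π q (Z q q)) (hπ.push_X_mem hF hD hξ (hYZ q) (hV q))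
    (hπ.push_X_ne_zero hF hD (hYZ q) (hV q))
  have hmem : ∀ q W X, IsAdapted oD oQ q W X → (dd E F π q (X q) : F) ∈ (Ψ q).dir := by
    intro q W X h
    obtain ⟨⟨g, hg, h1⟩, -⟩ := IsAdapted.compare hF hD hπ (hYZ q) (hV q) (hYZa q q (hV q)) h
    exact ⟨g, hg, h1⟩
  refine ⟨Ψ, ⟨fun q => rfl, fun q => ⟨_, _, _, hV q, hYZ q, fun x hx =>
    hmem x _ _ (hYZa q x hx)⟩⟩, fun q W X h => ?_⟩
  exact ⟨(Ψ q).mem_plane (hmem q W X h), (Ψ q).ne_zero (hmem q W X h),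
    (Ψ q).eq_ofVec (hmem q W X h)⟩

/-- The oriented development turns the characteristic direction into a positive rotation. -/
theorem isPosVertical_development (hF : finrank ℝ F = 3) (hD : IsEngel D)
    (hπ : IsLeafQuotient F D π) {κ : DirKind} {Ψ : Q → Prolong ξ κ} (hb : ∀ q, (Ψ q).base = π q)
    (hf : EngelFrame D U W X) (hd : ∀ x ∈ U, (dd E F π x (X x) : F) ∈ (Ψ x).dir) {q : Q}
    (hq : q ∈ U) (hpos : oξ.IsPos (π q) (pushPair F π W X q)) :
    IsPosVertical oξ (Ψ q) (dd E (F × ℝ) Ψ q (W q)) := by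
  obtain ⟨e, c, V, X₀, X₁, h, hp⟩ := exists_frameChartData (Ψ q)
  obtain ⟨hsm, s, hs, r, h1, h2⟩ := development_formula hF hD hπ hb hf hd hq h hp
  refine ⟨?_, e, c, V, X₀, X₁, h, hp, ?_⟩
  · rw [dd_base_development hπ hb hsm, hπ.dd_W hF hD hf hq]
  have hpos' : oξ.IsPos (Ψ q).base (pushPair F π W X q) := isPos_congr (hb q).symm hpos
  set y := dd (F × ℝ) ℝ (fun x : Prolong ξ κ => (e x).2) (Ψ q) (dd E (F × ℝ) Ψ q (W q)) with hy
  have hs0 := κ.ne_zero hs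
  have hli := LinearIndependent.pair_iff.1 (IsPosBasis.linearIndependent hpos)
  have hy0 : y ≠ 0 := by
    intro h0
    rw [h0, mul_zero, zero_smul] at h2
    have key : ∀ {a b : F}, b - r • a = 0 → (-r) • a + (1 : ℝ) • b = 0 := fun h => by
      rw [← h]
      module
    have := (hli (-r) 1 (key h2)).2
    exact one_ne_zero this
  refine IsPosBasis.of_posRel hpos' (PosRel.symm ?_)
  -- Solving the formulas for `dπ X` and `dπ [W,X]` in terms of `X₀` and `y X₁`, where `y` is the
  -- speed of the fiber coordinate; the determinant is `s²`.
  refine PosRel.pair s (s * (e (Ψ q)).2 / y) (r * s) (r * s * (e (Ψ q)).2 / y + s) ?_ ?_ ?_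
  · have : s * (r * s * (e (Ψ q)).2 / y + s) - s * (e (Ψ q)).2 / y * (r * s) = s ^ 2 := by ring
    rw [this]
    positivity
  · refine h1.trans ?_
    rw [smul_add, smul_smul, smul_smul, div_mul_cancel₀ _ hy0]
  · have key : ∀ {a b x₀ x₁ : F} {w : ℝ}, a = s • (x₀ + w • x₁) → b - r • a = (s * y) • x₁ →
        b = (r * s) • x₀ + (r * s * w / y + s) • (y • x₁) := by
      intro a b x₀ x₁ w ha hb
      rw [sub_eq_iff_eq_add.1 hb, ha, smul_smul (r * s * w / y + s), add_mul,
        div_mul_cancel₀ _ hy0]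
      module
    exact key h1 h2

theorem isCanonicalOrientation_of {oC : DistrOrientation 2 (canonical ξ .ray)}
    {oS : DistrOrientation 4 (fullDistr (F × ℝ) (Prolong ξ .ray))}
    (hoC : ∀ (p : Prolong ξ .ray)
      (w x : TangentSpace 𝓘(ℝ, F × ℝ) p), IsPosVertical oξ p w →
      (dd (F × ℝ) F (base : Prolong ξ .ray → M) p x : F) ∈ p.dir → oC.IsPos p ![w, x])
    (hoS : ∀ (p : Prolong ξ .ray)
      (w x y z : TangentSpace 𝓘(ℝ, F × ℝ) p), IsPosVertical oξ p w →
      oM.IsPos p.base (![dd (F × ℝ) F (base : Prolong ξ .ray → M) p x,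
        dd (F × ℝ) F (base : Prolong ξ .ray → M) p y,
        dd (F × ℝ) F (base : Prolong ξ .ray → M) p z] : Fin 3 → F) → oS.IsPos p ![w, x, y, z]) :
    IsCanonicalOrientation oξ oM oC oS := by
  rintro m u v hu hv huv hpos W X rfl hX
  have hW := isPosVertical_rotation (κ := .ray) hu hv huv hpos
  have hX' : dd (F × ℝ) F (base : Prolong ξ .ray → M) _ X = u := hX
  have hud : u ∈ (rotation ξ .ray m u v hu hv huv 0).dir :=
    ⟨1, DirKind.one_mem _, by rw [zero_smul, add_zero, one_smul]⟩
  refine ⟨hoC _ _ _ hW ?_, fun Y Z hYZ => hoS _ _ _ _ _ hW ?_⟩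
  · rw [hX']
    exact hud
  · rw [hX']
    exact hYZ

/-- It suffices to check one positive frame at each point. For an adapted frame the image of `W` is
a positive rotation, and the remaining images project to the frames that define the inherited
orientations. Other positive frames have the same transition matrix before and after the
differential. -/
theorem isOrientedEngelImmersion_development (hF : finrank ℝ F = 3) (hD : IsEngel D)
    (hπ : IsLeafQuotient F D π) (hcon : ξ.IsContact)
    (hor : IsInheritedOrientation oD oQ π oξ oM) {Ψ : Q → Prolong ξ .ray}
    (hΨ : IsDevelopment D π Ψ)
    (hdir : ∀ q W X, IsAdapted oD oQ q W X → (dd E F π q (X q) : F) ∈ (Ψ q).dir)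
    {oC : DistrOrientation 2 (canonical ξ .ray)}
    {oS : DistrOrientation 4 (fullDistr (F × ℝ) (Prolong ξ .ray))}
    (hoC : ∀ (p : Prolong ξ .ray)
      (w x : TangentSpace 𝓘(ℝ, F × ℝ) p), IsPosVertical oξ p w →
      (dd (F × ℝ) F (base : Prolong ξ .ray → M) p x : F) ∈ p.dir → oC.IsPos p ![w, x])
    (hoS : ∀ (p : Prolong ξ .ray)
      (w x y z : TangentSpace 𝓘(ℝ, F × ℝ) p), IsPosVertical oξ p w →
      oM.IsPos p.base (![dd (F × ℝ) F (base : Prolong ξ .ray → M) p x,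
        dd (F × ℝ) F (base : Prolong ξ .ray → M) p y,
        dd (F × ℝ) F (base : Prolong ξ .ray → M) p z] : Fin 3 → F) → oS.IsPos p ![w, x, y, z]) :
    IsOrientedEngelImmersion oD oQ oC oS Ψ := by
  have himm := hΨ.isEngelImmersion hF hD hπ hcon
  have key : ∀ q, ∃ W X, IsAdapted oD oQ q W X ∧ oC.IsPos (Ψ q)
      ![dd E (F × ℝ) Ψ q (W q), dd E (F × ℝ) Ψ q (X q)] ∧ oS.IsPos (Ψ q)
      ![dd E (F × ℝ) Ψ q (W q), dd E (F × ℝ) Ψ q (X q), dd E (F × ℝ) Ψ q (lieBr W X q),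
        dd E (F × ℝ) Ψ q (lieBr (lieBr W X) X q)] := by
    intro q
    obtain ⟨U, W, X, hq, hf, hfa⟩ := exists_adaptedFrame hD oD oQ q
    obtain ⟨h2, h3⟩ := hor q W X (hfa q hq)
    have hW := isPosVertical_development (oξ := oξ) hF hD hπ hΨ.base_eq hf
      (fun x hx => hdir x W X (hfa x hx)) hq h2
    have hb := fun v : TangentSpace 𝓘(ℝ, E) q =>
      dd_base_development hπ hΨ.base_eq (himm.smooth q) v
    refine ⟨W, X, hfa q hq, hoC _ _ _ hW ?_, hoS _ _ _ _ _ hW ?_⟩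
    · rw [hb]
      exact hdir q W X (hfa q hq)
    · rw [hb, hb, hb]
      exact isPos_congr (hΨ.base_eq q).symm h3
  refine ⟨himm, fun q v hv => ?_, fun q v hv => ?_⟩
  · obtain ⟨W, X, ha, h2, -⟩ := key q
    obtain ⟨A, hA, hj⟩ := IsPosBasis.posRel ha.2.1 hv
    refine IsPosBasis.of_posRel h2 ⟨A, hA, fun j => ?_⟩
    have h1 := congrArg (dd E (F × ℝ) Ψ q) (hj j)
    rw [Fin.sum_univ_two, dd_add, dd_smul, dd_smul] at h1
    rw [Fin.sum_univ_two]
    exact h1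
  · obtain ⟨W, X, ha, -, h4⟩ := key q
    obtain ⟨A, hA, hj⟩ := IsPosBasis.posRel ha.2.2 hv
    refine IsPosBasis.of_posRel h4 ⟨A, hA, fun j => ?_⟩
    have h1 := congrArg (dd E (F × ℝ) Ψ q) (hj j)
    rw [Fin.sum_univ_four, dd_add, dd_add, dd_add, dd_smul, dd_smul, dd_smul, dd_smul] at h1
    rw [Fin.sum_univ_four]
    exact h1

end OrientedDevelopment

/-! ### The lemma on contactification and development -/

theorem mainTheorem10
    {E : Type*} [NormedAddCommGroup E] [NormedSpace ℝ E]
    {Q : Type*} [TopologicalSpace Q] [T2Space Q] [ChartedSpace E Q] [IsManifold 𝓘(ℝ, E) ∞ Q]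
    {F : Type*} [NormedAddCommGroup F] [NormedSpace ℝ F] [FiniteDimensional ℝ F]
    {M : Type*} [TopologicalSpace M] [T2Space M] [ChartedSpace F M] [IsManifold 𝓘(ℝ, F) ∞ M]
    (hF : finrank ℝ F = 3)
    (D : Distr E Q) (hD : IsEngel D) (π : Q → M) (hπ : IsLeafQuotient F D π) :
    -- the contact structure `ξ = π_* D²` of the contactification and its prolongation
    ∃ ξ : PlaneField F M,
      (∀ q, ξ.plane (π q) =
        (derived2 D q).map (mfderiv 𝓘(ℝ, E) 𝓘(ℝ, F) π q).toLinearMap) ∧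
      ξ.IsContact ∧
      T2Space (Prolong ξ .line) ∧ IsEngel (Prolong.canonical ξ .line) ∧
      -- the development
      (∃ Ψ : Q → Prolong ξ .line,
        (∀ q, ∃ h, Ψ q = ⟨π q,
          ((D q).map (mfderiv 𝓘(ℝ, E) 𝓘(ℝ, F) π q).toLinearMap :
            Set (TangentSpace 𝓘(ℝ, F) (π q))) \ {0}, h⟩) ∧
        IsEngelImmersion D (Prolong.canonical ξ .line) Ψ ∧
        (∀ q, ∃ h : MapsTo Ψ (leaf D q) (Prolong.base ⁻¹' {π q}),
          IsLocalHomeomorph (h.restrict Ψ (leaf D q) (Prolong.base ⁻¹' {π q}))) ∧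
        (CompactSpace Q → IsCoveringMap Ψ ∧ Function.Surjective Ψ)) ∧
      -- three points determine an Engel immersion along a leaf
      (∀ p : Q, ∃ U ∈ 𝓝 p,
        ∀ (E' : Type*) [NormedAddCommGroup E'] [NormedSpace ℝ E']
          (Q' : Type*) [TopologicalSpace Q'] [T2Space Q'] [ChartedSpace E' Q']
          [IsManifold 𝓘(ℝ, E') ∞ Q']
          (F' : Type*) [NormedAddCommGroup F'] [NormedSpace ℝ F']
          (M' : Type*) [TopologicalSpace M'] [T2Space M'] [ChartedSpace F' M']
          [IsManifold 𝓘(ℝ, F') ∞ M']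
          (D' : Distr E' Q') (π' : Q' → M') (φ ψ : Q → Q'),
          finrank ℝ F' = 3 → IsEngel D' → IsLeafQuotient F' D' π' →
          IsEngelImmersion D D' φ → IsEngelImmersion D D' ψ →
          ∀ a ∈ U ∩ leaf D p, ∀ b ∈ U ∩ leaf D p, ∀ c ∈ U ∩ leaf D p,
            a ≠ b → a ≠ c → b ≠ c → φ a = ψ a → φ b = ψ b → φ c = ψ c →
            EqOn φ ψ (leaf D p)) ∧
      (∀ (E' : Type*) [NormedAddCommGroup E'] [NormedSpace ℝ E']
          (Q' : Type*) [TopologicalSpace Q'] [T2Space Q'] [ChartedSpace E' Q']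
          [IsManifold 𝓘(ℝ, E') ∞ Q'] (D' : Distr E' Q') (φ ψ : Q → Q'),
          IsEngel D' → IsEngelImmersion D D' φ → IsEngelImmersion D D' ψ →
          ∀ p : Q, ∃ U ∈ 𝓝 p,
            ∀ a ∈ U ∩ leaf D p, ∀ b ∈ U ∩ leaf D p, ∀ c ∈ U ∩ leaf D p,
              a ≠ b → a ≠ c → b ≠ c → φ a = ψ a → φ b = ψ b → φ c = ψ c →
              EqOn φ ψ (leaf D p)) ∧
      -- the oriented development
      (∀ (oD : DistrOrientation 2 D) (oQ : DistrOrientation 4 (fullDistr E Q)),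
        T2Space (Prolong ξ .ray) ∧ IsEngel (Prolong.canonical ξ .ray) ∧
        (∀ q, ∃ W X, IsAdapted oD oQ q W X) ∧
        ∃ (oξ : DistrOrientation 2 ξ.plane) (oM : DistrOrientation 3 (fullDistr F M))
          (oC : DistrOrientation 2 (Prolong.canonical ξ .ray))
          (oS : DistrOrientation 4 (fullDistr (F × ℝ) (Prolong ξ .ray)))
          (Ψ : Q → Prolong ξ .ray),
          IsInheritedOrientation oD oQ π oξ oM ∧
          Prolong.IsCanonicalOrientation oξ oM oC oS ∧
          (∀ q W X, IsAdapted oD oQ q W X → ∃ hv h0,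
            Ψ q = Prolong.ofVec ξ .ray (π q) (mfderiv 𝓘(ℝ, E) 𝓘(ℝ, F) π q (X q)) hv h0) ∧
          IsOrientedEngelImmersion oD oQ oC oS Ψ) := by
  obtain ⟨ξ, hξ, hcon⟩ := hπ.exists_contact hF hD
  obtain ⟨Ψ, hform, hΨ, hdir⟩ := hπ.exists_lineDevelopment hF hD hξ
  have hΨE := hΨ.isEngelImmersion hF hD hπ hcon
  refine ⟨ξ, hξ, hcon, Prolong.t2Space, Prolong.isEngel_canonical hcon,
    ⟨Ψ, hform, hΨE, hΨ.leaf_isLocalHomeomorph hF hD hπ hcon,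
      fun _ => hΨ.isCoveringMap hF hD hπ hcon⟩, fun p => ?_, ?_, fun oD oQ => ?_⟩
  -- The neighborhood only has to make the development of `Q` injective, so it is independent of the
  -- target and of the two immersions.
  · obtain ⟨U, hU, hpU, hinj⟩ :=
      (hΨE.isLocalHomeomorph hD (Prolong.isEngel_canonical hcon)).isLocallyInjective p
    refine ⟨U, hU.mem_nhds hpU, ?_⟩
    intro E' _ _ Q' _ _ _ _ F' _ _ M' _ _ _ _ D' π' φ ψ hF' hD' hπ' hφ hψ a ha b hb c hc hab hac
      hbc ea eb ec
    have hfin : FiniteDimensional ℝ F' := Module.finite_of_finrank_pos (by omega)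
    exact hφ.eqOn_leaf_of_three hF hD hπ hξ hΨ.base_eq hdir hF' hD' hπ' hψ ha.2 hb.2 hc.2
      (fun h => hab (hinj ha.1 hb.1 h)) (fun h => hac (hinj ha.1 hc.1 h))
      (fun h => hbc (hinj hb.1 hc.1 h)) ea eb ec
  · intro E' _ _ Q' _ _ _ _ D' φ ψ hD' hφ hψ p
    exact hφ.exists_nhds_eqOn_leaf_of_three hF hD hπ hD' hψ p
  · obtain ⟨oξ, oM, hor⟩ := exists_inheritedOrientation hF hD hπ hξ oD oQ
    obtain ⟨oC, hoC⟩ := Prolong.exists_orientation_canonical hcon oξ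
    obtain ⟨oS, hoS⟩ := Prolong.exists_orientation_total hcon oξ oM
    obtain ⟨Ψ, hΨ, hray⟩ := exists_rayDevelopment hF hD hπ hξ oD oQ
    refine ⟨Prolong.t2Space, Prolong.isEngel_canonical hcon, fun q => ?_, oξ, oM, oC, oS, Ψ, hor,
      isCanonicalOrientation_of hoC hoS, hray,
      isOrientedEngelImmersion_development hF hD hπ hcon hor hΨ (fun q W X h => ?_) hoC hoS⟩
    · obtain ⟨U, W, X, hq, -, h⟩ := exists_adaptedFrame hD oD oQ q
      exact ⟨W, X, h q hq⟩
    · obtain ⟨hv, h0, heq⟩ := hray q W X h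
      rw [heq]
      exact Prolong.mem_ofVec _ _ _ _
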